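/- Let $(M^n,g)$ be a compact connected Riemannian manifold without boundary, with Riemannian distance, volume $dv$ and geodesic balls $B_\rho(x)$. Then there is a constant $\lambda>0$, depending only on $(M,g)$, with the following property. Let $r,D,p\ge 0$ be integers, let $P^k_{ij}\in\mathbb R$ ($1\le k\le D$, $1\le i,j\le r$) be constants, and for an $r$-tuple $z=(z_1,\dots,z_r)$ of $p$-forms put $P^k(z)=\sum_{i,j}P^k_{ij}\,z_i\wedge z_j$, $|z|^2=\sum_i|z_i|^2$ and $\|z\|^2=\int_M|z|^2dv$. Let $h=(h_1,\dots,h_r)$ be a tuple of harmonic $p$-forms (for example the harmonic representatives of closed $p$-forms $f_i$ with $P^k(f)=0$ for all $k$), and let $$Q=\{\,y=(y_1,\dots,y_r):\ y_i\in H_1 \text{ a }(p-1)\text{-form},\ d^*y_i=0,\ P^k(h+dy)=0 \text{ a.e. for } 1\le k\le D\,\},$$ where $H_1$ is the Sobolev space of $L^2$ forms with $dy,d^*y\in L^2$ in the weak sense (if $p=0$ the only $y$ is $0$ and $dy=0$). Let $y\in Q$ minimize $E(y)=\|h+dy\|^2$ over $Q$, and put $z=h+dy$. Then: 1. (Price's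 first variation identity) for every smooth vector field $Y$ on $M$, with $\{e_i\}$ a local orthonormal frame, $\{w^i\}$ the dual coframe, $Y^i_{;j}=\langle\nabla_{e_j}Y,e_i\rangle$ for the Levi-Civita connection, $e(w)$ exterior multiplication by $w$ on the left and $i_v$ interior multiplication by $v$, $$\int_M\sum_l\Big\langle z_l,\big(-\tfrac12\operatorname{div}(Y)+Y^i_{;j}\,e(w^j)\,i_{e_i}\big)z_l\Big\rangle\,dv=0,$$ the integrand being integrable; 2. (monotonicity) for every $x\in M$ and all $0<\sigma\le\tau$, $$e^{\lambda\tau^2}\tau^{2p-n}\int_{B_\tau(x)}|z|^2dv\ \ge\ e^{\lambda\sigma^2}\sigma^{2p-n}\int_{B_\sigma(x)}|z|^2dv;$$ 3. $z$ lies in the Morrey space $L^{2,n-2p}$, that is, $z\in L^2$ and $$\sup_{x\in M,\ 0<\rho<\operatorname{diam}(M)}\rho^{2p-n}\int_{B_\rho(x)}|z|^2dv<\infty.$$ -/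

import Mathlib

open Set Filter Topology MeasureTheory Manifold Bundle
open scoped ContDiff ENNReal Nat

namespace NonlinearHarmonic

noncomputable section

/-! ### Exterior algebra of an inner product space -/

section LinearAlgebra

variable {V : Type*} [NormedAddCommGroup V] [InnerProductSpace ℝ V] [FiniteDimensional ℝ V]

/-- The inner product of two alternating `k`-covectors, normalised so that the wedge products
`w^{i₁} ∧ ⋯ ∧ w^{i_k}` (`i₁ < ⋯ < i_k`) of an orthonormal coframe are orthonormal.  (The sum over
all multi-indices counts every increasing one `k!` times.) -/
def covInner {k : ℕ} (α β : V [⋀^Fin k]→L[ℝ] ℝ) : ℝ :=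
  (k ! : ℝ)⁻¹ * ∑ I : Fin k → Fin (Module.finrank ℝ V),
    α (fun a => stdOrthonormalBasis ℝ V (I a)) * β (fun a => stdOrthonormalBasis ℝ V (I a))

/-- The wedge product `α ∧ β` (shuffle normalisation). -/
def wedge {k l : ℕ} (α : V [⋀^Fin k]→L[ℝ] ℝ) (β : V [⋀^Fin l]→L[ℝ] ℝ) :
    V [⋀^Fin (k + l)]→ₗ[ℝ] ℝ :=
  ((LinearMap.mul' ℝ ℝ).compAlternatingMap
    (α.toAlternatingMap.domCoprod β.toAlternatingMap)).domDomCongr finSumFinEquiv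

/-- The operator `e(w) i_v`: interior multiplication by the vector `v` followed by exterior
multiplication on the left by the covector `w`. It vanishes on `0`-covectors. -/
def extInt (w : V →L[ℝ] ℝ) (v : V) : {k : ℕ} → (V [⋀^Fin k]→L[ℝ] ℝ) → (V [⋀^Fin k]→L[ℝ] ℝ)
  | 0, _ => 0
  | _ + 1, α => ContinuousAlternatingMap.alternatizeUncurryFin (w.smulRight (α.curryLeft v))

end LinearAlgebra

/-! ### Charts -/

section Smooth

variable (n : ℕ) (M : Type*) [TopologicalSpace M] [ChartedSpace (EuclideanSpace ℝ (Fin n)) M]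

/-- Differential `k`-forms on the `n`-manifold `M`, with no regularity imposed. -/
abbrev Form (k : ℕ) : Type _ := ∀ x : M, (TangentSpace (𝓡 n) x) [⋀^Fin k]→L[ℝ] ℝ

variable {n M}

/-- The differential at `u` of the inverse of the preferred chart at `x₀`; it maps the standard
basis of `ℝⁿ` to the coordinate frame. -/
def chartFrame (x₀ : M) (u : EuclideanSpace ℝ (Fin n)) :
    EuclideanSpace ℝ (Fin n) →L[ℝ] TangentSpace (𝓡 n) ((extChartAt (𝓡 n) x₀).symm u) :=
  mfderiv 𝓘(ℝ, EuclideanSpace ℝ (Fin n)) (𝓡 n) (extChartAt (𝓡 n) x₀).symm u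

/-- The differential at `x` of the preferred chart at `x₀`. -/
def chartCoframe (x₀ x : M) : TangentSpace (𝓡 n) x →L[ℝ] EuclideanSpace ℝ (Fin n) :=
  mfderiv (𝓡 n) 𝓘(ℝ, EuclideanSpace ℝ (Fin n)) (extChartAt (𝓡 n) x₀) x

/-- The expression of a form in the preferred chart at `x₀`. -/
def inChart {k : ℕ} (α : Form n M k) (x₀ : M) (u : EuclideanSpace ℝ (Fin n)) :
    (EuclideanSpace ℝ (Fin n)) [⋀^Fin k]→L[ℝ] ℝ :=
  (α ((extChartAt (𝓡 n) x₀).symm u)).compContinuousLinearMap (chartFrame x₀ u)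

/-- Smooth forms: smooth in all charts. -/
def IsSmoothForm {k : ℕ} (α : Form n M k) : Prop :=
  ∀ x₀ : M, ContDiffOn ℝ ∞ (inChart α x₀) (extChartAt (𝓡 n) x₀).target

/-- The exterior derivative `dα`, computed at `x` in the preferred chart at `x`. -/
def extD {k : ℕ} (α : Form n M k) : Form n M (k + 1) := fun x =>
  (extDeriv (inChart α x) (extChartAt (𝓡 n) x x)).compContinuousLinearMap (chartCoframe x x)

/-- Measurable forms: the coefficients are Lebesgue measurable in all charts. -/
def IsMeasurableForm {k : ℕ} (α : Form n M k) : Prop :=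
  ∀ x₀ : M, AEStronglyMeasurable (inChart α x₀) (volume.restrict (extChartAt (𝓡 n) x₀).target)

end Smooth

/-! ### Riemannian geometry -/

section Riemannian

variable {n : ℕ} {M : Type*} [TopologicalSpace M] [ChartedSpace (EuclideanSpace ℝ (Fin n)) M]
  [RiemannianBundle (fun x : M => TangentSpace (𝓡 n) x)]

instance instFiniteDimensionalTangent (x : M) : FiniteDimensional ℝ (TangentSpace (𝓡 n) x) :=
  inferInstanceAs (FiniteDimensional ℝ (EuclideanSpace ℝ (Fin n)))

/-- The metric in the preferred chart at `x₀`, as a bilinear form on `ℝⁿ` depending on `u`. -/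
def chartMetric (x₀ : M) (u v w : EuclideanSpace ℝ (Fin n)) : ℝ :=
  inner ℝ (chartFrame x₀ u v) (chartFrame x₀ u w)

/-- `det (g_ij)` in the preferred chart at `x₀`. -/
def chartDet (x₀ : M) (u : EuclideanSpace ℝ (Fin n)) : ℝ :=
  Matrix.det (Matrix.of fun i j : Fin n =>
    chartMetric x₀ u (EuclideanSpace.single i 1) (EuclideanSpace.single j 1))

variable (n M) in
/-- The Riemannian volume measure. In the preferred chart at `x₀` it is `√(det g_ij) du`; each
of these measures is the restriction of the volume to the domain of the chart, and the volume is
the supremum (in the lattice of measures) of these restrictions. -/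
def riemVol [MeasurableSpace M] : Measure M :=
  ⨆ x₀ : M, Measure.map (extChartAt (𝓡 n) x₀).symm
    ((volume.restrict (extChartAt (𝓡 n) x₀).target).withDensity
      fun u => ENNReal.ofReal (Real.sqrt (chartDet x₀ u)))

/-- `⟨∇_v Y, w⟩` at `x`, for the Levi-Civita connection `∇`. In the coordinates of the preferred
chart at `x` it is
`g(∂_v Y, w) + ½ ((∂_v g)(Y, w) + (∂_Y g)(v, w) - (∂_w g)(v, Y))`,
that is `∂_v Y` plus the Christoffel symbols applied to `v` and `Y`. -/
def covDerivInner (Y : ∀ x : M, TangentSpace (𝓡 n) x) (x : M) (v w : TangentSpace (𝓡 n) x) : ℝ :=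
  let e := extChartAt (𝓡 n) x
  let Yc : EuclideanSpace ℝ (Fin n) → EuclideanSpace ℝ (Fin n) :=
    fun u => chartCoframe x (e.symm u) (Y (e.symm u))
  let dg : EuclideanSpace ℝ (Fin n) → EuclideanSpace ℝ (Fin n) → EuclideanSpace ℝ (Fin n) → ℝ :=
    fun a b c => fderiv ℝ (fun u => chartMetric x u b c) (e x) a
  let v' := chartCoframe x x v
  let w' := chartCoframe x x w
  let y' := Yc (e x)
  chartMetric x (e x) (fderiv ℝ Yc (e x) v') w'
    + (1 / 2) * (dg v' y' w' + dg y' v' w' - dg w' v' y')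

/-- The orthonormal frame `e_i` of `T_x M` used to write traces. -/
def frame (x : M) :
    OrthonormalBasis (Fin (Module.finrank ℝ (TangentSpace (𝓡 n) x))) ℝ (TangentSpace (𝓡 n) x) :=
  stdOrthonormalBasis ℝ (TangentSpace (𝓡 n) x)

/-- The divergence `div Y = ∑ ⟨∇_{e_i} Y, e_i⟩`. -/
def divergence (Y : ∀ x : M, TangentSpace (𝓡 n) x) (x : M) : ℝ :=
  ∑ i, covDerivInner Y x (frame x i) (frame x i)

/-- The zeroth order operator `-½ div Y + Y^i_{;j} e(w^j) i_{e_i}` on `k`-covectors at `x`, where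
`e_i` is an orthonormal frame, `w^j` the dual coframe and `Y^i_{;j} = ⟨∇_{e_j} Y, e_i⟩`. -/
def priceOp (Y : ∀ x : M, TangentSpace (𝓡 n) x) (x : M) {k : ℕ}
    (α : (TangentSpace (𝓡 n) x) [⋀^Fin k]→L[ℝ] ℝ) : (TangentSpace (𝓡 n) x) [⋀^Fin k]→L[ℝ] ℝ :=
  (-(1 / 2) * divergence Y x) • α
    + ∑ i, ∑ j, covDerivInner Y x (frame x j) (frame x i) •
        extInt (innerSL ℝ (frame x j)) (frame x i) α

variable [MeasurableSpace M]

/-- `L²` forms. -/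
def IsL2Form {k : ℕ} (α : Form n M k) : Prop :=
  IsMeasurableForm α ∧ Integrable (fun x => covInner (α x) (α x)) (riemVol n M)

/-- The `L²` inner product of forms. -/
def l2Inner {k : ℕ} (α β : Form n M k) : ℝ :=
  ∫ x, covInner (α x) (β x) ∂(riemVol n M)

/-- `χ = d^*ψ` for smooth forms: `d^*` is the formal `L²`-adjoint of `d`. -/
def IsCodiff {k : ℕ} (ψ : Form n M (k + 1)) (χ : Form n M k) : Prop :=
  IsSmoothForm ψ ∧ IsSmoothForm χ ∧
    ∀ η : Form n M k, IsSmoothForm η → l2Inner (extD η) ψ = l2Inner η χ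

/-- `dy = v` weakly, for `L²` forms: `⟨v, ψ⟩ = ⟨y, d^*ψ⟩` for all smooth `ψ`. -/
def IsWeakD {k : ℕ} (y : Form n M k) (v : Form n M (k + 1)) : Prop :=
  ∀ (ψ : Form n M (k + 1)) (χ : Form n M k), IsCodiff ψ χ → l2Inner v ψ = l2Inner y χ

/-- `d^*y = w` weakly, for `L²` forms: `⟨y, dη⟩ = ⟨w, η⟩` for all smooth `η`. -/
def IsWeakCodiff {k : ℕ} (y : Form n M (k + 1)) (w : Form n M k) : Prop :=
  ∀ η : Form n M k, IsSmoothForm η → l2Inner y (extD η) = l2Inner w η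

/-- `d^*y = 0` weakly; there is no condition on `0`-forms. -/
def IsCoclosed : {k : ℕ} → Form n M k → Prop
  | 0, _ => True
  | _ + 1, y => IsWeakCodiff y 0

/-- `d^*y` is (weakly) in `L²`; there is no condition on `0`-forms. -/
def HasL2Codiff : {k : ℕ} → Form n M k → Prop
  | 0, _ => True
  | _ + 1, y => ∃ w, IsL2Form w ∧ IsWeakCodiff y w

/-- The Sobolev space `H_1`, with norm
`‖(1+Δ)^{1/2} y‖² = ⟨(1+Δ) y, y⟩ = ‖y‖² + ‖dy‖² + ‖d^*y‖²`: the forms `y` in `L²` whose weak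
derivatives `dy` and `d^*y` are in `L²`. -/
def MemH1 {k : ℕ} (y : Form n M k) : Prop :=
  IsL2Form y ∧ (∃ v, IsL2Form v ∧ IsWeakD y v) ∧ HasL2Codiff y

/-- `h` is a (smooth) harmonic form: `dh = 0` and `d^*h = 0`. -/
def IsHarmonic {k : ℕ} (h : Form n M k) : Prop :=
  IsSmoothForm h ∧ (∀ x, extD h x = 0) ∧ IsCoclosed h

/-- The `p`-form `u` is `dy` for some `(p-1)`-form `y ∈ H_1` with `d^*y = 0`. There are no forms
of degree `-1` other than `0`, so that `u = 0` if `p = 0`. -/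
def IsAdmissibleExact : {p : ℕ} → Form n M p → Prop
  | 0, u => ∀ x, u x = 0
  | p + 1, u => ∃ y : Form n M p, MemH1 y ∧ IsCoclosed y ∧ IsL2Form u ∧ IsWeakD y u

/-- The constraint `P^k(z) = ∑_{i,j} P^k_{ij} z_i ∧ z_j = 0` (almost everywhere) for all `k`, with
constant coefficients. -/
def SatisfiesConstraint {r D p : ℕ} (P : Fin D → Fin r → Fin r → ℝ) (z : Fin r → Form n M p) :
    Prop :=
  ∀ k : Fin D, ∀ᵐ x ∂(riemVol n M), ∑ i, ∑ j, P k i j • wedge (z i x) (z j x) = 0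

/-- The tuples `z = h + dy` with `y_i ∈ H_1`, `d^*y_i = 0`, that satisfy the constraint. -/
def admissible {r D p : ℕ} (P : Fin D → Fin r → Fin r → ℝ) (h : Fin r → Form n M p) :
    Set (Fin r → Form n M p) :=
  {z | (∃ u : Fin r → Form n M p, (∀ i, IsAdmissibleExact (u i)) ∧ z = h + u) ∧
    SatisfiesConstraint P z}

/-- The pointwise square norm `|z|² = ∑ |z_i|²` of a tuple of forms. -/
def normSq {r p : ℕ} (z : Fin r → Form n M p) (x : M) : ℝ :=
  ∑ i, covInner (z i x) (z i x)

/-- The energy `‖z‖² = ∑ ‖z_i‖²_{L²}`. -/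
def energy {r p : ℕ} (z : Fin r → Form n M p) : ℝ := ∑ i, l2Inner (z i) (z i)

/-- `z = h + dy` minimizes the energy among the tuples `h + dy'` that satisfy the constraint. -/
structure IsNonlinearHarmonic {r D p : ℕ} (P : Fin D → Fin r → Fin r → ℝ)
    (h z : Fin r → Form n M p) : Prop where
  harmonic : ∀ i, IsHarmonic (h i)
  mem : z ∈ admissible P h
  isMin : IsMinOn energy (admissible P h) z

/-- The Price first variation identity:
`∫ ⟨z, (-½ div Y + Y^i_{;j} e(w^j) i_{e_i}) z⟩ = 0` for every smooth vector field `Y`. -/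
def PriceIdentity [IsManifold (𝓡 n) ∞ M] {r p : ℕ} (z : Fin r → Form n M p) : Prop :=
  ∀ Y : (∀ x : M, TangentSpace (𝓡 n) x),
    ContMDiff (𝓡 n) (𝓡 n).tangent ∞ (fun x => (⟨x, Y x⟩ : TangentBundle (𝓡 n) M)) →
    Integrable (fun x => ∑ i, covInner (z i x) (priceOp Y x (z i x))) (riemVol n M) ∧
    ∫ x, ∑ i, covInner (z i x) (priceOp Y x (z i x)) ∂(riemVol n M) = 0

end Riemannian

/-! ### Morrey spaces -/

section Morrey

variable {n : ℕ} {M : Type*} [MetricSpace M] [ChartedSpace (EuclideanSpace ℝ (Fin n)) M]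
  [RiemannianBundle (fun x : M => TangentSpace (𝓡 n) x)] [MeasurableSpace M]

/-- The Morrey norm
`(sup_{x ∈ M, 0 < r < diam M} r^{-μ} ∫_{B_r(x)} |z|^q)^{1/q}`, possibly infinite. -/
def morreyNorm (q μ : ℝ) {r p : ℕ} (z : Fin r → Form n M p) : ℝ≥0∞ :=
  (⨆ x : M, ⨆ ρ ∈ Set.Ioo (0 : ℝ) (Metric.diam (Set.univ : Set M)),
    ENNReal.ofReal (ρ ^ (-μ)) *
      ∫⁻ x' in Metric.ball x ρ, ENNReal.ofReal (Real.sqrt (normSq z x') ^ q) ∂(riemVol n M))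
    ^ (1 / q)

/-- The Morrey space `L^{q,μ}`: the tuples of forms in `L^q` with finite Morrey norm. -/
def MemMorrey (q μ : ℝ) {r p : ℕ} (z : Fin r → Form n M p) : Prop :=
  (∀ i, IsMeasurableForm (z i)) ∧
  ∫⁻ x, ENNReal.ofReal (Real.sqrt (normSq z x) ^ q) ∂(riemVol n M) < ⊤ ∧
  morreyNorm q μ z < ⊤

end Morrey

end

end NonlinearHarmonic

open Set Filter Topology MeasureTheory Manifold Bundle
open scoped ContDiff ENNReal Nat

namespace NonlinearHarmonic

noncomputable section

set_option linter.unusedSectionVars false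

open Metric (closedBall ball ball_subset_closedBall isOpen_ball closedBall_subset_closedBall
  mem_ball mem_closedBall ball_subset_ball closedBall_subset_ball mem_ball_self)
open Finset (sum_congr mul_sum sum_comm sum_add_distrib sum_le_sum sum_mul)

/-! Price's identity. The set of competitors is stable under diffeomorphisms Φ supported in a
coordinate ball. Pullback commutes with wedge products, so a constraint with constant coefficients
survives. On the ball h = dβ by the Poincaré lemma, so Φ^*h - h = d(Φ^*β - β) with Φ^*β - β
supported in the ball. Finally Φ^* commutes with the weak derivative, which is seen by passing to
the formal adjoint on smooth test forms. The potential obtained in this way need not be coclosed,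
but subtracting its L² projection onto the closure of the exact forms repairs this without changing
its weak derivative (`isAdmissibleExact_of_isWeakD`, `CompactDiffeo.formPull_mem_admissible`).

Hence the energy of Φ_s^*z is minimal at s = 0, where the inverse of Φ_s is v ↦ v + sY(v). Since z
is only square integrable, it cannot be differentiated; a change of variables turns the energy of
Φ_s^*z into the energy of the fixed form z for the pulled back metric, which is smooth in s. The
derivative at 0 is the integral of ½ tr(L_Y g)|z|² minus the contraction of L_Y g with the stress of
z (`first_variation_chart`). As L_Y g is twice the symmetric part of ∇Y and the stress is symmetric,
this is -2 times Price's integrand (`covInner_priceOp`). A partition of unity handles general Y.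

Monotonicity. In Euclidean space one inserts Y = ξ(r) r∂_r, for which the identity reads ∫ (ξ(n -
2p) + rξ')|z|² ≤ 0 after dropping a term with a sign. On M the field r∇r is replaced by X = (u - a)
- ½Γ(u - a, u - a), the two-jet of the radial field of normal coordinates at a. It satisfies L_X g =
2g + O(r²) and |X| ≤ (1 + Cr²)r, and a small step along -X brings points closer to a by the factor 1
- s + O(sr² + s²) (`exists_isRadial`). The distance is not smooth, so it is mollified; averaging
keeps the estimates |dr| ≤ 1 and dr(X) ≥ r - Cr³ up to an error that tends to 0
(`IsRadial.exists_smooth_dist`). The outcome is, for every smooth nonincreasing cutoff ξ constant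
near 0 and vanishing beyond a small radius, ∫ (ξ(r)(n - 2p - Cr²) + ξ'(r)(r + Cr³))|z|² ≤ 0, with C
and the radius uniform over M by compactness (`exists_radial_inequality`).

With m = n - 2p and w(t) = e^{λt²} t^{-m}, the cutoff solving -ξ'(t + Ct³) = w on [σ,τ], ξ(τ) = 0,
makes the factor in the integrand at least w(σ) - w(τ) on the σ-ball and at least -w(τ) on the rest
of the τ-ball, once 2λ ≥ C(m + 1). Smooth approximations of it yield w(σ)E(σ) ≤ w(τ)E(τ)
(`exists_isRadialCutoff`). For larger radii, and when 2p > n, the weight w itself is nondecreasing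
and nothing is to be proved. The Morrey bound is monotonicity with τ the diameter. -/

/-- Euclidean space. -/
abbrev Eu (n : ℕ) : Type := EuclideanSpace ℝ (Fin n)

/-- The preferred chart of an `n`-manifold at a point. -/
local notation:max "Ψ" n:max => extChartAt (𝓡 n)

/-! ### Pairings of alternating forms, contracted slot by slot -/

section Pairing

variable {V W X ι κ : Type*} [AddCommGroup V] [Module ℝ V] [TopologicalSpace V]
  [AddCommGroup W] [Module ℝ W] [TopologicalSpace W] [AddCommGroup X] [Module ℝ X]
  [TopologicalSpace X] [Fintype ι] [Fintype κ]

/-- The pairing of alternating forms obtained by contracting the `a`-th slots with the matrix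
`C a`, with respect to the families of vectors `v` and `w`. -/
def mpair {k : ℕ} (v : ι → V) (w : κ → W) (C : Fin k → Matrix ι κ ℝ)
    (α : V [⋀^Fin k]→L[ℝ] ℝ) (β : W [⋀^Fin k]→L[ℝ] ℝ) : ℝ :=
  (k ! : ℝ)⁻¹ * ∑ I : Fin k → ι, ∑ J : Fin k → κ,
    (∏ a, C a (I a) (J a)) * (α (fun a => v (I a)) * β (fun a => w (J a)))

theorem mpair_comm {k : ℕ} (v : ι → V) (w : κ → W) (C : Fin k → Matrix ι κ ℝ)
    (α : V [⋀^Fin k]→L[ℝ] ℝ) (β : W [⋀^Fin k]→L[ℝ] ℝ) :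
    mpair v w C α β = mpair w v (fun a => (C a).transpose) β α := by
  unfold mpair
  rw [sum_comm]
  simp only [Matrix.transpose_apply, mul_comm (α _)]

theorem apply_sum_smul {k : ℕ} (v : ι → V) (M : Fin k → ι → ℝ) (α : V [⋀^Fin k]→L[ℝ] ℝ) :
    α (fun a => ∑ i, M a i • v i) = ∑ I : Fin k → ι, (∏ a, M a (I a)) * α (fun a => v (I a)) := by
  classical
  rw [ContinuousAlternatingMap.map_sum]
  refine sum_congr rfl fun I _ => ?_
  rw [ContinuousAlternatingMap.map_smul_univ, smul_eq_mul]

/-- Each slot is expanded in the vectors `v` and the product over slots of sums is multiplied out,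
so a change of frame is absorbed in the matrix of each slot separately. The matrix may vary with the
slot because a stress contracts one slot with something other than the metric. -/
theorem mpair_change_left {k : ℕ} {ι' : Type*} [Fintype ι'] (v : ι → V) (v' : ι' → V)
    (M : Matrix ι' ι ℝ) (hM : ∀ c, v' c = ∑ i, M c i • v i) (w : κ → W)
    (C : Fin k → Matrix ι' κ ℝ) (α : V [⋀^Fin k]→L[ℝ] ℝ) (β : W [⋀^Fin k]→L[ℝ] ℝ) :
    mpair v' w C α β = mpair v w (fun a => M.transpose * C a) α β := by
  classical
  unfold mpair
  congr 1
  simp only [hM, apply_sum_smul v, Matrix.mul_apply, Matrix.transpose_apply,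
    Finset.prod_univ_sum, Fintype.piFinset_univ, sum_mul, mul_sum,
    Finset.prod_mul_distrib]
  have hL : ∀ f : (Fin k → ι') → (Fin k → κ) → (Fin k → ι) → ℝ,
      ∑ I, ∑ J, ∑ K, f I J K = ∑ K, ∑ J, ∑ I, f I J K := fun f => by
    rw [sum_comm]
    rw [sum_congr rfl fun J _ => sum_comm]
    rw [sum_comm]
  rw [hL]
  refine sum_congr rfl fun K _ => sum_congr rfl fun J _ =>
    sum_congr rfl fun I _ => by ring

theorem mpair_change_right {k : ℕ} {κ' : Type*} [Fintype κ'] (v : ι → V) (w : κ → W) (w' : κ' → W)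
    (M : Matrix κ' κ ℝ) (hM : ∀ c, w' c = ∑ i, M c i • w i)
    (C : Fin k → Matrix ι κ' ℝ) (α : V [⋀^Fin k]→L[ℝ] ℝ) (β : W [⋀^Fin k]→L[ℝ] ℝ) :
    mpair v w' C α β = mpair v w (fun a => C a * M) α β := by
  rw [mpair_comm, mpair_change_left w w' M hM, mpair_comm]
  simp

theorem mpair_change {k : ℕ} {ι' : Type*} [Fintype ι'] (v : ι → V) (v' : ι' → V)
    (M : Matrix ι' ι ℝ) (hM : ∀ c, v' c = ∑ i, M c i • v i)
    (C : Fin k → Matrix ι' ι' ℝ) (α β : V [⋀^Fin k]→L[ℝ] ℝ) :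
    mpair v' v' C α β = mpair v v (fun a => M.transpose * C a * M) α β := by
  rw [mpair_change_left v v' M hM, mpair_change_right v v v' M hM]

theorem mpair_comp_left {k : ℕ} (v : ι → X) (w : κ → W) (C : Fin k → Matrix ι κ ℝ) (A : X →L[ℝ] V)
    (α : V [⋀^Fin k]→L[ℝ] ℝ) (β : W [⋀^Fin k]→L[ℝ] ℝ) :
    mpair v w C (α.compContinuousLinearMap A) β = mpair (fun i => A (v i)) w C α β := rfl

theorem mpair_comp_right {k : ℕ} (v : ι → V) (w : κ → X) (C : Fin k → Matrix ι κ ℝ) (A : X →L[ℝ] W)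
    (α : V [⋀^Fin k]→L[ℝ] ℝ) (β : W [⋀^Fin k]→L[ℝ] ℝ) :
    mpair v w C α (β.compContinuousLinearMap A) = mpair v (fun i => A (w i)) C α β := rfl

theorem mpair_add_left {k : ℕ} (v : ι → V) (w : κ → W) (C : Fin k → Matrix ι κ ℝ)
    (α α' : V [⋀^Fin k]→L[ℝ] ℝ) (β : W [⋀^Fin k]→L[ℝ] ℝ) :
    mpair v w C (α + α') β = mpair v w C α β + mpair v w C α' β := by
  simp only [mpair, ContinuousAlternatingMap.add_apply, add_mul, mul_add, sum_add_distrib]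

theorem mpair_smul_left {k : ℕ} (v : ι → V) (w : κ → W) (C : Fin k → Matrix ι κ ℝ) (c : ℝ)
    (α : V [⋀^Fin k]→L[ℝ] ℝ) (β : W [⋀^Fin k]→L[ℝ] ℝ) :
    mpair v w C (c • α) β = c * mpair v w C α β := by
  simp only [mpair, ContinuousAlternatingMap.smul_apply, smul_eq_mul, mul_sum]
  refine sum_congr rfl fun I _ => sum_congr rfl fun J _ => by ring

theorem mpair_add_right {k : ℕ} (v : ι → V) (w : κ → W) (C : Fin k → Matrix ι κ ℝ)
    (α : V [⋀^Fin k]→L[ℝ] ℝ) (β β' : W [⋀^Fin k]→L[ℝ] ℝ) :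
    mpair v w C α (β + β') = mpair v w C α β + mpair v w C α β' := by
  rw [mpair_comm, mpair_add_left, mpair_comm v w, mpair_comm v w C α β']

theorem mpair_smul_right {k : ℕ} (v : ι → V) (w : κ → W) (C : Fin k → Matrix ι κ ℝ) (c : ℝ)
    (α : V [⋀^Fin k]→L[ℝ] ℝ) (β : W [⋀^Fin k]→L[ℝ] ℝ) :
    mpair v w C α (c • β) = c * mpair v w C α β := by
  rw [mpair_comm, mpair_smul_left, mpair_comm v w]

/-- The contraction of one slot with the matrix `S` and of the others with the identity, in terms
of the interior products with the vectors of the frame. -/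
theorem mpair_update_one [DecidableEq ι] {k : ℕ} (v : ι → V) (a : Fin (k + 1)) (S : Matrix ι ι ℝ)
    (α β : V [⋀^Fin (k + 1)]→L[ℝ] ℝ) :
    mpair v v (Function.update (fun _ => 1) a S) α β = ((k + 1)! : ℝ)⁻¹ *
      ∑ I : Fin k → ι, ∑ i, ∑ j, S i j *
        (α (fun b => v ((a.insertNth i I : Fin (k + 1) → ι) b))
          * β (fun b => v ((a.insertNth j I : Fin (k + 1) → ι) b))) := by
  unfold mpair
  congr 1
  -- Both multi-indices are split at the slot `a`; the identity matrices in the other slots then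
  -- force their remaining parts to agree.
  rw [← (Fin.insertNthEquiv (fun _ : Fin (k + 1) => ι) a).sum_comp, Fintype.sum_prod_type,
    sum_comm]
  refine sum_congr rfl fun I _ => sum_congr rfl fun i _ => ?_
  rw [← (Fin.insertNthEquiv (fun _ : Fin (k + 1) => ι) a).sum_comp, Fintype.sum_prod_type]
  refine sum_congr rfl fun j _ => ?_
  rw [Finset.sum_eq_single I]
  · simp [Fin.prod_univ_succAbove _ a, Fin.insertNthEquiv]
  · intro J _ hJ
    obtain ⟨b, hb⟩ := Function.ne_iff.1 hJ
    have : ∏ b, (1 : Matrix ι ι ℝ) (I b) (J b) = 0 :=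
      Finset.prod_eq_zero (Finset.mem_univ b) (Matrix.one_apply_ne (Ne.symm hb))
    simp [Fin.prod_univ_succAbove _ a, Fin.insertNthEquiv, this]
  · simp

end Pairing

/-! ### Inner products of covectors, the stress, and the operators e(w) i_v -/

section Inner

variable {V : Type*} [NormedAddCommGroup V] [InnerProductSpace ℝ V] [FiniteDimensional ℝ V]
  {ι : Type*} [Fintype ι] [DecidableEq ι]

theorem covInner_eq_mpair_std {k : ℕ} (α β : V [⋀^Fin k]→L[ℝ] ℝ) :
    covInner α β = mpair (stdOrthonormalBasis ℝ V) (stdOrthonormalBasis ℝ V) (fun _ => 1) α β := by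
  unfold covInner mpair
  congr 1
  refine sum_congr rfl fun I _ => ?_
  rw [Finset.sum_eq_single I]
  · simp
  · intro J _ hJ
    obtain ⟨c, hc⟩ := Function.ne_iff.1 hJ
    rw [Finset.prod_eq_zero (i := c) (Finset.mem_univ c)
      (by exact Matrix.one_apply_ne (Ne.symm hc)), zero_mul]
  · simp

/-- The matrix of an orthonormal basis `b` in a basis `v`. -/
theorem exists_frame_change {κ : Type*} [Fintype κ] [DecidableEq κ] (b : OrthonormalBasis κ ℝ V)
    (v : Module.Basis ι ℝ V) :
    ∃ M : Matrix κ ι ℝ, (∀ c, b c = ∑ i, M c i • v i) ∧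
      M.transpose * M = (Matrix.gram ℝ v)⁻¹ ∧ Matrix.det (Matrix.gram ℝ v) ≠ 0 := by
  let M : Matrix κ ι ℝ := Matrix.of fun c i => v.repr (b c) i
  let N : Matrix ι κ ℝ := Matrix.of fun i c => inner ℝ (b c) (v i)
  have hM : ∀ c, b c = ∑ i, M c i • v i := fun c => (v.sum_repr (b c)).symm
  have hN : ∀ i, v i = ∑ c, N i c • b c := fun i => (b.sum_repr' (v i)).symm
  have hNM : N * M = 1 := by
    ext i j
    have h1 : v i = ∑ j, (N * M) i j • v j := by
      conv_lhs => rw [hN i]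
      simp only [hM, Finset.smul_sum, Matrix.mul_apply, Finset.sum_smul, smul_smul]
      rw [sum_comm]
    have h2 := congrArg (fun x => v.repr x j) h1
    simp only [map_sum, map_smul, Module.Basis.repr_self, Finsupp.coe_finsetSum,
      Finset.sum_apply, Finsupp.smul_apply, smul_eq_mul] at h2
    rw [Finsupp.single_apply] at h2
    rw [Matrix.one_apply, h2]
    simp [Finsupp.single_apply]
  have hG : Matrix.gram ℝ v = N * N.transpose := by
    ext i j
    rw [Matrix.gram_apply, Matrix.mul_apply, ← b.sum_inner_mul_inner (v i) (v j)]
    exact sum_congr rfl fun c _ => by simp [N, real_inner_comm]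
  -- The Gram matrix is N Nᵀ and N is a two-sided inverse of M, so MᵀM N Nᵀ = MᵀNᵀ = (NM)ᵀ = 1.
  have hH : M.transpose * M * Matrix.gram ℝ v = 1 := by
    have hcard : M * N = 1 := by
      have : Fintype.card κ = Fintype.card ι := by
        rw [← Module.finrank_eq_card_basis v, ← Module.finrank_eq_card_basis b.toBasis]
      exact (Matrix.mul_eq_one_comm_of_card_eq _ _ _ this.symm).1 hNM
    rw [hG, Matrix.mul_assoc, ← Matrix.mul_assoc M N, hcard, Matrix.one_mul,
      ← Matrix.transpose_mul, hNM, Matrix.transpose_one]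
  exact ⟨M, hM, (Matrix.inv_eq_left_inv hH).symm, fun h0 => by
    have := congrArg Matrix.det hH
    rw [Matrix.det_mul, h0, mul_zero, Matrix.det_one] at this
    exact zero_ne_one this⟩

/-- The orthonormal basis is M applied to `v`, so every slot is contracted with MᵀM, the inverse
Gram matrix. In a coordinate frame this expresses the norm of a form through g^{ij}, where it can be
differentiated. -/
theorem covInner_eq_mpair {k : ℕ} (v : Module.Basis ι ℝ V) (α β : V [⋀^Fin k]→L[ℝ] ℝ) :
    covInner α β = mpair v v (fun _ => (Matrix.gram ℝ v)⁻¹) α β := by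
  obtain ⟨M, hM, hH, -⟩ := exists_frame_change (stdOrthonormalBasis ℝ V) v
  rw [covInner_eq_mpair_std, mpair_change v _ M hM]
  simp [hH]

theorem covInner_comm {k : ℕ} (α β : V [⋀^Fin k]→L[ℝ] ℝ) : covInner α β = covInner β α := by
  simp only [covInner, mul_comm]

theorem covInner_add_left {k : ℕ} (α α' β : V [⋀^Fin k]→L[ℝ] ℝ) :
    covInner (α + α') β = covInner α β + covInner α' β := by
  simp only [covInner_eq_mpair_std, mpair_add_left]

theorem covInner_smul_left {k : ℕ} (c : ℝ) (α β : V [⋀^Fin k]→L[ℝ] ℝ) :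
    covInner (c • α) β = c * covInner α β := by
  simp only [covInner_eq_mpair_std, mpair_smul_left]

theorem covInner_add_right {k : ℕ} (α β β' : V [⋀^Fin k]→L[ℝ] ℝ) :
    covInner α (β + β') = covInner α β + covInner α β' := by
  simp only [covInner_eq_mpair_std, mpair_add_right]

theorem covInner_smul_right {k : ℕ} (c : ℝ) (α β : V [⋀^Fin k]→L[ℝ] ℝ) :
    covInner α (c • β) = c * covInner α β := by
  simp only [covInner_eq_mpair_std, mpair_smul_right]

theorem covInner_zero_left {k : ℕ} (β : V [⋀^Fin k]→L[ℝ] ℝ) : covInner 0 β = 0 := by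
  simpa using covInner_smul_left 0 0 β

theorem covInner_zero_right {k : ℕ} (α : V [⋀^Fin k]→L[ℝ] ℝ) : covInner α 0 = 0 := by
  simpa using covInner_smul_right 0 α 0

theorem covInner_self_nonneg {k : ℕ} (α : V [⋀^Fin k]→L[ℝ] ℝ) : 0 ≤ covInner α α :=
  mul_nonneg (by positivity) (Finset.sum_nonneg fun _ _ => mul_self_nonneg _)

/-- Nonnegativity of the square norms of α + β and α - β. This weak form of the Cauchy–Schwarz
inequality suffices for integrability and, after rescaling, for boundedness. -/
theorem abs_covInner_le {k : ℕ} (α β : V [⋀^Fin k]→L[ℝ] ℝ) :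
    |covInner α β| ≤ (covInner α α + covInner β β) / 2 := by
  have h1 : 0 ≤ covInner (α + (1 : ℝ) • β) (α + (1 : ℝ) • β) := covInner_self_nonneg _
  have h2 : 0 ≤ covInner (α + (-1 : ℝ) • β) (α + (-1 : ℝ) • β) := covInner_self_nonneg _
  simp only [covInner_add_left, covInner_add_right, covInner_smul_left, covInner_smul_right,
    covInner_comm β α] at h1 h2
  rw [abs_le]
  constructor <;> linarith

/-- The contraction `∑ S_{ij} ⟨i_{b_i} α, i_{b_j} α⟩` of a matrix with the stress of a form. -/
def stress {k : ℕ} (b : OrthonormalBasis ι ℝ V) (S : Matrix ι ι ℝ) (α : V [⋀^Fin k]→L[ℝ] ℝ) : ℝ :=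
  ∑ a, mpair b b (Function.update (fun _ => 1) a S) α α

theorem covInner_eq_mpair_orthonormal {k : ℕ} (b : OrthonormalBasis ι ℝ V)
    (α β : V [⋀^Fin k]→L[ℝ] ℝ) : covInner α β = mpair b b (fun _ => 1) α β := by
  have h := covInner_eq_mpair b.toBasis α β
  have hg : Matrix.gram ℝ b = 1 := by
    ext i j
    rw [Matrix.gram_apply, Matrix.one_apply, orthonormal_iff_ite.1 b.orthonormal]
  simpa [hg] using h

theorem covInner_eq_sum {k : ℕ} (b : OrthonormalBasis ι ℝ V) (α β : V [⋀^Fin k]→L[ℝ] ℝ) :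
    covInner α β = (k ! : ℝ)⁻¹ * ∑ I : Fin k → ι, α (fun a => b (I a)) * β (fun a => b (I a)) := by
  rw [covInner_eq_mpair_orthonormal b]
  unfold mpair
  congr 1
  refine sum_congr rfl fun I _ => ?_
  rw [Finset.sum_eq_single I]
  · simp
  · intro J _ hJ
    obtain ⟨c, hc⟩ := Function.ne_iff.1 hJ
    rw [Finset.prod_eq_zero (i := c) (Finset.mem_univ c)
      (by exact Matrix.one_apply_ne (Ne.symm hc)), zero_mul]
  · simp

theorem covInner_self_eq_sum {k : ℕ} (b : OrthonormalBasis ι ℝ V)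
    (α : V [⋀^Fin k]→L[ℝ] ℝ) :
    covInner α α = (k ! : ℝ)⁻¹ * ∑ I : Fin k → ι, α (fun a => b (I a)) ^ 2 := by
  simp only [covInner_eq_sum b, sq]

theorem mpair_update_add {k : ℕ} (v : ι → V) (H : Matrix ι ι ℝ) (a : Fin k) (S T : Matrix ι ι ℝ)
    (α β : V [⋀^Fin k]→L[ℝ] ℝ) :
    mpair v v (Function.update (fun _ => H) a (S + T)) α β =
      mpair v v (Function.update (fun _ => H) a S) α β
        + mpair v v (Function.update (fun _ => H) a T) α β := by
  simp only [mpair, ← Finset.mul_prod_erase Finset.univ _ (Finset.mem_univ a),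
    Function.update_self, Matrix.add_apply, add_mul, ← mul_add, sum_add_distrib]
  congr 2 <;>
  · refine sum_congr rfl fun I _ => sum_congr rfl fun J _ => ?_
    congr 2
    refine Finset.prod_congr rfl fun b hb => ?_
    simp [Function.update_of_ne (Finset.ne_of_mem_erase hb)]

theorem mpair_update_smul {k : ℕ} (v : ι → V) (H : Matrix ι ι ℝ) (a : Fin k) (c : ℝ)
    (S : Matrix ι ι ℝ) (α β : V [⋀^Fin k]→L[ℝ] ℝ) :
    mpair v v (Function.update (fun _ => H) a (c • S)) α β =
      c * mpair v v (Function.update (fun _ => H) a S) α β := by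
  simp only [mpair, ← Finset.mul_prod_erase Finset.univ _ (Finset.mem_univ a),
    Function.update_self, Matrix.smul_apply, smul_eq_mul, mul_sum]
  refine sum_congr rfl fun I _ => sum_congr rfl fun J _ => ?_
  have : ∀ T : Matrix ι ι ℝ, ∏ x ∈ Finset.univ.erase a,
      Function.update (fun _ => H) a T x (I x) (J x) = ∏ x ∈ Finset.univ.erase a, H (I x) (J x) :=
    fun T => Finset.prod_congr rfl fun b hb => by
      simp [Function.update_of_ne (Finset.ne_of_mem_erase hb)]
  rw [this, this]
  ring

theorem stress_add {k : ℕ} (b : OrthonormalBasis ι ℝ V) (S T : Matrix ι ι ℝ)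
    (α : V [⋀^Fin k]→L[ℝ] ℝ) : stress b (S + T) α = stress b S α + stress b T α := by
  simp only [stress, mpair_update_add, sum_add_distrib]

theorem stress_smul {k : ℕ} (b : OrthonormalBasis ι ℝ V) (c : ℝ) (S : Matrix ι ι ℝ)
    (α : V [⋀^Fin k]→L[ℝ] ℝ) : stress b (c • S) α = c * stress b S α := by
  simp only [stress, mpair_update_smul, mul_sum]

theorem stress_one {k : ℕ} (b : OrthonormalBasis ι ℝ V) (α : V [⋀^Fin k]→L[ℝ] ℝ) :
    stress b 1 α = k * covInner α α := by
  simp only [stress, covInner_eq_mpair_orthonormal b]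
  simp

/-- Exchanging the two copies of α transposes the contracted matrix. Hence only the symmetric part
of ∇Y enters, and the Lie derivative of the metric carries all the information. -/
theorem stress_transpose {k : ℕ} (b : OrthonormalBasis ι ℝ V) (S : Matrix ι ι ℝ)
    (α : V [⋀^Fin k]→L[ℝ] ℝ) : stress b S.transpose α = stress b S α := by
  refine sum_congr rfl fun a _ => ?_
  conv_rhs => rw [mpair_comm]
  congr 1
  funext c
  by_cases h : c = a
  · subst h; simp
  · simp [Function.update_of_ne h]

/-- A rank one matrix xxᵀ contracts the stress to a sum of squares, the coefficients of the interior
product of α with the vector of coordinates x. -/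
theorem stress_vecMulVec_self_nonneg {k : ℕ} (b : OrthonormalBasis ι ℝ V) (x : ι → ℝ)
    (α : V [⋀^Fin k]→L[ℝ] ℝ) : 0 ≤ stress b (Matrix.vecMulVec x x) α := by
  refine Finset.sum_nonneg fun a _ => ?_
  obtain _ | k := k
  · exact a.elim0
  rw [mpair_update_one]
  refine mul_nonneg (by positivity) (Finset.sum_nonneg fun I _ => ?_)
  have : ∑ i, ∑ j, Matrix.vecMulVec x x i j *
      (α (fun c => b ((a.insertNth i I : Fin (k + 1) → ι) c))
        * α (fun c => b ((a.insertNth j I : Fin (k + 1) → ι) c))) =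
      (∑ i, x i * α (fun c => b ((a.insertNth i I : Fin (k + 1) → ι) c))) ^ 2 := by
    rw [sq, Finset.sum_mul_sum]
    exact sum_congr rfl fun i _ => sum_congr rfl fun j _ => by
      simp only [Matrix.vecMulVec_apply]; ring
  rw [this]
  positivity

/-- With the other indices frozen, one slot contributes a quadratic form in the coefficients f_i;
bounding its entries by s and f_i f_j by half the sum of squares costs the factor s times the
dimension. There are k slots. -/
theorem abs_stress_le {k : ℕ} (b : OrthonormalBasis ι ℝ V) (S : Matrix ι ι ℝ) {s : ℝ}
    (hS : ∀ i j, |S i j| ≤ s) (α : V [⋀^Fin k]→L[ℝ] ℝ) :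
    |stress b S α| ≤ k * (s * Fintype.card ι * covInner α α) := by
  have key : ∀ a, |mpair b b (Function.update (fun _ => 1) a S) α α|
      ≤ s * Fintype.card ι * covInner α α := by
    intro a
    obtain _ | k := k
    · exact a.elim0
    rw [mpair_update_one, covInner_self_eq_sum b, abs_mul, abs_of_nonneg (by positivity),
      mul_left_comm]
    refine mul_le_mul_of_nonneg_left ?_ (by positivity)
    conv_rhs => rw [← (Fin.insertNthEquiv (fun _ : Fin (k + 1) => ι) a).sum_comp,
      Fintype.sum_prod_type, sum_comm, mul_sum]
    refine (Finset.abs_sum_le_sum_abs _ _).trans (sum_le_sum fun I _ => ?_)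
    set f : ι → ℝ := fun i =>
      α (fun c => b ((a.insertNth i I : Fin (k + 1) → ι) c)) with hf
    change |∑ i, ∑ j, S i j * (f i * f j)| ≤ s * Fintype.card ι * ∑ i, f i ^ 2
    calc |∑ i, ∑ j, S i j * (f i * f j)| ≤ ∑ i, ∑ j, s * ((f i ^ 2 + f j ^ 2) / 2) := by
          refine (Finset.abs_sum_le_sum_abs _ _).trans (sum_le_sum fun i _ => ?_)
          refine (Finset.abs_sum_le_sum_abs _ _).trans (sum_le_sum fun j _ => ?_)
          rw [abs_mul]
          refine mul_le_mul (hS i j) ?_ (abs_nonneg _) ((abs_nonneg _).trans (hS i j))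
          rw [abs_le]
          constructor <;> nlinarith [sq_nonneg (f i + f j), sq_nonneg (f i - f j)]
      _ = _ := by
          simp only [← mul_sum, ← Finset.sum_div, sum_add_distrib, Finset.sum_const,
            Finset.card_univ, nsmul_eq_mul]
          ring
  refine (Finset.abs_sum_le_sum_abs _ _).trans ((sum_le_sum fun a _ => key a).trans ?_)
  simp

/-- The stress in an arbitrary basis. -/
theorem stress_eq_sum_mpair {κ : Type*} [Fintype κ] [DecidableEq κ] {k : ℕ}
    (b : OrthonormalBasis κ ℝ V) (v : Module.Basis ι ℝ V) (S : V →ₗ[ℝ] V →ₗ[ℝ] ℝ)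
    (α : V [⋀^Fin k]→L[ℝ] ℝ) :
    stress b (Matrix.of fun c d => S (b c) (b d)) α =
      ∑ a, mpair v v (Function.update (fun _ => (Matrix.gram ℝ v)⁻¹) a
        ((Matrix.gram ℝ v)⁻¹ * (Matrix.of fun i j => S (v i) (v j)) * (Matrix.gram ℝ v)⁻¹)) α α ∧
    Matrix.trace (Matrix.of fun c d => S (b c) (b d)) =
      Matrix.trace ((Matrix.gram ℝ v)⁻¹ * (Matrix.of fun i j => S (v i) (v j))) := by
  obtain ⟨M, hM, hH, -⟩ := exists_frame_change b v
  -- The matrix of S in the orthonormal frame is M S Mᵀ; the frame change then surrounds it by MᵀM,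
  -- the inverse Gram matrix, on both sides.
  have hS : (Matrix.of fun c d => S (b c) (b d)) =
      M * (Matrix.of fun i j => S (v i) (v j)) * M.transpose := by
    ext c d
    simp only [Matrix.of_apply, hM, map_sum, map_smul, LinearMap.sum_apply, LinearMap.smul_apply,
      smul_eq_mul, Matrix.mul_apply, Matrix.transpose_apply, sum_mul, mul_sum]
    exact sum_congr rfl fun i _ => sum_congr rfl fun j _ => by ring
  constructor
  · refine sum_congr rfl fun a _ => ?_
    rw [mpair_change v _ M hM]
    congr 1
    funext c
    by_cases h : c = a
    · subst h
      simp only [Function.update_self, hS, ← hH, Matrix.mul_assoc]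
    · simp [Function.update_of_ne h, hH]
  · rw [hS, Matrix.trace_mul_comm, ← Matrix.mul_assoc, hH]

/-- `e(b_j) i_{b_i}` replaces one argument at a time. -/
theorem extInt_apply {k : ℕ} (b : OrthonormalBasis ι ℝ V) (i j : ι) (α : V [⋀^Fin k]→L[ℝ] ℝ)
    (v : Fin k → V) :
    extInt (innerSL ℝ (b j)) (b i) α v =
      ∑ a, inner ℝ (b j) (v a) * α (Function.update v a (b i)) := by
  obtain _ | k := k
  · simp [extInt]
  simp only [extInt]
  rw [ContinuousAlternatingMap.alternatizeUncurryFin_apply]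
  refine sum_congr rfl fun a _ => ?_
  -- Moving the inserted vector from the front to slot `a` costs (-1)^a, which cancels the sign in
  -- the alternatization.
  have h := α.toAlternatingMap.neg_one_pow_smul_map_insertNth a (b i) (a.removeNth v)
  rw [Fin.insertNth_removeNth] at h
  simp only [ContinuousLinearMap.smulRight_apply, innerSL_apply_apply,
    ContinuousAlternatingMap.smul_apply, smul_eq_mul, ContinuousAlternatingMap.curryLeft_apply_apply]
  have h' : α (Matrix.vecCons (b i) (a.removeNth v)) = (-1) ^ (a : ℕ) *
      α (Function.update v a (b i)) := by
    simpa using h.symm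
  rw [h']
  have : ((-1 : ℝ) ^ (a : ℕ)) * (-1) ^ (a : ℕ) = 1 := by rw [← mul_pow]; simp
  rw [zsmul_eq_mul]
  push_cast
  linear_combination (inner ℝ (b j) (v a) * α (Function.update v a (b i))) * this

/-- The operator e(w^j) i_{e_i} replaces e_j by e_i in one argument at a time. In an orthonormal
frame, pairing the result with α therefore contracts one slot with `C`: the derivation term of
Price's operator is a stress. -/
theorem sum_covInner_extInt {k : ℕ} (b : OrthonormalBasis ι ℝ V) (C : Matrix ι ι ℝ)
    (α : V [⋀^Fin k]→L[ℝ] ℝ) :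
    ∑ i, ∑ j, C j i * covInner α (extInt (innerSL ℝ (b j)) (b i) α) = stress b C α := by
  obtain _ | k := k
  · simp [stress, extInt, covInner_zero_right]
  unfold stress
  simp only [mpair_update_one, covInner_eq_sum b, extInt_apply,
    orthonormal_iff_ite.1 b.orthonormal]
  simp only [← mul_assoc, mul_comm _ ((k + 1)! : ℝ)⁻¹]
  simp only [mul_assoc, ← mul_sum]
  congr 1
  have hu : ∀ (I : Fin (k + 1) → ι) (a : Fin (k + 1)) (i : ι),
      Function.update (fun c => b (I c)) a (b i) = fun c => b (Function.update I a i c) := by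
    intro I a i
    funext c
    by_cases h : c = a
    · subst h; simp
    · simp [Function.update_of_ne h]
  have h1 : ∀ i, ∑ j, C j i * ∑ I : Fin (k + 1) → ι, α (fun a => b (I a)) *
      ∑ a, (if j = I a then (1 : ℝ) else 0) * α (Function.update (fun c => b (I c)) a (b i)) =
      ∑ a, ∑ I : Fin (k + 1) → ι, C (I a) i * (α (fun a => b (I a)) *
        α (fun c => b (Function.update I a i c))) := by
    intro i
    simp only [mul_sum, hu]
    rw [sum_comm]
    rw [sum_comm (s := (Finset.univ : Finset (Fin (k + 1))))]
    refine sum_congr rfl fun I _ => ?_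
    rw [sum_comm]
    refine sum_congr rfl fun a _ => ?_
    rw [Finset.sum_eq_single (I a)]
    · simp
    · intro j _ hj; simp [hj]
    · simp
  rw [sum_congr rfl fun i _ => h1 i, sum_comm]
  refine sum_congr rfl fun a _ => ?_
  rw [sum_comm, ← (Fin.insertNthEquiv (fun _ : Fin (k + 1) => ι) a).sum_comp,
    Fintype.sum_prod_type, sum_comm]
  refine sum_congr rfl fun I _ => sum_congr rfl fun i _ =>
    sum_congr rfl fun j _ => ?_
  simp [Fin.insertNthEquiv]

end Inner

/-! ### Naturality of the wedge product -/

section Wedge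

variable {V W : Type*} [NormedAddCommGroup V] [InnerProductSpace ℝ V] [FiniteDimensional ℝ V]
  [NormedAddCommGroup W] [InnerProductSpace ℝ W] [FiniteDimensional ℝ W]

/-- This is the algebraic reason why a constraint with constant coefficients is preserved by
pullbacks. -/
theorem wedge_comp {k l : ℕ} (A : W →L[ℝ] V) (α : V [⋀^Fin k]→L[ℝ] ℝ) (β : V [⋀^Fin l]→L[ℝ] ℝ)
    (v : Fin (k + l) → W) :
    wedge (α.compContinuousLinearMap A) (β.compContinuousLinearMap A) v
      = wedge α β (fun a => A (v a)) := by
  simp only [wedge, AlternatingMap.domDomCongr_apply, LinearMap.compAlternatingMap_apply,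
    AlternatingMap.domCoprod_apply, sum_apply, map_sum]
  refine sum_congr rfl fun σ _ => ?_
  induction σ using Quotient.inductionOn'
  rfl

end Wedge

/-! Shortcut instances. -/

local instance instIsManifoldOne (n : ℕ) (M : Type*) [TopologicalSpace M]
    [ChartedSpace (Eu n) M] [IsManifold (𝓡 n) ∞ M] :
    IsManifold (𝓡 n) 1 M := inferInstance

local instance instContinuousSMulEuclidean (n : ℕ) : ContinuousSMul ℝ (Eu n) :=
  inferInstance

local instance instContinuousSMulEnd (n : ℕ) :
    ContinuousSMul ℝ (Eu n →L[ℝ] Eu n) := inferInstance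

local instance instNormedAddCommGroupBilin (n : ℕ) : NormedAddCommGroup
    (Eu n →L[ℝ] Eu n →L[ℝ] ℝ) := inferInstance

local instance instAddCommGroupBilin (n : ℕ) : AddCommGroup
    (Eu n →L[ℝ] Eu n →L[ℝ] ℝ) :=
  (instNormedAddCommGroupBilin n).toAddCommGroup

local instance instNormedAddCommGroupEnd (n : ℕ) : NormedAddCommGroup
    (Eu n →L[ℝ] Eu n) := inferInstance

local instance instAddCommGroupEnd (n : ℕ) : AddCommGroup
    (Eu n →L[ℝ] Eu n) :=
  (instNormedAddCommGroupEnd n).toAddCommGroup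

theorem hasFDerivAt_comp_apply {E F : Type*} [NormedAddCommGroup E] [NormedSpace ℝ E]
    [NormedAddCommGroup F] [NormedSpace ℝ F] {g : E → F} {T : E → E} {u : E} {g' : E →L[ℝ] F}
    {T' : E →L[ℝ] E} (hg : HasFDerivAt g g' (T u)) (hT : HasFDerivAt T T' u) :
    HasFDerivAt (fun y => g (T y)) (g'.comp T') u := hg.comp u hT

/-! ### Coordinate frames and changes of coordinates -/

section ChartCalculus

variable {n : ℕ} {M : Type*} [TopologicalSpace M] [ChartedSpace (Eu n) M]
  [IsManifold (𝓡 n) ∞ M]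

theorem chartCoframe_chartFrame {x₀ : M} {u : Eu n}
    (hu : u ∈ (Ψ n x₀).target) (v : Eu n) :
    chartCoframe x₀ ((Ψ n x₀).symm u) (chartFrame x₀ u v) = v := by
  have h := mfderiv_extChartAt_comp_mfderivWithin_extChartAt_symm (I := 𝓡 n) hu
  rw [ModelWithCorners.range_eq_univ, mfderivWithin_univ] at h
  exact DFunLike.congr_fun h v

theorem chartFrame_chartCoframe {x₀ : M} {u : Eu n}
    (hu : u ∈ (Ψ n x₀).target)
    (w : TangentSpace (𝓡 n) ((Ψ n x₀).symm u)) :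
    chartFrame x₀ u (chartCoframe x₀ ((Ψ n x₀).symm u) w) = w := by
  have h := mfderivWithin_extChartAt_symm_comp_mfderiv_extChartAt (I := 𝓡 n) hu
  rw [ModelWithCorners.range_eq_univ, mfderivWithin_univ] at h
  exact DFunLike.congr_fun h w

/-- The coordinate frame as a linear equivalence. -/
def chartFrameEquiv {x₀ : M} {u : Eu n}
    (hu : u ∈ (Ψ n x₀).target) :
    Eu n ≃ₗ[ℝ] TangentSpace (𝓡 n) ((Ψ n x₀).symm u) :=
  LinearEquiv.ofLinearMap (chartFrame x₀ u).toLinearMap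
    (chartCoframe x₀ ((Ψ n x₀).symm u)).toLinearMap
    (LinearMap.ext fun w => chartFrame_chartCoframe hu w)
    (LinearMap.ext fun v => chartCoframe_chartFrame hu v)

/-- The coordinate frame as a basis. -/
def chartBasis {x₀ : M} {u : Eu n}
    (hu : u ∈ (Ψ n x₀).target) :
    Module.Basis (Fin n) ℝ (TangentSpace (𝓡 n) ((Ψ n x₀).symm u)) :=
  (EuclideanSpace.basisFun (Fin n) ℝ).toBasis.map (chartFrameEquiv hu)

theorem chartBasis_apply {x₀ : M} {u : Eu n}
    (hu : u ∈ (Ψ n x₀).target) (i : Fin n) :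
    chartBasis hu i = chartFrame x₀ u (EuclideanSpace.single i 1) := by
  rw [chartBasis, Module.Basis.map_apply, OrthonormalBasis.coe_toBasis,
    EuclideanSpace.basisFun_apply]
  rfl

theorem exists_target {x₀ x : M} (hx : x ∈ (Ψ n x₀).source) :
    ∃ u ∈ (Ψ n x₀).target, (Ψ n x₀).symm u = x :=
  ⟨_, (Ψ n x₀).map_source hx, (Ψ n x₀).left_inv hx⟩

/-- A form is recovered from its expression in a chart. -/
theorem form_eq_inChart {k : ℕ} (α : Form n M k) {x₀ x : M}
    (hx : x ∈ (Ψ n x₀).source) :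
    α x = (inChart α x₀ (Ψ n x₀ x)).compContinuousLinearMap (chartCoframe x₀ x) := by
  obtain ⟨u, hu, rfl⟩ := exists_target hx
  rw [(Ψ n x₀).right_inv hu]
  ext w
  simp only [inChart, ContinuousAlternatingMap.compContinuousLinearMap_apply]
  congr 1
  funext a
  exact (chartFrame_chartCoframe hu (w a)).symm

theorem mem_source_symm {x₀ : M} {u : Eu n}
    (hu : u ∈ (Ψ n x₀).target) :
    (Ψ n x₀).symm u ∈ (Ψ n x₀).source :=
  (Ψ n x₀).map_target hu

/-- The change of coordinates from the chart at `x₁` to the chart at `x₀`. -/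
def transition (x₁ x₀ : M) (u : Eu n) : Eu n :=
  Ψ n x₀ ((Ψ n x₁).symm u)

/-- The domain of the change of coordinates. -/
def overlap (x₁ x₀ : M) : Set (Eu n) :=
  (Ψ n x₁).target ∩ (Ψ n x₁).symm ⁻¹' (Ψ n x₀).source

omit [IsManifold (𝓡 n) ∞ M] in
theorem isOpen_overlap (x₁ x₀ : M) : IsOpen (overlap (n := n) x₁ x₀) :=
  (continuousOn_extChartAt_symm x₁).isOpen_inter_preimage (isOpen_extChartAt_target x₁)
    (isOpen_extChartAt_source x₀)

omit [IsManifold (𝓡 n) ∞ M] in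
theorem transition_mem {x₁ x₀ : M} {u : Eu n} (hu : u ∈ overlap x₁ x₀) :
    transition x₁ x₀ u ∈ overlap (n := n) x₀ x₁ := by
  refine ⟨(Ψ n x₀).map_source hu.2, ?_⟩
  simp only [transition, mem_preimage]
  rw [(Ψ n x₀).left_inv hu.2]
  exact (Ψ n x₁).map_target hu.1

omit [IsManifold (𝓡 n) ∞ M] in
theorem symm_transition {x₁ x₀ : M} {u : Eu n} (hu : u ∈ overlap x₁ x₀) :
    (Ψ n x₀).symm (transition x₁ x₀ u) = (Ψ n x₁).symm u :=
  (Ψ n x₀).left_inv hu.2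

omit [IsManifold (𝓡 n) ∞ M] in
theorem transition_transition {x₁ x₀ : M} {u : Eu n}
    (hu : u ∈ overlap x₁ x₀) : transition x₀ x₁ (transition x₁ x₀ u) = u := by
  rw [transition, symm_transition hu, (Ψ n x₁).right_inv hu.1]

theorem contDiffOn_transition (x₁ x₀ : M) :
    ContDiffOn ℝ ∞ (transition x₁ x₀) (overlap (n := n) x₁ x₀) := by
  have h := contDiffOn_ext_coord_change (I := 𝓡 n) (n := ∞) x₀ x₁
  refine h.mono fun u hu => ?_
  simp only [PartialEquiv.trans_source, PartialEquiv.symm_source, mem_inter_iff]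
  exact hu

theorem contDiffAt_transition {x₁ x₀ : M} {u : Eu n}
    (hu : u ∈ overlap x₁ x₀) : ContDiffAt ℝ ∞ (transition x₁ x₀) u :=
  (contDiffOn_transition x₁ x₀).contDiffAt ((isOpen_overlap x₁ x₀).mem_nhds hu)

theorem mdifferentiableAt_symm {x₀ : M} {u : Eu n}
    (hu : u ∈ (Ψ n x₀).target) :
    MDifferentiableAt 𝓘(ℝ, Eu n) (𝓡 n) (Ψ n x₀).symm u := by
  have h := mdifferentiableWithinAt_extChartAt_symm (I := 𝓡 n) hu
  rwa [ModelWithCorners.range_eq_univ, mdifferentiableWithinAt_univ] at h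

theorem chartCoframe_chartFrame_transition {x₁ x₀ : M} {u : Eu n}
    (hu : u ∈ overlap x₁ x₀) (v : Eu n) :
    chartCoframe x₀ ((Ψ n x₁).symm u) (chartFrame x₁ u v)
      = fderiv ℝ (transition x₁ x₀) u v := by
  have h0 : MDifferentiableAt (𝓡 n) 𝓘(ℝ, Eu n) (Ψ n x₀)
      ((Ψ n x₁).symm u) := by
    refine mdifferentiableAt_extChartAt ?_
    rw [← extChartAt_source (𝓡 n)]
    exact hu.2
  have h := mfderiv_comp u h0 (mdifferentiableAt_symm hu.1)
  rw [mfderiv_eq_fderiv] at h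
  exact (DFunLike.congr_fun h v).symm

/-- The transformation law of forms. -/
theorem inChart_transition {k : ℕ} (α : Form n M k) {x₁ x₀ : M} {u : Eu n}
    (hu : u ∈ overlap x₁ x₀) :
    inChart α x₁ u = (inChart α x₀ (transition x₁ x₀ u)).compContinuousLinearMap
      (fderiv ℝ (transition x₁ x₀) u) := by
  ext w
  conv_lhs => rw [inChart, form_eq_inChart α hu.2]
  simp only [ContinuousAlternatingMap.compContinuousLinearMap_apply]
  congr 1
  funext a
  exact chartCoframe_chartFrame_transition hu (w a)

theorem fderiv_transition_transition {x₁ x₀ : M} {u : Eu n}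
    (hu : u ∈ overlap x₁ x₀) (v : Eu n) :
    fderiv ℝ (transition x₀ x₁) (transition x₁ x₀ u) (fderiv ℝ (transition x₁ x₀) u v) = v := by
  have h1 := (contDiffAt_transition hu).differentiableAt (by simp)
  have h2 := (contDiffAt_transition (transition_mem hu)).differentiableAt (by simp)
  have h := fderiv_comp u h2 h1
  have h3 : transition x₀ x₁ ∘ transition x₁ x₀ =ᶠ[𝓝 u] id := by
    filter_upwards [(isOpen_overlap x₁ x₀).mem_nhds hu] with y hy
    exact transition_transition hy
  rw [h3.fderiv_eq, fderiv_id] at h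
  exact (DFunLike.congr_fun h v).symm

end ChartCalculus

/-! ### The metric and its Lie derivatives in a chart -/

section Metric

variable {n : ℕ} {M : Type*} [TopologicalSpace M] [ChartedSpace (Eu n) M]
  [IsManifold (𝓡 n) ∞ M]
  [RiemannianBundle (fun x : M => TangentSpace (𝓡 n) x)]

/-- The metric in a chart as a continuous bilinear map. -/
def metricCLM (x₀ : M) (u : Eu n) :
    Eu n →L[ℝ] Eu n →L[ℝ] ℝ :=
  LinearMap.toContinuousLinearMap
    ((LinearMap.toContinuousLinearMap (𝕜 := ℝ) (E := Eu n) (F' := ℝ)).toLinearMap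
      ∘ₗ LinearMap.mk₂ ℝ (chartMetric x₀ u)
        (fun _ _ _ => by simp only [chartMetric, map_add, inner_add_left])
        (fun _ _ _ => by simp only [chartMetric, map_smul, real_inner_smul_left, smul_eq_mul])
        (fun _ _ _ => by simp only [chartMetric, map_add, inner_add_right])
        (fun _ _ _ => by simp only [chartMetric, map_smul, real_inner_smul_right, smul_eq_mul]))

omit [IsManifold (𝓡 n) ∞ M] in
@[simp]
theorem metricCLM_apply (x₀ : M) (u v w : Eu n) :
    metricCLM x₀ u v w = chartMetric x₀ u v w := rfl

omit [IsManifold (𝓡 n) ∞ M] in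
theorem chartMetric_comm (x₀ : M) (u v w : Eu n) :
    chartMetric x₀ u v w = chartMetric x₀ u w v := real_inner_comm _ _

theorem chartMetric_pos {x₀ : M} {u : Eu n}
    (hu : u ∈ (Ψ n x₀).target) {v : Eu n} (hv : v ≠ 0) :
    0 < chartMetric x₀ u v v := by
  refine real_inner_self_pos.2 fun h => hv ?_
  have := chartCoframe_chartFrame hu v
  rw [h, map_zero] at this
  exact this.symm

/-- The metric in terms of its coordinate expression. -/
theorem inner_eq_chartMetric {x₀ x : M} (hx : x ∈ (Ψ n x₀).source)
    (v w : TangentSpace (𝓡 n) x) :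
    inner ℝ v w = chartMetric x₀ (Ψ n x₀ x) (chartCoframe x₀ x v)
      (chartCoframe x₀ x w) := by
  obtain ⟨u, hu, rfl⟩ := exists_target hx
  rw [(Ψ n x₀).right_inv hu, chartMetric, chartFrame_chartCoframe hu,
    chartFrame_chartCoframe hu]

theorem chartMetric_transition {x₁ x₀ : M} {u : Eu n}
    (hu : u ∈ overlap x₁ x₀) (v w : Eu n) :
    chartMetric x₁ u v w = chartMetric x₀ (transition x₁ x₀ u) (fderiv ℝ (transition x₁ x₀) u v)
      (fderiv ℝ (transition x₁ x₀) u w) := by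
  conv_lhs => rw [chartMetric, inner_eq_chartMetric hu.2]
  rw [chartCoframe_chartFrame_transition hu, chartCoframe_chartFrame_transition hu]
  rfl

/-- The trivialization of the tangent bundle at `x₀` is the differential of the chart there. The
vectors are indexed by coordinates, so that both the coordinate frame and global vector fields can
be inserted. -/
theorem contMDiffOn_chartSection (x₀ : M)
    {V : ∀ u : Eu n, TangentSpace (𝓡 n) ((Ψ n x₀).symm u)} :
    ContMDiffOn 𝓘(ℝ, Eu n) (𝓡 n).tangent ∞
      (fun u => (⟨(Ψ n x₀).symm u, V u⟩ : TangentBundle (𝓡 n) M))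
      (Ψ n x₀).target ↔
    ContDiffOn ℝ ∞ (fun u => chartCoframe x₀ ((Ψ n x₀).symm u) (V u))
      (Ψ n x₀).target := by
  have hsrc : ∀ u ∈ (Ψ n x₀).target,
      (Ψ n x₀).symm u ∈ (chartAt (Eu n) x₀).source := by
    intro u hu
    rw [← extChartAt_source (𝓡 n)]
    exact mem_source_symm hu
  have he : MapsTo (fun u => (⟨(Ψ n x₀).symm u, V u⟩ : TangentBundle (𝓡 n) M))
      (Ψ n x₀).target
      (trivializationAt (Eu n) (TangentSpace (𝓡 n)) x₀).source := by
    intro u hu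
    rw [TangentBundle.trivializationAt_source]
    exact hsrc u hu
  rw [ModelWithCorners.tangent, (trivializationAt (Eu n)
    (TangentSpace (𝓡 n)) x₀).contMDiffOn_iff he, ← contMDiffOn_iff_contDiffOn]
  have h1 : ContMDiffOn 𝓘(ℝ, Eu n) (𝓡 n) ∞ (Ψ n x₀).symm
      (Ψ n x₀).target := contMDiffOn_extChartAt_symm x₀
  have h2 : ∀ u ∈ (Ψ n x₀).target,
      (trivializationAt (Eu n) (TangentSpace (𝓡 n)) x₀
        (⟨(Ψ n x₀).symm u, V u⟩ : TangentBundle (𝓡 n) M)).2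
        = chartCoframe x₀ ((Ψ n x₀).symm u) (V u) := by
    intro u hu
    have h := TangentBundle.continuousLinearMapAt_trivializationAt (I := 𝓡 n) (hsrc u hu)
    rw [chartCoframe, ← h, Trivialization.continuousLinearMapAt_apply,
      Trivialization.coe_linearMapAt_of_mem]
    exact hsrc u hu
  constructor
  · rintro ⟨-, h⟩
    exact h.congr fun u hu => (h2 u hu).symm
  · intro h
    exact ⟨h1, h.congr h2⟩

variable [IsContMDiffRiemannianBundle (𝓡 n) ∞ (Eu n)
      (fun x : M => TangentSpace (𝓡 n) x)]

/-- The coordinate fields have constant components, hence are smooth sections, and the bundle metric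
is smooth on smooth sections. -/
theorem contDiffOn_chartMetric (x₀ : M) (v w : Eu n) :
    ContDiffOn ℝ ∞ (fun u => chartMetric x₀ u v w) (Ψ n x₀).target := by
  have h : ∀ v : Eu n, ContMDiffOn 𝓘(ℝ, Eu n)
      (𝓡 n).tangent ∞ (fun u => (⟨(Ψ n x₀).symm u, chartFrame x₀ u v⟩ :
        TangentBundle (𝓡 n) M)) (Ψ n x₀).target := by
    intro v
    rw [contMDiffOn_chartSection]
    exact contDiffOn_const.congr fun u hu => chartCoframe_chartFrame hu v
  rw [← contMDiffOn_iff_contDiffOn]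
  exact (h v).inner_bundle (h w)

theorem contDiffOn_metricCLM (x₀ : M) :
    ContDiffOn ℝ ∞ (metricCLM x₀) (Ψ n x₀).target := by
  rw [contDiffOn_clm_apply]
  intro v
  rw [contDiffOn_clm_apply]
  exact contDiffOn_chartMetric x₀ v

/-- The Gram matrix of the coordinate frame. -/
def chartGram (x₀ : M) (u : Eu n) : Matrix (Fin n) (Fin n) ℝ :=
  Matrix.of fun i j =>
    chartMetric x₀ u (EuclideanSpace.single i 1) (EuclideanSpace.single j 1)

omit [IsManifold (𝓡 n) ∞ M] [IsContMDiffRiemannianBundle (𝓡 n) ∞ (Eu n)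
      (fun x : M => TangentSpace (𝓡 n) x)] in
theorem chartDet_eq (x₀ : M) (u : Eu n) :
    chartDet x₀ u = (chartGram x₀ u).det := rfl

omit [IsContMDiffRiemannianBundle (𝓡 n) ∞ (Eu n)
      (fun x : M => TangentSpace (𝓡 n) x)] in
theorem gram_chartBasis {x₀ : M} {u : Eu n}
    (hu : u ∈ (Ψ n x₀).target) :
    Matrix.gram ℝ (chartBasis hu) = chartGram x₀ u := by
  ext i j
  simp only [Matrix.gram_apply, chartBasis_apply, chartGram, chartMetric, Matrix.of_apply]

omit [IsContMDiffRiemannianBundle (𝓡 n) ∞ (Eu n)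
      (fun x : M => TangentSpace (𝓡 n) x)] in
theorem chartGram_posDef {x₀ : M} {u : Eu n}
    (hu : u ∈ (Ψ n x₀).target) : (chartGram x₀ u).PosDef := by
  rw [← gram_chartBasis hu, Matrix.posDef_gram_iff_linearIndependent]
  exact (chartBasis hu).linearIndependent

omit [IsContMDiffRiemannianBundle (𝓡 n) ∞ (Eu n)
      (fun x : M => TangentSpace (𝓡 n) x)] in
theorem chartDet_pos {x₀ : M} {u : Eu n}
    (hu : u ∈ (Ψ n x₀).target) : 0 < chartDet x₀ u :=
  (chartGram_posDef hu).det_pos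

theorem contDiffOn_chartDet (x₀ : M) :
    ContDiffOn ℝ ∞ (chartDet x₀) (Ψ n x₀).target := by
  have : chartDet x₀ = fun u => ∑ σ : Equiv.Perm (Fin n), (Equiv.Perm.sign σ : ℤ) •
      ∏ i, chartMetric x₀ u (EuclideanSpace.single (σ i) 1) (EuclideanSpace.single i 1) := by
    funext u
    rw [chartDet, Matrix.det_apply]
    rfl
  rw [this]
  exact ContDiffOn.sum fun σ _ => (contDiffOn_prod fun i _ =>
    contDiffOn_chartMetric x₀ _ _).const_smul (R := ℤ) _

/-- The standard frame of `ℝⁿ`. -/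
def stdFrame (n : ℕ) (i : Fin n) : Eu n := EuclideanSpace.single i 1

omit [IsContMDiffRiemannianBundle (𝓡 n) ∞ (Eu n)
      (fun x : M => TangentSpace (𝓡 n) x)] in
/-- The inner product of forms in a chart. -/
theorem covInner_eq_inChart {k : ℕ} (α β : Form n M k) {x₀ : M} {u : Eu n}
    (hu : u ∈ (Ψ n x₀).target) :
    covInner (α ((Ψ n x₀).symm u)) (β ((Ψ n x₀).symm u)) =
      mpair (stdFrame n) (stdFrame n) (fun _ => (chartGram x₀ u)⁻¹) (inChart α x₀ u)
        (inChart β x₀ u) := by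
  rw [covInner_eq_mpair (chartBasis hu), gram_chartBasis hu, inChart, inChart, mpair_comp_left,
    mpair_comp_right]
  have : (chartBasis hu : Fin n → _) = fun i => chartFrame x₀ u (stdFrame n i) :=
    funext fun i => chartBasis_apply hu i
  rw [this]

/-- The Lie derivative `L_Y g` of the metric in a chart. -/
def lieMetric (x₀ : M) (Y : Eu n → Eu n)
    (u v w : Eu n) : ℝ :=
  fderiv ℝ (metricCLM x₀) u (Y u) v w + chartMetric x₀ u (fderiv ℝ Y u v) w
    + chartMetric x₀ u v (fderiv ℝ Y u w)

theorem fderiv_chartMetric {x₀ : M} {u : Eu n}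
    (hu : u ∈ (Ψ n x₀).target) (a v w : Eu n) :
    fderiv ℝ (fun u => chartMetric x₀ u v w) u a = fderiv ℝ (metricCLM x₀) u a v w := by
  have h : HasFDerivAt (metricCLM (n := n) x₀) (fderiv ℝ (metricCLM x₀) u) u :=
    (((contDiffOn_metricCLM x₀).contDiffAt ((isOpen_extChartAt_target x₀).mem_nhds hu)
      ).differentiableAt (by simp)).hasFDerivAt
  have h2 := (h.clm_apply (hasFDerivAt_const v u)).clm_apply (hasFDerivAt_const w u)
  have := h2.fderiv
  simp only [metricCLM_apply] at this
  rw [this]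
  simp

/-- Twice the symmetric part of the covariant derivative is the Lie derivative of the metric. -/
theorem covDerivInner_add_swap (Y : ∀ x : M, TangentSpace (𝓡 n) x) (x : M)
    (v w : TangentSpace (𝓡 n) x) :
    covDerivInner Y x v w + covDerivInner Y x w v =
      lieMetric x (fun u => chartCoframe x ((Ψ n x).symm u)
        (Y ((Ψ n x).symm u))) (Ψ n x x)
        (chartCoframe x x v) (chartCoframe x x w) := by
  have hu : Ψ n x x ∈ (Ψ n x).target := mem_extChartAt_target x
  simp only [covDerivInner, lieMetric, fderiv_chartMetric hu]
  rw [chartMetric_comm x _ (chartCoframe x x v) (fderiv ℝ _ _ _)]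
  -- With dg symmetric in its last two arguments, the Christoffel terms for (v,w) and for (w,v)
  -- cancel except for twice ½ (∂_Y g)(v,w).
  have hs : ∀ a b c : Eu n,
      fderiv ℝ (metricCLM x) (Ψ n x x) a b c =
      fderiv ℝ (metricCLM x) (Ψ n x x) a c b := by
    intro a b c
    rw [← fderiv_chartMetric hu, ← fderiv_chartMetric hu]
    simp only [chartMetric_comm x _ b c]
  rw [hs _ (chartCoframe x x w) (chartCoframe x x v),
    hs _ (chartCoframe x x w) (chartCoframe x ((Ψ n x).symm _) _),
    hs _ (chartCoframe x x v) (chartCoframe x ((Ψ n x).symm _) _)]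
  ring

/-- The Lie derivative of the metric does not depend on the chart. -/
theorem lieMetric_transition {x₁ x₀ : M} {u : Eu n} (hu : u ∈ overlap x₁ x₀)
    {Y₁ Y₀ : Eu n → Eu n}
    (hY₁ : DifferentiableAt ℝ Y₁ u) (hY₀ : DifferentiableAt ℝ Y₀ (transition x₁ x₀ u))
    (hY : ∀ᶠ y in 𝓝 u, fderiv ℝ (transition x₁ x₀) y (Y₁ y) = Y₀ (transition x₁ x₀ y))
    (v w : Eu n) :
    lieMetric x₁ Y₁ u v w = lieMetric x₀ Y₀ (transition x₁ x₀ u)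
      (fderiv ℝ (transition x₁ x₀) u v) (fderiv ℝ (transition x₁ x₀) u w) := by
  set T := transition (n := n) x₁ x₀ with hT
  have hTc : ContDiffAt ℝ ∞ T u := contDiffAt_transition hu
  have hT1 : HasFDerivAt T (fderiv ℝ T u) u := (hTc.differentiableAt (by simp)).hasFDerivAt
  have hT2 : HasFDerivAt (fderiv ℝ T) (fderiv ℝ (fderiv ℝ T) u) u :=
    ((hTc.fderiv_right (m := 1) (by norm_cast)).differentiableAt (by simp)).hasFDerivAt
  -- Second derivatives of the transition map enter through the pulled back metric and through the
  -- transformed field. By symmetry the two contributions are the same, which makes the Lie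
  -- derivative tensorial.
  have hsym : ∀ a b, fderiv ℝ (fderiv ℝ T) u a b = fderiv ℝ (fderiv ℝ T) u b a := by
    intro a b
    exact (hTc.isSymmSndFDerivAt (by simp; norm_cast)).eq a b
  have hmem := (transition_mem hu).1
  have hg0 : HasFDerivAt (metricCLM (n := n) x₀) (fderiv ℝ (metricCLM x₀) (T u)) (T u) :=
    (((contDiffOn_metricCLM x₀).contDiffAt ((isOpen_extChartAt_target x₀).mem_nhds hmem)
      ).differentiableAt (by simp)).hasFDerivAt
  have hD : ∀ a, fderiv ℝ (fderiv ℝ T) u a (Y₁ u) + fderiv ℝ T u (fderiv ℝ Y₁ u a)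
      = fderiv ℝ Y₀ (T u) (fderiv ℝ T u a) := by
    intro a
    have h1 := hT2.clm_apply hY₁.hasFDerivAt
    have h2 := hY₀.hasFDerivAt.comp u hT1
    have h3 := DFunLike.congr_fun (h1.unique (h2.congr_of_eventuallyEq hY)) a
    simp only [ContinuousLinearMap.comp_apply, add_apply,
      ContinuousLinearMap.flip_apply] at h3
    rw [← h3, add_comm]
  have hg1 : fderiv ℝ (metricCLM x₁) u (Y₁ u) v w =
      fderiv ℝ (metricCLM x₀) (T u) (fderiv ℝ T u (Y₁ u)) (fderiv ℝ T u v) (fderiv ℝ T u w)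
      + chartMetric x₀ (T u) (fderiv ℝ (fderiv ℝ T) u (Y₁ u) v) (fderiv ℝ T u w)
      + chartMetric x₀ (T u) (fderiv ℝ T u v) (fderiv ℝ (fderiv ℝ T) u (Y₁ u) w) := by
    rw [← fderiv_chartMetric hu.1]
    have he : (fun y => chartMetric x₁ y v w) =ᶠ[𝓝 u]
        fun y => metricCLM x₀ (T y) (fderiv ℝ T y v) (fderiv ℝ T y w) := by
      filter_upwards [(isOpen_overlap x₁ x₀).mem_nhds hu] with y hy
      exact chartMetric_transition hy v w
    rw [he.fderiv_eq]
    have hv := hT2.clm_apply (hasFDerivAt_const v u)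
    have hw := hT2.clm_apply (hasFDerivAt_const w u)
    have hgT : HasFDerivAt (fun y => metricCLM (n := n) x₀ (T y))
        ((fderiv ℝ (metricCLM x₀) (T u)).comp (fderiv ℝ T u)) u :=
      hasFDerivAt_comp_apply (E := Eu n)
        (F := Eu n →L[ℝ] Eu n →L[ℝ] ℝ) hg0 hT1
    rw [((hgT.clm_apply hv).clm_apply hw).fderiv]
    simp
    ring
  have hYu : fderiv ℝ T u (Y₁ u) = Y₀ (T u) := hY.self_of_nhds
  simp only [lieMetric]
  rw [hg1, hYu, chartMetric_transition hu, chartMetric_transition hu, ← hD, ← hD, hsym _ (Y₁ u),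
    hsym _ (Y₁ u)]
  simp only [← metricCLM_apply, map_add, add_apply]
  ring

end Metric

section RiemannianManifold

variable {n : ℕ} {M : Type*} [TopologicalSpace M] [ChartedSpace (Eu n) M] [IsManifold (𝓡 n) ∞ M]
  [RiemannianBundle (fun x : M => TangentSpace (𝓡 n) x)]
  [IsContMDiffRiemannianBundle (𝓡 n) ∞ (Eu n) (fun x : M => TangentSpace (𝓡 n) x)]

/-! ### The Riemannian volume in charts -/

section Volume

/-- The Riemannian density in a chart. -/
def chartDensity (x₀ : M) (u : Eu n) : ℝ := √(chartDet x₀ u)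

theorem chartDensity_pos {x₀ : M} {u : Eu n}
    (hu : u ∈ (Ψ n x₀).target) : 0 < chartDensity x₀ u :=
  Real.sqrt_pos.2 (chartDet_pos hu)

theorem contDiffOn_chartDensity (x₀ : M) :
    ContDiffOn ℝ ∞ (chartDensity x₀) (Ψ n x₀).target :=
  (contDiffOn_chartDet x₀).sqrt fun _ hu => (chartDet_pos hu).ne'

theorem aemeasurable_chartDensity (x₀ : M) :
    AEMeasurable (fun u => ENNReal.ofReal (chartDensity x₀ u))
      (volume.restrict (Ψ n x₀).target) :=
  ((contDiffOn_chartDensity x₀).continuousOn.aemeasurable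
    (isOpen_extChartAt_target x₀).measurableSet).ennreal_ofReal

/-- The volume in the coordinates of a chart. -/
def coordMeasure (x₀ : M) : Measure (Eu n) :=
  (volume.restrict (Ψ n x₀).target).withDensity
    fun u => ENNReal.ofReal (chartDensity x₀ u)

theorem ae_coordMeasure_iff (x₀ : M) {p : Eu n → Prop} :
    (∀ᵐ u ∂(coordMeasure x₀), p u) ↔
      ∀ᵐ u ∂(volume.restrict (Ψ n x₀).target), p u := by
  rw [coordMeasure, ae_withDensity_iff' (aemeasurable_chartDensity x₀)]
  have hmem := ae_restrict_mem (μ := (volume : Measure (Eu n)))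
    (isOpen_extChartAt_target (I := 𝓡 n) x₀).measurableSet
  refine ⟨fun h => ?_, fun h => h.mono fun u hu _ => hu⟩
  filter_upwards [h, hmem] with u hu hu'
  exact hu (by simpa using chartDensity_pos hu')

theorem det_mapMatrix (A : Eu n →L[ℝ] Eu n) :
    A.det = (Matrix.of fun i j : Fin n => A (stdFrame n j) i).det := by
  rw [ContinuousLinearMap.det, ← LinearMap.det_toMatrix (EuclideanSpace.basisFun (Fin n) ℝ).toBasis]
  congr 1

/-- The Gram determinant of a pulled back bilinear form. -/
theorem det_pullback (B : Eu n →L[ℝ] Eu n →L[ℝ] ℝ)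
    (A : Eu n →L[ℝ] Eu n) :
    (Matrix.of fun i j : Fin n => B (A (stdFrame n i)) (A (stdFrame n j))).det =
      A.det ^ 2 * (Matrix.of fun i j : Fin n => B (stdFrame n i) (stdFrame n j)).det := by
  set D : Matrix (Fin n) (Fin n) ℝ := Matrix.of fun i j : Fin n => A (stdFrame n j) i with hD
  have hA : ∀ j, A (stdFrame n j) = ∑ i, D i j • stdFrame n i := by
    intro j
    have := (EuclideanSpace.basisFun (Fin n) ℝ).sum_repr (A (stdFrame n j))
    simpa [hD, stdFrame] using this.symm
  have : (Matrix.of fun i j : Fin n => B (A (stdFrame n i)) (A (stdFrame n j))) =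
      D.transpose * (Matrix.of fun i j : Fin n => B (stdFrame n i) (stdFrame n j)) * D := by
    ext i j
    simp only [Matrix.of_apply, hA, map_sum, map_smul, sum_apply, smul_apply,
      smul_eq_mul, Matrix.mul_apply, Matrix.transpose_apply, sum_mul, mul_sum]
    refine sum_congr rfl fun k _ => sum_congr rfl fun l _ => by ring
  rw [this, Matrix.det_mul, Matrix.det_mul, Matrix.det_transpose, det_mapMatrix]
  ring

theorem chartDensity_transition {x₁ x₀ : M} {u : Eu n}
    (hu : u ∈ overlap x₁ x₀) :
    chartDensity x₁ u = |(fderiv ℝ (transition x₁ x₀) u).det| *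
      chartDensity x₀ (transition x₁ x₀ u) := by
  have h : chartDet x₁ u = (fderiv ℝ (transition x₁ x₀) u).det ^ 2 *
      chartDet x₀ (transition x₁ x₀ u) := by
    have h2 := det_pullback (metricCLM x₀ (transition x₁ x₀ u)) (fderiv ℝ (transition x₁ x₀) u)
    simp only [metricCLM_apply, ← chartMetric_transition hu] at h2
    exact h2
  rw [chartDensity, h, Real.sqrt_mul (sq_nonneg _), Real.sqrt_sq_eq_abs, chartDensity]

variable [MeasurableSpace M] [BorelSpace M]

variable (n) in
/-- The volume of the domain of a chart. -/
def chartMeasure (x₀ : M) : Measure M :=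
  Measure.map (Ψ n x₀).symm (coordMeasure x₀)

theorem riemVol_eq_iSup : riemVol n M = ⨆ x₀ : M, chartMeasure n x₀ := rfl

theorem aemeasurable_symm (x₀ : M) :
    AEMeasurable (Ψ n x₀).symm (coordMeasure (n := n) x₀) :=
  ((continuousOn_extChartAt_symm x₀).aemeasurable
    (isOpen_extChartAt_target x₀).measurableSet).mono_ac (withDensity_absolutelyContinuous _ _)

theorem measurableSet_preimage_symm (x₀ : M) {s : Set M} (hs : MeasurableSet s) :
    MeasurableSet ((Ψ n x₀).target ∩ (Ψ n x₀).symm ⁻¹' s) := by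
  have hc : Measurable ((Ψ n x₀).target.domRestrict (Ψ n x₀).symm) :=
    (continuousOn_iff_continuous_domRestrict.1 (continuousOn_extChartAt_symm x₀)).measurable
  have := (isOpen_extChartAt_target (I := 𝓡 n) x₀).measurableSet.subtype_image (hc hs)
  convert this using 1
  ext u
  simp [Set.domRestrict, and_comm]

theorem chartMeasure_apply (x₀ : M) {s : Set M} (hs : MeasurableSet s) :
    chartMeasure n x₀ s = ∫⁻ u in (Ψ n x₀).target ∩ (Ψ n x₀).symm ⁻¹' s,
      ENNReal.ofReal (chartDensity x₀ u) := by
  have hm := measurableSet_preimage_symm (n := n) x₀ hs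
  have h0 : coordMeasure x₀ ((Ψ n x₀).target)ᶜ = 0 := by
    rw [coordMeasure]
    refine withDensity_absolutelyContinuous _ _ ?_
    rw [Measure.restrict_apply (isOpen_extChartAt_target x₀).measurableSet.compl]
    simp
  rw [chartMeasure, Measure.map_apply_of_aemeasurable (aemeasurable_symm x₀) hs]
  have : coordMeasure x₀ ((Ψ n x₀).symm ⁻¹' s) =
      coordMeasure x₀ ((Ψ n x₀).target ∩ (Ψ n x₀).symm ⁻¹' s) := by
    refine le_antisymm ?_ (measure_mono inter_subset_right)
    calc _ ≤ coordMeasure x₀ (((Ψ n x₀).target ∩ (Ψ n x₀).symm ⁻¹' s)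
          ∪ ((Ψ n x₀).target)ᶜ) := measure_mono fun u hu => by
            by_cases h : u ∈ (Ψ n x₀).target
            · exact Or.inl ⟨h, hu⟩
            · exact Or.inr h
      _ ≤ _ := (measure_union_le _ _).trans (by rw [h0, add_zero])
  rw [this, coordMeasure, withDensity_apply _ hm, Measure.restrict_restrict hm]
  congr 2
  exact inter_eq_left.2 inter_subset_left

/-- Change of variables for the transition map: its Jacobian is exactly the ratio of the two
densities. This makes the chart measures restrictions of a single measure. -/
theorem chartMeasure_compat (x₀ x₁ : M) {s : Set M} (hs : MeasurableSet s)
    (h0 : s ⊆ (Ψ n x₀).source) (h1 : s ⊆ (Ψ n x₁).source) :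
    chartMeasure n x₀ s = chartMeasure n x₁ s := by
  rw [chartMeasure_apply x₀ hs, chartMeasure_apply x₁ hs]
  set A₁ := (Ψ n x₁).target ∩ (Ψ n x₁).symm ⁻¹' s with hA₁
  have hsub : A₁ ⊆ overlap x₁ x₀ := fun u hu => ⟨hu.1, h0 hu.2⟩
  have himg : (Ψ n x₀).target ∩ (Ψ n x₀).symm ⁻¹' s =
      transition x₁ x₀ '' A₁ := by
    ext v
    constructor
    · rintro ⟨hv, hvs⟩
      have hv' : v ∈ overlap x₀ x₁ := ⟨hv, h1 hvs⟩
      refine ⟨transition x₀ x₁ v, ⟨(transition_mem hv').1, ?_⟩, transition_transition hv'⟩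
      rw [mem_preimage, symm_transition hv']
      exact hvs
    · rintro ⟨u, hu, rfl⟩
      refine ⟨(transition_mem (hsub hu)).1, ?_⟩
      rw [mem_preimage, symm_transition (hsub hu)]
      exact hu.2
  rw [himg, lintegral_image_eq_lintegral_abs_det_fderiv_mul volume
    (measurableSet_preimage_symm x₁ hs) (f' := fderiv ℝ (transition x₁ x₀))
    (fun u hu => ((contDiffAt_transition (hsub hu)).differentiableAt
      (by simp)).hasFDerivAt.hasFDerivWithinAt)
    (fun u hu v hv huv => by
      rw [← transition_transition (hsub hu), huv, transition_transition (hsub hv)])]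
  refine setLIntegral_congr_fun (measurableSet_preimage_symm x₁ hs) fun u hu => ?_
  rw [chartDensity_transition (hsub hu), ENNReal.ofReal_mul (abs_nonneg _)]

theorem chartMeasure_compl_source (x₀ : M) :
    chartMeasure n x₀ ((Ψ n x₀).source)ᶜ = 0 := by
  rw [chartMeasure_apply x₀ (isOpen_extChartAt_source x₀).measurableSet.compl]
  have : (Ψ n x₀).target ∩
      (Ψ n x₀).symm ⁻¹' ((Ψ n x₀).source)ᶜ = ∅ := by
    ext u
    simp only [mem_inter_iff, mem_preimage, mem_compl_iff, mem_empty_iff_false, iff_false, not_and,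
      not_not]
    exact fun hu => mem_source_symm hu
  rw [this]
  simp

variable [CompactSpace M]

/-- A finite Borel partition subordinate to a family of neighbourhoods. -/
theorem exists_partition {V : M → Set M} (hV : ∀ x, IsOpen (V x)) (hmem : ∀ x, x ∈ V x) :
    ∃ (N : ℕ) (c : Fin N → M) (A : Fin N → Set M),
    (∀ i, MeasurableSet (A i)) ∧ Pairwise (fun i j => Disjoint (A i) (A j)) ∧
    (⋃ i, A i) = univ ∧ ∀ i, A i ⊆ V (c i) := by
  obtain ⟨t, ht⟩ := isCompact_univ.elim_nhds_subcover V fun x _ => (hV x).mem_nhds (hmem x)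
  let c : Fin t.card → M := fun i => (t.equivFin.symm i : M)
  refine ⟨t.card, c, disjointed fun i => V (c i), fun i => ?_, disjoint_disjointed _, ?_,
    fun i => disjointed_subset _ _⟩
  · exact disjointedRec (f := fun i => V (c i)) (p := MeasurableSet)
      (fun t i ht => ht.diff (hV _).measurableSet) (hV _).measurableSet
  · rw [iUnion_disjointed]
    refine eq_univ_of_univ_subset (ht.2.trans fun x hx => ?_)
    obtain ⟨y, hy, hxy⟩ := mem_iUnion₂.1 hx
    refine mem_iUnion.2 ⟨t.equivFin ⟨y, hy⟩, ?_⟩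
    simpa [c] using hxy

/-- The set is cut along a partition and every piece is measured in its own chart. For sets leaving
the chart at `x₀` only an inequality remains, as the chart measure ignores what lies outside; the
inequality serves to dominate the supremum defining the volume. -/
theorem chartMeasure_partition {N : ℕ} {c : Fin N → M} {A : Fin N → Set M}
    (hA : ∀ i, MeasurableSet (A i))
    (hd : Pairwise (fun i j => Disjoint (A i) (A j))) (hU : (⋃ i, A i) = univ)
    (hs : ∀ i, A i ⊆ (Ψ n (c i)).source) (x₀ : M) {s : Set M} (hm : MeasurableSet s) :
    chartMeasure n x₀ s ≤ ∑ i, chartMeasure n (c i) (s ∩ A i) ∧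
    (s ⊆ (Ψ n x₀).source →
      chartMeasure n x₀ s = ∑ i, chartMeasure n (c i) (s ∩ A i)) := by
  have hS : MeasurableSet (Ψ n x₀).source :=
    (isOpen_extChartAt_source x₀).measurableSet
  have key : ∀ s, MeasurableSet s → s ⊆ (Ψ n x₀).source →
      chartMeasure n x₀ s = ∑ i, chartMeasure n (c i) (s ∩ A i) := by
    intro s hm hsub
    calc chartMeasure n x₀ s = chartMeasure n x₀ (⋃ i, s ∩ A i) := by
          rw [← inter_iUnion, hU, inter_univ]
      _ = ∑ i, chartMeasure n x₀ (s ∩ A i) := by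
          rw [measure_iUnion (fun i j hij => (hd hij).mono inter_subset_right inter_subset_right)
            (fun i => hm.inter (hA i)), tsum_fintype]
      _ = _ := sum_congr rfl fun i _ => chartMeasure_compat x₀ (c i) (hm.inter (hA i))
          (inter_subset_left.trans hsub) (inter_subset_right.trans (hs i))
  refine ⟨?_, key s hm⟩
  calc chartMeasure n x₀ s ≤ chartMeasure n x₀ (s ∩ (Ψ n x₀).source)
        + chartMeasure n x₀ ((Ψ n x₀).source)ᶜ := by
        refine (measure_mono fun y hy => ?_).trans (measure_union_le _ _)
        by_cases h : y ∈ (Ψ n x₀).source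
        · exact Or.inl ⟨hy, h⟩
        · exact Or.inr h
    _ = chartMeasure n x₀ (s ∩ (Ψ n x₀).source) := by
        rw [chartMeasure_compl_source, add_zero]
    _ = ∑ i, chartMeasure n (c i) (s ∩ (Ψ n x₀).source ∩ A i) :=
        key _ (hm.inter hS) inter_subset_right
    _ ≤ _ := sum_le_sum fun i _ => measure_mono
        (inter_subset_inter_left _ inter_subset_left)

/-- The measure ν glued from a partition is an upper bound of all chart measures, hence of their
supremum, and it coincides with the chart measure at `x₀` on subsets of the chart domain. So the
supremum adds nothing there. -/
theorem riemVol_apply_of_subset {x₀ : M} {s : Set M} (hm : MeasurableSet s)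
    (hs : s ⊆ (Ψ n x₀).source) : riemVol n M s = chartMeasure n x₀ s := by
  refine le_antisymm ?_ ?_
  · obtain ⟨N, c, A, hA, hd, hU, hsub⟩ := exists_partition
      (V := fun x : M => (Ψ n x).source) (fun x => isOpen_extChartAt_source x)
      (fun x => mem_extChartAt_source x)
    let ν : Measure M := Measure.sum fun i => (chartMeasure n (c i)).restrict (A i)
    have hν : ∀ s, MeasurableSet s → ν s = ∑ i, chartMeasure n (c i) (s ∩ A i) := by
      intro s hm
      rw [Measure.sum_apply _ hm, tsum_fintype]
      exact sum_congr rfl fun i _ => Measure.restrict_apply hm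
    have hle : riemVol n M ≤ ν := by
      rw [riemVol_eq_iSup]
      refine iSup_le fun x => Measure.le_iff.2 fun s hm => ?_
      rw [hν s hm]
      exact (chartMeasure_partition hA hd hU hsub x hm).1
    rw [(chartMeasure_partition hA hd hU hsub x₀ hm).2 hs, ← hν s hm]
    exact hle s
  · rw [riemVol_eq_iSup]
    exact le_iSup (fun x => chartMeasure n x) x₀ s

theorem riemVol_restrict_source (x₀ : M) :
    (riemVol n M).restrict (Ψ n x₀).source = chartMeasure n x₀ := by
  have hS : MeasurableSet (Ψ n x₀).source :=
    (isOpen_extChartAt_source x₀).measurableSet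
  ext s hm
  rw [Measure.restrict_apply hm, riemVol_apply_of_subset (hm.inter hS) inter_subset_right]
  refine le_antisymm (measure_mono inter_subset_left) ?_
  calc chartMeasure n x₀ s ≤ chartMeasure n x₀ (s ∩ (Ψ n x₀).source)
        + chartMeasure n x₀ ((Ψ n x₀).source)ᶜ := by
        refine (measure_mono fun y hy => ?_).trans (measure_union_le _ _)
        by_cases h : y ∈ (Ψ n x₀).source
        · exact Or.inl ⟨hy, h⟩
        · exact Or.inr h
    _ = _ := by rw [chartMeasure_compl_source, add_zero]

/-- Measurable embeddings transport null sets, measurability and integrals of arbitrary functions,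
so the transfer statements below need no measurability hypothesis. -/
theorem measurableEmbedding_symm (x₀ : M) :
    MeasurableEmbedding ((Ψ n x₀).target.domRestrict (Ψ n x₀).symm) := by
  refine (Topology.IsOpenEmbedding.of_continuous_injective_isOpenMap
    (continuousOn_iff_continuous_domRestrict.1 (continuousOn_extChartAt_symm x₀))
    ?_ ?_).measurableEmbedding
  · intro u v huv
    exact Subtype.ext ((Ψ n x₀).symm.injOn u.2 v.2 huv)
  · intro s hs
    have h1 : IsOpen (Subtype.val '' s : Set (Eu n)) :=
      (isOpen_extChartAt_target x₀).isOpenMap_subtype_val s hs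
    have h2 := (continuousOn_extChartAt x₀).isOpen_inter_preimage
      (isOpen_extChartAt_source (I := 𝓡 n) x₀) h1
    convert h2 using 1
    ext y
    constructor
    · rintro ⟨u, hu, rfl⟩
      refine ⟨mem_source_symm u.2, u, hu, ?_⟩
      exact ((Ψ n x₀).right_inv u.2).symm
    · rintro ⟨hy, u, hu, huy⟩
      refine ⟨u, hu, ?_⟩
      change (Ψ n x₀).symm u = y
      rw [huy, (Ψ n x₀).left_inv hy]

theorem coordMeasure_eq_map (x₀ : M) : coordMeasure (n := n) x₀ =
    (Measure.comap ((↑) : (Ψ n x₀).target → Eu n)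
      (coordMeasure x₀)).map (↑) := by
  have hm := (isOpen_extChartAt_target (I := 𝓡 n) x₀).measurableSet
  rw [(MeasurableEmbedding.subtype_coe hm).map_comap, Subtype.range_coe, coordMeasure,
    restrict_withDensity hm, Measure.restrict_restrict hm, inter_self]

theorem chartMeasure_eq_map (x₀ : M) : chartMeasure n x₀ =
    (Measure.comap ((↑) : (Ψ n x₀).target → Eu n)
      (coordMeasure x₀)).map
      ((Ψ n x₀).target.domRestrict (Ψ n x₀).symm) := by
  have hm := (isOpen_extChartAt_target (I := 𝓡 n) x₀).measurableSet
  ext s hs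
  rw [chartMeasure, Measure.map_apply_of_aemeasurable (aemeasurable_symm x₀) hs,
    (measurableEmbedding_symm x₀).map_apply]
  conv_lhs => rw [coordMeasure_eq_map]
  rw [(MeasurableEmbedding.subtype_coe hm).map_apply]
  rfl

theorem aestronglyMeasurable_chart_iff {F : Type*} [TopologicalSpace F] (x₀ : M) {f : M → F} :
    AEStronglyMeasurable f ((riemVol n M).restrict (Ψ n x₀).source) ↔
      AEStronglyMeasurable (fun u => f ((Ψ n x₀).symm u))
        (volume.restrict (Ψ n x₀).target) := by
  have hm := (isOpen_extChartAt_target (I := 𝓡 n) x₀).measurableSet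
  rw [riemVol_restrict_source, chartMeasure_eq_map,
    (measurableEmbedding_symm x₀).aestronglyMeasurable_map_iff]
  have h : AEStronglyMeasurable (fun u => f ((Ψ n x₀).symm u)) (coordMeasure x₀) ↔
      AEStronglyMeasurable (fun u => f ((Ψ n x₀).symm u))
        (volume.restrict (Ψ n x₀).target) := by
    constructor
    · intro h
      refine h.mono_ac (Measure.AbsolutelyContinuous.mk fun s _ hs => ?_)
      have := (ae_coordMeasure_iff (n := n) x₀ (p := fun u => u ∉ s)).1
        (by rw [ae_iff]; simpa using hs)
      rw [ae_iff] at this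
      simpa using this
    · exact fun h => h.mono_ac (withDensity_absolutelyContinuous _ _)
  rw [← h]
  conv_rhs => rw [coordMeasure_eq_map]
  rw [(MeasurableEmbedding.subtype_coe hm).aestronglyMeasurable_map_iff]
  rfl

theorem ae_chart_iff (x₀ : M) {p : M → Prop} :
    (∀ᵐ x ∂((riemVol n M).restrict (Ψ n x₀).source), p x) ↔
      ∀ᵐ u ∂(volume.restrict (Ψ n x₀).target), p ((Ψ n x₀).symm u) := by
  have hm := (isOpen_extChartAt_target (I := 𝓡 n) x₀).measurableSet
  rw [riemVol_restrict_source, chartMeasure_eq_map, (measurableEmbedding_symm x₀).ae_map_iff,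
    ← ae_coordMeasure_iff x₀]
  conv_rhs => rw [coordMeasure_eq_map]
  rw [(MeasurableEmbedding.subtype_coe hm).ae_map_iff]
  rfl

theorem integrable_chart_iff (x₀ : M) {f : M → ℝ} :
    IntegrableOn f (Ψ n x₀).source (riemVol n M) ↔
      IntegrableOn (fun u => chartDensity x₀ u * f ((Ψ n x₀).symm u))
        (Ψ n x₀).target := by
  have hm := (isOpen_extChartAt_target (I := 𝓡 n) x₀).measurableSet
  rw [IntegrableOn, riemVol_restrict_source, chartMeasure_eq_map,
    (measurableEmbedding_symm x₀).integrable_map_iff]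
  have h : Integrable (fun u => f ((Ψ n x₀).symm u)) (coordMeasure x₀) ↔
      IntegrableOn (fun u => chartDensity x₀ u * f ((Ψ n x₀).symm u))
        (Ψ n x₀).target := by
    rw [coordMeasure, integrable_withDensity_iff_integrable_smul₀' (aemeasurable_chartDensity x₀)
      (Eventually.of_forall fun _ => ENNReal.ofReal_lt_top), IntegrableOn]
    refine integrable_congr (Eventually.of_forall fun u => ?_)
    simp only [smul_eq_mul, ENNReal.toReal_ofReal (show 0 ≤ chartDensity x₀ u from
      Real.sqrt_nonneg _)]
  rw [← h]
  conv_rhs => rw [coordMeasure_eq_map]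
  rw [(MeasurableEmbedding.subtype_coe hm).integrable_map_iff]
  rfl

theorem setIntegral_chart (x₀ : M) (f : M → ℝ) :
    ∫ x in (Ψ n x₀).source, f x ∂(riemVol n M) =
      ∫ u in (Ψ n x₀).target,
        chartDensity x₀ u * f ((Ψ n x₀).symm u) := by
  have hm := (isOpen_extChartAt_target (I := 𝓡 n) x₀).measurableSet
  rw [riemVol_restrict_source, chartMeasure_eq_map, (measurableEmbedding_symm x₀).integral_map]
  have h : ∫ u, f ((Ψ n x₀).symm u) ∂(coordMeasure (n := n) x₀) =
      ∫ u in (Ψ n x₀).target,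
        chartDensity x₀ u * f ((Ψ n x₀).symm u) := by
    rw [coordMeasure, integral_withDensity_eq_integral_toReal_smul₀ (aemeasurable_chartDensity x₀)
      (Eventually.of_forall fun _ => ENNReal.ofReal_lt_top)]
    refine integral_congr_ae (Eventually.of_forall fun u => ?_)
    simp only [smul_eq_mul, ENNReal.toReal_ofReal (show 0 ≤ chartDensity x₀ u from
      Real.sqrt_nonneg _)]
  rw [← h]
  conv_rhs => rw [coordMeasure_eq_map]
  rw [(MeasurableEmbedding.subtype_coe hm).integral_map]
  rfl

/-- The volume of a compact manifold is finite. -/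
instance instIsFiniteMeasureRiemVol : IsFiniteMeasure (riemVol n M) := by
  -- Each point has a neighbourhood whose image lies in a compact coordinate ball, where the density
  -- is bounded; finitely many of them cover M.
  have hloc : ∀ x : M, ∃ V : Set M, IsOpen V ∧ x ∈ V ∧ riemVol n M V < ⊤ := by
    intro x
    obtain ⟨r, hr, hsub⟩ := Metric.nhds_basis_closedBall.mem_iff.1
      ((isOpen_extChartAt_target (I := 𝓡 n) x).mem_nhds (mem_extChartAt_target x))
    set V := (Ψ n x).source ∩
      Ψ n x ⁻¹' ball (Ψ n x x) r with hV
    have hVo : IsOpen V := (continuousOn_extChartAt x).isOpen_inter_preimage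
      (isOpen_extChartAt_source x) isOpen_ball
    refine ⟨V, hVo, ⟨mem_extChartAt_source x, mem_ball_self hr⟩, ?_⟩
    rw [riemVol_apply_of_subset hVo.measurableSet inter_subset_left,
      chartMeasure_apply x hVo.measurableSet]
    have hcomp : IsCompact (closedBall (Ψ n x x) r) := isCompact_closedBall _ _
    obtain ⟨C, hC⟩ := hcomp.bddAbove_image ((contDiffOn_chartDensity x).continuousOn.mono hsub)
    calc _ ≤ ∫⁻ u in closedBall (Ψ n x x) r, ENNReal.ofReal C := by
          refine (lintegral_mono_set (t := closedBall (Ψ n x x) r) ?_).trans ?_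
          · rintro u ⟨hu, hu'⟩
            have := hu'.2
            rw [mem_preimage, (Ψ n x).right_inv hu] at this
            exact ball_subset_closedBall this
          · refine setLIntegral_mono' Metric.isClosed_closedBall.measurableSet fun u hu => ?_
            exact ENNReal.ofReal_le_ofReal (hC (mem_image_of_mem _ hu))
      _ < ⊤ := by
          rw [setLIntegral_const]
          exact ENNReal.mul_lt_top ENNReal.ofReal_lt_top hcomp.measure_lt_top
  choose V hVo hmem hfin using hloc
  obtain ⟨t, ht⟩ := isCompact_univ.elim_nhds_subcover V fun x _ => (hVo x).mem_nhds (hmem x)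
  refine ⟨(measure_mono ht.2).trans_lt ((measure_biUnion_finset_le _ _).trans_lt ?_)⟩
  exact ENNReal.sum_lt_top.2 fun x _ => hfin x

end Volume

/-- Alternating forms on Euclidean space. -/
abbrev EuForm (n k : ℕ) : Type := Eu n [⋀^Fin k]→L[ℝ] ℝ

local instance instT2SpaceEuForm (n k : ℕ) : T2Space (EuForm n k) := inferInstance

set_option synthInstance.maxHeartbeats 400000 in
theorem contDiff_alternatizeUncurryFin {E F : Type*} [NormedAddCommGroup E] [NormedSpace ℝ E]
    [NormedAddCommGroup F] [NormedSpace ℝ F] {k : ℕ} : ContDiff ℝ ∞ (fun A : E →L[ℝ] E [⋀^Fin k]→L[ℝ] F =>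
      ContinuousAlternatingMap.alternatizeUncurryFin A) := by
  exact ContinuousLinearMap.contDiff (𝕜 := ℝ) (E := E →L[ℝ] E [⋀^Fin k]→L[ℝ] F)
    (F := E [⋀^Fin (k + 1)]→L[ℝ] F) (ContinuousAlternatingMap.alternatizeUncurryFinCLM ℝ E F (n := k))

theorem contDiffAt_extDeriv {E F : Type*} [NormedAddCommGroup E] [NormedSpace ℝ E]
    [NormedAddCommGroup F] [NormedSpace ℝ F] {k : ℕ} {a : E → E [⋀^Fin k]→L[ℝ] F} {u : E}
    (h : ContDiffAt ℝ ∞ a u) : ContDiffAt ℝ ∞ (extDeriv a) u := by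
  exact contDiff_alternatizeUncurryFin.contDiffAt.comp u (h.fderiv_right (m := ∞) (by simp))

/-! ### Coefficients of forms on Euclidean space -/

section Coordinates

variable {n k : ℕ}

/-- The coefficients of an alternating form in the standard frame. -/
def formCoeff (n k : ℕ) : EuForm n k →ₗ[ℝ] ((Fin k → Fin n) → ℝ) where
  toFun α I := α fun a => stdFrame n (I a)
  map_add' _ _ := rfl
  map_smul' _ _ := rfl

theorem formCoeff_injective : Function.Injective (formCoeff n k) := by
  intro α β h
  apply ContinuousAlternatingMap.toAlternatingMap_injective
  refine Module.Basis.ext_alternating (EuclideanSpace.basisFun (Fin n) ℝ).toBasis fun I _ => ?_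
  simpa [formCoeff, stdFrame] using congrFun h I

instance instFiniteDimensionalEuForm : FiniteDimensional ℝ (EuForm n k) :=
  FiniteDimensional.of_injective (formCoeff n k) formCoeff_injective

/-- A form is a continuous linear function of its coefficients. -/
theorem exists_formCoeff_leftInverse (n k : ℕ) :
    ∃ g : ((Fin k → Fin n) → ℝ) →L[ℝ] EuForm n k, ∀ α, g (formCoeff n k α) = α := by
  obtain ⟨g, hg⟩ := LinearMap.exists_leftInverse_of_injective (formCoeff n k)
    (LinearMap.ker_eq_bot.2 formCoeff_injective)
  exact ⟨LinearMap.toContinuousLinearMap g, fun α => DFunLike.congr_fun hg α⟩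

theorem continuous_formCoeff : Continuous (formCoeff n k) :=
  (formCoeff n k).continuous_of_finiteDimensional

/-- The coefficient map is linear and injective with a continuous linear left inverse, the target
being finite dimensional; regularity of forms is regularity of coefficients. -/
theorem contDiffWithinAt_form_iff {X : Type*} [NormedAddCommGroup X] [NormedSpace ℝ X]
    {f : X → EuForm n k} {s : Set X} {x : X} {N : WithTop ℕ∞} :
    ContDiffWithinAt ℝ N f s x ↔
      ∀ I : Fin k → Fin n, ContDiffWithinAt ℝ N (fun y => f y fun a => stdFrame n (I a)) s x := by
  constructor
  · intro h I
    have h1 : ContDiffWithinAt ℝ N (fun y => formCoeff n k (f y)) s x :=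
      (LinearMap.toContinuousLinearMap (formCoeff n k)).contDiff.comp_contDiffWithinAt h
    exact contDiffWithinAt_pi.1 h1 I
  · intro h
    obtain ⟨g, hg⟩ := exists_formCoeff_leftInverse n k
    have h1 : ContDiffWithinAt ℝ N (fun y => formCoeff n k (f y)) s x := contDiffWithinAt_pi.2 h
    have h2 := g.contDiff.comp_contDiffWithinAt h1
    exact h2.congr_of_eventuallyEq (Eventually.of_forall fun y => (hg _).symm) (hg _).symm

theorem contDiffAt_form_iff {X : Type*} [NormedAddCommGroup X] [NormedSpace ℝ X]
    {f : X → EuForm n k} {x : X} {N : WithTop ℕ∞} :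
    ContDiffAt ℝ N f x ↔
      ∀ I : Fin k → Fin n, ContDiffAt ℝ N (fun y => f y fun a => stdFrame n (I a)) x := by
  simp only [← contDiffWithinAt_univ, contDiffWithinAt_form_iff]

theorem aestronglyMeasurable_form_iff {X : Type*} [MeasurableSpace X] {μ : Measure X}
    {f : X → EuForm n k} : AEStronglyMeasurable f μ ↔
      ∀ I : Fin k → Fin n, AEStronglyMeasurable (fun y => f y fun a => stdFrame n (I a)) μ := by
  constructor
  · intro h I
    exact ((continuous_apply I).comp continuous_formCoeff).comp_aestronglyMeasurable h
  · intro h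
    obtain ⟨g, hg⟩ := exists_formCoeff_leftInverse n k
    have h1 : AEStronglyMeasurable (fun y => formCoeff n k (f y)) μ :=
      (aemeasurable_pi_lambda _ fun I => (h I).aemeasurable).aestronglyMeasurable
    have h2 := g.continuous.comp_aestronglyMeasurable h1
    exact h2.congr (Eventually.of_forall fun y => hg _)

/-- The expansion of a form evaluated on arbitrary vectors. -/
theorem form_apply_eq_sum (α : EuForm n k) (v : Fin k → Eu n) :
    α v = ∑ I : Fin k → Fin n, (∏ a, v a (I a)) * α fun a => stdFrame n (I a) := by
  have : v = fun a => ∑ i, v a i • stdFrame n i := by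
    funext a
    simpa [stdFrame] using ((EuclideanSpace.basisFun (Fin n) ℝ).sum_repr (v a)).symm
  conv_lhs => rw [this]
  exact apply_sum_smul (stdFrame n) (fun a => v a) α

theorem ContDiffWithinAt.form_apply {X : Type*} [NormedAddCommGroup X] [NormedSpace ℝ X]
    {f : X → EuForm n k} {v : Fin k → X → Eu n} {s : Set X} {x : X} {N : WithTop ℕ∞}
    (hf : ContDiffWithinAt ℝ N f s x) (hv : ∀ a, ContDiffWithinAt ℝ N (v a) s x) :
    ContDiffWithinAt ℝ N (fun y => f y fun a => v a y) s x := by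
  have hsum : (fun y => f y fun a => v a y) = fun y => ∑ I : Fin k → Fin n,
      (∏ a, v a y (I a)) * f y fun a => stdFrame n (I a) :=
    funext fun y => form_apply_eq_sum _ _
  rw [hsum]
  refine ContDiffWithinAt.sum fun I _ => ContDiffWithinAt.mul (contDiffWithinAt_prod fun a _ => ?_)
    (contDiffWithinAt_form_iff.1 hf I)
  exact contDiffWithinAt_euclidean.1 (hv a) (I a)

theorem ContDiffWithinAt.form_comp {X : Type*} [NormedAddCommGroup X] [NormedSpace ℝ X]
    {f : X → EuForm n k} {A : X → Eu n →L[ℝ] Eu n} {s : Set X} {x : X} {N : WithTop ℕ∞}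
    (hf : ContDiffWithinAt ℝ N f s x) (hA : ContDiffWithinAt ℝ N A s x) :
    ContDiffWithinAt ℝ N (fun y => (f y).compContinuousLinearMap (A y)) s x :=
  contDiffWithinAt_form_iff.2 fun I => ContDiffWithinAt.form_apply hf
    (v := fun a y => A y (stdFrame n (I a))) fun _ => hA.clm_apply contDiffWithinAt_const

theorem ContDiffAt.form_comp {X : Type*} [NormedAddCommGroup X] [NormedSpace ℝ X]
    {f : X → EuForm n k} {A : X → Eu n →L[ℝ] Eu n} {x : X} {N : WithTop ℕ∞}
    (hf : ContDiffAt ℝ N f x) (hA : ContDiffAt ℝ N A x) :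
    ContDiffAt ℝ N (fun y => (f y).compContinuousLinearMap (A y)) x :=
  ContDiffWithinAt.form_comp hf hA

theorem AEStronglyMeasurable.form_comp {X : Type*} [MeasurableSpace X] {μ : Measure X}
    {f : X → EuForm n k} {A : X → Eu n →L[ℝ] Eu n}
    (hf : AEStronglyMeasurable f μ) (hA : AEStronglyMeasurable A μ) :
    AEStronglyMeasurable (fun y => (f y).compContinuousLinearMap (A y)) μ := by
  refine aestronglyMeasurable_form_iff.2 fun I => ?_
  have hsum : (fun y => (f y).compContinuousLinearMap (A y) fun a => stdFrame n (I a)) =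
      fun y => ∑ J : Fin k → Fin n,
        (∏ a, A y (stdFrame n (I a)) (J a)) * f y fun a => stdFrame n (J a) :=
    funext fun y => form_apply_eq_sum (f y) fun a => A y (stdFrame n (I a))
  rw [hsum]
  refine Finset.aestronglyMeasurable_fun_sum _ fun J _ =>
    (Finset.aestronglyMeasurable_fun_prod _ fun a _ => ?_).mul (aestronglyMeasurable_form_iff.1 hf J)
  have : Continuous fun B : Eu n →L[ℝ] Eu n => B (stdFrame n (I a)) (J a) := by fun_prop
  exact this.comp_aestronglyMeasurable hA

theorem contDiffWithinAt_clm_iff {X : Type*} [NormedAddCommGroup X] [NormedSpace ℝ X]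
    {A : X → Eu n →L[ℝ] Eu n} {s : Set X} {x : X} {N : WithTop ℕ∞} :
    ContDiffWithinAt ℝ N A s x ↔
      ∀ i, ContDiffWithinAt ℝ N (fun y => A y (stdFrame n i)) s x := by
  refine ⟨fun h i => h.clm_apply contDiffWithinAt_const, fun h => ?_⟩
  let L : (Eu n →L[ℝ] Eu n) →ₗ[ℝ] (Fin n → Eu n) :=
    { toFun := fun A i => A (stdFrame n i), map_add' := fun _ _ => rfl, map_smul' := fun _ _ => rfl }
  have hL : Function.Injective L := by
    intro A B hAB
    apply ContinuousLinearMap.coe_injective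
    refine (EuclideanSpace.basisFun (Fin n) ℝ).toBasis.ext fun i => ?_
    simpa [L, stdFrame] using congrFun hAB i
  obtain ⟨g, hg⟩ := LinearMap.exists_leftInverse_of_injective L (LinearMap.ker_eq_bot.2 hL)
  have h1 : ContDiffWithinAt ℝ N (fun y => L (A y)) s x := contDiffWithinAt_pi.2 h
  have h2 := (LinearMap.toContinuousLinearMap g).contDiff.comp_contDiffWithinAt h1
  have hg' : ∀ A, g (L A) = A := fun A => DFunLike.congr_fun hg A
  exact h2.congr_of_eventuallyEq (Eventually.of_forall fun y => (hg' _).symm) (hg' _).symm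

end Coordinates

/-! ### Smooth and measurable forms on the manifold, and gluing in a chart -/

section Forms

variable {k : ℕ}

theorem inChart_add (α β : Form n M k) (x₀ : M) (u : Eu n) :
    inChart (α + β) x₀ u = inChart α x₀ u + inChart β x₀ u := rfl

theorem inChart_zero (x₀ : M) (u : Eu n) : inChart (0 : Form n M k) x₀ u = 0 := rfl

theorem contDiffAt_fderiv_transition {x₁ x₀ : M} {u : Eu n} (hu : u ∈ overlap x₁ x₀) :
    ContDiffAt ℝ ∞ (fderiv ℝ (transition x₁ x₀)) u :=
  (contDiffAt_transition hu).fderiv_right (by simp)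

theorem contDiffAt_inChart_of_overlap {α : Form n M k} {x₁ x₀ : M} {u : Eu n}
    (hu : u ∈ overlap x₁ x₀) (h : ContDiffAt ℝ ∞ (inChart α x₀) (transition x₁ x₀ u)) :
    ContDiffAt ℝ ∞ (inChart α x₁) u := by
  have h1 : ContDiffAt ℝ ∞ (fun u => (inChart α x₀ (transition x₁ x₀ u)).compContinuousLinearMap
      (fderiv ℝ (transition x₁ x₀) u)) u :=
    ContDiffAt.form_comp (h.comp u (contDiffAt_transition hu)) (contDiffAt_fderiv_transition hu)
  refine h1.congr_of_eventuallyEq ?_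
  filter_upwards [(isOpen_overlap x₁ x₀).mem_nhds hu] with u' hu'
  exact inChart_transition α hu'

/-- Smoothness of a form is a local condition, and can be checked in any chart. -/
theorem isSmoothForm_of_local {α : Form n M k}
    (h : ∀ x : M, ∃ x₀ : M, x ∈ (Ψ n x₀).source ∧
      ContDiffAt ℝ ∞ (inChart α x₀) (Ψ n x₀ x)) : IsSmoothForm α := by
  intro x₁ u hu
  obtain ⟨x₀, hx, h⟩ := h ((Ψ n x₁).symm u)
  exact (contDiffAt_inChart_of_overlap (x₀ := x₀) ⟨hu, hx⟩ h).contDiffWithinAt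

theorem IsSmoothForm.contDiffAt {α : Form n M k} (h : IsSmoothForm α) {x₀ : M} {u : Eu n}
    (hu : u ∈ (Ψ n x₀).target) : ContDiffAt ℝ ∞ (inChart α x₀) u :=
  (h x₀).contDiffAt ((isOpen_extChartAt_target x₀).mem_nhds hu)

theorem IsSmoothForm.add {α β : Form n M k} (hα : IsSmoothForm α) (hβ : IsSmoothForm β) :
    IsSmoothForm (α + β) := fun x₀ => (hα x₀).add (hβ x₀)

theorem IsSmoothForm.smul (c : ℝ) {α : Form n M k} (hα : IsSmoothForm α) :
    IsSmoothForm (c • α) := fun x₀ => (hα x₀).const_smul c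

theorem isSmoothForm_zero : IsSmoothForm (0 : Form n M k) :=
  fun _ => contDiffOn_const (c := (0 : EuForm n k))

theorem extDeriv_inChart_transition {α : Form n M k} {x₁ x₀ : M} {u : Eu n}
    (hu : u ∈ overlap x₁ x₀)
    (h : DifferentiableAt ℝ (inChart α x₀) (transition x₁ x₀ u)) :
    extDeriv (inChart α x₁) u = (extDeriv (inChart α x₀) (transition x₁ x₀ u)).compContinuousLinearMap
      (fderiv ℝ (transition x₁ x₀) u) := by
  rw [← extDeriv_pullback h (contDiffAt_transition hu) (by simp; norm_cast)]
  refine Filter.EventuallyEq.extDeriv_eq ?_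
  filter_upwards [(isOpen_overlap x₁ x₀).mem_nhds hu] with u' hu'
  exact inChart_transition α hu'

/-- The exterior derivative can be computed in any chart. -/
theorem inChart_extD {α : Form n M k} {x₀ : M} {u : Eu n}
    (hu : u ∈ (Ψ n x₀).target) (h : DifferentiableAt ℝ (inChart α x₀) u) :
    inChart (extD α) x₀ u = extDeriv (inChart α x₀) u := by
  set x := (Ψ n x₀).symm u with hx
  have hov : u ∈ overlap x₀ x := ⟨hu, mem_extChartAt_source x⟩
  have hov' := transition_mem hov
  have hT : transition x x₀ (transition x₀ x u) = u := transition_transition hov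
  have h1 := extDeriv_inChart_transition (α := α) hov' (by rwa [hT])
  rw [hT] at h1
  have h2 : Ψ n x x = transition x₀ x u := rfl
  ext w
  rw [inChart]
  simp only [extD, ContinuousAlternatingMap.compContinuousLinearMap_apply]
  change (extDeriv (inChart α x) (Ψ n x x)) _ = _
  rw [h2, h1, ContinuousAlternatingMap.compContinuousLinearMap_apply]
  congr 1
  funext a
  simp only [Function.comp]
  have h3 := chartCoframe_chartFrame_transition hov (w a)
  have h4 := fderiv_transition_transition hov (w a)
  change (fderiv ℝ (transition x x₀) (transition x₀ x u))
    (chartCoframe x ((Ψ n x₀).symm u) (chartFrame x₀ u (w a))) = w a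
  rw [h3]
  exact h4

theorem IsSmoothForm.inChart_extD {α : Form n M k} (h : IsSmoothForm α) {x₀ : M} {u : Eu n}
    (hu : u ∈ (Ψ n x₀).target) :
    inChart (extD α) x₀ u = extDeriv (inChart α x₀) u :=
  NonlinearHarmonic.inChart_extD hu ((h.contDiffAt hu).differentiableAt (by simp))

theorem IsSmoothForm.extD {α : Form n M k} (h : IsSmoothForm α) : IsSmoothForm (extD α) := by
  intro x₀ u hu
  refine ((contDiffAt_extDeriv (h.contDiffAt hu)).congr_of_eventuallyEq ?_).contDiffWithinAt
  filter_upwards [(isOpen_extChartAt_target x₀).mem_nhds hu] with u' hu'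
  exact h.inChart_extD hu'

theorem form_ext_inChart {α β : Form n M k}
    (h : ∀ (x₀ : M), ∀ u ∈ (Ψ n x₀).target, inChart α x₀ u = inChart β x₀ u) :
    α = β := by
  funext x
  rw [form_eq_inChart α (mem_extChartAt_source (I := 𝓡 n) x),
    form_eq_inChart β (mem_extChartAt_source (I := 𝓡 n) x), h x _ (mem_extChartAt_target x)]

theorem IsSmoothForm.extD_extD {α : Form n M k} (h : IsSmoothForm α) :
    NonlinearHarmonic.extD (NonlinearHarmonic.extD α) = 0 := by
  refine form_ext_inChart fun x₀ u hu => ?_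
  rw [h.extD.inChart_extD hu, inChart_zero]
  have h1 : inChart (NonlinearHarmonic.extD α) x₀ =ᶠ[𝓝 u] extDeriv (inChart α x₀) := by
    filter_upwards [(isOpen_extChartAt_target x₀).mem_nhds hu] with u' hu'
    exact h.inChart_extD hu'
  rw [h1.extDeriv_eq, extDeriv_extDeriv_apply (h.contDiffAt hu) (by simp; norm_cast)]

theorem IsSmoothForm.extD_add {α β : Form n M k} (hα : IsSmoothForm α) (hβ : IsSmoothForm β) :
    NonlinearHarmonic.extD (α + β) = NonlinearHarmonic.extD α + NonlinearHarmonic.extD β := by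
  refine form_ext_inChart fun x₀ u hu => ?_
  rw [(hα.add hβ).inChart_extD hu, inChart_add, hα.inChart_extD hu, hβ.inChart_extD hu]
  exact extDeriv_add ((hα.contDiffAt hu).differentiableAt (by simp))
    ((hβ.contDiffAt hu).differentiableAt (by simp))

theorem extD_smul (c : ℝ) (α : Form n M k) : extD (c • α) = c • extD α := by
  funext x
  change (extDeriv (c • inChart α x) _).compContinuousLinearMap _ = _
  rw [extDeriv_smul]
  rfl

theorem measurableSet_target (x₀ : M) : MeasurableSet (Ψ n x₀).target :=
  (isOpen_extChartAt_target x₀).measurableSet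

theorem IsSmoothForm.isMeasurableForm {α : Form n M k} (h : IsSmoothForm α) :
    IsMeasurableForm α := fun x₀ =>
  (h x₀).continuousOn.aestronglyMeasurable (measurableSet_target x₀)

theorem IsMeasurableForm.add {α β : Form n M k} (hα : IsMeasurableForm α)
    (hβ : IsMeasurableForm β) : IsMeasurableForm (α + β) := fun x₀ => (hα x₀).add (hβ x₀)

theorem IsMeasurableForm.smul (c : ℝ) {α : Form n M k} (hα : IsMeasurableForm α) :
    IsMeasurableForm (c • α) := fun x₀ => (hα x₀).const_smul c

/-- The exceptional set in `s` is contained in the image under S of the exceptional set in `t`, and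
a differentiable map sends null sets to null sets. -/
theorem ae_comp_of_leftInverse {p : Eu n → Prop} {T S : Eu n → Eu n} {s t : Set (Eu n)}
    (hs : MeasurableSet s) (ht : MeasurableSet t) (hmaps : MapsTo T s t)
    (hS : DifferentiableOn ℝ S t) (hST : ∀ u ∈ s, S (T u) = u)
    (hp : ∀ᵐ v ∂(volume.restrict t), p v) : ∀ᵐ u ∂(volume.restrict s), p (T u) := by
  rw [ae_restrict_iff' hs, ae_iff]
  rw [ae_restrict_iff' ht, ae_iff] at hp
  refine measure_mono_null (t := S '' {a | ¬(a ∈ t → p a)}) (fun u hu => ?_)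
    (addHaar_image_eq_zero_of_differentiableOn_of_addHaar_eq_zero _
      (hS.mono fun a ha => by by_contra h; exact ha fun h' => (h h').elim) hp)
  simp only [mem_ofPred_eq, Classical.not_imp] at hu
  exact ⟨T u, by simpa using ⟨hmaps hu.1, hu.2⟩, hST u hu.1⟩

/-- A diffeomorphism preserves almost everywhere measurable functions. -/
theorem aestronglyMeasurable_comp_of_leftInverse {F : Type*} [TopologicalSpace F]
    {f : Eu n → F} {T S : Eu n → Eu n} {s t : Set (Eu n)}
    (hs : MeasurableSet s) (ht : MeasurableSet t) (hT : ContinuousOn T s) (hmaps : MapsTo T s t)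
    (hS : DifferentiableOn ℝ S t) (hST : ∀ u ∈ s, S (T u) = u)
    (hf : AEStronglyMeasurable f (volume.restrict t)) :
    AEStronglyMeasurable (fun u => f (T u)) (volume.restrict s) :=
  (hf.stronglyMeasurable_mk.aestronglyMeasurable.comp_aemeasurable (hT.aemeasurable hs)).congr
    (ae_comp_of_leftInverse (p := fun v => hf.mk f v = f v) hs ht hmaps hS hST
      (hf.ae_eq_mk.mono fun _ h => h.symm))

theorem differentiableOn_transition (x₁ x₀ : M) :
    DifferentiableOn ℝ (transition x₁ x₀) (overlap (n := n) x₁ x₀) :=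
  (contDiffOn_transition x₁ x₀).differentiableOn (by simp)

theorem aestronglyMeasurable_inChart_overlap {α : Form n M k} {x₁ x₀ : M}
    (h : AEStronglyMeasurable (inChart α x₀) (volume.restrict (Ψ n x₀).target)) :
    AEStronglyMeasurable (inChart α x₁) (volume.restrict (overlap x₁ x₀)) := by
  have hm : MeasurableSet (overlap (n := n) x₁ x₀) := (isOpen_overlap x₁ x₀).measurableSet
  have hm' : MeasurableSet (overlap (n := n) x₀ x₁) := (isOpen_overlap x₀ x₁).measurableSet
  have h1 := aestronglyMeasurable_comp_of_leftInverse hm hm'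
    (contDiffOn_transition x₁ x₀).continuousOn (fun u hu => transition_mem hu)
    (differentiableOn_transition x₀ x₁) (fun u hu => transition_transition hu)
    (h.mono_measure (Measure.restrict_mono (fun u hu => hu.1) le_rfl))
  have h2 : AEStronglyMeasurable (fderiv ℝ (transition x₁ x₀)) (volume.restrict (overlap x₁ x₀)) :=
    ContinuousOn.aestronglyMeasurable
      (fun u hu => (contDiffAt_fderiv_transition hu).continuousAt.continuousWithinAt) hm
  refine (AEStronglyMeasurable.form_comp h1 h2).congr ?_
  filter_upwards [ae_restrict_mem hm] with u hu
  exact (inChart_transition α hu).symm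

/-! ### Modification of a form in a chart -/

open Classical in
/-- The form with the expression `b` in the chart at `x₀`, and equal to `z` elsewhere. -/
def glue (x₀ : M) (b : Eu n → EuForm n k) (z : Form n M k) : Form n M k := fun x =>
  if x ∈ (Ψ n x₀).source then
    (b (Ψ n x₀ x)).compContinuousLinearMap (chartCoframe x₀ x) else z x

theorem glue_of_notMem {x₀ x : M} (b : Eu n → EuForm n k) (z : Form n M k)
    (hx : x ∉ (Ψ n x₀).source) : glue x₀ b z x = z x := if_neg hx

theorem glue_of_mem {x₀ x : M} (b : Eu n → EuForm n k) (z : Form n M k)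
    (hx : x ∈ (Ψ n x₀).source) : glue x₀ b z x =
      (b (Ψ n x₀ x)).compContinuousLinearMap (chartCoframe x₀ x) := if_pos hx

theorem inChart_glue {x₀ : M} (b : Eu n → EuForm n k) (z : Form n M k) {u : Eu n}
    (hu : u ∈ (Ψ n x₀).target) : inChart (glue x₀ b z) x₀ u = b u := by
  rw [inChart, glue_of_mem b z (mem_source_symm hu)]
  ext w
  simp only [ContinuousAlternatingMap.compContinuousLinearMap_apply]
  rw [(Ψ n x₀).right_inv hu]
  congr 1
  funext a
  exact chartCoframe_chartFrame hu (w a)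

theorem glue_eq_of_inChart {x₀ x : M} {b : Eu n → EuForm n k} {z : Form n M k}
    (h : b (Ψ n x₀ x) = inChart z x₀ (Ψ n x₀ x)) :
    glue x₀ b z x = z x := by
  by_cases hx : x ∈ (Ψ n x₀).source
  · rw [glue_of_mem b z hx, h, ← form_eq_inChart z hx]
  · exact glue_of_notMem b z hx

theorem eq_glue {x₀ : M} {b : Eu n → EuForm n k} {z α : Form n M k}
    (h : ∀ u ∈ (Ψ n x₀).target, inChart α x₀ u = b u)
    (h' : ∀ x ∉ (Ψ n x₀).source, α x = z x) : α = glue x₀ b z := by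
  funext x
  by_cases hx : x ∈ (Ψ n x₀).source
  · rw [glue_of_mem b z hx, form_eq_inChart α hx, h _ ((Ψ n x₀).map_source hx)]
  · rw [glue_of_notMem b z hx, h' x hx]

theorem glue_add (x₀ : M) (b b' : Eu n → EuForm n k) (z z' : Form n M k) :
    glue x₀ (b + b') (z + z') = glue x₀ b z + glue x₀ b' z' := by
  refine (eq_glue (fun u hu => ?_) fun x hx => ?_).symm
  · rw [inChart_add, inChart_glue b z hu, inChart_glue b' z' hu]
    rfl
  · rw [Pi.add_apply, glue_of_notMem b z hx, glue_of_notMem b' z' hx, Pi.add_apply]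

theorem extD_congr {α β : Form n M k} {x : M} (h : ∀ᶠ y in 𝓝 x, α y = β y) : extD α x = extD β x := by
  have h1 : inChart α x =ᶠ[𝓝 (Ψ n x x)] inChart β x := by
    have hc : Tendsto (Ψ n x).symm (𝓝 (Ψ n x x)) (𝓝 x) := by
      have := continuousAt_extChartAt_symm (I := 𝓡 n) x
      rwa [ContinuousAt, extChartAt_to_inv] at this
    filter_upwards [hc.eventually h] with u hu
    rw [inChart, inChart, hu]
  rw [extD, extD, h1.extDeriv_eq]

theorem isClosed_symm_image [T2Space M] {x₀ : M} {K : Set (Eu n)} (hK : IsCompact K)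
    (hKt : K ⊆ (Ψ n x₀).target) : IsClosed ((Ψ n x₀).symm '' K) :=
  (hK.image_of_continuousOn ((continuousOn_extChartAt_symm x₀).mono hKt)).isClosed

/-- In a Hausdorff space the image of the compact set `K` is closed, so a point off the chart domain
has a neighbourhood avoiding it. Thus the glued form agrees with z near such points and no
regularity is lost at the boundary of the chart. -/
theorem glue_eventuallyEq [T2Space M] {x₀ x : M} {b : Eu n → EuForm n k} {z : Form n M k}
    {K : Set (Eu n)} (hK : IsCompact K) (hKt : K ⊆ (Ψ n x₀).target)
    (hb : ∀ u ∈ (Ψ n x₀).target, u ∉ K → b u = inChart z x₀ u)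
    (hx : x ∉ (Ψ n x₀).source) : ∀ᶠ y in 𝓝 x, glue x₀ b z y = z y := by
  have hx' : x ∉ (Ψ n x₀).symm '' K := by
    rintro ⟨u, hu, rfl⟩
    exact hx (mem_source_symm (hKt hu))
  filter_upwards [(isClosed_symm_image hK hKt).isOpen_compl.mem_nhds hx'] with y hy
  by_cases hys : y ∈ (Ψ n x₀).source
  · refine glue_eq_of_inChart (hb _ ((Ψ n x₀).map_source hys) fun hyK => hy ?_)
    exact ⟨_, hyK, (Ψ n x₀).left_inv hys⟩
  · exact glue_of_notMem b z hys

theorem isSmoothForm_glue [T2Space M] {x₀ : M} {b : Eu n → EuForm n k} {z : Form n M k}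
    {K : Set (Eu n)} (hK : IsCompact K) (hKt : K ⊆ (Ψ n x₀).target)
    (hb : ∀ u ∈ (Ψ n x₀).target, u ∉ K → b u = inChart z x₀ u)
    (hz : IsSmoothForm z) (hbs : ContDiffOn ℝ ∞ b (Ψ n x₀).target) :
    IsSmoothForm (glue x₀ b z) := by
  refine isSmoothForm_of_local fun x => ?_
  by_cases hx : x ∈ (Ψ n x₀).source
  · refine ⟨x₀, hx, ?_⟩
    have hu := (Ψ n x₀).map_source hx
    have hn := (isOpen_extChartAt_target x₀).mem_nhds hu
    refine (hbs.contDiffAt hn).congr_of_eventuallyEq ?_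
    filter_upwards [hn] with u hu
    exact inChart_glue b z hu
  · refine ⟨x, mem_extChartAt_source x, ?_⟩
    refine (hz.contDiffAt (mem_extChartAt_target x)).congr_of_eventuallyEq ?_
    have hc : Tendsto (Ψ n x).symm (𝓝 (Ψ n x x)) (𝓝 x) := by
      have := continuousAt_extChartAt_symm (I := 𝓡 n) x
      rwa [ContinuousAt, extChartAt_to_inv] at this
    filter_upwards [hc.eventually (glue_eventuallyEq hK hKt hb hx)] with u hu
    rw [inChart, inChart, hu]

theorem extD_glue [T2Space M] {x₀ : M} {b : Eu n → EuForm n k} {z : Form n M k}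
    {K : Set (Eu n)} (hK : IsCompact K) (hKt : K ⊆ (Ψ n x₀).target)
    (hb : ∀ u ∈ (Ψ n x₀).target, u ∉ K → b u = inChart z x₀ u)
    (hbs : ContDiffOn ℝ ∞ b (Ψ n x₀).target) :
    extD (glue x₀ b z) = glue x₀ (extDeriv b) (extD z) := by
  refine eq_glue (fun u hu => ?_) fun x hx => extD_congr (glue_eventuallyEq hK hKt hb hx)
  have hn := (isOpen_extChartAt_target x₀).mem_nhds hu
  have h1 : inChart (glue x₀ b z) x₀ =ᶠ[𝓝 u] b := by
    filter_upwards [hn] with u hu using inChart_glue b z hu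
  rw [inChart_extD hu, h1.extDeriv_eq]
  exact ((hbs.contDiffAt hn).congr_of_eventuallyEq h1).differentiableAt (by simp)

theorem isMeasurableForm_glue {x₀ : M} {b : Eu n → EuForm n k} {z : Form n M k}
    (hz : IsMeasurableForm z)
    (hb : AEStronglyMeasurable b (volume.restrict (Ψ n x₀).target)) :
    IsMeasurableForm (glue x₀ b z) := by
  intro x₁
  have h0 : AEStronglyMeasurable (inChart (glue x₀ b z) x₀)
      (volume.restrict (Ψ n x₀).target) := by
    refine hb.congr ?_
    filter_upwards [ae_restrict_mem (measurableSet_target x₀)] with u hu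
    exact (inChart_glue b z hu).symm
  have h1 := aestronglyMeasurable_inChart_overlap (x₁ := x₁) h0
  have hm : MeasurableSet (overlap (n := n) x₁ x₀) := (isOpen_overlap x₁ x₀).measurableSet
  have h2 : AEStronglyMeasurable (inChart (glue x₀ b z) x₁)
      (volume.restrict ((Ψ n x₁).target \ overlap x₁ x₀)) := by
    refine ((hz x₁).mono_measure (Measure.restrict_mono sdiff_subset le_rfl)).congr ?_
    filter_upwards [ae_restrict_mem ((measurableSet_target x₁).diff hm)] with u hu
    rw [inChart, inChart, glue_of_notMem]
    exact fun h => hu.2 ⟨hu.1, h⟩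
  have h3 := aestronglyMeasurable_union_iff.2 ⟨h1, h2⟩
  exact h3.mono_measure (Measure.restrict_mono (fun u hu => by
    by_cases h : u ∈ overlap x₁ x₀
    · exact Or.inl h
    · exact Or.inr ⟨hu, h⟩) le_rfl)

end Forms

/-! ### Square integrable forms -/

section L2

variable {k : ℕ}

/-- The inner product of forms in the coordinates of a chart. -/
def chartInner (x₀ : M) (u : Eu n) (a b : EuForm n k) : ℝ :=
  mpair (stdFrame n) (stdFrame n) (fun _ => (chartGram x₀ u)⁻¹) a b

theorem covInner_symm_eq (α β : Form n M k) {x₀ : M} {u : Eu n}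
    (hu : u ∈ (Ψ n x₀).target) :
    covInner (α ((Ψ n x₀).symm u)) (β ((Ψ n x₀).symm u)) =
      chartInner x₀ u (inChart α x₀ u) (inChart β x₀ u) := covInner_eq_inChart α β hu

theorem chartInner_eq_covInner {x₀ : M} {u : Eu n} (hu : u ∈ (Ψ n x₀).target)
    (a b : EuForm n k) : chartInner x₀ u a b =
      covInner (glue x₀ (fun _ => a) 0 ((Ψ n x₀).symm u))
        (glue x₀ (fun _ => b) 0 ((Ψ n x₀).symm u)) := by
  rw [covInner_symm_eq _ _ hu, inChart_glue _ _ hu, inChart_glue _ _ hu]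

theorem chartInner_self_nonneg {x₀ : M} {u : Eu n} (hu : u ∈ (Ψ n x₀).target)
    (a : EuForm n k) : 0 ≤ chartInner x₀ u a a := by
  rw [chartInner_eq_covInner hu]
  exact covInner_self_nonneg _

theorem covInner_self_eq_zero {V : Type*} [NormedAddCommGroup V] [InnerProductSpace ℝ V]
    [FiniteDimensional ℝ V] {α : V [⋀^Fin k]→L[ℝ] ℝ} (h : covInner α α = 0) : α = 0 := by
  set b := stdOrthonormalBasis ℝ V
  rw [covInner_self_eq_sum b, mul_eq_zero, or_iff_right (by positivity),
    Finset.sum_eq_zero_iff_of_nonneg fun _ _ => sq_nonneg _] at h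
  apply ContinuousAlternatingMap.toAlternatingMap_injective
  refine Module.Basis.ext_alternating b.toBasis fun I _ => ?_
  simpa using h I (Finset.mem_univ I)

theorem eq_zero_of_chartInner {x₀ : M} {u : Eu n} (hu : u ∈ (Ψ n x₀).target)
    {a : EuForm n k} (h : chartInner x₀ u a a = 0) : a = 0 := by
  rw [chartInner_eq_covInner hu] at h
  rw [← inChart_glue (x₀ := x₀) (fun _ => a) 0 hu, inChart, covInner_self_eq_zero h]
  rfl

theorem contDiffOn_det {X : Type*} [NormedAddCommGroup X] [NormedSpace ℝ X] {ι : Type*} [Fintype ι]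
    [DecidableEq ι] {A : X → Matrix ι ι ℝ} {s : Set X} {N : WithTop ℕ∞}
    (h : ∀ i j, ContDiffOn ℝ N (fun x => A x i j) s) : ContDiffOn ℝ N (fun x => (A x).det) s := by
  simp only [Matrix.det_apply]
  exact ContDiffOn.sum fun σ _ => (contDiffOn_prod fun i _ => h _ _).const_smul (R := ℤ) _

theorem contDiffOn_matrix_inv {X : Type*} [NormedAddCommGroup X] [NormedSpace ℝ X] {ι : Type*}
    [Fintype ι] [DecidableEq ι] {A : X → Matrix ι ι ℝ} {s : Set X} {N : WithTop ℕ∞}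
    (h : ∀ i j, ContDiffOn ℝ N (fun x => A x i j) s) (h0 : ∀ x ∈ s, (A x).det ≠ 0) (i j : ι) :
    ContDiffOn ℝ N (fun x => (A x)⁻¹ i j) s := by
  have : (fun x => (A x)⁻¹ i j) = fun x => ((A x).det)⁻¹ * ((A x).updateRow j (Pi.single i 1)).det := by
    funext x
    rw [Matrix.inv_def, Matrix.smul_apply, Matrix.adjugate_apply, Ring.inverse_eq_inv', smul_eq_mul]
  rw [this]
  refine ((contDiffOn_det h).inv h0).mul (contDiffOn_det fun i' j' => ?_)
  simp only [Matrix.updateRow_apply]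
  split_ifs
  · exact contDiffOn_const
  · exact h i' j'

theorem contDiffOn_chartGram (x₀ : M) (i j : Fin n) :
    ContDiffOn ℝ ∞ (fun u => chartGram x₀ u i j) (Ψ n x₀).target :=
  contDiffOn_chartMetric x₀ _ _

theorem contDiffOn_chartGram_inv (x₀ : M) (i j : Fin n) :
    ContDiffOn ℝ ∞ (fun u => (chartGram x₀ u)⁻¹ i j) (Ψ n x₀).target :=
  contDiffOn_matrix_inv (contDiffOn_chartGram x₀) (fun _ hu => (chartDet_pos hu).ne') i j

theorem continuousOn_chartInner {x₀ : M} {a b : Eu n → EuForm n k} {s : Set (Eu n)}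
    (hs : s ⊆ (Ψ n x₀).target) (ha : ContinuousOn a s) (hb : ContinuousOn b s) :
    ContinuousOn (fun u => chartInner x₀ u (a u) (b u)) s := by
  unfold chartInner mpair
  have hc : ∀ (c : Eu n → EuForm n k) (I : Fin k → Fin n), ContinuousOn c s →
      ContinuousOn (fun u => c u fun a => stdFrame n (I a)) s := fun c I h =>
    ((continuous_apply I).comp continuous_formCoeff).comp_continuousOn h
  refine continuousOn_const.mul (continuousOn_finsetSum _ fun I _ =>
    continuousOn_finsetSum _ fun J _ => (continuousOn_finsetProd _ fun i _ => ?_).mul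
      ((hc a I ha).mul (hc b J hb)))
  exact (contDiffOn_chartGram_inv x₀ _ _).continuousOn.mono hs

theorem aestronglyMeasurable_chartInner {x₀ : M} {a b : Eu n → EuForm n k} {s : Set (Eu n)}
    (hs : s ⊆ (Ψ n x₀).target) (hm : MeasurableSet s)
    (ha : AEStronglyMeasurable a (volume.restrict s))
    (hb : AEStronglyMeasurable b (volume.restrict s)) :
    AEStronglyMeasurable (fun u => chartInner x₀ u (a u) (b u)) (volume.restrict s) := by
  unfold chartInner mpair
  refine aestronglyMeasurable_const.mul (Finset.aestronglyMeasurable_fun_sum _ fun I _ =>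
    Finset.aestronglyMeasurable_fun_sum _ fun J _ =>
      (Finset.aestronglyMeasurable_fun_prod _ fun i _ => ?_).mul
      ((aestronglyMeasurable_form_iff.1 ha I).mul (aestronglyMeasurable_form_iff.1 hb J)))
  exact ((contDiffOn_chartGram_inv x₀ _ _).continuousOn.mono hs).aestronglyMeasurable hm

/-- The squared norm is bounded above and below on compact sets of a chart. -/
theorem exists_chartInner_bounds {x₀ : M} {K : Set (Eu n)} (hK : IsCompact K)
    (hKt : K ⊆ (Ψ n x₀).target) (k : ℕ) :
    ∃ c C : ℝ, 0 < c ∧ 0 < C ∧ ∀ u ∈ K, ∀ a : EuForm n k,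
      c * ‖a‖ ^ 2 ≤ chartInner x₀ u a a ∧ chartInner x₀ u a a ≤ C * ‖a‖ ^ 2 := by
  have : ProperSpace (EuForm n k) := FiniteDimensional.proper ℝ _
  -- By homogeneity it is enough to bound the square norm on the product of `K` with the unit
  -- sphere, which is compact since forms have finite dimension.
  have hS : IsCompact (K ×ˢ Metric.sphere (0 : EuForm n k) 1) := hK.prod (isCompact_sphere 0 1)
  have hc : ContinuousOn (fun q : Eu n × EuForm n k => chartInner x₀ q.1 q.2 q.2)
      (K ×ˢ Metric.sphere (0 : EuForm n k) 1) := by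
    unfold chartInner mpair
    have hc : ∀ (I : Fin k → Fin n),
        Continuous (fun q : Eu n × EuForm n k => q.2 fun a => stdFrame n (I a)) := fun I =>
      ((continuous_apply I).comp continuous_formCoeff).comp continuous_snd
    refine continuousOn_const.mul (continuousOn_finsetSum _ fun I _ =>
      continuousOn_finsetSum _ fun J _ => (continuousOn_finsetProd _ fun i _ => ?_).mul
        ((hc I).mul (hc J)).continuousOn)
    exact (((contDiffOn_chartGram_inv x₀ (I i) (J i)).continuousOn).comp continuousOn_fst
      fun q hq => hKt hq.1)
  have hsmul : ∀ u (t : ℝ) (a : EuForm n k),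
      chartInner x₀ u (t • a) (t • a) = t ^ 2 * chartInner x₀ u a a := by
    intro u t a
    rw [chartInner, mpair_smul_left, mpair_smul_right, chartInner]
    ring
  obtain ⟨C, hC⟩ := hS.bddAbove_image hc
  obtain ⟨c, hc0, hc1⟩ : ∃ c : ℝ, 0 < c ∧ ∀ q ∈ K ×ˢ Metric.sphere (0 : EuForm n k) 1,
      c ≤ chartInner x₀ q.1 q.2 q.2 := by
    rcases (K ×ˢ Metric.sphere (0 : EuForm n k) 1).eq_empty_or_nonempty with h | h
    -- The product is empty when `K` is empty or when the space of forms is zero; any positive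
    -- constant serves.
    · exact ⟨1, one_pos, by simp [h]⟩
    · obtain ⟨q, hq, hmin⟩ := hS.exists_isMinOn h hc
      refine ⟨_, lt_of_le_of_ne (chartInner_self_nonneg (hKt hq.1) q.2) fun h0 => ?_, hmin⟩
      have := eq_zero_of_chartInner (hKt hq.1) h0.symm
      have h1 := hq.2
      simp [this] at h1
  refine ⟨c, max C 1, hc0, by positivity, fun u hu a => ?_⟩
  rcases eq_or_ne a 0 with rfl | ha
  · have := hsmul u 0 (0 : EuForm n k)
    simp at this
    simp [this]
  · have h1 : a = ‖a‖ • (‖a‖⁻¹ • a) := by rw [smul_inv_smul₀ (norm_ne_zero_iff.2 ha)]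
    have h2 : (u, ‖a‖⁻¹ • a) ∈ K ×ˢ Metric.sphere (0 : EuForm n k) 1 :=
      ⟨hu, by simp [norm_smul, inv_mul_cancel₀ (norm_ne_zero_iff.2 ha)]⟩
    have h3 := hc1 _ h2
    have h4 := hC (mem_image_of_mem _ h2)
    simp only at h3 h4
    have h5 : chartInner x₀ u a a = ‖a‖ ^ 2 * chartInner x₀ u (‖a‖⁻¹ • a) (‖a‖⁻¹ • a) := by
      rw [← hsmul, ← h1]
    rw [h5]
    have h6 : 0 ≤ ‖a‖ ^ 2 := sq_nonneg _
    constructor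
    · nlinarith
    · nlinarith [le_max_left C 1]

variable [MeasurableSpace M] [BorelSpace M] [CompactSpace M]

theorem exists_chart_cover : ∃ (N : ℕ) (c : Fin N → M),
    (⋃ i, (Ψ n (c i)).source) = univ := by
  obtain ⟨N, c, A, -, -, hU, hsub⟩ := exists_partition
    (V := fun x : M => (Ψ n x).source) (fun x => isOpen_extChartAt_source x)
    (fun x => mem_extChartAt_source x)
  exact ⟨N, c, eq_univ_of_univ_subset (hU ▸ iUnion_mono hsub)⟩

theorem ae_chart_of_ae {p : M → Prop} (h : ∀ᵐ x ∂(riemVol n M), p x) (x₀ : M) :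
    ∀ᵐ u ∂(volume.restrict (Ψ n x₀).target), p ((Ψ n x₀).symm u) :=
  (ae_chart_iff x₀).1 (ae_restrict_of_ae h)

theorem aestronglyMeasurable_of_charts {f : M → ℝ}
    (h : ∀ x₀ : M, AEStronglyMeasurable (fun u => f ((Ψ n x₀).symm u))
      (volume.restrict (Ψ n x₀).target)) : AEStronglyMeasurable f (riemVol n M) := by
  obtain ⟨N, c, hc⟩ := exists_chart_cover (n := n) (M := M)
  rw [← Measure.restrict_univ (μ := riemVol n M), ← hc, aestronglyMeasurable_iUnion_iff]
  exact fun i => (aestronglyMeasurable_chart_iff (c i)).2 (h (c i))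

theorem IsMeasurableForm.aestronglyMeasurable_covInner {α β : Form n M k} (hα : IsMeasurableForm α)
    (hβ : IsMeasurableForm β) :
    AEStronglyMeasurable (fun x => covInner (α x) (β x)) (riemVol n M) := by
  refine aestronglyMeasurable_of_charts fun x₀ => ?_
  refine (aestronglyMeasurable_chartInner subset_rfl (measurableSet_target x₀) (hα x₀)
    (hβ x₀)).congr ?_
  filter_upwards [ae_restrict_mem (measurableSet_target x₀)] with u hu
  exact (covInner_symm_eq α β hu).symm

theorem form_sub_eq (α β : Form n M k) : α - β = α + (-1 : ℝ) • β := by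
  funext x
  ext w
  change α x w - β x w = α x w + (-1 : ℝ) * β x w
  ring

theorem IsL2Form.integrable {α β : Form n M k} (hα : IsL2Form α) (hβ : IsL2Form β) :
    Integrable (fun x => covInner (α x) (β x)) (riemVol n M) :=
  Integrable.mono' ((hα.2.add hβ.2).div_const 2) (hα.1.aestronglyMeasurable_covInner hβ.1)
    (Eventually.of_forall fun _ => abs_covInner_le _ _)

theorem IsL2Form.add {α β : Form n M k} (hα : IsL2Form α) (hβ : IsL2Form β) :
    IsL2Form (α + β) := by
  refine ⟨hα.1.add hβ.1, ?_⟩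
  refine (((hα.2.add hβ.2).add (hα.integrable hβ)).add (hβ.integrable hα)).congr
    (Eventually.of_forall fun x => ?_)
  simp only [Pi.add_apply, covInner_add_left, covInner_add_right]
  ring

theorem IsL2Form.smul (c : ℝ) {α : Form n M k} (hα : IsL2Form α) : IsL2Form (c • α) := by
  refine ⟨hα.1.smul c, (hα.2.const_mul (c ^ 2)).congr (Eventually.of_forall fun x => ?_)⟩
  simp only [Pi.smul_apply, covInner_smul_left, covInner_smul_right]
  ring

theorem IsL2Form.sub {α β : Form n M k} (hα : IsL2Form α) (hβ : IsL2Form β) :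
    IsL2Form (α - β) := by
  rw [form_sub_eq]
  exact hα.add (hβ.smul _)

theorem l2Inner_comm (α β : Form n M k) : l2Inner α β = l2Inner β α := by
  simp only [l2Inner, covInner_comm]

theorem l2Inner_add_left {α β γ : Form n M k} (hα : IsL2Form α) (hβ : IsL2Form β)
    (hγ : IsL2Form γ) : l2Inner (α + β) γ = l2Inner α γ + l2Inner β γ := by
  simp only [l2Inner, Pi.add_apply, covInner_add_left]
  exact integral_add (hα.integrable hγ) (hβ.integrable hγ)

theorem l2Inner_smul_left (c : ℝ) (α β : Form n M k) :
    l2Inner (c • α) β = c * l2Inner α β := by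
  simp only [l2Inner, Pi.smul_apply, covInner_smul_left, integral_const_mul]

theorem l2Inner_sub_left {α β γ : Form n M k} (hα : IsL2Form α) (hβ : IsL2Form β)
    (hγ : IsL2Form γ) : l2Inner (α - β) γ = l2Inner α γ - l2Inner β γ := by
  rw [form_sub_eq, l2Inner_add_left hα (hβ.smul _) hγ, l2Inner_smul_left]
  ring

theorem l2Inner_zero_left (β : Form n M k) : l2Inner 0 β = 0 := by
  have := l2Inner_smul_left 0 (0 : Form n M k) β
  simpa using this

theorem l2Inner_add_right {α β γ : Form n M k} (hα : IsL2Form α) (hβ : IsL2Form β)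
    (hγ : IsL2Form γ) : l2Inner γ (α + β) = l2Inner γ α + l2Inner γ β := by
  rw [l2Inner_comm, l2Inner_add_left hα hβ hγ, l2Inner_comm α, l2Inner_comm β]

theorem continuousAt_of_chart {f : M → ℝ} {x₀ x : M} (hx : x ∈ (Ψ n x₀).source)
    (h : ContinuousAt (fun u => f ((Ψ n x₀).symm u)) (Ψ n x₀ x)) :
    ContinuousAt f x := by
  have h1 : ContinuousAt (fun y => f ((Ψ n x₀).symm (Ψ n x₀ y))) x :=
    ContinuousAt.comp (f := Ψ n x₀) h (continuousAt_extChartAt' hx)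
  refine h1.congr ?_
  filter_upwards [(isOpen_extChartAt_source x₀).mem_nhds hx] with y hy
  rw [(Ψ n x₀).left_inv hy]

theorem IsSmoothForm.continuous_covInner {α β : Form n M k} (hα : IsSmoothForm α)
    (hβ : IsSmoothForm β) : Continuous fun x => covInner (α x) (β x) := by
  refine continuous_iff_continuousAt.2 fun x =>
    continuousAt_of_chart (mem_extChartAt_source (I := 𝓡 n) x) ?_
  have hn := (isOpen_extChartAt_target (I := 𝓡 n) x).mem_nhds (mem_extChartAt_target x)
  refine ((continuousOn_chartInner subset_rfl (hα x).continuousOn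
    (hβ x).continuousOn).continuousAt hn).congr ?_
  filter_upwards [hn] with u hu
  exact (covInner_symm_eq α β hu).symm

theorem IsSmoothForm.isL2Form {α : Form n M k} (hα : IsSmoothForm α) : IsL2Form α := by
  refine ⟨hα.isMeasurableForm, ?_⟩
  have hc := hα.continuous_covInner hα
  obtain ⟨C, hC⟩ := isCompact_univ.bddAbove_image hc.continuousOn
  refine Integrable.of_bound (hα.isMeasurableForm.aestronglyMeasurable_covInner
    hα.isMeasurableForm) C (Eventually.of_forall fun x => ?_)
  rw [Real.norm_of_nonneg (covInner_self_nonneg _)]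
  exact hC (mem_image_of_mem _ (mem_univ x))

theorem integral_eq_chart_add {f : M → ℝ} (hf : Integrable f (riemVol n M)) (x₀ : M) :
    ∫ x, f x ∂(riemVol n M) = (∫ u in (Ψ n x₀).target,
      chartDensity x₀ u * f ((Ψ n x₀).symm u)) +
      ∫ x in (Ψ n x₀).sourceᶜ, f x ∂(riemVol n M) := by
  rw [← integral_add_compl (isOpen_extChartAt_source (I := 𝓡 n) x₀).measurableSet hf, setIntegral_chart]

theorem l2Inner_eq_chart_add {α β : Form n M k} (hα : IsL2Form α) (hβ : IsL2Form β) (x₀ : M) :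
    l2Inner α β = (∫ u in (Ψ n x₀).target,
      chartDensity x₀ u * chartInner x₀ u (inChart α x₀ u) (inChart β x₀ u)) +
      ∫ x in (Ψ n x₀).sourceᶜ, covInner (α x) (β x) ∂(riemVol n M) := by
  rw [l2Inner, integral_eq_chart_add (hα.integrable hβ) x₀]
  congr 1
  refine setIntegral_congr_fun (measurableSet_target x₀) fun u hu => ?_
  simp only [covInner_symm_eq α β hu]

theorem IsL2Form.integrableOn_chart {α : Form n M k} (hα : IsL2Form α) (x₀ : M) :
    IntegrableOn (fun u => chartDensity x₀ u * chartInner x₀ u (inChart α x₀ u) (inChart α x₀ u))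
      (Ψ n x₀).target := by
  refine ((integrable_chart_iff x₀).1 hα.2.integrableOn).congr_fun (fun u hu => ?_)
    (measurableSet_target x₀)
  simp only [covInner_symm_eq α α hu]

/-- A glued form is square integrable if both parts are. -/
theorem isL2Form_glue {x₀ : M} {b : Eu n → EuForm n k} {z : Form n M k} (hz : IsL2Form z)
    (hb : AEStronglyMeasurable b (volume.restrict (Ψ n x₀).target))
    (hi : IntegrableOn (fun u => chartDensity x₀ u * chartInner x₀ u (b u) (b u))
      (Ψ n x₀).target) : IsL2Form (glue x₀ b z) := by
  have hm := (isOpen_extChartAt_source (I := 𝓡 n) x₀).measurableSet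
  refine ⟨isMeasurableForm_glue hz.1 hb, ?_⟩
  rw [← integrableOn_univ, ← union_compl_self (Ψ n x₀).source]
  refine IntegrableOn.union ((integrable_chart_iff x₀).2 ?_) ?_
  · refine hi.congr_fun (fun u hu => ?_) (measurableSet_target x₀)
    simp only [covInner_symm_eq _ _ hu, inChart_glue b z hu]
  · refine hz.2.integrableOn.congr_fun (fun x hx => ?_) hm.compl
    simp only [glue_of_notMem b z hx]

end L2

/-! ### A measurable trivialization of the bundle of forms -/

section Trivialization

variable {k : ℕ}

theorem covInner_comp_coframe {x₀ x : M} (hx : x ∈ (Ψ n x₀).source)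
    (a b : EuForm n k) : covInner (a.compContinuousLinearMap (chartCoframe x₀ x))
      (b.compContinuousLinearMap (chartCoframe x₀ x)) =
      chartInner x₀ (Ψ n x₀ x) a b := by
  obtain ⟨u, hu, rfl⟩ := exists_target hx
  rw [(Ψ n x₀).right_inv hu, chartInner_eq_covInner hu, glue_of_mem _ _ hx,
    glue_of_mem _ _ hx]

/-- Pullback of forms on Euclidean space by the differential of a chart. -/
def coframeMap (k : ℕ) (x₀ x : M) :
    EuForm n k →ₗ[ℝ] (TangentSpace (𝓡 n) x) [⋀^Fin k]→L[ℝ] ℝ where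
  toFun a := a.compContinuousLinearMap (chartCoframe x₀ x)
  map_add' _ _ := rfl
  map_smul' _ _ := rfl

theorem coframeMap_inChart {x₀ x : M} (hx : x ∈ (Ψ n x₀).source) (α : Form n M k) :
    coframeMap k x₀ x (inChart α x₀ (Ψ n x₀ x)) = α x :=
  (form_eq_inChart α hx).symm

theorem coframeMap_bijective {x₀ x : M} (hx : x ∈ (Ψ n x₀).source) :
    Function.Bijective (coframeMap (n := n) k x₀ x) := by
  classical
  constructor
  · rw [injective_iff_map_eq_zero]
    intro a ha
    refine eq_zero_of_chartInner ((Ψ n x₀).map_source hx) ?_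
    rw [← covInner_comp_coframe hx]
    change covInner (coframeMap k x₀ x a) (coframeMap k x₀ x a) = 0
    rw [ha, covInner_zero_left]
  · intro α
    refine ⟨_, (coframeMap_inChart hx (Function.update (0 : Form n M k) x α)).trans ?_⟩
    exact Function.update_self _ _ _

/-- The Euclidean space isomorphic to the space of forms. -/
abbrev FormCoord (n k : ℕ) : Type := EuclideanSpace ℝ (Fin (Module.finrank ℝ (EuForm n k)))

variable [MeasurableSpace M] [BorelSpace M] [CompactSpace M]

/-- A measurable trivialization of the bundle of forms, with bounded distortion. -/
theorem exists_trivialization (n k : ℕ) (M : Type*) [TopologicalSpace M]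
    [ChartedSpace (Eu n) M] [IsManifold (𝓡 n) ∞ M]
    [RiemannianBundle (fun x : M => TangentSpace (𝓡 n) x)]
    [IsContMDiffRiemannianBundle (𝓡 n) ∞ (Eu n)
      (fun x : M => TangentSpace (𝓡 n) x)]
    [MeasurableSpace M] [BorelSpace M] [CompactSpace M] :
    ∃ (T : ∀ x : M, ((TangentSpace (𝓡 n) x) [⋀^Fin k]→L[ℝ] ℝ) ≃ₗ[ℝ] FormCoord n k) (c C : ℝ),
      0 < c ∧ 0 < C ∧
      (∀ (x : M) (α : (TangentSpace (𝓡 n) x) [⋀^Fin k]→L[ℝ] ℝ),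
        c * ‖T x α‖ ^ 2 ≤ covInner α α ∧ covInner α α ≤ C * ‖T x α‖ ^ 2) ∧
      ∀ α : Form n M k, IsMeasurableForm α ↔
        AEStronglyMeasurable (fun x => T x (α x)) (riemVol n M) := by
  classical
  have hball : ∀ x : M, ∃ r : ℝ, 0 < r ∧
      closedBall (Ψ n x x) r ⊆ (Ψ n x).target := fun x =>
    Metric.nhds_basis_closedBall.mem_iff.1
      ((isOpen_extChartAt_target (I := 𝓡 n) x).mem_nhds (mem_extChartAt_target x))
  choose r hr hball using hball
  -- The pieces of the partition lie over compact coordinate balls, so that the comparison of norms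
  -- is uniform on each of the finitely many pieces.
  set V : M → Set M := fun x => (Ψ n x).source ∩
      Ψ n x ⁻¹' ball (Ψ n x x) (r x) with hV
  obtain ⟨N, p, A, hAm, hAd, hAU, hAV⟩ := exists_partition (V := V)
    (fun x => (continuousOn_extChartAt x).isOpen_inter_preimage
      (isOpen_extChartAt_source x) isOpen_ball)
    (fun x => ⟨mem_extChartAt_source x, mem_ball_self (hr x)⟩)
  have hidx : ∀ x : M, ∃ i, x ∈ A i := fun x => mem_iUnion.1 (hAU ▸ mem_univ x)
  choose idx hidx using hidx
  have hidx_eq : ∀ {x : M} {i}, x ∈ A i → idx x = i := by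
    intro x i hx
    by_contra h
    exact disjoint_left.1 (hAd h) (hidx x) hx
  have hsrc : ∀ x : M, x ∈ (Ψ n (p (idx x))).source := fun x => (hAV _ (hidx x)).1
  have hAs : ∀ i, A i ⊆ (Ψ n (p i)).source := fun i x hx => (hAV _ hx).1
  set Q : EuForm n k ≃L[ℝ] FormCoord n k := toEuclidean with hQ
  let L : ∀ x : M, EuForm n k ≃ₗ[ℝ] ((TangentSpace (𝓡 n) x) [⋀^Fin k]→L[ℝ] ℝ) := fun x =>
    LinearEquiv.ofBijective (coframeMap k (p (idx x)) x) (coframeMap_bijective (hsrc x))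
  have hL : ∀ (α : Form n M k) (x : M),
      (L x).symm (α x) = inChart α (p (idx x)) (Ψ n (p (idx x)) x) := by
    intro α x
    rw [LinearEquiv.symm_apply_eq]
    exact (coframeMap_inChart (hsrc x) α).symm
  have hbd : ∀ i : Fin N, ∃ c C : ℝ, 0 < c ∧ 0 < C ∧
      ∀ u ∈ closedBall (Ψ n (p i) (p i)) (r (p i)), ∀ a : EuForm n k,
      c * ‖a‖ ^ 2 ≤ chartInner (p i) u a a ∧ chartInner (p i) u a a ≤ C * ‖a‖ ^ 2 := fun i =>
    exists_chartInner_bounds (isCompact_closedBall _ _) (hball _) k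
  choose c C hc hC hbd using hbd
  obtain ⟨c', hc', hc'le⟩ : ∃ c' : ℝ, 0 < c' ∧ ∀ i, c' ≤ c i := by
    rcases isEmpty_or_nonempty (Fin N) with h | h
    · exact ⟨1, one_pos, fun i => h.elim i⟩
    · obtain ⟨i, hi⟩ := Finite.exists_min c
      exact ⟨c i, hc i, hi⟩
  obtain ⟨C', hC', hC'le⟩ : ∃ C' : ℝ, 0 < C' ∧ ∀ i, C i ≤ C' := by
    rcases isEmpty_or_nonempty (Fin N) with h | h
    · exact ⟨1, one_pos, fun i => h.elim i⟩
    · obtain ⟨i, hi⟩ := Finite.exists_max C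
      exact ⟨C i, hC i, hi⟩
  have hQ1 : ∀ a : EuForm n k, ‖Q a‖ ≤ (‖(Q : EuForm n k →L[ℝ] FormCoord n k)‖ + 1) * ‖a‖ := fun a =>
    ((Q : EuForm n k →L[ℝ] FormCoord n k).le_opNorm a).trans (by gcongr; linarith)
  have hQ2 : ∀ a : EuForm n k,
      ‖a‖ ≤ (‖(Q.symm : FormCoord n k →L[ℝ] EuForm n k)‖ + 1) * ‖Q a‖ := fun a => by
    have := (Q.symm : FormCoord n k →L[ℝ] EuForm n k).le_opNorm (Q a)
    rw [ContinuousLinearEquiv.coe_coe, Q.symm_apply_apply] at this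
    exact this.trans (by gcongr; linarith)
  -- The summand 1 keeps the constants positive even when the space of forms is zero.
  set q1 := ‖(Q : EuForm n k →L[ℝ] FormCoord n k)‖ + 1
  set q2 := ‖(Q.symm : FormCoord n k →L[ℝ] EuForm n k)‖ + 1
  have hq1 : 0 < q1 := by positivity
  have hq2 : 0 < q2 := by positivity
  refine ⟨fun x => (L x).symm.trans Q.toLinearEquiv, c' / q1 ^ 2, C' * q2 ^ 2, by positivity,
    by positivity, fun x α => ?_, fun α => ?_⟩
  · obtain ⟨a, rfl⟩ := (L x).surjective α
    have h1 : ((L x).symm.trans Q.toLinearEquiv) (L x a) = Q a := by simp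
    have hu : Ψ n (p (idx x)) x ∈ closedBall
        (Ψ n (p (idx x)) (p (idx x))) (r (p (idx x))) :=
      ball_subset_closedBall (hAV _ (hidx x)).2
    have h2 : covInner (L x a) (L x a) =
        chartInner (p (idx x)) (Ψ n (p (idx x)) x) a a :=
      covInner_comp_coframe (hsrc x) a a
    obtain ⟨h3, h4⟩ := hbd _ _ hu a
    rw [h1, h2]
    have h5 : ‖Q a‖ ^ 2 ≤ q1 ^ 2 * ‖a‖ ^ 2 := by
      rw [← mul_pow]; exact pow_le_pow_left₀ (norm_nonneg _) (hQ1 a) 2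
    have h6 : ‖a‖ ^ 2 ≤ q2 ^ 2 * ‖Q a‖ ^ 2 := by
      rw [← mul_pow]; exact pow_le_pow_left₀ (norm_nonneg _) (hQ2 a) 2
    constructor
    · calc c' / q1 ^ 2 * ‖Q a‖ ^ 2 ≤ c' / q1 ^ 2 * (q1 ^ 2 * ‖a‖ ^ 2) := by gcongr
        _ = c' * ‖a‖ ^ 2 := by field_simp
        _ ≤ c (idx x) * ‖a‖ ^ 2 := by gcongr; exact hc'le _
        _ ≤ _ := h3
    · calc _ ≤ C (idx x) * ‖a‖ ^ 2 := h4
        _ ≤ C' * ‖a‖ ^ 2 := by gcongr; exact hC'le _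
        _ ≤ C' * (q2 ^ 2 * ‖Q a‖ ^ 2) := by gcongr
        _ = _ := by ring
  · have hT : ∀ x, ((L x).symm.trans Q.toLinearEquiv) (α x) =
        Q (inChart α (p (idx x)) (Ψ n (p (idx x)) x)) := by
      intro x
      rw [← hL α x]
      rfl
    simp only [hT]
    constructor
    · intro h
      rw [← Measure.restrict_univ (μ := riemVol n M), ← hAU, aestronglyMeasurable_iUnion_iff]
      intro i
      have h1 : AEStronglyMeasurable (fun x => Q (inChart α (p i) (Ψ n (p i) x)))
          ((riemVol n M).restrict (Ψ n (p i)).source) := by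
        rw [aestronglyMeasurable_chart_iff]
        refine (Q.continuous.comp_aestronglyMeasurable (h (p i))).congr ?_
        filter_upwards [ae_restrict_mem (measurableSet_target (p i))] with u hu
        rw [(Ψ n (p i)).right_inv hu]
      refine (h1.mono_measure (Measure.restrict_mono (hAs i) le_rfl)).congr ?_
      filter_upwards [ae_restrict_mem (hAm i)] with x hx
      rw [hidx_eq hx]
    · intro h x₀
      have hS : ∀ i, MeasurableSet ((Ψ n x₀).target ∩
          (Ψ n x₀).symm ⁻¹' A i) := fun i => measurableSet_preimage_symm x₀ (hAm i)
      have hcov : (Ψ n x₀).target = ⋃ i, (Ψ n x₀).target ∩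
          (Ψ n x₀).symm ⁻¹' A i := by
        rw [← inter_iUnion, ← preimage_iUnion, hAU, preimage_univ, inter_univ]
      rw [hcov, aestronglyMeasurable_iUnion_iff]
      intro i
      have hov : (Ψ n x₀).target ∩ (Ψ n x₀).symm ⁻¹' A i ⊆
          overlap x₀ (p i) := fun u hu => ⟨hu.1, hAs i hu.2⟩
      have h1 := (aestronglyMeasurable_chart_iff x₀).1 (h.restrict
        (s := (Ψ n x₀).source))
      have h2 := Q.symm.continuous.comp_aestronglyMeasurable
        (h1.mono_measure (Measure.restrict_mono (s := (Ψ n x₀).target ∩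
          (Ψ n x₀).symm ⁻¹' A i) inter_subset_left le_rfl))
      have h3 : AEStronglyMeasurable (fderiv ℝ (transition x₀ (p i)))
          (volume.restrict ((Ψ n x₀).target ∩
            (Ψ n x₀).symm ⁻¹' A i)) :=
        ContinuousOn.aestronglyMeasurable (fun u hu =>
          (contDiffAt_fderiv_transition (hov hu)).continuousAt.continuousWithinAt) (hS i)
      refine (AEStronglyMeasurable.form_comp h2 h3).congr ?_
      filter_upwards [ae_restrict_mem (hS i)] with u hu
      rw [inChart_transition α (hov hu), hidx_eq hu.2, Q.symm_apply_apply]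
      rfl

end Trivialization

/-! ### L² projection onto exact forms and coclosed potentials -/

section Projection

/-- Projection onto the closure of a subspace, for a bilinear form equivalent to the inner
product. -/
theorem exists_projection_of_coercive {H : Type*} [NormedAddCommGroup H] [InnerProductSpace ℝ H]
    [CompleteSpace H] (b : H →ₗ[ℝ] H →ₗ[ℝ] ℝ) {c C : ℝ} (hc : 0 < c)
    (h1 : ∀ f, c * ‖f‖ ^ 2 ≤ b f f) (h2 : ∀ f, b f f ≤ C * ‖f‖ ^ 2)
    (h3 : ∀ f g, |b f g| ≤ (b f f + b g g) / 2) (R : Submodule ℝ H) (f : H) :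
    ∃ g : H, (∀ ξ ∈ R, b g ξ = b f ξ) ∧ ∀ l : H →L[ℝ] ℝ, (∀ ξ ∈ R, l ξ = 0) → l g = 0 := by
  have hb : ∀ f g, ‖b f g‖ ≤ C * ‖f‖ * ‖g‖ := by
    intro f g
    rcases eq_or_ne f 0 with rfl | hf
    · simp
    rcases eq_or_ne g 0 with rfl | hg
    · simp
    have hf' := norm_pos_iff.2 hf
    have hg' := norm_pos_iff.2 hg
    -- Scaling both vectors to the common length ‖f‖‖g‖ turns the hypothesis on arithmetic means
    -- into boundedness of `b`.
    have h4 := h3 (‖g‖ • f) (‖f‖ • g)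
    have h5 := h2 f
    have h6 := h2 g
    simp only [map_smul, LinearMap.smul_apply, smul_eq_mul] at h4
    rw [abs_mul, abs_mul, abs_norm, abs_norm] at h4
    rw [Real.norm_eq_abs]
    have h7 : ‖g‖ * (‖f‖ * |b f g|) ≤ (‖g‖ * (‖f‖ * (C * ‖f‖ * ‖g‖))) := by
      have h8 : ‖g‖ * (‖g‖ * b f f) ≤ ‖g‖ * (‖g‖ * (C * ‖f‖ ^ 2)) := by gcongr
      have h9 : ‖f‖ * (‖f‖ * b g g) ≤ ‖f‖ * (‖f‖ * (C * ‖g‖ ^ 2)) := by gcongr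
      linarith
    exact le_of_mul_le_mul_left (le_of_mul_le_mul_left h7 hg') hf'
  set B : H →L[ℝ] H →L[ℝ] ℝ := LinearMap.mkContinuous₂ b C hb with hB
  have hBa : ∀ f g, B f g = b f g := fun f g => rfl
  set K := R.topologicalClosure
  have : CompleteSpace K := R.isClosed_topologicalClosure.completeSpace_coe
  set B' : K →L[ℝ] K →L[ℝ] ℝ := B.bilinearComp K.subtypeL K.subtypeL with hB'
  have hcoer : IsCoercive B' := ⟨c, hc, fun u => by
    have := h1 (u : H)
    calc c * ‖u‖ * ‖u‖ = c * ‖(u : H)‖ ^ 2 := by rw [Submodule.coe_norm]; ring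
      _ ≤ _ := this⟩
  -- On the closure of `R`, the Riesz vector of b(f,·) is inverted by the Lax–Milgram theorem. The
  -- projection lies in that closure, so continuous functionals vanishing on `R` vanish on it.
  set w : K := (InnerProductSpace.toDual ℝ K).symm ((B f).comp K.subtypeL) with hw
  set g := hcoer.continuousLinearEquivOfBilin.symm w with hg
  refine ⟨g, fun ξ hξ => ?_, fun l hl => ?_⟩
  · have h4 := hcoer.continuousLinearEquivOfBilin_apply g ⟨ξ, R.le_topologicalClosure hξ⟩
    rw [hg, ContinuousLinearEquiv.apply_symm_apply, hw, InnerProductSpace.toDual_symm_apply] at h4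
    exact h4.symm
  · have h4 : (R : Set H) ⊆ l.ker := fun ξ hξ => hl ξ hξ
    have h5 := closure_minimal h4 l.isClosed_ker
    exact h5 g.2

variable [MeasurableSpace M] [BorelSpace M] [CompactSpace M]

variable {k : ℕ}

theorem l2Inner_congr_ae {α α' β β' : Form n M k} (h : ∀ᵐ x ∂(riemVol n M), α x = α' x)
    (h' : ∀ᵐ x ∂(riemVol n M), β x = β' x) : l2Inner α β = l2Inner α' β' := by
  refine integral_congr_ae ?_
  filter_upwards [h, h'] with x hx hx'
  rw [hx, hx']

theorem abs_l2Inner_le {α β : Form n M k} (hα : IsL2Form α) (hβ : IsL2Form β) :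
    |l2Inner α β| ≤ (l2Inner α α + l2Inner β β) / 2 := by
  rw [l2Inner, l2Inner, l2Inner, ← integral_add hα.2 hβ.2, ← integral_div]
  refine (abs_integral_le_integral_abs).trans (integral_mono (hα.integrable hβ).abs
    ((hα.2.add hβ.2).div_const 2) fun x => abs_covInner_le _ _)

/-- The `L²` projection to the closure of a space of forms. -/
theorem exists_l2_projection {y : Form n M k} (hy : IsL2Form y) (S : Submodule ℝ (Form n M k))
    (hS : ∀ ξ ∈ S, IsL2Form ξ) : ∃ y' : Form n M k, IsL2Form y' ∧
      (∀ ξ ∈ S, l2Inner y' ξ = l2Inner y ξ) ∧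
      ∀ χ, IsL2Form χ → (∀ ξ ∈ S, l2Inner ξ χ = 0) → l2Inner y' χ = 0 := by
  obtain ⟨T, c, C, hc, hC, hbd, hmeas⟩ := exists_trivialization n k M
  -- Through the trivialization, square integrable forms modulo null sets become a Hilbert space of
  -- functions. The L² product of forms is only equivalent to its inner product, which is why the
  -- projection is taken for a coercive bilinear form.
  set H := Lp (FormCoord n k) 2 (riemVol n M)
  set F : (M → FormCoord n k) → Form n M k := fun f x => (T x).symm (f x) with hF
  have hTF : ∀ f x, T x (F f x) = f x := fun f x => (T x).apply_symm_apply _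
  have hsq : ∀ f : H, Integrable (fun x => ‖f x‖ ^ 2) (riemVol n M) := fun f =>
    (memLp_two_iff_integrable_sq_norm (Lp.aestronglyMeasurable f)).1 (Lp.memLp f)
  have hnorm : ∀ f : H, ∫ x, ‖f x‖ ^ 2 ∂(riemVol n M) = ‖f‖ ^ 2 := by
    intro f
    rw [← real_inner_self_eq_norm_sq, L2.inner_def]
    simp only [real_inner_self_eq_norm_sq]
  have hFL2 : ∀ f : H, IsL2Form (F f) := by
    intro f
    have hm : IsMeasurableForm (F f) := by
      rw [hmeas]
      simp only [hTF]
      exact Lp.aestronglyMeasurable f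
    refine ⟨hm, ((hsq f).const_mul C).mono' (hm.aestronglyMeasurable_covInner hm)
      (Eventually.of_forall fun x => ?_)⟩
    rw [Real.norm_of_nonneg (covInner_self_nonneg _)]
    have := (hbd x (F f x)).2
    rwa [hTF] at this
  have hFadd : ∀ f g : H, ∀ᵐ x ∂(riemVol n M), F (f + g : H) x = (F f + F g) x := by
    intro f g
    filter_upwards [Lp.coeFn_add f g] with x hx
    simp only [hF, hx, Pi.add_apply, map_add]
  have hFsmul : ∀ (t : ℝ) (f : H), ∀ᵐ x ∂(riemVol n M), F (t • f : H) x = (t • F f) x := by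
    intro t f
    filter_upwards [Lp.coeFn_smul t f] with x hx
    simp only [hF, hx, Pi.smul_apply, map_smul]
  have hrfl : ∀ α : Form n M k, ∀ᵐ x ∂(riemVol n M), α x = α x := fun _ =>
    Eventually.of_forall fun _ => rfl
  have hsurj : ∀ α : Form n M k, IsL2Form α → ∃ f : H, ∀ᵐ x ∂(riemVol n M), F f x = α x := by
    intro α hα
    have hm := (hmeas α).1 hα.1
    have hL : MemLp (fun x => T x (α x)) 2 (riemVol n M) := by
      rw [memLp_two_iff_integrable_sq_norm hm]
      refine (hα.2.const_mul c⁻¹).mono' (hm.norm.pow 2) (Eventually.of_forall fun x => ?_)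
      rw [Real.norm_of_nonneg (sq_nonneg _), le_inv_mul_iff₀ hc]
      exact (hbd x (α x)).1
    refine ⟨hL.toLp, ?_⟩
    filter_upwards [hL.coeFn_toLp] with x hx
    simp only [hF, hx, LinearEquiv.symm_apply_apply]
  let b : H →ₗ[ℝ] H →ₗ[ℝ] ℝ := LinearMap.mk₂ ℝ (fun f g => l2Inner (F f) (F g))
    (fun f f' g => by
      rw [l2Inner_congr_ae (hFadd f f') (hrfl _), l2Inner_add_left (hFL2 _) (hFL2 _) (hFL2 _)])
    (fun t f g => by
      rw [l2Inner_congr_ae (hFsmul t f) (hrfl _), l2Inner_smul_left, smul_eq_mul])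
    (fun f g g' => by
      rw [l2Inner_congr_ae (hrfl _) (hFadd g g'), l2Inner_add_right (hFL2 _) (hFL2 _) (hFL2 _)])
    (fun t f g => by
      rw [l2Inner_congr_ae (hrfl _) (hFsmul t g), l2Inner_comm, l2Inner_smul_left, smul_eq_mul,
        l2Inner_comm])
  have hba : ∀ f g, b f g = l2Inner (F f) (F g) := fun _ _ => rfl
  let R : Submodule ℝ H :=
    { carrier := {f | ∃ ξ ∈ S, ∀ᵐ x ∂(riemVol n M), F f x = ξ x}
      add_mem' := by
        rintro f g ⟨ξ, hξ, h⟩ ⟨ψ, hψ, h'⟩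
        refine ⟨ξ + ψ, S.add_mem hξ hψ, ?_⟩
        filter_upwards [hFadd f g, h, h'] with x hx h1 h2
        rw [hx, Pi.add_apply, h1, h2, Pi.add_apply]
      zero_mem' := by
        refine ⟨0, S.zero_mem, ?_⟩
        filter_upwards [hFsmul 0 0] with x hx
        rw [zero_smul] at hx
        simpa using hx
      smul_mem' := by
        rintro t f ⟨ξ, hξ, h⟩
        refine ⟨t • ξ, S.smul_mem t hξ, ?_⟩
        filter_upwards [hFsmul t f, h] with x hx h1
        rw [hx, Pi.smul_apply, h1, Pi.smul_apply] }
  have h1 : ∀ f, c * ‖f‖ ^ 2 ≤ b f f := by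
    intro f
    rw [hba, l2Inner, ← hnorm, ← integral_const_mul]
    refine integral_mono ((hsq f).const_mul c) (hFL2 f).2 fun x => ?_
    have := (hbd x (F f x)).1
    rwa [hTF] at this
  have h2 : ∀ f, b f f ≤ C * ‖f‖ ^ 2 := by
    intro f
    rw [hba, l2Inner, ← hnorm, ← integral_const_mul]
    refine integral_mono (hFL2 f).2 ((hsq f).const_mul C) fun x => ?_
    have := (hbd x (F f x)).2
    rwa [hTF] at this
  obtain ⟨f, hf⟩ := hsurj y hy
  obtain ⟨g, hg, hg'⟩ := exists_projection_of_coercive b hc h1 h2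
    (fun f g => abs_l2Inner_le (hFL2 f) (hFL2 g)) R f
  refine ⟨F g, hFL2 g, fun ξ hξ => ?_, fun χ hχ hχS => ?_⟩
  · obtain ⟨e, he⟩ := hsurj ξ (hS ξ hξ)
    have := hg e ⟨ξ, hξ, he⟩
    rw [hba, hba, l2Inner_congr_ae (hrfl _) he, l2Inner_congr_ae hf he] at this
    exact this
  · obtain ⟨e, he⟩ := hsurj χ hχ
    -- Continuity of pairing with χ follows from `abs_l2Inner_le` for the normalised vector.
    have hl : ∀ f, ‖b.flip e f‖ ≤ (C + C * ‖e‖ ^ 2) * ‖f‖ := by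
      intro f
      rcases eq_or_ne f 0 with rfl | hf
      · simp
      have hn := norm_pos_iff.2 hf
      have h3 : |b (‖f‖⁻¹ • f) e| ≤ _ := abs_l2Inner_le (hFL2 (‖f‖⁻¹ • f)) (hFL2 e)
      have h4 := h2 (‖f‖⁻¹ • f)
      have h5 := h2 e
      rw [hba] at h4 h5
      have h6 : ‖‖f‖⁻¹ • f‖ = 1 := by
        rw [norm_smul, norm_inv, norm_norm, inv_mul_cancel₀ hn.ne']
      rw [h6] at h4
      have h7 : b f e = ‖f‖ * b (‖f‖⁻¹ • f) e := by
        rw [map_smul, LinearMap.smul_apply, smul_eq_mul, mul_inv_cancel_left₀ hn.ne']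
      rw [LinearMap.flip_apply, Real.norm_eq_abs, h7, abs_mul, abs_norm, mul_comm]
      gcongr
      linarith [mul_nonneg hC.le (sq_nonneg ‖e‖)]
    have := hg' (LinearMap.mkContinuous (b.flip e) _ hl) (by
      rintro ξ' ⟨ξ, hξ, h⟩
      change b ξ' e = 0
      rw [hba, l2Inner_congr_ae h he, hχS ξ hξ])
    change b g e = 0 at this
    rwa [hba, l2Inner_congr_ae (hrfl _) he] at this

/-- The exact smooth forms. -/
def exactForms (n : ℕ) (M : Type*) [TopologicalSpace M]
    [ChartedSpace (Eu n) M] [IsManifold (𝓡 n) ∞ M]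
    [RiemannianBundle (fun x : M => TangentSpace (𝓡 n) x)]
    [IsContMDiffRiemannianBundle (𝓡 n) ∞ (Eu n)
      (fun x : M => TangentSpace (𝓡 n) x)] (k : ℕ) : Submodule ℝ (Form n M (k + 1)) where
  carrier := {α | ∃ ξ : Form n M k, IsSmoothForm ξ ∧ extD ξ = α}
  add_mem' := by
    rintro _ _ ⟨ξ, hξ, rfl⟩ ⟨ψ, hψ, rfl⟩
    exact ⟨ξ + ψ, hξ.add hψ, hξ.extD_add hψ⟩
  zero_mem' := ⟨(0 : ℝ) • (0 : Form n M k), isSmoothForm_zero.smul 0, by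
    rw [extD_smul, zero_smul]⟩
  smul_mem' := by
    rintro t _ ⟨ξ, hξ, rfl⟩
    exact ⟨t • ξ, hξ.smul t, extD_smul t ξ⟩

theorem isL2Form_zero : IsL2Form (0 : Form n M k) := isSmoothForm_zero.isL2Form

/-- A weakly exact `L²` form is the weak derivative of a coclosed form in `H_1`. -/
theorem isAdmissibleExact_of_isWeakD {y : Form n M k} {u : Form n M (k + 1)} (hy : IsL2Form y)
    (hu : IsL2Form u) (h : IsWeakD y u) : IsAdmissibleExact u := by
  cases k with
  | zero => exact ⟨y, ⟨hy, ⟨u, hu, h⟩, trivial⟩, trivial, hu, h⟩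
  | succ k =>
    -- Let y' be the projection of y onto the closure of the exact smooth forms. Then y - y' is
    -- orthogonal to exact forms, that is, coclosed. Since d² = 0, codifferentials are orthogonal to
    -- exact forms and hence to y', so y and y - y' have the same weak derivative.
    obtain ⟨y', hy', h1, h2⟩ := exists_l2_projection hy (exactForms n M k) (by
      rintro _ ⟨ξ, hξ, rfl⟩
      exact hξ.extD.isL2Form)
    have hco : IsCoclosed (y - y') := by
      intro η hη
      rw [l2Inner_sub_left hy hy' hη.extD.isL2Form, h1 _ ⟨η, hη, rfl⟩, sub_self,
        l2Inner_zero_left]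
    have hd : IsWeakD (y - y') u := by
      intro ψ χ hψ
      rw [l2Inner_sub_left hy hy' hψ.2.1.isL2Form, h2 χ hψ.2.1.isL2Form, sub_zero]
      · exact h ψ χ hψ
      · rintro _ ⟨ξ, hξ, rfl⟩
        rw [← hψ.2.2 _ hξ.extD, hξ.extD_extD, l2Inner_zero_left]
    exact ⟨y - y', ⟨hy.sub hy', ⟨u, hu, hd⟩, 0, isL2Form_zero, hco⟩, hco, hu, hd⟩

end Projection

/-! ### Smoothness of integrals depending on a parameter -/

section Parametric

variable {E F : Type*} [NormedAddCommGroup E] [NormedSpace ℝ E] [NormedAddCommGroup F]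
  [NormedSpace ℝ F]

theorem hasFDerivAt_partial {f : E → ℝ → F} (hf : ContDiff ℝ 1 (fun q : E × ℝ => f q.1 q.2))
    (u : E) (t : ℝ) : HasFDerivAt (fun u => f u t)
      ((fderiv ℝ (fun q : E × ℝ => f q.1 q.2) (u, t)).comp (ContinuousLinearMap.inl ℝ E ℝ)) u :=
  HasFDerivAt.comp (g := fun q : E × ℝ => f q.1 q.2) (f := fun e : E => (e, t)) u
    ((hf.differentiable (by simp)) (u, t)).hasFDerivAt (hasFDerivAt_prodMk_left u t)

theorem continuous_fderiv_partial {f : E → ℝ → F}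
    (hf : ContDiff ℝ 1 (fun q : E × ℝ => f q.1 q.2)) :
    Continuous fun q : E × ℝ => fderiv ℝ (fun u => f u q.2) q.1 := by
  have : (fun q : E × ℝ => fderiv ℝ (fun u => f u q.2) q.1) = fun q =>
      (fderiv ℝ (fun q : E × ℝ => f q.1 q.2) q).comp (ContinuousLinearMap.inl ℝ E ℝ) :=
    funext fun q => (hasFDerivAt_partial hf q.1 q.2).fderiv
  rw [this]
  exact (hf.continuous_fderiv (by simp)).clm_comp continuous_const

variable [FiniteDimensional ℝ E] [CompleteSpace F]

theorem hasFDerivAt_parametric_integral {f : E → ℝ → F}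
    (hf : ContDiff ℝ 1 (fun q : E × ℝ => f q.1 q.2)) (u : E) :
    HasFDerivAt (fun u => ∫ t in (0 : ℝ)..1, f u t)
      (∫ t in (0 : ℝ)..1, fderiv ℝ (fun u => f u t) u) u := by
  have : ProperSpace E := FiniteDimensional.proper ℝ E
  have hc := continuous_fderiv_partial hf
  obtain ⟨C, hC⟩ := ((isCompact_closedBall u 1).prod (isCompact_Icc (a := (0 : ℝ)) (b := 1))
    ).bddAbove_image hc.norm.continuousOn
  refine intervalIntegral.hasFDerivAt_integral_of_dominated_of_fderiv_le (bound := fun _ => C)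
    (F := f) (F' := fun u t => fderiv ℝ (fun u => f u t) u) (μ := volume)
    (Metric.closedBall_mem_nhds u one_pos)
    (Eventually.of_forall fun x => ?_) ?_ ?_ (Eventually.of_forall fun t ht x hx => ?_)
    intervalIntegrable_const (Eventually.of_forall fun t _ x _ => ?_)
  · exact (hf.continuous.comp (Continuous.prodMk_right x)).aestronglyMeasurable
  · exact (hf.continuous.comp (Continuous.prodMk_right u)).intervalIntegrable _ _
  · exact (hc.comp (Continuous.prodMk_right u)).aestronglyMeasurable
  · rw [uIoc_of_le zero_le_one] at ht
    have hm : ((x, t) : E × ℝ) ∈ closedBall u 1 ×ˢ Icc (0 : ℝ) 1 := ⟨hx, ht.1.le, ht.2⟩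
    exact hC (mem_image_of_mem _ hm)
  · exact (hasFDerivAt_partial hf x t).differentiableAt.hasFDerivAt

theorem fderiv_parametric_integral_apply {f : E → ℝ → F}
    (hf : ContDiff ℝ 1 (fun q : E × ℝ => f q.1 q.2)) (u w : E) :
    fderiv ℝ (fun u => ∫ t in (0 : ℝ)..1, f u t) u w =
      ∫ t in (0 : ℝ)..1, fderiv ℝ (fun u => f u t) u w := by
  rw [(hasFDerivAt_parametric_integral hf u).fderiv]
  exact ContinuousLinearMap.intervalIntegral_apply
    (((continuous_fderiv_partial hf).comp (Continuous.prodMk_right u)).intervalIntegrable _ _) w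

/-- Induction on the order: the derivative in a fixed direction is again an integral of the same
kind. The integrand has one derivative more than the conclusion, so that differentiation under the
integral is available already at order 0. -/
theorem contDiff_parametric_integral_nat (N : ℕ) :
    ∀ f : E → ℝ → F, ContDiff ℝ (N + 1 : ℕ) (fun q : E × ℝ => f q.1 q.2) →
      ContDiff ℝ N (fun u => ∫ t in (0 : ℝ)..1, f u t) := by
  induction N with
  | zero =>
    intro f hf
    exact contDiff_zero.2 (continuous_iff_continuousAt.2 fun u =>
      (hasFDerivAt_parametric_integral (f := f) (by simpa using hf) u).continuousAt)
  | succ N ih =>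
    intro f hf
    have hf1 : ContDiff ℝ 1 (fun q : E × ℝ => f q.1 q.2) :=
      hf.of_le (by norm_cast; omega)
    have h1 : ((N + 1 : ℕ) : WithTop ℕ∞) = (N : WithTop ℕ∞) + 1 := by norm_cast
    rw [h1, contDiff_succ_iff_fderiv_apply]
    refine ⟨fun u => (hasFDerivAt_parametric_integral hf1 u).differentiableAt, by simp,
      fun w => ?_⟩
    have hcd : ContDiff ℝ (N + 1 : ℕ) (fun q : E × ℝ => fderiv ℝ (fun u => f u q.2) q.1 w) := by
      have : (fun q : E × ℝ => fderiv ℝ (fun u => f u q.2) q.1 w) = fun q =>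
          fderiv ℝ (fun q : E × ℝ => f q.1 q.2) q (w, 0) := by
        funext q
        rw [(hasFDerivAt_partial hf1 q.1 q.2).fderiv]
        rfl
      rw [this]
      exact (hf.fderiv_right (m := (N + 1 : ℕ)) (by norm_cast)).clm_apply contDiff_const
    simp only [fderiv_parametric_integral_apply hf1]
    exact ih (fun u t => fderiv ℝ (fun u => f u t) u w) hcd

/-- Integrals of smooth functions depending on a parameter are smooth. -/
theorem contDiff_parametric_integral {f : E → ℝ → F}
    (hf : ContDiff ℝ ∞ (fun q : E × ℝ => f q.1 q.2)) :
    ContDiff ℝ ∞ (fun u => ∫ t in (0 : ℝ)..1, f u t) :=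
  contDiff_infty.2 fun N => contDiff_parametric_integral_nat N f (contDiff_infty.1 hf _)

end Parametric

/-! ### The Poincaré lemma on a ball -/

section Poincare

variable {n k : ℕ}

/-- Evaluation of forms at fixed vectors. -/
def formEval (v : Fin k → Eu n) : EuForm n k →L[ℝ] ℝ :=
  LinearMap.toContinuousLinearMap
    { toFun := fun α => α v, map_add' := fun _ _ => rfl, map_smul' := fun _ _ => rfl }

/-- Moving the i-th vector back to its place costs (-1)^i, so all k + 1 terms are equal. -/
theorem sum_vecCons_removeNth (α : EuForm n (k + 1)) (v : Fin (k + 1) → Eu n) :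
    ∑ i : Fin (k + 1), (-1 : ℝ) ^ (i : ℕ) * α (Matrix.vecCons (v i) (i.removeNth v)) =
      (k + 1) * α v := by
  have : ∀ i : Fin (k + 1), (-1 : ℝ) ^ (i : ℕ) * α (Matrix.vecCons (v i) (i.removeNth v)) = α v := by
    intro i
    rw [← α.neg_one_pow_smul_map_insertNth, Fin.insertNth_self_removeNth, zsmul_eq_mul]
    push_cast
    rw [← mul_assoc, ← mul_pow]
    simp
  simp [this]

/-- This is dh(x, v_0, …, v_k) = 0 with the term differentiating along x isolated. -/
theorem sum_fderiv_vecCons {h : Eu n → EuForm n (k + 1)} {y : Eu n} (hd : extDeriv h y = 0)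
    (x : Eu n) (v : Fin (k + 1) → Eu n) :
    ∑ i : Fin (k + 1), (-1 : ℝ) ^ (i : ℕ) *
      fderiv ℝ h y (v i) (Matrix.vecCons x (i.removeNth v)) = fderiv ℝ h y x v := by
  have h1 : extDeriv h y (Matrix.vecCons x v) = 0 := by rw [hd]; rfl
  rw [extDeriv, ContinuousAlternatingMap.alternatizeUncurryFin_apply, Fin.sum_univ_succ] at h1
  have h2 : ∀ i : Fin (k + 1), (-1 : ℤ) ^ ((i.succ : Fin (k + 2)) : ℕ) •
      fderiv ℝ h y ((Matrix.vecCons x v : Fin (k + 2) → Eu n) i.succ)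
        (i.succ.removeNth (Matrix.vecCons x v : Fin (k + 2) → Eu n)) =
      -((-1 : ℝ) ^ (i : ℕ) * fderiv ℝ h y (v i) (Matrix.vecCons x (i.removeNth v))) := by
    intro i
    have h3 : i.succ.removeNth (Matrix.vecCons x v : Fin (k + 2) → Eu n) =
        Matrix.vecCons x (i.removeNth v) := by
      funext j
      refine Fin.cases ?_ (fun j => ?_) j <;> simp [Fin.removeNth]
    rw [h3, zsmul_eq_mul, Fin.val_succ, pow_succ]
    push_cast
    simp
  have h4 : (0 : Fin (k + 2)).removeNth (Matrix.vecCons x v : Fin (k + 2) → Eu n) = v := by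
    funext j
    simp [Fin.removeNth]
  simp only [h2, h4, Finset.sum_neg_distrib, Fin.val_zero, pow_zero, one_smul,
    Matrix.cons_val_zero] at h1
  linarith

/-- The Poincaré lemma on a ball. -/
theorem exists_primitive {h : Eu n → EuForm n (k + 1)} (hh : ContDiff ℝ ∞ h) (c : Eu n) (R : ℝ)
    (hd : ∀ u ∈ ball c R, extDeriv h u = 0) :
    ∃ β : Eu n → EuForm n k, ContDiff ℝ ∞ β ∧ ∀ u ∈ ball c R, extDeriv β u = h u := by
  -- The homotopy operator of the radial contraction: the primitive is the integral over t in [0,1]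
  -- of t^k h(c + t(u - c)) with u - c inserted in the first slot.
  set f : Eu n → ℝ → EuForm n k := fun u t =>
    t ^ k • (h (c + t • (u - c))).curryLeft (u - c) with hf
  have hγ : ContDiff ℝ ∞ fun q : Eu n × ℝ => c + q.2 • (q.1 - c) := by fun_prop
  have hfs : ContDiff ℝ ∞ fun q : Eu n × ℝ => f q.1 q.2 := by
    refine ContDiff.smul (contDiff_snd.pow k) ?_
    refine contDiff_iff_contDiffAt.2 fun q => contDiffAt_form_iff.2 fun I => ?_
    refine ContDiffWithinAt.form_apply (f := fun q : Eu n × ℝ => h (c + q.2 • (q.1 - c)))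
      (v := fun a q => Matrix.vecCons (q.1 - c) (fun a => stdFrame n (I a)) a)
      (hh.comp hγ).contDiffAt.contDiffWithinAt fun a => ?_
    refine Fin.cases ?_ (fun a => ?_) a
    · simp only [Matrix.cons_val_zero]
      exact (contDiff_fst.sub contDiff_const).contDiffWithinAt
    · simp only [Matrix.cons_val_succ]
      exact contDiffWithinAt_const
  have hfs1 : ContDiff ℝ 1 fun q : Eu n × ℝ => f q.1 q.2 := hfs.of_le (by simp)
  -- The product rule gives one term from moving the base point, which carries an extra factor t,
  -- and one from moving the inserted vector.
  have hpd : ∀ u t w v, fderiv ℝ (fun u => f u t) u w v =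
      t ^ (k + 1) * fderiv ℝ h (c + t • (u - c)) w (Matrix.vecCons (u - c) v) +
        t ^ k * h (c + t • (u - c)) (Matrix.vecCons w v) := by
    intro u t w v
    have h1 : HasDerivAt (fun s : ℝ => f (u + s • w) t v) (fderiv ℝ (fun u => f u t) u w v) 0 := by
      have h2 : HasDerivAt (fun s : ℝ => u + s • w) w 0 := by
        simpa using ((hasDerivAt_id (0 : ℝ)).smul_const w).const_add u
      have h3 : HasFDerivAt (fun u => f u t) (fderiv ℝ (fun u => f u t) u) (u + (0 : ℝ) • w) := by
        rw [zero_smul, add_zero]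
        exact (hasFDerivAt_partial hfs1 u t).differentiableAt.hasFDerivAt
      exact (formEval v).hasFDerivAt.comp_hasDerivAt 0 (h3.comp_hasDerivAt 0 h2)
    have h4 : ∀ v', HasDerivAt (fun s : ℝ => h (c + t • (u + s • w - c)) v')
        (t * fderiv ℝ h (c + t • (u - c)) w v') 0 := by
      intro v'
      have h2 : HasDerivAt (fun s : ℝ => c + t • (u + s • w - c)) (t • w) 0 := by
        simpa using (((((hasDerivAt_id (0 : ℝ)).smul_const w).const_add u).sub_const c).const_smul
          t).const_add c
      have h3 : HasFDerivAt h (fderiv ℝ h (c + t • (u - c))) (c + t • (u + (0 : ℝ) • w - c)) := by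
        rw [zero_smul, add_zero]
        exact ((hh.differentiable (by simp)) _).hasFDerivAt
      have h5 := (formEval v').hasFDerivAt.comp_hasDerivAt 0 (h3.comp_hasDerivAt 0 h2)
      rw [map_smul, map_smul] at h5
      exact h5
    have h5 := ((h4 (Matrix.vecCons (u - c) v)).add
      ((hasDerivAt_id (0 : ℝ)).mul (h4 (Matrix.vecCons w v)))).const_mul (t ^ k)
    have h6 : (fun s : ℝ => f (u + s • w) t v) = fun s => t ^ k *
        (h (c + t • (u + s • w - c)) (Matrix.vecCons (u - c) v) +
          s * h (c + t • (u + s • w - c)) (Matrix.vecCons w v)) := by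
      funext s
      have h7 : u + s • w - c = (u - c) + s • w := by abel
      change t ^ k * (h (c + t • (u + s • w - c))).curryLeft (u + s • w - c) v = t ^ k *
        ((h (c + t • (u + s • w - c))).curryLeft (u - c) v +
          s * (h (c + t • (u + s • w - c))).curryLeft w v)
      conv_lhs => rw [h7, map_add, map_smul]
      rw [h7]
      rfl
    rw [h6] at h1
    rw [h1.unique h5]
    simp only [zero_smul, add_zero, id]
    ring
  refine ⟨fun u => ∫ t in (0 : ℝ)..1, f u t, contDiff_parametric_integral hfs, fun u hu => ?_⟩
  ext v
  have hint : ∀ w, ∀ v, fderiv ℝ (fun u => ∫ t in (0 : ℝ)..1, f u t) u w v =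
      ∫ t in (0 : ℝ)..1, fderiv ℝ (fun u => f u t) u w v := by
    intro w v
    rw [fderiv_parametric_integral_apply hfs1]
    exact ((formEval v).intervalIntegral_comp_comm
      ((((continuous_fderiv_partial hfs1).comp (Continuous.prodMk_right u)).clm_apply
        continuous_const).intervalIntegrable _ _)).symm
  have hc : ∀ w v, Continuous fun t => fderiv ℝ (fun u => f u t) u w v := fun w v =>
    (formEval v).continuous.comp
      (((continuous_fderiv_partial hfs1).comp (Continuous.prodMk_right u)).clm_apply
        continuous_const)
  rw [extDeriv, ContinuousAlternatingMap.alternatizeUncurryFin_apply]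
  simp only [hint, zsmul_eq_mul, Int.cast_pow, Int.cast_neg, Int.cast_one]
  have hsum : ∑ i : Fin (k + 1), (-1 : ℝ) ^ (i : ℕ) *
      ∫ t in (0 : ℝ)..1, fderiv ℝ (fun u => f u t) u (v i) (i.removeNth v) =
      ∫ t in (0 : ℝ)..1, ∑ i : Fin (k + 1), (-1 : ℝ) ^ (i : ℕ) *
        fderiv ℝ (fun u => f u t) u (v i) (i.removeNth v) := by
    rw [intervalIntegral.integral_finsetSum (f := fun (i : Fin (k + 1)) t =>
      (-1 : ℝ) ^ (i : ℕ) * fderiv ℝ (fun u => f u t) u (v i) (i.removeNth v))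
      fun i _ => ((continuous_const.mul (hc _ _)).intervalIntegrable _ _)]
    exact sum_congr rfl fun i _ => (intervalIntegral.integral_const_mul _ _).symm
  rw [hsum]
  -- The alternating sum is the derivative of t^{k+1} h(c + t(u - c)): the moving base point gives
  -- the derivative along u - c by closedness, and the inserted vector gives k + 1 copies of h. The
  -- integral is then h(u), because the power of t kills the lower endpoint.
  have hderiv : ∀ t ∈ uIcc (0 : ℝ) 1, HasDerivAt (fun t => t ^ (k + 1) * h (c + t • (u - c)) v)
      (∑ i : Fin (k + 1), (-1 : ℝ) ^ (i : ℕ) *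
        fderiv ℝ (fun u => f u t) u (v i) (i.removeNth v)) t := by
    intro t ht
    rw [uIcc_of_le zero_le_one] at ht
    have hmem : c + t • (u - c) ∈ ball c R := by
      rw [mem_ball, dist_eq_norm] at hu ⊢
      rw [add_sub_cancel_left, norm_smul, Real.norm_of_nonneg ht.1]
      exact (mul_le_of_le_one_left (norm_nonneg _) ht.2).trans_lt hu
    have h1 : HasDerivAt (fun t : ℝ => h (c + t • (u - c)) v)
        (fderiv ℝ h (c + t • (u - c)) (u - c) v) t := by
      have h2 : HasDerivAt (fun t : ℝ => c + t • (u - c)) (u - c) t := by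
        simpa using ((hasDerivAt_id t).smul_const (u - c)).const_add c
      have h3 := ((hh.differentiable (by simp)) (c + t • (u - c))).hasFDerivAt.comp_hasDerivAt t h2
      exact (formEval v).hasFDerivAt.comp_hasDerivAt t h3
    have h2 := (hasDerivAt_pow (k + 1) t).mul h1
    convert! h2 using 1
    simp only [hpd, mul_add, sum_add_distrib, mul_left_comm _ (t ^ _), ← mul_sum]
    rw [sum_fderiv_vecCons (hd _ hmem), sum_vecCons_removeNth]
    push_cast

    ring
  have hci : Continuous fun t => ∑ i : Fin (k + 1), (-1 : ℝ) ^ (i : ℕ) *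
      fderiv ℝ (fun u => f u t) u (v i) (i.removeNth v) :=
    continuous_finsetSum _ fun i _ => continuous_const.mul (hc _ _)
  rw [intervalIntegral.integral_eq_sub_of_hasDerivAt hderiv (hci.intervalIntegrable _ _)]
  simp

end Poincare

/-! ### Compactly supported diffeomorphisms of Euclidean space -/

section Diffeo

variable {n k : ℕ}

/-- A diffeomorphism of Euclidean space that is the identity off `K`. -/
structure CompactDiffeo (K : Set (Eu n)) where
  /-- the map -/
  map : Eu n → Eu n
  /-- its inverse -/
  inv : Eu n → Eu n
  contDiff_map : ContDiff ℝ ∞ map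
  contDiff_inv : ContDiff ℝ ∞ inv
  map_inv : ∀ u, map (inv u) = u
  inv_map : ∀ u, inv (map u) = u
  map_eq : ∀ u, u ∉ K → map u = u

namespace CompactDiffeo

variable {K : Set (Eu n)} (Φ : CompactDiffeo K)

theorem inv_eq {u : Eu n} (hu : u ∉ K) : Φ.inv u = u := by
  conv_lhs => rw [← Φ.map_eq u hu]
  exact Φ.inv_map u

/-- The inverse also fixes the complement of `K`, so no point of `K` can leave a set containing `K`.
In particular the chart target is preserved. -/
theorem map_mem_iff {s : Set (Eu n)} (hs : K ⊆ s) {u : Eu n} : Φ.map u ∈ s ↔ u ∈ s := by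
  by_cases hu : u ∈ K
  · refine ⟨fun _ => hs hu, fun _ => ?_⟩
    by_contra h
    have h1 := Φ.inv_eq fun h' => h (hs h')
    rw [Φ.inv_map] at h1
    exact h (hs (h1 ▸ hu))
  · rw [Φ.map_eq u hu]

theorem inv_mem_iff {s : Set (Eu n)} (hs : K ⊆ s) {u : Eu n} : Φ.inv u ∈ s ↔ u ∈ s := by
  conv_rhs => rw [← Φ.map_inv u, Φ.map_mem_iff hs]

theorem image_inv {s : Set (Eu n)} (hs : K ⊆ s) : Φ.inv '' s = s := by
  ext u
  constructor
  · rintro ⟨v, hv, rfl⟩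
    exact (Φ.inv_mem_iff hs).2 hv
  · exact fun hu => ⟨Φ.map u, (Φ.map_mem_iff hs).2 hu, Φ.inv_map u⟩

theorem differentiable_map : Differentiable ℝ Φ.map := Φ.contDiff_map.differentiable (by simp)

theorem differentiable_inv : Differentiable ℝ Φ.inv := Φ.contDiff_inv.differentiable (by simp)

theorem fderiv_map_fderiv_inv (v w : Eu n) :
    fderiv ℝ Φ.map (Φ.inv v) (fderiv ℝ Φ.inv v w) = w := by
  have h := fderiv_comp v (Φ.differentiable_map (Φ.inv v)) (Φ.differentiable_inv v)
  have h1 : Φ.map ∘ Φ.inv = id := funext Φ.map_inv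
  rw [h1, fderiv_id] at h
  exact (DFunLike.congr_fun h w).symm

theorem fderiv_inv_fderiv_map (v w : Eu n) :
    fderiv ℝ Φ.inv v (fderiv ℝ Φ.map (Φ.inv v) w) = w := by
  have h := fderiv_comp (Φ.inv v) (g := Φ.inv) (Φ.differentiable_inv _) (Φ.differentiable_map _)
  have h1 : Φ.inv ∘ Φ.map = id := funext Φ.inv_map
  rw [h1, fderiv_id, Φ.map_inv] at h
  exact (DFunLike.congr_fun h w).symm

theorem det_fderiv_inv_ne_zero (v : Eu n) : (fderiv ℝ Φ.inv v).det ≠ 0 := by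
  intro h
  have h1 : (fderiv ℝ Φ.map (Φ.inv v)).toLinearMap ∘ₗ (fderiv ℝ Φ.inv v).toLinearMap =
      LinearMap.id := LinearMap.ext fun w => Φ.fderiv_map_fderiv_inv v w
  have h2 := congrArg LinearMap.det h1
  rw [LinearMap.det_comp, LinearMap.det_id] at h2
  rw [ContinuousLinearMap.det] at h
  rw [h, mul_zero] at h2
  exact zero_ne_one h2

theorem fderiv_map_eq (hK : IsClosed K) {u : Eu n} (hu : u ∉ K) :
    fderiv ℝ Φ.map u = ContinuousLinearMap.id ℝ (Eu n) := by
  have : Φ.map =ᶠ[𝓝 u] id := by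
    filter_upwards [hK.isOpen_compl.mem_nhds hu] with v hv using Φ.map_eq v hv
  rw [this.fderiv_eq, fderiv_id]

theorem fderiv_inv_eq (hK : IsClosed K) {u : Eu n} (hu : u ∉ K) :
    fderiv ℝ Φ.inv u = ContinuousLinearMap.id ℝ (Eu n) := by
  have : Φ.inv =ᶠ[𝓝 u] id := by
    filter_upwards [hK.isOpen_compl.mem_nhds hu] with v hv using Φ.inv_eq hv
  rw [this.fderiv_eq, fderiv_id]

theorem setIntegral_eq {s : Set (Eu n)} (hs : K ⊆ s) (hm : MeasurableSet s) (f : Eu n → ℝ) :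
    ∫ u in s, f u = ∫ v in s, |(fderiv ℝ Φ.inv v).det| * f (Φ.inv v) := by
  conv_lhs => rw [← Φ.image_inv hs]
  exact integral_image_eq_integral_abs_det_fderiv_smul volume hm
    (fun v _ => (Φ.differentiable_inv v).hasFDerivAt.hasFDerivWithinAt)
    (Function.LeftInverse.injective Φ.map_inv).injOn f

theorem integrableOn_iff {s : Set (Eu n)} (hs : K ⊆ s) (hm : MeasurableSet s) (f : Eu n → ℝ) :
    IntegrableOn f s ↔ IntegrableOn (fun v => |(fderiv ℝ Φ.inv v).det| * f (Φ.inv v)) s := by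
  conv_lhs => rw [← Φ.image_inv hs]
  exact integrableOn_image_iff_integrableOn_abs_det_fderiv_smul volume hm
    (fun v _ => (Φ.differentiable_inv v).hasFDerivAt.hasFDerivWithinAt)
    (Function.LeftInverse.injective Φ.map_inv).injOn f

/-- The pullback of a form on Euclidean space. -/
def pull (a : Eu n → EuForm n k) (u : Eu n) : EuForm n k :=
  (a (Φ.map u)).compContinuousLinearMap (fderiv ℝ Φ.map u)

theorem pull_eq (hK : IsClosed K) (a : Eu n → EuForm n k) {u : Eu n} (hu : u ∉ K) :
    Φ.pull a u = a u := by
  rw [pull, Φ.map_eq u hu, Φ.fderiv_map_eq hK hu]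
  rfl

theorem contDiffAt_pull {a : Eu n → EuForm n k} {u : Eu n} (ha : ContDiffAt ℝ ∞ a (Φ.map u)) :
    ContDiffAt ℝ ∞ (Φ.pull a) u :=
  ContDiffAt.form_comp (ha.comp u Φ.contDiff_map.contDiffAt)
    (Φ.contDiff_map.fderiv_right (m := ∞) (by simp)).contDiffAt

theorem extDeriv_pull {a : Eu n → EuForm n k} {u : Eu n} (ha : ContDiffAt ℝ ∞ a (Φ.map u)) :
    extDeriv (Φ.pull a) u = Φ.pull (extDeriv a) u :=
  extDeriv_pullback (ha.differentiableAt (by simp)) (Φ.contDiff_map.contDiffAt (n := ∞))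
    (by simp; norm_cast)

theorem aestronglyMeasurable_pull {s : Set (Eu n)} (hs : K ⊆ s) (hm : MeasurableSet s)
    {a : Eu n → EuForm n k} (ha : AEStronglyMeasurable a (volume.restrict s)) :
    AEStronglyMeasurable (Φ.pull a) (volume.restrict s) :=
  AEStronglyMeasurable.form_comp (aestronglyMeasurable_comp_of_leftInverse hm hm
    Φ.contDiff_map.continuous.continuousOn (fun _ hu => (Φ.map_mem_iff hs).2 hu)
    Φ.differentiable_inv.differentiableOn (fun u _ => Φ.inv_map u) ha)
    (Φ.contDiff_map.continuous_fderiv (by simp)).aestronglyMeasurable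

end CompactDiffeo

end Diffeo

/-! ### Pullback of forms and its formal adjoint -/

section Adjoint

variable {k : ℕ}

/-- The linear map of Euclidean space with a given matrix. -/
def matCLM (m : Matrix (Fin n) (Fin n) ℝ) : Eu n →L[ℝ] Eu n :=
  LinearMap.toContinuousLinearMap (Matrix.toLin (EuclideanSpace.basisFun (Fin n) ℝ).toBasis
    (EuclideanSpace.basisFun (Fin n) ℝ).toBasis m)

theorem matCLM_stdFrame (m : Matrix (Fin n) (Fin n) ℝ) (j : Fin n) :
    matCLM m (stdFrame n j) = ∑ i, m i j • stdFrame n i := by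
  have := Matrix.toLin_self (EuclideanSpace.basisFun (Fin n) ℝ).toBasis
    (EuclideanSpace.basisFun (Fin n) ℝ).toBasis m j
  simpa [matCLM, stdFrame] using this

/-- The matrix of a linear map of Euclidean space. -/
def clmMat (A : Eu n →L[ℝ] Eu n) : Matrix (Fin n) (Fin n) ℝ :=
  Matrix.of fun i j => A (stdFrame n j) i

theorem clm_stdFrame (A : Eu n →L[ℝ] Eu n) (j : Fin n) :
    A (stdFrame n j) = ∑ i, clmMat A i j • stdFrame n i := by
  simpa [clmMat, stdFrame] using
    ((EuclideanSpace.basisFun (Fin n) ℝ).sum_repr (A (stdFrame n j))).symm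

theorem mpair_comp_clm_left (C : Matrix (Fin n) (Fin n) ℝ) (A : Eu n →L[ℝ] Eu n)
    (a b : EuForm n k) :
    mpair (stdFrame n) (stdFrame n) (fun _ => C) (a.compContinuousLinearMap A) b =
      mpair (stdFrame n) (stdFrame n) (fun _ => clmMat A * C) a b := by
  rw [mpair_comp_left, mpair_change_left (stdFrame n) _ (clmMat A).transpose
    (fun j => clm_stdFrame A j), Matrix.transpose_transpose]

theorem mpair_comp_clm_right (C : Matrix (Fin n) (Fin n) ℝ) (A : Eu n →L[ℝ] Eu n)
    (a b : EuForm n k) :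
    mpair (stdFrame n) (stdFrame n) (fun _ => C) a (b.compContinuousLinearMap A) =
      mpair (stdFrame n) (stdFrame n) (fun _ => C * (clmMat A).transpose) a b := by
  rw [mpair_comp_right, mpair_change_right (stdFrame n) (stdFrame n) _ (clmMat A).transpose
    (fun j => clm_stdFrame A j)]

theorem clmMat_matCLM (m : Matrix (Fin n) (Fin n) ℝ) : clmMat (matCLM m) = m := by
  ext i j
  rw [clmMat, Matrix.of_apply, matCLM_stdFrame]
  simp [stdFrame, Pi.single_apply]

theorem clmMat_id : clmMat (ContinuousLinearMap.id ℝ (Eu n)) = 1 := by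
  ext i j
  simp [clmMat, stdFrame, Matrix.one_apply]

theorem matCLM_one : matCLM (1 : Matrix (Fin n) (Fin n) ℝ) = ContinuousLinearMap.id ℝ (Eu n) := by
  ext1 w
  simp [matCLM]

variable {K : Set (Eu n)} (Φ : CompactDiffeo K)

/-- The metric transpose of the differential of a diffeomorphism. -/
def CompactDiffeo.adjCLM (x₀ : M) (v : Eu n) : Eu n →L[ℝ] Eu n :=
  matCLM (chartGram x₀ v * clmMat (fderiv ℝ Φ.map (Φ.inv v)) *
    (chartGram x₀ (Φ.inv v))⁻¹).transpose

/-- Let A be the matrix of the differential and G the Gram matrix. Both sides contract every slot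
with A G(Φ⁻¹v)⁻¹ = G(v)⁻¹ (G(v) A G(Φ⁻¹v)⁻¹), and the factor in parentheses is the transpose of the
adjoint matrix. -/
theorem CompactDiffeo.chartInner_adjCLM {x₀ : M} {v : Eu n}
    (hv : v ∈ (Ψ n x₀).target) (a b : EuForm n k) :
    chartInner x₀ (Φ.inv v) (a.compContinuousLinearMap (fderiv ℝ Φ.map (Φ.inv v))) b =
      chartInner x₀ v a (b.compContinuousLinearMap (Φ.adjCLM x₀ v)) := by
  have h : IsUnit (chartGram x₀ v).det := (chartDet_pos hv).ne'.isUnit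
  rw [chartInner, chartInner, mpair_comp_clm_left, mpair_comp_clm_right, CompactDiffeo.adjCLM,
    clmMat_matCLM, Matrix.transpose_transpose, ← Matrix.mul_assoc, ← Matrix.mul_assoc,
    Matrix.nonsing_inv_mul _ h, Matrix.one_mul]

theorem CompactDiffeo.adjCLM_eq (hK : IsClosed K) {x₀ : M} {v : Eu n}
    (hv : v ∈ (Ψ n x₀).target) (hvK : v ∉ K) :
    Φ.adjCLM x₀ v = ContinuousLinearMap.id ℝ (Eu n) := by
  have h : IsUnit (chartGram x₀ v).det := (chartDet_pos hv).ne'.isUnit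
  rw [CompactDiffeo.adjCLM, Φ.inv_eq hvK, Φ.fderiv_map_eq hK hvK, clmMat_id, Matrix.mul_one,
    Matrix.mul_nonsing_inv _ h, Matrix.transpose_one, matCLM_one]

theorem contDiffOn_matCLM {X : Type*} [NormedAddCommGroup X] [NormedSpace ℝ X]
    {m : X → Matrix (Fin n) (Fin n) ℝ} {s : Set X} {N : WithTop ℕ∞}
    (h : ∀ i j, ContDiffOn ℝ N (fun x => m x i j) s) : ContDiffOn ℝ N (fun x => matCLM (m x)) s := by
  intro x hx
  refine contDiffWithinAt_clm_iff.2 fun j => ?_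
  simp only [matCLM_stdFrame]
  exact ContDiffWithinAt.sum fun i _ => (h i j x hx).smul contDiffWithinAt_const

theorem contDiffOn_matrix_mul {X ι : Type*} [Fintype ι] [NormedAddCommGroup X] [NormedSpace ℝ X]
    {A B : X → Matrix ι ι ℝ} {s : Set X} {N : WithTop ℕ∞}
    (hA : ∀ i j, ContDiffOn ℝ N (fun x => A x i j) s)
    (hB : ∀ i j, ContDiffOn ℝ N (fun x => B x i j) s) (i j : ι) :
    ContDiffOn ℝ N (fun x => (A x * B x) i j) s := by
  simp only [Matrix.mul_apply]
  exact ContDiffOn.sum fun l _ => (hA i l).mul (hB l j)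

theorem CompactDiffeo.contDiffOn_adjCLM {x₀ : M} (hKt : K ⊆ (Ψ n x₀).target) :
    ContDiffOn ℝ ∞ (Φ.adjCLM x₀) (Ψ n x₀).target := by
  refine contDiffOn_matCLM fun i j => ?_
  refine contDiffOn_matrix_mul (contDiffOn_matrix_mul (contDiffOn_chartGram x₀) fun i j => ?_)
    (fun i j => ?_) j i
  · have h1 : ContDiff ℝ ∞ fun v => fderiv ℝ Φ.map (Φ.inv v) (stdFrame n j) :=
      ((Φ.contDiff_map.fderiv_right (m := ∞) (by simp)).comp Φ.contDiff_inv).clm_apply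
        contDiff_const
    exact ((contDiff_euclidean.1 h1) i).contDiffOn
  · exact (contDiffOn_chartGram_inv x₀ i j).comp Φ.contDiff_inv.contDiffOn
      fun v hv => (Φ.inv_mem_iff hKt).2 hv

/-- The factor relating the densities under a diffeomorphism. -/
def CompactDiffeo.jac (x₀ : M) (v : Eu n) : ℝ :=
  |(fderiv ℝ Φ.inv v).det| * chartDensity x₀ (Φ.inv v) / chartDensity x₀ v

theorem contDiff_abs_det_fderiv_inv : ContDiff ℝ ∞ fun v => |(fderiv ℝ Φ.inv v).det| := by
  have h1 : ContDiff ℝ ∞ fun v => (fderiv ℝ Φ.inv v).det := by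
    simp only [det_mapMatrix]
    rw [← contDiffOn_univ]
    refine contDiffOn_det fun i j => ?_
    have h1 : ContDiff ℝ ∞ fun v => fderiv ℝ Φ.inv v (stdFrame n j) :=
      (Φ.contDiff_inv.fderiv_right (m := ∞) (by simp)).clm_apply contDiff_const
    exact ((contDiff_euclidean.1 h1) i).contDiffOn
  exact contDiff_iff_contDiffAt.2 fun v =>
    ContDiffAt.comp (g := fun x : ℝ => |x|) v (contDiffAt_abs (Φ.det_fderiv_inv_ne_zero v))
      h1.contDiffAt

theorem CompactDiffeo.contDiffOn_jac {x₀ : M} (hKt : K ⊆ (Ψ n x₀).target) :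
    ContDiffOn ℝ ∞ (Φ.jac x₀) (Ψ n x₀).target :=
  ((contDiff_abs_det_fderiv_inv Φ).contDiffOn.mul ((contDiffOn_chartDensity x₀).comp
    Φ.contDiff_inv.contDiffOn fun _ hv => (Φ.inv_mem_iff hKt).2 hv)).div
    (contDiffOn_chartDensity x₀) fun _ hv => (chartDensity_pos hv).ne'

theorem CompactDiffeo.jac_eq (hK : IsClosed K) {x₀ : M} {v : Eu n}
    (hv : v ∈ (Ψ n x₀).target) (hvK : v ∉ K) : Φ.jac x₀ v = 1 := by
  rw [CompactDiffeo.jac, Φ.inv_eq hvK, Φ.fderiv_inv_eq hK hvK, ContinuousLinearMap.det,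
    ContinuousLinearMap.coe_id, LinearMap.det_id, abs_one, one_mul,
    div_self (chartDensity_pos hv).ne']

/-- The formal adjoint of the pullback of forms in a chart. -/
def CompactDiffeo.push (x₀ : M) (b : Eu n → EuForm n k) (v : Eu n) : EuForm n k :=
  Φ.jac x₀ v • (b (Φ.inv v)).compContinuousLinearMap (Φ.adjCLM x₀ v)

theorem CompactDiffeo.push_eq (hK : IsClosed K) {x₀ : M} {v : Eu n}
    (hv : v ∈ (Ψ n x₀).target) (hvK : v ∉ K) (b : Eu n → EuForm n k) :
    Φ.push x₀ b v = b v := by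
  rw [CompactDiffeo.push, Φ.jac_eq hK hv hvK, Φ.adjCLM_eq hK hv hvK, Φ.inv_eq hvK, one_smul]
  rfl

theorem CompactDiffeo.contDiffOn_push {x₀ : M} (hKt : K ⊆ (Ψ n x₀).target)
    {b : Eu n → EuForm n k} (hb : ContDiffOn ℝ ∞ b (Ψ n x₀).target) :
    ContDiffOn ℝ ∞ (Φ.push x₀ b) (Ψ n x₀).target := fun v hv =>
  (Φ.contDiffOn_jac hKt v hv).smul (ContDiffWithinAt.form_comp
    (hb.comp Φ.contDiff_inv.contDiffOn (fun _ hv => (Φ.inv_mem_iff hKt).2 hv) v hv)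
    (Φ.contDiffOn_adjCLM hKt v hv))

theorem chartInner_smul_right (x₀ : M) (u : Eu n) (c : ℝ) (a b : EuForm n k) :
    chartInner x₀ u a (c • b) = c * chartInner x₀ u a b := mpair_smul_right _ _ _ _ _ _

/-- The inner product of the pullback of `a` with `b`, in the coordinates of the source. -/
theorem CompactDiffeo.density_mul_chartInner {x₀ : M} {v : Eu n}
    (hv : v ∈ (Ψ n x₀).target) (a b : Eu n → EuForm n k) :
    |(fderiv ℝ Φ.inv v).det| * (chartDensity x₀ (Φ.inv v) *
      chartInner x₀ (Φ.inv v) (Φ.pull a (Φ.inv v)) (b (Φ.inv v))) =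
    chartDensity x₀ v * chartInner x₀ v (a v) (Φ.push x₀ b v) := by
  have h := (chartDensity_pos hv).ne'
  rw [CompactDiffeo.pull, Φ.map_inv, Φ.chartInner_adjCLM hv, CompactDiffeo.push,
    chartInner_smul_right, CompactDiffeo.jac]
  field_simp

/-- Pulling back distorts the energy density by a bounded factor, so L² forms stay in L². On `K` all
factors are bounded by compactness; off `K` nothing changes. -/
theorem CompactDiffeo.exists_pull_bound (hK : IsCompact K) {x₀ : M}
    (hKt : K ⊆ (Ψ n x₀).target) (k : ℕ) :
    ∃ C : ℝ, ∀ v ∈ (Ψ n x₀).target, ∀ a : EuForm n k,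
      |(fderiv ℝ Φ.inv v).det| * (chartDensity x₀ (Φ.inv v) *
        chartInner x₀ (Φ.inv v) (a.compContinuousLinearMap (fderiv ℝ Φ.map (Φ.inv v)))
          (a.compContinuousLinearMap (fderiv ℝ Φ.map (Φ.inv v)))) ≤
      C * (chartDensity x₀ v * chartInner x₀ v a a) := by
  obtain ⟨c, C, hc, hC, hb⟩ := exists_chartInner_bounds hK hKt k
  obtain ⟨D, hD⟩ := hK.bddAbove_image (f := fun v => ‖fderiv ℝ Φ.map (Φ.inv v)‖)
    ((Φ.contDiff_map.continuous_fderiv (by simp)).comp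
      Φ.contDiff_inv.continuous).norm.continuousOn
  obtain ⟨J, hJ⟩ := hK.bddAbove_image ((Φ.contDiffOn_jac hKt).continuousOn.mono hKt)
  -- The constant 1 serves off `K`. On `K` the second constant collects the Jacobian factor, the two
  -- norm comparisons, and the k-th power of the differential, squared.
  refine ⟨max 1 (max J 0 * (C * ((max D 0) ^ k) ^ 2 * c⁻¹)), fun v hv a => ?_⟩
  have h0 : 0 ≤ chartDensity x₀ v * chartInner x₀ v a a :=
    mul_nonneg (chartDensity_pos hv).le (chartInner_self_nonneg hv a)
  have hρ := chartDensity_pos hv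
  by_cases hvK : v ∈ K
  · have hvK' : Φ.inv v ∈ K := (Φ.inv_mem_iff subset_rfl).2 hvK
    refine le_trans ?_ (mul_le_mul_of_nonneg_right (le_max_right _ _) h0)
    have h1 : |(fderiv ℝ Φ.inv v).det| * chartDensity x₀ (Φ.inv v) =
        Φ.jac x₀ v * chartDensity x₀ v := by
      rw [CompactDiffeo.jac, div_mul_cancel₀ _ hρ.ne']
    have h2 : Φ.jac x₀ v ≤ max J 0 := (hJ (mem_image_of_mem _ hvK)).trans (le_max_left _ _)
    have h3 : ‖fderiv ℝ Φ.map (Φ.inv v)‖ ≤ max D 0 :=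
      (hD (mem_image_of_mem _ hvK)).trans (le_max_left _ _)
    have h4 : ‖a.compContinuousLinearMap (fderiv ℝ Φ.map (Φ.inv v))‖ ≤ ‖a‖ * (max D 0) ^ k := by
      refine (a.norm_compContinuousLinearMap_le _).trans ?_
      rw [Fintype.card_fin]
      gcongr
    have h5 : ‖a‖ ^ 2 ≤ c⁻¹ * chartInner x₀ v a a := by
      rw [le_inv_mul_iff₀ hc]
      exact (hb v hvK a).1
    have h6 := (hb _ hvK' (a.compContinuousLinearMap (fderiv ℝ Φ.map (Φ.inv v)))).2
    have h7 : chartInner x₀ (Φ.inv v) (a.compContinuousLinearMap (fderiv ℝ Φ.map (Φ.inv v)))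
          (a.compContinuousLinearMap (fderiv ℝ Φ.map (Φ.inv v))) ≤
        C * ((max D 0) ^ k) ^ 2 * c⁻¹ * chartInner x₀ v a a := by
      calc _ ≤ C * (‖a‖ * (max D 0) ^ k) ^ 2 := h6.trans (by gcongr)
        _ = C * ((max D 0) ^ k) ^ 2 * ‖a‖ ^ 2 := by ring
        _ ≤ C * ((max D 0) ^ k) ^ 2 * (c⁻¹ * chartInner x₀ v a a) := by gcongr
        _ = _ := by ring
    rw [← mul_assoc, h1]
    calc _ ≤ max J 0 * chartDensity x₀ v *
          (C * ((max D 0) ^ k) ^ 2 * c⁻¹ * chartInner x₀ v a a) := by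
          refine mul_le_mul (mul_le_mul_of_nonneg_right h2 hρ.le) h7
            (chartInner_self_nonneg (hKt hvK') _) (by positivity)
      _ = _ := by ring
  · refine le_trans (le_of_eq ?_) (mul_le_mul_of_nonneg_right (le_max_left _ _) h0)
    rw [Φ.inv_eq hvK, Φ.fderiv_inv_eq hK.isClosed hvK, Φ.fderiv_map_eq hK.isClosed hvK,
      ContinuousLinearMap.det, ContinuousLinearMap.coe_id, LinearMap.det_id, abs_one, one_mul,
      one_mul]
    rfl

variable [MeasurableSpace M] [BorelSpace M] [CompactSpace M] [T2Space M]

/-- The pullback of a form by a diffeomorphism supported in a chart. -/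
def CompactDiffeo.formPull (x₀ : M) (α : Form n M k) : Form n M k :=
  glue x₀ (Φ.pull (inChart α x₀)) α

/-- The formal adjoint of the pullback. -/
def CompactDiffeo.formPush (x₀ : M) (α : Form n M k) : Form n M k :=
  glue x₀ (Φ.push x₀ (inChart α x₀)) α

theorem CompactDiffeo.isSmoothForm_formPull (hK : IsCompact K) {x₀ : M}
    (hKt : K ⊆ (Ψ n x₀).target) {α : Form n M k} (hα : IsSmoothForm α) :
    IsSmoothForm (Φ.formPull x₀ α) :=
  isSmoothForm_glue hK hKt (fun _ _ hu => Φ.pull_eq hK.isClosed _ hu) hα fun _ hu =>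
    (Φ.contDiffAt_pull (hα.contDiffAt ((Φ.map_mem_iff hKt).2 hu))).contDiffWithinAt

theorem CompactDiffeo.isSmoothForm_formPush (hK : IsCompact K) {x₀ : M}
    (hKt : K ⊆ (Ψ n x₀).target) {α : Form n M k} (hα : IsSmoothForm α) :
    IsSmoothForm (Φ.formPush x₀ α) :=
  isSmoothForm_glue hK hKt (fun _ hu hu' => Φ.push_eq hK.isClosed hu hu' _) hα
    (Φ.contDiffOn_push hKt (hα x₀))

theorem CompactDiffeo.extD_formPull (hK : IsCompact K) {x₀ : M}
    (hKt : K ⊆ (Ψ n x₀).target) {α : Form n M k} (hα : IsSmoothForm α) :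
    extD (Φ.formPull x₀ α) = Φ.formPull x₀ (extD α) := by
  have hs := Φ.isSmoothForm_formPull hK hKt hα
  rw [CompactDiffeo.formPull, extD_glue hK hKt (fun _ _ hu => Φ.pull_eq hK.isClosed _ hu) fun _ hu =>
    (Φ.contDiffAt_pull (hα.contDiffAt ((Φ.map_mem_iff hKt).2 hu))).contDiffWithinAt]
  refine eq_glue (fun u hu => ?_) fun x hx => glue_of_notMem _ _ hx
  have hu' := (Φ.map_mem_iff hKt).2 hu
  rw [inChart_glue _ _ hu, Φ.extDeriv_pull (hα.contDiffAt hu'), CompactDiffeo.pull,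
    CompactDiffeo.pull, hα.inChart_extD hu']

theorem CompactDiffeo.isL2Form_formPull (hK : IsCompact K) {x₀ : M}
    (hKt : K ⊆ (Ψ n x₀).target) {α : Form n M k} (hα : IsL2Form α) :
    IsL2Form (Φ.formPull x₀ α) := by
  have hm := measurableSet_target (n := n) x₀
  have hp := Φ.aestronglyMeasurable_pull hKt hm (hα.1 x₀)
  refine isL2Form_glue hα hp ?_
  obtain ⟨C, hC⟩ := Φ.exists_pull_bound hK hKt k
  rw [Φ.integrableOn_iff hKt hm]
  refine ((hα.integrableOn_chart x₀).const_mul C).mono' ?_ ?_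
  · refine ((contDiff_abs_det_fderiv_inv Φ).continuous.aestronglyMeasurable).mul
      (aestronglyMeasurable_comp_of_leftInverse (S := Φ.map) (t := (Ψ n x₀).target)
        (f := fun u => chartDensity x₀ u * chartInner x₀ u (Φ.pull (inChart α x₀) u)
          (Φ.pull (inChart α x₀) u)) hm hm
        Φ.contDiff_inv.continuous.continuousOn (fun _ hu => (Φ.inv_mem_iff hKt).2 hu)
        Φ.differentiable_map.differentiableOn (fun u _ => Φ.map_inv u) ?_)
    exact ((contDiffOn_chartDensity x₀).continuousOn.aestronglyMeasurable hm).mul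
      (aestronglyMeasurable_chartInner subset_rfl hm hp hp)
  · filter_upwards [ae_restrict_mem hm] with v hv
    have hv' := (Φ.inv_mem_iff hKt).2 hv
    rw [Real.norm_of_nonneg (mul_nonneg (abs_nonneg _) (mul_nonneg (chartDensity_pos hv').le
      (chartInner_self_nonneg hv' _))), CompactDiffeo.pull, Φ.map_inv]
    exact hC v hv _

theorem CompactDiffeo.l2Inner_formPull (hK : IsCompact K) {x₀ : M}
    (hKt : K ⊆ (Ψ n x₀).target) {α ψ : Form n M k} (hα : IsL2Form α)
    (hψ : IsSmoothForm ψ) :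
    l2Inner (Φ.formPull x₀ α) ψ = l2Inner α (Φ.formPush x₀ ψ) := by
  rw [l2Inner_eq_chart_add (Φ.isL2Form_formPull hK hKt hα) hψ.isL2Form x₀,
    l2Inner_eq_chart_add hα (Φ.isSmoothForm_formPush hK hKt hψ).isL2Form x₀,
    Φ.setIntegral_eq hKt (measurableSet_target x₀)]
  congr 1
  · refine setIntegral_congr_fun (measurableSet_target x₀) fun v hv => ?_
    have hv' := (Φ.inv_mem_iff hKt).2 hv
    simp only [CompactDiffeo.formPull, CompactDiffeo.formPush]
    rw [inChart_glue _ _ hv, inChart_glue _ _ hv', Φ.density_mul_chartInner hv]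
  · refine setIntegral_congr_fun (isOpen_extChartAt_source x₀).measurableSet.compl fun x hx => ?_
    simp only [CompactDiffeo.formPull, CompactDiffeo.formPush]
    rw [glue_of_notMem _ _ hx, glue_of_notMem _ _ hx]

/-- The adjoint of the relation dΦ^* = Φ^*d on smooth forms. It converts a test form for the weak
derivative of Φ^*y into a test form for that of y. -/
theorem CompactDiffeo.isCodiff_formPush (hK : IsCompact K) {x₀ : M}
    (hKt : K ⊆ (Ψ n x₀).target) {ψ : Form n M (k + 1)} {χ : Form n M k}
    (h : IsCodiff ψ χ) : IsCodiff (Φ.formPush x₀ ψ) (Φ.formPush x₀ χ) := by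
  refine ⟨Φ.isSmoothForm_formPush hK hKt h.1, Φ.isSmoothForm_formPush hK hKt h.2.1,
    fun η hη => ?_⟩
  rw [← Φ.l2Inner_formPull hK hKt hη.extD.isL2Form h.1, ← Φ.extD_formPull hK hKt hη,
    h.2.2 _ (Φ.isSmoothForm_formPull hK hKt hη), Φ.l2Inner_formPull hK hKt hη.isL2Form h.2.1]

theorem CompactDiffeo.isWeakD_formPull (hK : IsCompact K) {x₀ : M}
    (hKt : K ⊆ (Ψ n x₀).target) {y : Form n M k} {u : Form n M (k + 1)}
    (hy : IsL2Form y) (hu : IsL2Form u) (h : IsWeakD y u) :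
    IsWeakD (Φ.formPull x₀ y) (Φ.formPull x₀ u) := by
  intro ψ χ hψ
  rw [Φ.l2Inner_formPull hK hKt hu hψ.1, Φ.l2Inner_formPull hK hKt hy hψ.2.1]
  exact h _ _ (Φ.isCodiff_formPush hK hKt hψ)

end Adjoint

/-! ### Stability of the competitors under pullback -/

section Competitor

variable [MeasurableSpace M] [BorelSpace M] [CompactSpace M] [T2Space M]

variable {k : ℕ} {K : Set (Eu n)} (Φ : CompactDiffeo K)

theorem CompactDiffeo.formPull_add (x₀ : M) (α β : Form n M k) :
    Φ.formPull x₀ (α + β) = Φ.formPull x₀ α + Φ.formPull x₀ β := by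
  rw [CompactDiffeo.formPull, CompactDiffeo.formPull, CompactDiffeo.formPull, ← glue_add]
  congr 1

/-- Pulling back a closed form of positive degree changes it by an exact form. -/
theorem CompactDiffeo.exists_formPull_eq_add_extD (hK : IsCompact K) {x₀ : M} {c : Eu n}
    {R R' : ℝ} (hR : 0 < R) (hRR' : R < R') (hKR : K ⊆ ball c R)
    (hR' : closedBall c R' ⊆ (Ψ n x₀).target) {h : Form n M (k + 1)}
    (hh : IsSmoothForm h) (hd : ∀ x, extD h x = 0) :
    ∃ γ : Form n M k, IsSmoothForm γ ∧ Φ.formPull x₀ h = h + extD γ := by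
  have hball : ball c R ⊆ (Ψ n x₀).target :=
    (ball_subset_closedBall.trans (closedBall_subset_closedBall hRR'.le)).trans hR'
  have hKt := hKR.trans hball
  -- The cutoff extends h smoothly to all of Euclidean space without changing it on the ball of
  -- radius `R`, where alone closedness is needed.
  let χ : ContDiffBump c := ⟨R, R', hR, hRR'⟩
  have hχ1 : ∀ u ∈ ball c R, χ u = 1 := fun u hu =>
    χ.one_of_mem_closedBall (ball_subset_closedBall hu)
  have hχs : ContDiff ℝ ∞ fun u => χ u • inChart h x₀ u := by
    refine contDiff_iff_contDiffAt.2 fun u => ?_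
    by_cases hu : u ∈ closedBall c R'
    · exact χ.contDiff.contDiffAt.smul (hh.contDiffAt (hR' hu))
    · refine contDiffAt_const (c := (0 : EuForm n (k + 1))) |>.congr_of_eventuallyEq ?_
      filter_upwards [Metric.isClosed_closedBall.isOpen_compl.mem_nhds hu] with v hv
      rw [χ.zero_of_le_dist, zero_smul]
      simpa using (not_le.1 (fun h' => hv (mem_closedBall.2 h'))).le
  have hext : ∀ u ∈ ball c R, extDeriv (inChart h x₀) u = 0 := fun u hu => by
    rw [← hh.inChart_extD (hball hu), inChart, hd]
    rfl
  obtain ⟨β, hβ, hβd⟩ := exists_primitive hχs c R fun u hu => by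
    rw [← hext u hu]
    refine Filter.EventuallyEq.extDeriv_eq ?_
    filter_upwards [isOpen_ball.mem_nhds hu] with v hv
    rw [hχ1 v hv, one_smul]
  have hβd' : ∀ u ∈ ball c R, extDeriv β u = inChart h x₀ u := fun u hu => by
    rw [hβd u hu, hχ1 u hu, one_smul]
  have hp : ∀ u, ContDiffAt ℝ ∞ (Φ.pull β) u := fun u => Φ.contDiffAt_pull hβ.contDiffAt
  have hbz : ∀ u ∈ (Ψ n x₀).target, u ∉ K →
      Φ.pull β u - β u = inChart (0 : Form n M k) x₀ u := fun u _ hu => by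
    rw [Φ.pull_eq hK.isClosed _ hu, sub_self, inChart_zero]
  have hbs : ContDiffOn ℝ ∞ (fun u => Φ.pull β u - β u) (Ψ n x₀).target :=
    fun u _ => ((hp u).sub hβ.contDiffAt).contDiffWithinAt
  have hγ := isSmoothForm_glue (z := (0 : Form n M k)) hK hKt hbz isSmoothForm_zero hbs
  -- The potential is Φ^*β - β, extended by zero. On `K`, which Φ preserves, dβ = h, so h + dγ =
  -- Φ^*h; off the closed set `K` both γ and Φ^*h - h vanish.
  refine ⟨glue x₀ (fun u => Φ.pull β u - β u) 0, hγ, ?_⟩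
  symm
  refine eq_glue (fun u hu => ?_) fun x hx => ?_
  · rw [inChart_add, hγ.inChart_extD hu]
    have h1 : extDeriv (inChart (glue x₀ (fun u => Φ.pull β u - β u) (0 : Form n M k)) x₀) u =
        Φ.pull (extDeriv β) u - extDeriv β u := by
      have h2 : Φ.pull (extDeriv β) u - extDeriv β u =
          Φ.pull (extDeriv β) u + (-1 : ℝ) • extDeriv β u := by
        rw [neg_one_smul, sub_eq_add_neg]
      rw [h2, ← Φ.extDeriv_pull hβ.contDiffAt, ← extDeriv_smul, ← extDeriv_add]
      · refine Filter.EventuallyEq.extDeriv_eq ?_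
        filter_upwards [(isOpen_extChartAt_target x₀).mem_nhds hu] with v hv
        rw [inChart_glue _ _ hv]
        ext w
        change Φ.pull β v w - β v w = Φ.pull β v w + (-1 : ℝ) * β v w
        ring
      · exact (hp u).differentiableAt (by simp)
      · exact ((hβ.const_smul (-1 : ℝ)).contDiffAt (x := u)).differentiableAt (by simp)
    rw [h1]
    by_cases huK : u ∈ K
    · rw [hβd' u (hKR huK), CompactDiffeo.pull, hβd' _ (hKR ((Φ.map_mem_iff subset_rfl).2 huK))]
      rw [add_sub_cancel]
      rfl
    · rw [Φ.pull_eq hK.isClosed _ huK, Φ.pull_eq hK.isClosed _ huK, sub_self, add_zero]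
  · have : extD (glue x₀ (fun u => Φ.pull β u - β u) (0 : Form n M k)) x = 0 := by
      rw [extD_congr (glue_eventuallyEq hK hKt hbz hx)]
      exact congrFun (by simpa using extD_smul (0 : ℝ) (0 : Form n M k)) x
    rw [Pi.add_apply, this, add_zero]

/-- In degree 0 there are no potentials, but a closed function is constant on the ball, and Φ moves
points of `K` only inside the ball. -/
theorem CompactDiffeo.formPull_zero_form {x₀ : M} {c : Eu n} {R : ℝ}
    (hKR : K ⊆ ball c R)
    (hR : ball c R ⊆ (Ψ n x₀).target) {h : Form n M 0}
    (hK : IsClosed K) (hh : IsSmoothForm h) (hd : ∀ x, extD h x = 0) : Φ.formPull x₀ h = h := by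
  symm
  refine eq_glue (fun u hu => ?_) fun _ _ => rfl
  by_cases huK : u ∈ K
  · have h0 : EqOn (fderiv ℝ (inChart h x₀)) 0 (ball c R) := fun v hv => by
      have h1 : extDeriv (inChart h x₀) v = 0 := by
        rw [← hh.inChart_extD (hR hv), inChart, hd]
        rfl
      ext w e
      have h2 := DFunLike.congr_fun h1 (fun _ => w)
      rw [extDeriv, ContinuousAlternatingMap.alternatizeUncurryFin_apply] at h2
      simpa [Subsingleton.elim e (Fin.tail fun _ => w)] using h2
    have h1 := isOpen_ball.is_const_of_fderiv_eq_zero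
      (convex_ball c R).isPreconnected (fun v hv =>
        ((hh.contDiffAt (hR hv)).differentiableAt (by simp)).differentiableWithinAt) h0
      (hKR huK) (hKR ((Φ.map_mem_iff subset_rfl).2 huK))
    ext e
    rw [h1]
    exact congrArg _ (Subsingleton.elim _ _)
  · rw [Φ.pull_eq hK _ huK]

theorem isWeakD_extD {γ : Form n M k} (hγ : IsSmoothForm γ) : IsWeakD γ (extD γ) :=
  fun _ _ h => h.2.2 γ hγ

theorem IsWeakD.add {y y' : Form n M k} {u u' : Form n M (k + 1)} (h : IsWeakD y u)
    (h' : IsWeakD y' u') (hy : IsL2Form y) (hy' : IsL2Form y') (hu : IsL2Form u)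
    (hu' : IsL2Form u') : IsWeakD (y + y') (u + u') := fun ψ χ hψ => by
  rw [l2Inner_add_left hu hu' hψ.1.isL2Form, l2Inner_add_left hy hy' hψ.2.1.isL2Form,
    h ψ χ hψ, h' ψ χ hψ]

theorem alternatingMap_sum_apply {V ι κ : Type*} [AddCommGroup V] [Module ℝ V] (s : Finset ι)
    (f : ι → V [⋀^κ]→ₗ[ℝ] ℝ) (v : κ → V) : (∑ i ∈ s, f i) v = ∑ i ∈ s, f i v := by
  classical
  induction s using Finset.induction_on with
  | empty => rfl
  | insert a s ha ih =>
    rw [Finset.sum_insert ha, Finset.sum_insert ha, AlternatingMap.add_apply, ih]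

/-- The constraint holds at Φ(u) for almost every u because diffeomorphisms preserve null sets;
evaluated there on the images of the tangent vectors, it is the constraint for the pulled back
forms. -/
theorem CompactDiffeo.satisfiesConstraint_formPull {x₀ : M}
    (hKt : K ⊆ (Ψ n x₀).target) {r D p : ℕ} {P : Fin D → Fin r → Fin r → ℝ}
    {z : Fin r → Form n M p} (hz : SatisfiesConstraint P z) :
    SatisfiesConstraint P fun i => Φ.formPull x₀ (z i) := by
  intro l
  have hm := measurableSet_target (n := n) x₀
  have hs := (isOpen_extChartAt_source (I := 𝓡 n) x₀).measurableSet
  refine ae_of_ae_restrict_of_ae_restrict_compl (Ψ n x₀).source ?_ ?_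
  · rw [ae_chart_iff]
    have h1 := ae_comp_of_leftInverse hm hm (T := Φ.map) (S := Φ.inv)
      (fun _ hu => (Φ.map_mem_iff hKt).2 hu)
      Φ.differentiable_inv.differentiableOn (fun u _ => Φ.inv_map u)
      (ae_chart_of_ae (hz l) x₀)
    filter_upwards [h1, ae_restrict_mem hm] with u hu hut
    have hsrc := mem_source_symm hut
    ext v
    have h2 := DFunLike.congr_fun hu fun a => chartFrame x₀ (Φ.map u)
      (fderiv ℝ Φ.map u (chartCoframe x₀ ((Ψ n x₀).symm u) (v a)))
    simp only [alternatingMap_sum_apply, AlternatingMap.smul_apply] at h2 ⊢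
    rw [AlternatingMap.zero_apply] at h2 ⊢
    rw [← h2]
    refine sum_congr rfl fun i _ => sum_congr rfl fun j _ => ?_
    congr 1
    simp only [CompactDiffeo.formPull]
    rw [glue_of_mem _ _ hsrc, glue_of_mem _ _ hsrc, (Ψ n x₀).right_inv hut,
      wedge_comp, CompactDiffeo.pull, CompactDiffeo.pull, wedge_comp, inChart, inChart, wedge_comp]
  · filter_upwards [ae_restrict_of_ae (hz l), ae_restrict_mem hs.compl] with x hx hxs
    simp only [CompactDiffeo.formPull, glue_of_notMem _ _ hxs]
    exact hx

/-- Diffeomorphisms supported in a coordinate ball preserve the class of competitors. -/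
theorem CompactDiffeo.formPull_mem_admissible (hK : IsCompact K) {x₀ : M} {c : Eu n}
    {R R' : ℝ} (hR : 0 < R) (hRR' : R < R') (hKR : K ⊆ ball c R)
    (hR' : closedBall c R' ⊆ (Ψ n x₀).target) {r D p : ℕ}
    {P : Fin D → Fin r → Fin r → ℝ} {h z : Fin r → Form n M p} (hh : ∀ i, IsHarmonic (h i))
    (hz : z ∈ admissible P h) : (fun i => Φ.formPull x₀ (z i)) ∈ admissible P h := by
  have hball : ball c R ⊆ (Ψ n x₀).target :=
    (ball_subset_closedBall.trans (closedBall_subset_closedBall hRR'.le)).trans hR'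
  have hKt := hKR.trans hball
  obtain ⟨⟨u, hu, rfl⟩, hc⟩ := hz
  refine ⟨?_, Φ.satisfiesConstraint_formPull hKt hc⟩
  cases p with
  | zero =>
    refine ⟨u, hu, funext fun i => ?_⟩
    have h0 : u i = 0 := funext (hu i)
    rw [Pi.add_apply, h0, add_zero,
      Φ.formPull_zero_form hKR hball hK.isClosed (hh i).1 (hh i).2.1]
  | succ p =>
    have key : ∀ i, ∃ u' : Form n M (p + 1), IsAdmissibleExact u' ∧
        Φ.formPull x₀ ((h + u) i) = h i + u' := fun i => by
      obtain ⟨γ, hγ, hγe⟩ := Φ.exists_formPull_eq_add_extD hK hR hRR' hKR hR' (hh i).1 (hh i).2.1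
      obtain ⟨y, hy, -, hui, hw⟩ := hu i
      -- The new exact part has the potential γ + Φ^*y. It is not coclosed in general, and
      -- `isAdmissibleExact_of_isWeakD` replaces it by one that is.
      refine ⟨extD γ + Φ.formPull x₀ (u i), ?_, ?_⟩
      · have h1 := Φ.isL2Form_formPull hK hKt hy.1
        have h2 := Φ.isL2Form_formPull hK hKt hui
        exact isAdmissibleExact_of_isWeakD (hγ.isL2Form.add h1) (hγ.extD.isL2Form.add h2)
          ((isWeakD_extD hγ).add (Φ.isWeakD_formPull hK hKt hy.1 hui hw) hγ.isL2Form h1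
            hγ.extD.isL2Form h2)
      · rw [Pi.add_apply, Φ.formPull_add, hγe, add_assoc]
    choose u' h1 h2 using key
    exact ⟨u', h1, funext h2⟩

theorem isL2Form_of_mem_admissible {r D p : ℕ} {P : Fin D → Fin r → Fin r → ℝ}
    {h z : Fin r → Form n M p} (hh : ∀ i, IsHarmonic (h i)) (hz : z ∈ admissible P h) (i : Fin r) :
    IsL2Form (z i) := by
  obtain ⟨⟨u, hu, rfl⟩, -⟩ := hz
  refine (hh i).1.isL2Form.add ?_
  cases p with
  | zero =>
    have h0 : u i = 0 := funext (hu i)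
    rw [h0]
    exact isL2Form_zero
  | succ p =>
    obtain ⟨y, hy, -, hui, hw⟩ := hu i
    exact hui

end Competitor

/-! ### Derivatives of determinants and inverse matrices -/

section MatrixDeriv

variable {ι : Type*} [Fintype ι] [DecidableEq ι]

theorem hasDerivAt_finset_prod {κ : Type*} [DecidableEq κ] {s : Finset κ} {f : κ → ℝ → ℝ}
    {f' : κ → ℝ} {t : ℝ} (h : ∀ i ∈ s, HasDerivAt (f i) (f' i) t) :
    HasDerivAt (fun x => ∏ i ∈ s, f i x)
      (∑ i ∈ s, (∏ j ∈ s.erase i, f j t) * f' i) t := by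
  simpa using HasDerivAt.fun_finsetProd h

/-- The derivative of the determinant of a curve of matrices only depends on its one-jet. -/
theorem hasDerivAt_det_sum {Q : ℝ → Matrix ι ι ℝ} {S : Matrix ι ι ℝ} {t : ℝ}
    (hQ : ∀ i j, HasDerivAt (fun s => Q s i j) (S i j) t) :
    HasDerivAt (fun s => (Q s).det) (∑ σ : Equiv.Perm ι, (Equiv.Perm.sign σ : ℝ) *
      ∑ i, (∏ j ∈ Finset.univ.erase i, Q t (σ j) j) * S (σ i) i) t := by
  simp only [Matrix.det_apply']
  exact HasDerivAt.fun_sum fun σ _ => (hasDerivAt_finset_prod fun i _ => hQ (σ i) i).const_mul _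

theorem hasDerivAt_det_one_add_smul (A : Matrix ι ι ℝ) :
    HasDerivAt (fun s : ℝ => (1 + s • A).det) A.trace 0 := by
  have h1 : (fun s : ℝ => (1 + s • A).det) = fun s => 1 + A.trace * s +
      ((1 + (Polynomial.X : Polynomial ℝ) • A.map Polynomial.C).det.divX.divX).eval s * s ^ 2 :=
    funext fun s => Matrix.det_one_add_smul s A
  rw [h1]
  have h2 := (((hasDerivAt_id (0 : ℝ)).const_mul A.trace).const_add 1).add
    ((Polynomial.hasDerivAt ((1 + (Polynomial.X : Polynomial ℝ) •
      A.map Polynomial.C).det.divX.divX) (0 : ℝ)).mul ((hasDerivAt_id (0 : ℝ)).pow 2))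
  refine h2.congr_deriv ?_
  simp

/-- Jacobi's formula. -/
theorem hasDerivAt_det {Q : ℝ → Matrix ι ι ℝ} {S : Matrix ι ι ℝ} {t : ℝ}
    (hQ : ∀ i j, HasDerivAt (fun s => Q s i j) (S i j) t) (h0 : (Q t).det ≠ 0) :
    HasDerivAt (fun s => (Q s).det) ((Q t).det * ((Q t)⁻¹ * S).trace) t := by
  refine (hasDerivAt_det_sum hQ).congr_deriv ?_
  -- Only the one-jet of Q matters, so Q is replaced by the affine curve Q(t) + sS, whose
  -- determinant is det Q(t) times det(1 + s Q(t)⁻¹S).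
  have h1 : ∀ i j, HasDerivAt (fun s : ℝ => (Q t + s • S) i j) (S i j) 0 := fun i j => by
    have := ((hasDerivAt_id (0 : ℝ)).mul_const (S i j)).const_add (Q t i j)
    simpa using this
  have h2 := hasDerivAt_det_sum h1
  rw [zero_smul, add_zero] at h2
  have h3 : (fun s : ℝ => (Q t + s • S).det) =
      fun s => (Q t).det * (1 + s • ((Q t)⁻¹ * S)).det := by
    funext s
    rw [← Matrix.det_mul, mul_add, mul_one, Matrix.mul_smul,
      Matrix.mul_nonsing_inv_cancel_left _ _ h0.isUnit]
  rw [h3] at h2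
  exact h2.unique ((hasDerivAt_det_one_add_smul _).const_mul _)

/-- Cramer's rule gives differentiability of the entries; differentiating Q⁻¹Q = 1 then gives the
value. -/
theorem hasDerivAt_matrix_inv {Q : ℝ → Matrix ι ι ℝ} {S : Matrix ι ι ℝ} {t : ℝ}
    (hQ : ∀ i j, HasDerivAt (fun s => Q s i j) (S i j) t) (h0 : (Q t).det ≠ 0) (i j : ι) :
    HasDerivAt (fun s => (Q s)⁻¹ i j) (-((Q t)⁻¹ * S * (Q t)⁻¹) i j) t := by
  have hdet := hasDerivAt_det_sum hQ
  have hadj : ∀ i j, DifferentiableAt ℝ (fun s => (Q s)⁻¹ i j) t := fun i j => by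
    simp only [Matrix.inv_def, Ring.inverse_eq_inv', Matrix.smul_apply, Matrix.adjugate_apply,
      smul_eq_mul]
    refine (hdet.differentiableAt.inv h0).mul ?_
    -- In Cramer's rule the row `j` is replaced by a constant row, so its derivative is zero.
    refine (hasDerivAt_det_sum (S := Matrix.of fun a b => if a = j then 0 else S a b)
      fun a b => ?_).differentiableAt
    by_cases ha : a = j
    · subst ha
      simpa using hasDerivAt_const t _
    · simpa [Matrix.updateRow_ne ha, ha] using hQ a b
  set H' : Matrix ι ι ℝ := Matrix.of fun i j => deriv (fun s => (Q s)⁻¹ i j) t with hH'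
  have hH : ∀ i j, HasDerivAt (fun s => (Q s)⁻¹ i j) (H' i j) t :=
    fun i j => (hadj i j).hasDerivAt
  have hne : ∀ᶠ s in 𝓝 t, (Q s).det ≠ 0 := hdet.continuousAt.eventually_ne h0
  have h1 : H' * Q t + (Q t)⁻¹ * S = 0 := by
    ext a b
    have h2 : HasDerivAt (fun s => ∑ l, (Q s)⁻¹ a l * Q s l b)
        (∑ l, (H' a l * Q t l b + (Q t)⁻¹ a l * S l b)) t :=
      HasDerivAt.fun_sum fun l _ => (hH a l).mul (hQ l b)
    have h3 : (fun s => ∑ l, (Q s)⁻¹ a l * Q s l b) =ᶠ[𝓝 t] fun _ => (1 : Matrix ι ι ℝ) a b := by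
      filter_upwards [hne] with s hs
      rw [← Matrix.mul_apply, Matrix.nonsing_inv_mul _ hs.isUnit]
    have h4 := (h2.congr_of_eventuallyEq h3.symm).unique (hasDerivAt_const t _)
    rw [sum_add_distrib] at h4
    rw [Matrix.add_apply, Matrix.mul_apply, Matrix.mul_apply]
    exact h4
  have h2 : H' = -((Q t)⁻¹ * S * (Q t)⁻¹) := by
    have h3 := congrArg (· * (Q t)⁻¹) h1
    simp only [add_mul, zero_mul] at h3
    rw [Matrix.mul_nonsing_inv_cancel_right _ _ h0.isUnit] at h3
    exact eq_neg_of_add_eq_zero_left h3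
  have h3 := hH i j
  rwa [h2] at h3

/-- The derivative of the norm of a covector with respect to the metric. -/
theorem hasDerivAt_mpair_inv {V : Type*} [AddCommGroup V] [Module ℝ V] [TopologicalSpace V]
    {k : ℕ} (v : ι → V) {Q : ℝ → Matrix ι ι ℝ} {S : Matrix ι ι ℝ} {t : ℝ}
    (hQ : ∀ i j, HasDerivAt (fun s => Q s i j) (S i j) t) (h0 : (Q t).det ≠ 0)
    (α : V [⋀^Fin k]→L[ℝ] ℝ) :
    HasDerivAt (fun s => mpair v v (fun _ => (Q s)⁻¹) α α)
      (-∑ a, mpair v v (Function.update (fun _ => (Q t)⁻¹) a ((Q t)⁻¹ * S * (Q t)⁻¹)) α α) t := by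
  have h1 : HasDerivAt (fun s => mpair v v (fun _ => (Q s)⁻¹) α α)
      ((k ! : ℝ)⁻¹ * ∑ I : Fin k → ι, ∑ J : Fin k → ι,
        (∑ a, (∏ b ∈ Finset.univ.erase a, (Q t)⁻¹ (I b) (J b)) *
          (-((Q t)⁻¹ * S * (Q t)⁻¹) (I a) (J a))) *
          (α (fun a => v (I a)) * α (fun a => v (J a)))) t := by
    unfold mpair
    exact (HasDerivAt.fun_sum fun I _ => HasDerivAt.fun_sum fun J _ =>
      (hasDerivAt_finset_prod fun a _ =>
        hasDerivAt_matrix_inv hQ h0 (I a) (J a)).mul_const _).const_mul _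
  refine h1.congr_deriv ?_
  unfold mpair
  rw [← mul_sum, ← mul_neg]
  congr 1
  have hcomm : ∀ {A B : Type _} [Fintype A] [Fintype B] (f : A → B → B → ℝ),
      ∑ a, ∑ I, ∑ J, f a I J = ∑ I, ∑ J, ∑ a, f a I J := fun f => by
    rw [sum_comm]
    exact sum_congr rfl fun _ _ => sum_comm
  rw [hcomm, ← Finset.sum_neg_distrib]
  refine sum_congr rfl fun I _ => ?_
  rw [← Finset.sum_neg_distrib]
  refine sum_congr rfl fun J _ => ?_
  rw [← sum_mul, ← neg_mul, ← Finset.sum_neg_distrib]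
  congr 1
  refine sum_congr rfl fun a _ => ?_
  rw [← Finset.prod_erase_mul _ _ (Finset.mem_univ a), Function.update_self, mul_neg]
  congr 2
  refine Finset.prod_congr rfl fun b hb => ?_
  rw [Function.update_of_ne (Finset.ne_of_mem_erase hb)]

end MatrixDeriv

/-! ### Differentiation of integrals with smooth coefficients and integrable densities -/

section QuadraticIntegral

variable {E : Type*} [NormedAddCommGroup E] [NormedSpace ℝ E] [MeasurableSpace E] [BorelSpace E]

/-- Only the coefficients depend on s, while the functions `g i` are merely integrable; this is the
form the energy takes once the variation has been moved to the metric. The dominating function is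
the supremum of the s-derivatives over a compact box times |g_i|. -/
theorem hasDerivAt_integral_sum_mul {ι : Type*} [Fintype ι] {μ : Measure E} {K U : Set E} {δ : ℝ}
    (hδ : 0 < δ) (hK : IsCompact K) (hU : IsOpen U) (hKU : K ⊆ U) (hKm : MeasurableSet K)
    [SecondCountableTopology E]
    {c : ι → ℝ × E → ℝ} (hc : ∀ i, ContDiffOn ℝ 1 (c i) (Ioo (-δ) δ ×ˢ U)) {g : ι → E → ℝ}
    (hg : ∀ i, IntegrableOn (g i) K μ) :
    IntegrableOn (fun v => ∑ i, fderiv ℝ (c i) (0, v) (1, 0) * g i v) K μ ∧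
    HasDerivAt (fun s => ∫ v in K, ∑ i, c i (s, v) * g i v ∂μ)
      (∫ v in K, ∑ i, fderiv ℝ (c i) (0, v) (1, 0) * g i v ∂μ) 0 := by
  have hD : IsOpen (Ioo (-δ) δ ×ˢ U) := isOpen_Ioo.prod hU
  have hcd : ∀ i, ∀ q ∈ Ioo (-δ) δ ×ˢ U, DifferentiableAt ℝ (c i) q := fun i q hq =>
    ((hc i).contDiffAt (hD.mem_nhds hq)).differentiableAt (by simp)
  have hfc : ∀ i, ContinuousOn (fun q => fderiv ℝ (c i) q (1, 0)) (Ioo (-δ) δ ×ˢ U) := fun i =>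
    ((hc i).continuousOn_fderiv_of_isOpen hD (by simp)).clm_apply continuousOn_const
  have hsub : Icc (-(δ / 2)) (δ / 2) ×ˢ K ⊆ Ioo (-δ) δ ×ˢ U :=
    prod_mono (fun s hs => ⟨by linarith [hs.1], by linarith [hs.2]⟩) hKU
  have hbd : ∀ i, ∃ C, ∀ q ∈ Icc (-(δ / 2)) (δ / 2) ×ˢ K, ‖fderiv ℝ (c i) q (1, 0)‖ ≤ C :=
    fun i => (isCompact_Icc.prod hK).exists_bound_of_continuousOn ((hfc i).mono hsub)
  choose C hC using hbd
  have hslice : ∀ s ∈ Ioo (-δ) δ, ContinuousOn (fun v : E => (s, v)) K := fun s _ => by fun_prop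
  have hmeas : ∀ s ∈ Ioo (-δ) δ,
      AEStronglyMeasurable (fun v => ∑ i, c i (s, v) * g i v) (μ.restrict K) := fun s hs => by
    refine Finset.aestronglyMeasurable_fun_sum _ fun i _ => ?_
    refine AEStronglyMeasurable.mul ?_ (hg i).1
    exact ((hc i).continuousOn.comp (hslice s hs)
      fun v hv => ⟨hs, hKU hv⟩).aestronglyMeasurable hKm
  have h0 : (0 : ℝ) ∈ Ioo (-δ) δ := ⟨by linarith, hδ⟩
  refine hasDerivAt_integral_of_dominated_loc_of_deriv_le
    (s := Icc (-(δ / 2)) (δ / 2)) (bound := fun v => ∑ i, C i * ‖g i v‖)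
    (F' := fun s v => ∑ i, fderiv ℝ (c i) (s, v) (1, 0) * g i v)
    (Icc_mem_nhds (by linarith) (by linarith)) ?_ ?_ ?_ ?_ ?_ ?_
  · filter_upwards [isOpen_Ioo.mem_nhds h0] with s hs using hmeas s hs
  · refine integrable_finsetSum _ fun i _ => ?_
    have := (hg i).continuousOn_mul (((hc i).continuousOn.comp (hslice 0 h0)
      fun v hv => ⟨h0, hKU hv⟩)) hK
    exact this
  · refine Finset.aestronglyMeasurable_fun_sum _ fun i _ => ?_
    refine AEStronglyMeasurable.mul ?_ (hg i).1
    exact ((hfc i).comp (hslice 0 h0) fun v hv => ⟨h0, hKU hv⟩).aestronglyMeasurable hKm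
  · filter_upwards [ae_restrict_mem hKm] with v hv s hs
    refine (norm_sum_le _ _).trans (sum_le_sum fun i _ => ?_)
    rw [norm_mul]
    exact mul_le_mul_of_nonneg_right (hC i _ ⟨hs, hv⟩) (norm_nonneg _)
  · exact integrable_finsetSum _ fun i _ => (hg i).norm.const_mul _
  · filter_upwards [ae_restrict_mem hKm] with v hv s hs
    refine HasDerivAt.fun_sum fun i _ => HasDerivAt.mul_const ?_ _
    have h1 := (hcd i (s, v) (hsub ⟨hs, hv⟩)).hasFDerivAt
    exact h1.comp_hasDerivAt s ((hasDerivAt_id s).prodMk (hasDerivAt_const s v))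

end QuadraticIntegral

/-! ### Diffeomorphisms generated by a compactly supported field -/

section Flow

variable {n : ℕ}

/-- A perturbation of the identity with Lipschitz constant ½ is a homeomorphism with injective
differential, hence a diffeomorphism. The explicit formula is imposed on the inverse because the
energy, written in the target variable, involves the inverse only. -/
theorem exists_compactDiffeo {K : Set (Eu n)} (hK : IsCompact K) {Y : Eu n → Eu n}
    (hY : ContDiff ℝ ∞ Y) (hYK : ∀ u ∉ K, Y u = 0) :
    ∃ δ : ℝ, 0 < δ ∧ ∀ s ∈ Ioo (-δ) δ, ∃ Φ : CompactDiffeo K, ∀ v, Φ.inv v = v + s • Y v := by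
  obtain ⟨C, hC⟩ := hY.lipschitzWith_of_hasCompactSupport (HasCompactSupport.intro hK hYK)
    (by simp)
  have hC0 : (0 : ℝ) ≤ C := C.2
  -- With C a Lipschitz constant of Y, this range gives |s| C ≤ ½; the summand 1 covers C = 0.
  refine ⟨(2 * (C + 1))⁻¹, by positivity, fun s hs => ?_⟩
  have hs1 : |s| * C ≤ 1 / 2 := by
    have h1 : |s| ≤ (2 * ((C : ℝ) + 1))⁻¹ := abs_le.2 ⟨hs.1.le, hs.2.le⟩
    calc |s| * C ≤ (2 * ((C : ℝ) + 1))⁻¹ * (C + 1) := by gcongr; linarith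
      _ = 1 / 2 := by field_simp
  have hlip : ∀ v w, ‖s • Y v - s • Y w‖ ≤ 1 / 2 * ‖v - w‖ := fun v w => by
    rw [← smul_sub, norm_smul, Real.norm_eq_abs]
    calc |s| * ‖Y v - Y w‖ ≤ |s| * (C * ‖v - w‖) := by
          gcongr
          simpa [dist_eq_norm] using hC.dist_le_mul v w
      _ = |s| * C * ‖v - w‖ := by ring
      _ ≤ _ := by gcongr
  have happ : ApproximatesLinearOn (fun v => v + s • Y v)
      ((ContinuousLinearEquiv.refl ℝ (Eu n) : Eu n ≃L[ℝ] Eu n) : Eu n →L[ℝ] Eu n) univ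
      (1 / 2 : NNReal) := by
    intro v _ w _
    have h1 : v + s • Y v - (w + s • Y w) - (v - w) = s • Y v - s • Y w := by abel
    simpa [h1] using hlip v w
  have hN : Subsingleton (Eu n) ∨ (1 / 2 : NNReal) <
      ‖((ContinuousLinearEquiv.refl ℝ (Eu n)).symm : Eu n →L[ℝ] Eu n)‖₊⁻¹ := by
    rcases subsingleton_or_nontrivial (Eu n) with h | h
    · exact Or.inl h
    · refine Or.inr ?_
      have : ‖((ContinuousLinearEquiv.refl ℝ (Eu n)).symm : Eu n →L[ℝ] Eu n)‖₊ = 1 :=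
        NNReal.eq (ContinuousLinearMap.norm_id (𝕜 := ℝ) (E := Eu n))
      rw [this, inv_one]
      exact NNReal.half_lt_self one_ne_zero
  let e : Eu n ≃ₜ Eu n := happ.toHomeomorph _ hN
  have he : ∀ v, e v = v + s • Y v := fun _ => rfl
  have hsm : ContDiff ℝ ∞ fun v => v + s • Y v := contDiff_id.add (hY.const_smul s)
  have hinj : ∀ v, Function.Injective (fderiv ℝ (fun v => v + s • Y v) v).toLinearMap := fun v => by
    rw [← LinearMap.ker_eq_bot, LinearMap.ker_eq_bot']
    intro w hw
    have hY' := (hY.differentiable (by simp) v).hasFDerivAt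
    have h1 : w + s • fderiv ℝ Y v w = 0 := by
      rw [← hw]
      have h2 : HasFDerivAt (fun v => v + s • Y v)
          (ContinuousLinearMap.id ℝ (Eu n) + s • fderiv ℝ Y v) v :=
        (hasFDerivAt_id v).add (hY'.const_smul s)
      rw [ContinuousLinearMap.coe_coe, h2.fderiv]
      rfl
    have h3 : ‖fderiv ℝ Y v‖ ≤ C := norm_fderiv_le_of_lipschitz ℝ hC
    have h4 : ‖w‖ ≤ 1 / 2 * ‖w‖ := by
      calc ‖w‖ = ‖s • fderiv ℝ Y v w‖ := by
            rw [eq_neg_of_add_eq_zero_left h1, norm_neg]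
            rw [← eq_neg_of_add_eq_zero_left h1]
        _ ≤ |s| * (C * ‖w‖) := by
            rw [norm_smul, Real.norm_eq_abs]
            gcongr
            exact (ContinuousLinearMap.le_opNorm _ _).trans (by gcongr)
        _ = |s| * C * ‖w‖ := by ring
        _ ≤ _ := by gcongr
    exact norm_eq_zero.1 (by linarith [norm_nonneg w])
  let f₀ : Eu n → Eu n ≃L[ℝ] Eu n := fun v =>
    (LinearEquiv.ofInjectiveEndo _ (hinj v)).toContinuousLinearEquiv
  have hf₀ : ∀ v, HasFDerivAt e (f₀ v : Eu n →L[ℝ] Eu n) v := fun v => by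
    have h1 : (f₀ v : Eu n →L[ℝ] Eu n) = fderiv ℝ (fun v => v + s • Y v) v :=
      ContinuousLinearMap.ext fun w => rfl
    rw [h1]
    exact (hsm.differentiable (by simp) v).hasFDerivAt
  exact ⟨{ map := e.symm
           inv := fun v => v + s • Y v
           contDiff_map := e.contDiff_symm hf₀ hsm
           contDiff_inv := hsm
           map_inv := fun u => e.symm_apply_apply u
           inv_map := fun u => e.apply_symm_apply u
           map_eq := fun u hu => e.symm_apply_eq.2 (by rw [he, hYK u hu, smul_zero, add_zero]) },
    fun _ => rfl⟩

end Flow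

/-! ### The metric pulled back by v ↦ v + sY(v) -/

section FlowMetric

variable {k : ℕ}

/-- The Gram matrix of the pullback of the metric by `v ↦ v + s Y(v)`. -/
def flowGram (x₀ : M) (Y : Eu n → Eu n) (s : ℝ) (v : Eu n) : Matrix (Fin n) (Fin n) ℝ :=
  Matrix.of fun i j => metricCLM x₀ (v + s • Y v) (stdFrame n i + s • fderiv ℝ Y v (stdFrame n i))
    (stdFrame n j + s • fderiv ℝ Y v (stdFrame n j))

/-- The matrix of the Lie derivative of the metric. -/
def lieGram (x₀ : M) (Y : Eu n → Eu n) (v : Eu n) : Matrix (Fin n) (Fin n) ℝ :=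
  Matrix.of fun i j => lieMetric x₀ Y v (stdFrame n i) (stdFrame n j)

theorem flowGram_zero (x₀ : M) (Y : Eu n → Eu n) (v : Eu n) :
    flowGram x₀ Y 0 v = chartGram x₀ v := by
  ext i j
  simp [flowGram, chartGram, stdFrame]

theorem contDiffOn_flowGram {x₀ : M} {Y : Eu n → Eu n} (hY : ContDiff ℝ ∞ Y) {I : Set ℝ}
    (hI : ∀ s ∈ I, ∀ v ∈ (Ψ n x₀).target, v + s • Y v ∈ (Ψ n x₀).target)
    (i j : Fin n) :
    ContDiffOn ℝ ∞ (fun q : ℝ × Eu n => flowGram x₀ Y q.1 q.2 i j)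
      (I ×ˢ (Ψ n x₀).target) := by
  have h1 : ContDiff ℝ ∞ fun q : ℝ × Eu n => q.2 + q.1 • Y q.2 :=
    contDiff_snd.add (contDiff_fst.smul (hY.comp contDiff_snd))
  have h2 : ∀ i, ContDiff ℝ ∞ fun q : ℝ × Eu n =>
      stdFrame n i + q.1 • fderiv ℝ Y q.2 (stdFrame n i) := fun i =>
    contDiff_const.add (contDiff_fst.smul
      (((hY.fderiv_right (m := ∞) (by simp)).comp contDiff_snd).clm_apply contDiff_const))
  exact ((((contDiffOn_metricCLM x₀).comp h1.contDiffOn fun q hq => hI _ hq.1 _ hq.2).clm_apply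
    (h2 i).contDiffOn).clm_apply (h2 j).contDiffOn)

theorem hasDerivAt_flowGram {x₀ : M} {Y : Eu n → Eu n} {v : Eu n}
    (hv : v ∈ (Ψ n x₀).target) (i j : Fin n) :
    HasDerivAt (fun s => flowGram x₀ Y s v i j) (lieGram x₀ Y v i j) 0 := by
  have h1 : HasDerivAt (fun s : ℝ => v + s • Y v) (Y v) 0 := by
    simpa using ((hasDerivAt_id (0 : ℝ)).smul_const (Y v)).const_add v
  have h2 : ∀ a b, HasDerivAt (fun s : ℝ => metricCLM x₀ (v + s • Y v) a b)
      (fderiv ℝ (metricCLM x₀) v (Y v) a b) 0 := fun a b => by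
    rw [← fderiv_chartMetric hv]
    have h3 : HasFDerivAt (fun u => chartMetric x₀ u a b)
        (fderiv ℝ (fun u => chartMetric x₀ u a b) v) (v + (0 : ℝ) • Y v) := by
      rw [zero_smul, add_zero]
      exact (((contDiffOn_chartMetric x₀ a b).contDiffAt
        ((isOpen_extChartAt_target x₀).mem_nhds hv)).differentiableAt (by simp)).hasFDerivAt
    exact h3.comp_hasDerivAt (0 : ℝ) h1
  have h3 : ∀ a b a' b', HasDerivAt
      (fun s : ℝ => metricCLM x₀ (v + s • Y v) (a + s • a') (b + s • b'))
      (fderiv ℝ (metricCLM x₀) v (Y v) a b + metricCLM x₀ v a' b + metricCLM x₀ v a b') 0 :=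
    fun a b a' b' => by
    have h4 := (((h2 a b).add ((hasDerivAt_id (0 : ℝ)).mul (h2 a' b))).add
      ((hasDerivAt_id (0 : ℝ)).mul (h2 a b'))).add
      (((hasDerivAt_id (0 : ℝ)).mul (hasDerivAt_id (0 : ℝ))).mul (h2 a' b'))
    refine (h4.congr_deriv (by simp)).congr_of_eventuallyEq (Eventually.of_forall fun s => ?_)
    change metricCLM x₀ (v + s • Y v) (a + s • a') (b + s • b') =
      metricCLM x₀ (v + s • Y v) a b + s * metricCLM x₀ (v + s • Y v) a' b +
        s * metricCLM x₀ (v + s • Y v) a b' + s * s * metricCLM x₀ (v + s • Y v) a' b'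
    simp only [map_add, map_smul, add_apply, smul_apply, smul_eq_mul]
    ring
  exact h3 _ _ _ _

theorem CompactDiffeo.flowGram_eq {K : Set (Eu n)} (Φ : CompactDiffeo K) {x₀ : M}
    {Y : Eu n → Eu n} (hY : ContDiff ℝ ∞ Y) {s : ℝ} (hΦ : ∀ v, Φ.inv v = v + s • Y v) (v : Eu n) :
    flowGram x₀ Y s v = (clmMat (fderiv ℝ Φ.inv v)).transpose * chartGram x₀ (Φ.inv v) *
      clmMat (fderiv ℝ Φ.inv v) ∧
    (flowGram x₀ Y s v).det = (fderiv ℝ Φ.inv v).det ^ 2 * chartDet x₀ (Φ.inv v) := by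
  have h1 : ∀ w, fderiv ℝ Φ.inv v w = w + s • fderiv ℝ Y v w := fun w => by
    have h2 : HasFDerivAt Φ.inv (ContinuousLinearMap.id ℝ (Eu n) + s • fderiv ℝ Y v) v := by
      rw [funext hΦ]
      exact (hasFDerivAt_id v).add ((hY.differentiable (by simp) v).hasFDerivAt.const_smul s)
    rw [h2.fderiv]
    rfl
  have h3 : flowGram x₀ Y s v = Matrix.of fun i j => metricCLM x₀ (Φ.inv v)
      (fderiv ℝ Φ.inv v (stdFrame n i)) (fderiv ℝ Φ.inv v (stdFrame n j)) := by
    ext i j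
    rw [flowGram, Matrix.of_apply, Matrix.of_apply, h1, h1, hΦ]
  have h4 : (flowGram x₀ Y s v) = (clmMat (fderiv ℝ Φ.inv v)).transpose *
      chartGram x₀ (Φ.inv v) * clmMat (fderiv ℝ Φ.inv v) := by
    rw [h3]
    ext i j
    rw [Matrix.of_apply, clm_stdFrame, clm_stdFrame, Matrix.mul_assoc, Matrix.mul_apply]
    simp only [map_sum, map_smul, sum_apply, smul_apply,
      smul_eq_mul, Matrix.mul_apply, Matrix.transpose_apply, mul_sum]
    rw [sum_comm]
    refine sum_congr rfl fun a _ => sum_congr rfl fun b _ => ?_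
    simp only [chartGram, Matrix.of_apply, metricCLM_apply, stdFrame]
    ring
  refine ⟨h4, ?_⟩
  rw [h4, Matrix.det_mul, Matrix.det_mul, Matrix.det_transpose, det_mapMatrix, chartDet_eq]
  have : clmMat (fderiv ℝ Φ.inv v) =
    Matrix.of fun i j => fderiv ℝ Φ.inv v (stdFrame n j) i := rfl
  rw [← this]
  ring

/-- The energy density of a pulled back form, in the coordinates of the target. -/
theorem CompactDiffeo.energyDensity_eq {K : Set (Eu n)} (Φ : CompactDiffeo K) {x₀ : M}
    (hKt : K ⊆ (Ψ n x₀).target)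
    {Y : Eu n → Eu n} (hY : ContDiff ℝ ∞ Y) {s : ℝ} (hΦ : ∀ v, Φ.inv v = v + s • Y v) {v : Eu n}
    (hv : v ∈ (Ψ n x₀).target) (b : Eu n → EuForm n k) :
    (flowGram x₀ Y s v).det ≠ 0 ∧
    |(fderiv ℝ Φ.inv v).det| * (chartDensity x₀ (Φ.inv v) *
      chartInner x₀ (Φ.inv v) (Φ.pull b (Φ.inv v)) (Φ.pull b (Φ.inv v))) =
    √(flowGram x₀ Y s v).det *
      mpair (stdFrame n) (stdFrame n) (fun _ => (flowGram x₀ Y s v)⁻¹) (b v) (b v) := by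
  have hv' := (Φ.inv_mem_iff hKt).2 hv
  obtain ⟨h1, h2⟩ := Φ.flowGram_eq (x₀ := x₀) hY hΦ v
  refine ⟨?_, ?_⟩
  · rw [h2]
    exact mul_ne_zero (pow_ne_zero _ (Φ.det_fderiv_inv_ne_zero v)) (chartDet_pos hv').ne'
  · have hG : IsUnit (chartGram x₀ (Φ.inv v)).det := (chartDet_pos hv').ne'.isUnit
    have hAB : clmMat (fderiv ℝ Φ.inv v) * clmMat (fderiv ℝ Φ.map (Φ.inv v)) = 1 := by
      have hc : (fderiv ℝ Φ.inv v).comp (fderiv ℝ Φ.map (Φ.inv v)) =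
          ContinuousLinearMap.id ℝ (Eu n) :=
        ContinuousLinearMap.ext fun w => Φ.fderiv_inv_fderiv_map v w
      rw [← clmMat_id, ← hc]
      ext i j
      rw [clmMat, clmMat, clmMat, Matrix.mul_apply, Matrix.of_apply,
        ContinuousLinearMap.comp_apply, clm_stdFrame (fderiv ℝ Φ.map (Φ.inv v)), map_sum]
      simp [clmMat, mul_comm]
    -- With A = DΦ⁻¹ and B = DΦ inverse to each other, the inverse of AᵀGA is B G⁻¹ Bᵀ, the matrix
    -- through which the pulled back form is paired with itself.
    have hinv : (flowGram x₀ Y s v)⁻¹ = clmMat (fderiv ℝ Φ.map (Φ.inv v)) *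
        (chartGram x₀ (Φ.inv v))⁻¹ * (clmMat (fderiv ℝ Φ.map (Φ.inv v))).transpose := by
      refine Matrix.inv_eq_right_inv ?_
      rw [h1, show ∀ a b c d e f : Matrix (Fin n) (Fin n) ℝ, a * b * c * (d * e * f) =
        a * (b * (c * d) * e) * f from fun a b c d e f => by simp only [Matrix.mul_assoc], hAB,
        Matrix.mul_one, Matrix.mul_nonsing_inv _ hG, Matrix.mul_one, ← Matrix.transpose_mul,
        mul_eq_one_comm.1 hAB, Matrix.transpose_one]
    rw [hinv, h2, Real.sqrt_mul (sq_nonneg _), Real.sqrt_sq_eq_abs, CompactDiffeo.pull,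
      Φ.map_inv, chartInner, mpair_comp_clm_left, mpair_comp_clm_right, chartDensity, Matrix.mul_assoc, mul_assoc]

end FlowMetric

/-! ### The first variation of the energy -/

section FirstVariation

variable {k : ℕ}

/-- The contraction of a symmetric matrix with the stress-energy tensor of a covector. -/
def chartStress (x₀ : M) (S : Matrix (Fin n) (Fin n) ℝ) (u : Eu n) (α : EuForm n k) : ℝ :=
  1 / 2 * ((chartGram x₀ u)⁻¹ * S).trace * chartInner x₀ u α α -
    ∑ a, mpair (stdFrame n) (stdFrame n) (Function.update (fun _ => (chartGram x₀ u)⁻¹) a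
      ((chartGram x₀ u)⁻¹ * S * (chartGram x₀ u)⁻¹)) α α

theorem chartStress_zero (x₀ : M) (u : Eu n) (α : EuForm n k) : chartStress x₀ 0 u α = 0 := by
  have h := fun a => mpair_update_smul (stdFrame n) (chartGram x₀ u)⁻¹ a 0 0 α α
  simp only [zero_smul, zero_mul] at h
  simp [chartStress, h]

/-- The energy density of a covector for the metric pulled back by the flow. -/
def flowEnergy (x₀ : M) (Y : Eu n → Eu n) (s : ℝ) (v : Eu n) (α : EuForm n k) : ℝ :=
  √(flowGram x₀ Y s v).det *
    mpair (stdFrame n) (stdFrame n) (fun _ => (flowGram x₀ Y s v)⁻¹) α α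

theorem flowEnergy_zero (x₀ : M) (Y : Eu n → Eu n) (v : Eu n) (α : EuForm n k) :
    flowEnergy x₀ Y 0 v α = chartDensity x₀ v * chartInner x₀ v α α := by
  rw [flowEnergy, flowGram_zero, ← chartDet_eq]
  rfl

/-- Jacobi's formula differentiates the volume density and gives the trace term; differentiating the
inverse metric in each slot gives the stress term with a minus sign. -/
theorem hasDerivAt_flowEnergy {x₀ : M} {Y : Eu n → Eu n} {v : Eu n}
    (hv : v ∈ (Ψ n x₀).target) (α : EuForm n k) :
    HasDerivAt (fun s => flowEnergy x₀ Y s v α)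
      (chartDensity x₀ v * chartStress x₀ (lieGram x₀ Y v) v α) 0 := by
  have hQ := fun i j => hasDerivAt_flowGram (Y := Y) hv i j
  have hpos : 0 < (flowGram x₀ Y 0 v).det := by
    rw [flowGram_zero, ← chartDet_eq]
    exact chartDet_pos hv
  have h1 := (hasDerivAt_det hQ hpos.ne').sqrt hpos.ne'
  have h2 := h1.mul (hasDerivAt_mpair_inv (stdFrame n) hQ hpos.ne' α)
  refine h2.congr_deriv ?_
  rw [flowGram_zero] at hpos ⊢
  have hs := Real.sqrt_pos.2 hpos
  rw [chartStress, chartDensity, chartDet_eq, chartInner]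
  have h3 : (chartGram x₀ v).det / (2 * √(chartGram x₀ v).det) = √(chartGram x₀ v).det / 2 := by
    rw [div_eq_div_iff (by positivity) two_ne_zero]
    nlinarith [Real.mul_self_sqrt hpos.le]
  rw [mul_div_right_comm, h3]
  ring

/-- The coefficients of the energy density as a quadratic form. -/
def flowCoeff (x₀ : M) (Y : Eu n → Eu n) (I J : Fin k → Fin n) (q : ℝ × Eu n) : ℝ :=
  √(flowGram x₀ Y q.1 q.2).det * ((k ! : ℝ)⁻¹ * ∏ a, (flowGram x₀ Y q.1 q.2)⁻¹ (I a) (J a))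

theorem flowEnergy_eq_sum (x₀ : M) (Y : Eu n → Eu n) (s : ℝ) (v : Eu n) (α : EuForm n k) :
    flowEnergy x₀ Y s v α = ∑ I, ∑ J, flowCoeff x₀ Y I J (s, v) *
      (α (fun a => stdFrame n (I a)) * α (fun a => stdFrame n (J a))) := by
  simp only [flowEnergy, mpair, flowCoeff, mul_sum]
  refine sum_congr rfl fun I _ => sum_congr rfl fun J _ => by ring

theorem contDiffOn_finset_prod' {X ι : Type*} [NormedAddCommGroup X] [NormedSpace ℝ X]
    {s : Finset ι} {f : ι → X → ℝ} {t : Set X} {N : WithTop ℕ∞}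
    (h : ∀ i ∈ s, ContDiffOn ℝ N (f i) t) : ContDiffOn ℝ N (fun x => ∏ i ∈ s, f i x) t := by
  classical
  induction s using Finset.induction_on with
  | empty => simpa using contDiffOn_const
  | insert a s ha ih =>
    simp only [Finset.prod_insert ha]
    exact (h a (Finset.mem_insert_self a s)).mul
      (ih fun i hi => h i (Finset.mem_insert_of_mem hi))

theorem contDiffOn_flowCoeff {x₀ : M} {Y : Eu n → Eu n} (hY : ContDiff ℝ ∞ Y) {T : Set ℝ}
    (hT : ∀ s ∈ T, ∀ v ∈ (Ψ n x₀).target, v + s • Y v ∈ (Ψ n x₀).target)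
    (hdet : ∀ s ∈ T, ∀ v ∈ (Ψ n x₀).target, (flowGram x₀ Y s v).det ≠ 0)
    (I J : Fin k → Fin n) :
    ContDiffOn ℝ ∞ (flowCoeff x₀ Y I J) (T ×ˢ (Ψ n x₀).target) := by
  have h1 := contDiffOn_flowGram hY hT
  have h2 : ∀ q ∈ T ×ˢ (Ψ n x₀).target, (flowGram x₀ Y q.1 q.2).det ≠ 0 :=
    fun q hq => hdet _ hq.1 _ hq.2
  exact ((contDiffOn_det h1).sqrt h2).mul (contDiffOn_const.mul
    (contDiffOn_finset_prod' fun a _ => contDiffOn_matrix_inv h1 h2 (I a) (J a)))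

theorem norm_form_stdFrame_le (α : EuForm n k) (I : Fin k → Fin n) :
    |α (fun a => stdFrame n (I a))| ≤ ‖α‖ := by
  have h := α.le_opNorm fun a => stdFrame n (I a)
  simpa [stdFrame] using h

variable [MeasurableSpace M] [BorelSpace M] [CompactSpace M]

/-- A product of two coefficients is at most the square of the operator norm, which on compact sets
is controlled by the metric square norm; the density is bounded below there. -/
theorem IsL2Form.integrableOn_coeff_mul {α : Form n M k} (hα : IsL2Form α) {x₀ : M}
    {K : Set (Eu n)} (hK : IsCompact K) (hKt : K ⊆ (Ψ n x₀).target)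
    (I J : Fin k → Fin n) :
    IntegrableOn (fun v => inChart α x₀ v (fun a => stdFrame n (I a)) *
      inChart α x₀ v (fun a => stdFrame n (J a))) K := by
  obtain ⟨c, C, hc, hC, hb⟩ := exists_chartInner_bounds hK hKt k
  obtain ⟨B, hB⟩ := hK.exists_bound_of_continuousOn (f := fun v => (chartDensity x₀ v)⁻¹)
    (((contDiffOn_chartDensity x₀).continuousOn.mono hKt).inv₀
      fun v hv => (chartDensity_pos (hKt hv)).ne')
  have hm : ∀ I : Fin k → Fin n, AEStronglyMeasurable
      (fun v => inChart α x₀ v (fun a => stdFrame n (I a))) (volume.restrict K) := fun I =>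
    (aestronglyMeasurable_form_iff.1 (hα.1 x₀) I).mono_measure (Measure.restrict_mono hKt le_rfl)
  refine (((hα.integrableOn_chart x₀).mono_set hKt).const_mul (c⁻¹ * B)).mono'
    ((hm I).mul (hm J)) ?_
  filter_upwards [ae_restrict_mem hK.measurableSet] with v hv
  have hρ := chartDensity_pos (hKt hv)
  have h0 := chartInner_self_nonneg (hKt hv) (inChart α x₀ v)
  have h1 := hB v hv
  rw [Real.norm_of_nonneg (inv_nonneg.2 hρ.le)] at h1
  have h2 : 1 ≤ B * chartDensity x₀ v := by
    rw [← inv_mul_cancel₀ hρ.ne']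
    gcongr
  rw [Real.norm_eq_abs, abs_mul]
  calc _ ≤ ‖inChart α x₀ v‖ * ‖inChart α x₀ v‖ := by
        gcongr <;> exact norm_form_stdFrame_le _ _
    _ ≤ c⁻¹ * chartInner x₀ v (inChart α x₀ v) (inChart α x₀ v) := by
        rw [le_inv_mul_iff₀ hc, ← sq]
        exact (hb v hv _).1
    _ ≤ c⁻¹ * ((B * chartDensity x₀ v) * chartInner x₀ v (inChart α x₀ v) (inChart α x₀ v)) := by
        gcongr
        exact le_mul_of_one_le_left h0 h2
    _ = _ := by ring

variable [T2Space M]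

/-- The energy of a form and of its pullback, split along the support of the diffeomorphism. -/
theorem CompactDiffeo.l2Inner_formPull_self {K : Set (Eu n)} (Φ : CompactDiffeo K)
    (hK : IsCompact K) {x₀ : M} (hKt : K ⊆ (Ψ n x₀).target) {Y : Eu n → Eu n}
    (hY : ContDiff ℝ ∞ Y) {s : ℝ} (hΦ : ∀ v, Φ.inv v = v + s • Y v) {α : Form n M k}
    (hα : IsL2Form α) :
    l2Inner (Φ.formPull x₀ α) (Φ.formPull x₀ α) - l2Inner α α =
      (∫ v in K, flowEnergy x₀ Y s v (inChart α x₀ v)) -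
        ∫ v in K, flowEnergy x₀ Y 0 v (inChart α x₀ v) := by
  have hm := measurableSet_target (n := n) x₀
  have hp := Φ.isL2Form_formPull hK hKt hα
  have h1 : ∀ v ∈ (Ψ n x₀).target, |(fderiv ℝ Φ.inv v).det| *
      (chartDensity x₀ (Φ.inv v) * chartInner x₀ (Φ.inv v)
        (inChart (Φ.formPull x₀ α) x₀ (Φ.inv v)) (inChart (Φ.formPull x₀ α) x₀ (Φ.inv v))) =
      flowEnergy x₀ Y s v (inChart α x₀ v) := fun v hv => by
    have hv' := (Φ.inv_mem_iff hKt).2 hv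
    simp only [CompactDiffeo.formPull]
    rw [inChart_glue _ _ hv']
    exact (Φ.energyDensity_eq hKt hY hΦ hv (inChart α x₀)).2
  have hi1 := (hp.integrableOn_chart x₀)
  rw [Φ.integrableOn_iff hKt hm] at hi1
  have hi1 := hi1.congr_fun h1 hm
  have hi0 := (hα.integrableOn_chart x₀)
  simp only [← flowEnergy_zero x₀ Y] at hi0
  rw [l2Inner_eq_chart_add hp hp x₀, l2Inner_eq_chart_add hα hα x₀,
    Φ.setIntegral_eq hKt hm, setIntegral_congr_fun hm h1]
  simp only [← flowEnergy_zero x₀ Y]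
  have h2 : ∫ x in (Ψ n x₀).sourceᶜ, covInner (Φ.formPull x₀ α x)
      (Φ.formPull x₀ α x) ∂(riemVol n M) =
      ∫ x in (Ψ n x₀).sourceᶜ, covInner (α x) (α x) ∂(riemVol n M) := by
    refine setIntegral_congr_fun (isOpen_extChartAt_source x₀).measurableSet.compl fun x hx => ?_
    simp only [CompactDiffeo.formPull]
    rw [glue_of_notMem _ _ hx]
  have h3 : ∀ v ∈ (Ψ n x₀).target \ K, flowEnergy x₀ Y s v (inChart α x₀ v) =
      flowEnergy x₀ Y 0 v (inChart α x₀ v) := fun v hv => by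
    rw [← h1 v hv.1, Φ.inv_eq hv.2, Φ.fderiv_inv_eq hK.isClosed hv.2, ContinuousLinearMap.det,
      ContinuousLinearMap.coe_id, LinearMap.det_id, abs_one, one_mul, flowEnergy_zero]
    simp only [CompactDiffeo.formPull]
    rw [inChart_glue _ _ hv.1, Φ.pull_eq hK.isClosed _ hv.2]
  rw [h2, ← integral_inter_add_sdiff hK.measurableSet hi1,
    ← integral_inter_add_sdiff hK.measurableSet hi0,
    setIntegral_congr_fun (hm.diff hK.measurableSet) h3, inter_eq_self_of_subset_right hKt]
  ring

/-- The first variation of the energy along a vector field supported in a chart. -/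
theorem first_variation_chart {x₀ : M} {c : Eu n} {R R' : ℝ} (hR : 0 < R) (hRR' : R < R')
    (hR' : closedBall c R' ⊆ (Ψ n x₀).target) {K : Set (Eu n)}
    (hK : IsCompact K) (hKR : K ⊆ ball c R) {r D p : ℕ} {P : Fin D → Fin r → Fin r → ℝ}
    {h z : Fin r → Form n M p} (hz : IsNonlinearHarmonic P h z) {Y : Eu n → Eu n}
    (hY : ContDiff ℝ ∞ Y) (hYK : ∀ u ∉ K, Y u = 0) :
    IntegrableOn (fun v => chartDensity x₀ v *
      ∑ i, chartStress x₀ (lieGram x₀ Y v) v (inChart (z i) x₀ v)) (Ψ n x₀).target ∧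
    ∫ v in (Ψ n x₀).target, chartDensity x₀ v *
      ∑ i, chartStress x₀ (lieGram x₀ Y v) v (inChart (z i) x₀ v) = 0 := by
  have hball : ball c R ⊆ (Ψ n x₀).target :=
    (ball_subset_closedBall.trans (closedBall_subset_closedBall hRR'.le)).trans hR'
  have hKt := hKR.trans hball
  have hL2 := isL2Form_of_mem_admissible hz.harmonic hz.mem
  obtain ⟨δ, hδ, hflow⟩ := exists_compactDiffeo hK hY hYK
  have hT : ∀ s ∈ Ioo (-δ) δ, ∀ v ∈ (Ψ n x₀).target,
      v + s • Y v ∈ (Ψ n x₀).target := fun s hs v hv => by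
    obtain ⟨Φ, hΦ⟩ := hflow s hs
    rw [← hΦ]
    exact (Φ.inv_mem_iff hKt).2 hv
  -- Nondegeneracy of the pulled back metric does not involve a form, so the zero form is inserted.
  have hdet : ∀ s ∈ Ioo (-δ) δ, ∀ v ∈ (Ψ n x₀).target,
      (flowGram x₀ Y s v).det ≠ 0 := fun s hs v hv => by
    obtain ⟨Φ, hΦ⟩ := hflow s hs
    exact (Φ.energyDensity_eq hKt hY hΦ hv (inChart (0 : Form n M 0) x₀)).1
  have hcd := fun I J : Fin p → Fin n => (contDiffOn_flowCoeff hY hT hdet I J).of_le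
    (m := 1) (by simp)
  have hg := fun q : Fin r × (Fin p → Fin n) × (Fin p → Fin n) =>
    (hL2 q.1).integrableOn_coeff_mul hK hKt q.2.1 q.2.2
  obtain ⟨hint, hder⟩ := hasDerivAt_integral_sum_mul hδ hK (isOpen_extChartAt_target x₀) hKt
    hK.measurableSet (fun q : Fin r × (Fin p → Fin n) × (Fin p → Fin n) => hcd q.2.1 q.2.2) hg
  have hsum : ∀ s v, ∑ q : Fin r × (Fin p → Fin n) × (Fin p → Fin n),
      flowCoeff x₀ Y q.2.1 q.2.2 (s, v) *
        (inChart (z q.1) x₀ v (fun a => stdFrame n (q.2.1 a)) *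
          inChart (z q.1) x₀ v (fun a => stdFrame n (q.2.2 a))) =
      ∑ i, flowEnergy x₀ Y s v (inChart (z i) x₀ v) := fun s v => by
    simp only [flowEnergy_eq_sum, Fintype.sum_prod_type]
  -- Both expressions are the derivative at 0 of the same function of s, once as a sum over
  -- coefficients and once through `hasDerivAt_flowEnergy`.
  have hpt : ∀ v ∈ K, ∑ q : Fin r × (Fin p → Fin n) × (Fin p → Fin n),
      fderiv ℝ (flowCoeff x₀ Y q.2.1 q.2.2) (0, v) (1, 0) *
        (inChart (z q.1) x₀ v (fun a => stdFrame n (q.2.1 a)) *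
          inChart (z q.1) x₀ v (fun a => stdFrame n (q.2.2 a))) =
      chartDensity x₀ v * ∑ i, chartStress x₀ (lieGram x₀ Y v) v (inChart (z i) x₀ v) :=
    fun v hv => by
    have h1 : HasDerivAt (fun s => ∑ i, flowEnergy x₀ Y s v (inChart (z i) x₀ v))
        (∑ i, chartDensity x₀ v * chartStress x₀ (lieGram x₀ Y v) v (inChart (z i) x₀ v)) 0 :=
      HasDerivAt.fun_sum fun i _ => hasDerivAt_flowEnergy (hKt hv) _
    rw [mul_sum]
    simp only [← hsum] at h1
    refine HasDerivAt.unique (HasDerivAt.fun_sum fun q _ => HasDerivAt.mul_const ?_ _) h1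
    have h2 := (((hcd q.2.1 q.2.2).contDiffAt ((isOpen_Ioo.prod
      (isOpen_extChartAt_target x₀)).mem_nhds (show ((0 : ℝ), v) ∈ _ from
        ⟨⟨by linarith, hδ⟩, hKt hv⟩))).differentiableAt (by simp)).hasFDerivAt
    exact h2.comp_hasDerivAt (0 : ℝ) ((hasDerivAt_id (0 : ℝ)).prodMk (hasDerivAt_const (0 : ℝ) v))
  have hIi : ∀ s ∈ Ioo (-δ) δ, ∀ i,
      IntegrableOn (fun v => flowEnergy x₀ Y s v (inChart (z i) x₀ v)) K := fun s hs i => by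
    simp only [flowEnergy_eq_sum]
    refine integrable_finsetSum _ fun I _ => integrable_finsetSum _ fun J _ => ?_
    have hc : ContinuousOn (fun v => flowCoeff x₀ Y I J (s, v)) K :=
      (hcd I J).continuousOn.comp (by fun_prop) fun v hv => ⟨hs, hKt hv⟩
    exact (hg (i, I, J)).continuousOn_mul hc hK
  -- The difference of this integral and its value at 0 is the difference of the energies of Φ_s^*z
  -- and z, and the pullback is a competitor.
  have hmin : IsLocalMin (fun s => ∫ v in K, ∑ q : Fin r × (Fin p → Fin n) × (Fin p → Fin n),
      flowCoeff x₀ Y q.2.1 q.2.2 (s, v) *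
        (inChart (z q.1) x₀ v (fun a => stdFrame n (q.2.1 a)) *
          inChart (z q.1) x₀ v (fun a => stdFrame n (q.2.2 a)))) 0 := by
    filter_upwards [isOpen_Ioo.mem_nhds (show (0 : ℝ) ∈ Ioo (-δ) δ from ⟨by linarith, hδ⟩)]
      with s hs
    simp only [hsum]
    rw [integral_finsetSum _ fun i _ => hIi s hs i,
      integral_finsetSum _ fun i _ => hIi 0 ⟨by linarith, hδ⟩ i, ← sub_nonneg,
      ← Finset.sum_sub_distrib]
    obtain ⟨Φ, hΦ⟩ := hflow s hs
    simp only [← Φ.l2Inner_formPull_self hK hKt hY hΦ (hL2 _)]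
    rw [Finset.sum_sub_distrib, sub_nonneg]
    exact hz.isMin (Φ.formPull_mem_admissible hK hR hRR' hKR hR' hz.harmonic hz.mem)
  have hzero := hmin.hasDerivAt_eq_zero hder
  -- Off the closed set `K` the field vanishes identically near v, so the Lie derivative of the
  -- metric is zero.
  have hoff : ∀ v ∈ (Ψ n x₀).target \ K, chartDensity x₀ v *
      ∑ i, chartStress x₀ (lieGram x₀ Y v) v (inChart (z i) x₀ v) = 0 := fun v hv => by
    have h1 : fderiv ℝ Y v = 0 := by
      have : Y =ᶠ[𝓝 v] fun _ => 0 := by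
        filter_upwards [hK.isClosed.isOpen_compl.mem_nhds hv.2] with w hw using hYK w hw
      rw [this.fderiv_eq, fderiv_const_apply]
    have h2 : lieGram x₀ Y v = 0 := by
      ext i j
      change lieMetric x₀ Y v (stdFrame n i) (stdFrame n j) = 0
      rw [lieMetric, ← fderiv_chartMetric hv.1, h1, hYK v hv.2, ← metricCLM_apply,
        ← metricCLM_apply]
      simp only [zero_apply, map_zero, add_zero]
    simp [h2, chartStress_zero]
  rw [setIntegral_congr_fun hK.measurableSet hpt] at hzero
  refine ⟨(hint.congr_fun hpt hK.measurableSet).of_forall_sdiff_eq_zero (measurableSet_target x₀)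
    hoff, ?_⟩
  rw [setIntegral_eq_of_subset_of_forall_sdiff_eq_zero (measurableSet_target x₀) hKt hoff, hzero]

end FirstVariation

/-! ### Price's identity -/

section Price

variable {k : ℕ}

/-- The Lie derivative of the metric as a bilinear form. -/
def lieBilin (x₀ : M) (Y : Eu n → Eu n) (u : Eu n) : Eu n →ₗ[ℝ] Eu n →ₗ[ℝ] ℝ :=
  LinearMap.mk₂ ℝ (lieMetric x₀ Y u)
    (fun v v' w => by
      simp only [lieMetric, ← metricCLM_apply, map_add, add_apply]; ring)
    (fun c v w => by
      simp only [lieMetric, ← metricCLM_apply, map_smul, smul_apply, smul_eq_mul]; ring)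
    (fun v w w' => by
      simp only [lieMetric, ← metricCLM_apply, map_add]; ring)
    (fun c v w => by
      simp only [lieMetric, ← metricCLM_apply, map_smul, smul_eq_mul]; ring)

/-- The trace and the stress are invariant under changes of frame, so the coordinate expression may
be evaluated in an orthonormal frame. -/
theorem chartStress_eq_stress {κ : Type*} [Fintype κ] [DecidableEq κ] {x₀ : M} {u : Eu n}
    (hu : u ∈ (Ψ n x₀).target)
    (b : OrthonormalBasis κ ℝ (TangentSpace (𝓡 n) ((Ψ n x₀).symm u)))
    (S : Eu n →ₗ[ℝ] Eu n →ₗ[ℝ] ℝ) (α : Form n M k) :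
    chartStress x₀ (Matrix.of fun i j => S (stdFrame n i) (stdFrame n j)) u (inChart α x₀ u) =
      1 / 2 * (Matrix.of fun c d => S (chartCoframe x₀ ((Ψ n x₀).symm u) (b c))
        (chartCoframe x₀ ((Ψ n x₀).symm u) (b d))).trace *
        covInner (α ((Ψ n x₀).symm u)) (α ((Ψ n x₀).symm u)) -
      stress b (Matrix.of fun c d => S (chartCoframe x₀ ((Ψ n x₀).symm u) (b c))
        (chartCoframe x₀ ((Ψ n x₀).symm u) (b d)))
        (α ((Ψ n x₀).symm u)) := by
  obtain ⟨h1, h2⟩ := stress_eq_sum_mpair b (chartBasis hu)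
    (S.compl₁₂ (chartCoframe x₀ ((Ψ n x₀).symm u)).toLinearMap
      (chartCoframe x₀ ((Ψ n x₀).symm u)).toLinearMap)
    (α ((Ψ n x₀).symm u))
  have hb : (chartBasis hu : Fin n → _) = fun i => chartFrame x₀ u (stdFrame n i) :=
    funext fun i => chartBasis_apply hu i
  have hg := gram_chartBasis hu
  rw [hb] at hg
  simp only [LinearMap.compl₁₂_apply, ContinuousLinearMap.coe_coe, hb, hg,
    chartCoframe_chartFrame hu] at h1 h2
  rw [chartStress, h1, h2, covInner_symm_eq _ _ hu]
  simp only [inChart, mpair_comp_left, mpair_comp_right]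

/-- The coordinate expression of a vector field. -/
def vecInChart (Y : ∀ x : M, TangentSpace (𝓡 n) x) (x₀ : M) (u : Eu n) : Eu n :=
  chartCoframe x₀ ((Ψ n x₀).symm u) (Y ((Ψ n x₀).symm u))

theorem contDiffOn_vecInChart {Y : ∀ x : M, TangentSpace (𝓡 n) x}
    (hY : ContMDiff (𝓡 n) (𝓡 n).tangent ∞ (fun x => (⟨x, Y x⟩ : TangentBundle (𝓡 n) M)))
    (x₀ : M) : ContDiffOn ℝ ∞ (vecInChart Y x₀) (Ψ n x₀).target :=
  (contMDiffOn_chartSection x₀).1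
    (hY.comp_contMDiffOn (contMDiffOn_extChartAt_symm (I := 𝓡 n) (n := ∞) x₀))

theorem fderiv_transition_vecInChart (Y : ∀ x : M, TangentSpace (𝓡 n) x) {x₁ x₀ : M} {u : Eu n}
    (hu : u ∈ overlap x₁ x₀) :
    fderiv ℝ (transition x₁ x₀) u (vecInChart Y x₁ u) =
      vecInChart Y x₀ (transition x₁ x₀ u) := by
  rw [← chartCoframe_chartFrame_transition hu, vecInChart, chartFrame_chartCoframe hu.1,
    vecInChart, symm_transition hu]

/-- The covariant derivative at a point is defined through the preferred chart at that very point,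
which varies; invariance of the Lie derivative transfers its symmetric part to one fixed chart. -/
theorem lieMetric_vecInChart {Y : ∀ x : M, TangentSpace (𝓡 n) x}
    (hY : ContMDiff (𝓡 n) (𝓡 n).tangent ∞ (fun x => (⟨x, Y x⟩ : TangentBundle (𝓡 n) M)))
    {x₀ : M} {u : Eu n} (hu : u ∈ (Ψ n x₀).target)
    (v w : TangentSpace (𝓡 n) ((Ψ n x₀).symm u)) :
    covDerivInner Y ((Ψ n x₀).symm u) v w +
      covDerivInner Y ((Ψ n x₀).symm u) w v =
    lieMetric x₀ (vecInChart Y x₀) u (chartCoframe x₀ ((Ψ n x₀).symm u) v)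
      (chartCoframe x₀ ((Ψ n x₀).symm u) w) := by
  set x := (Ψ n x₀).symm u with hx
  have hov : u ∈ overlap x₀ x := ⟨hu, mem_extChartAt_source (I := 𝓡 n) x⟩
  have htr : transition x₀ x u = Ψ n x x := rfl
  have hd := fun x₀ : M => contDiffOn_vecInChart hY x₀
  rw [covDerivInner_add_swap, lieMetric_transition hov
    (((hd x₀).contDiffAt ((isOpen_extChartAt_target x₀).mem_nhds hu)).differentiableAt (by simp))
    (((hd x).contDiffAt ((isOpen_extChartAt_target x).mem_nhds
      (transition_mem hov).1)).differentiableAt (by simp))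
    (by
      filter_upwards [(isOpen_overlap x₀ x).mem_nhds hov] with y hy
      exact fderiv_transition_vecInChart Y hy), ← chartCoframe_chartFrame_transition hov,
    ← chartCoframe_chartFrame_transition hov, chartFrame_chartCoframe hu,
    chartFrame_chartCoframe hu]
  rfl

/-- The integrand in the Price identity, in a chart. -/
theorem covInner_priceOp {Y : ∀ x : M, TangentSpace (𝓡 n) x}
    (hY : ContMDiff (𝓡 n) (𝓡 n).tangent ∞ (fun x => (⟨x, Y x⟩ : TangentBundle (𝓡 n) M)))
    {x₀ : M} {u : Eu n} (hu : u ∈ (Ψ n x₀).target) (α : Form n M k) :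
    covInner (α ((Ψ n x₀).symm u)) (priceOp Y ((Ψ n x₀).symm u)
      (α ((Ψ n x₀).symm u))) =
    -(1 / 2) * chartStress x₀ (lieGram x₀ (vecInChart Y x₀) u) u (inChart α x₀ u) := by
  set x := (Ψ n x₀).symm u with hx
  set C : Matrix _ _ ℝ := Matrix.of fun i j => covDerivInner Y x (frame x i) (frame x j) with hC
  have hsum : ∀ (s : Finset (Fin (Module.finrank ℝ (TangentSpace (𝓡 n) x))))
      (f : Fin (Module.finrank ℝ (TangentSpace (𝓡 n) x)) →
        (TangentSpace (𝓡 n) x) [⋀^Fin k]→L[ℝ] ℝ) (β : (TangentSpace (𝓡 n) x) [⋀^Fin k]→L[ℝ] ℝ),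
      covInner β (∑ i ∈ s, f i) = ∑ i ∈ s, covInner β (f i) := fun s f β => by
    induction s using Finset.induction_on with
    | empty => simp [covInner_zero_right]
    | insert a s ha ih => rw [Finset.sum_insert ha, Finset.sum_insert ha, covInner_add_right, ih]
  have h1 : lieGram x₀ (vecInChart Y x₀) u = Matrix.of fun i j =>
      lieBilin x₀ (vecInChart Y x₀) u (stdFrame n i) (stdFrame n j) := rfl
  -- In the orthonormal frame L_Y g is C + Cᵀ. Trace and stress take the same value on C and on Cᵀ,
  -- so the variation doubles Price's expression, with the opposite sign.
  have h2 : (Matrix.of fun c d => lieBilin x₀ (vecInChart Y x₀) u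
      (chartCoframe x₀ x (frame x c)) (chartCoframe x₀ x (frame x d))) = C + C.transpose := by
    ext c d
    exact (lieMetric_vecInChart hY hu (frame x c) (frame x d)).symm
  rw [h1, chartStress_eq_stress hu (frame x), h2, stress_add, stress_transpose, Matrix.trace_add,
    Matrix.trace_transpose, priceOp, covInner_add_right, covInner_smul_right]
  simp only [hsum, covInner_smul_right]
  have h3 := sum_covInner_extInt (frame x) C (α x)
  have h4 : divergence Y x = C.trace := rfl
  rw [h4, ← h3]
  simp only [hC, Matrix.of_apply]
  ring

theorem lieMetric_sum {ι : Type*} (s : Finset ι) {x₀ : M} {Y : ι → Eu n → Eu n} {u : Eu n}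
    (hu : u ∈ (Ψ n x₀).target) (hY : ∀ i ∈ s, DifferentiableAt ℝ (Y i) u)
    (v w : Eu n) :
    lieMetric x₀ (fun y => ∑ i ∈ s, Y i y) u v w = ∑ i ∈ s, lieMetric x₀ (Y i) u v w := by
  simp only [lieMetric, ← fderiv_chartMetric hu, ← metricCLM_apply]
  rw [fderiv_fun_sum hY]
  simp only [map_sum, sum_apply, sum_add_distrib]

theorem chartStress_sum {ι : Type*} (s : Finset ι) (x₀ : M)
    (S : ι → Matrix (Fin n) (Fin n) ℝ) (u : Eu n) (α : EuForm n k) :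
    chartStress x₀ (∑ i ∈ s, S i) u α = ∑ i ∈ s, chartStress x₀ (S i) u α := by
  classical
  induction s using Finset.induction_on with
  | empty => simp [chartStress_zero]
  | insert a s ha ih =>
    rw [Finset.sum_insert ha, Finset.sum_insert ha, ← ih]
    simp only [chartStress, mul_add, add_mul, Matrix.trace_add, mpair_update_add,
      sum_add_distrib]
    ring

theorem chartStress_congr {x₀ : M} {Y Y' : Eu n → Eu n} {u : Eu n} (h : Y =ᶠ[𝓝 u] Y') :
    lieGram x₀ Y u = lieGram x₀ Y' u := by
  ext i j
  simp only [lieGram, lieMetric, Matrix.of_apply, h.fderiv_eq, h.eq_of_nhds]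

theorem lieGram_zero {x₀ : M} {u : Eu n} (hu : u ∈ (Ψ n x₀).target) :
    lieGram x₀ (fun _ => 0) u = 0 := by
  ext i j
  change lieMetric x₀ (fun _ => 0) u (stdFrame n i) (stdFrame n j) = 0
  rw [lieMetric, ← fderiv_chartMetric hu, fderiv_const_apply, ← metricCLM_apply,
    ← metricCLM_apply]
  simp only [zero_apply, map_zero, add_zero]

variable [MeasurableSpace M] [BorelSpace M] [CompactSpace M] [T2Space M]

/-- The Price identity for vector fields supported in a coordinate ball. -/
theorem price_of_support {r D p : ℕ} {P : Fin D → Fin r → Fin r → ℝ} {h z : Fin r → Form n M p}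
    (hz : IsNonlinearHarmonic P h z) {x₀ : M} {c : Eu n} {R R' R₁ : ℝ} (hR : 0 < R) (hR₁ : R₁ < R)
    (hRR' : R < R') (hR' : closedBall c R' ⊆ (Ψ n x₀).target)
    {Y : ∀ x : M, TangentSpace (𝓡 n) x}
    (hY : ContMDiff (𝓡 n) (𝓡 n).tangent ∞ (fun x => (⟨x, Y x⟩ : TangentBundle (𝓡 n) M)))
    (hYs : ∀ x ∉ (Ψ n x₀).symm '' closedBall c R₁, Y x = 0) :
    Integrable (fun x => ∑ i, covInner (z i x) (priceOp Y x (z i x))) (riemVol n M) ∧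
    ∫ x, ∑ i, covInner (z i x) (priceOp Y x (z i x)) ∂(riemVol n M) = 0 := by
  classical
  set K := closedBall c R₁ with hKdef
  have hK : IsCompact K := isCompact_closedBall c R₁
  have hKR : K ⊆ ball c R := closedBall_subset_ball hR₁
  have hKt : K ⊆ (Ψ n x₀).target :=
    (closedBall_subset_closedBall (hR₁.trans hRR').le).trans hR'
  have hot := isOpen_extChartAt_target (I := 𝓡 n) x₀
  -- The components of Y extended by zero are smooth on the whole space, since they vanish off a
  -- compact subset of the target.
  set Y' : Eu n → Eu n := indicator (Ψ n x₀).target (vecInChart Y x₀) with hY'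
  have hY'K : ∀ u ∉ K, Y' u = 0 := fun u hu => by
    rw [hY', indicator_apply_eq_zero]
    intro hut
    rw [vecInChart, hYs _ ?_, map_zero]
    rintro ⟨v, hv, hvu⟩
    exact hu ((Ψ n x₀).symm.injOn (hKt hv) hut hvu ▸ hv)
  have heq : ∀ u ∈ (Ψ n x₀).target, Y' =ᶠ[𝓝 u] vecInChart Y x₀ := fun u hu => by
    filter_upwards [hot.mem_nhds hu] with v hv using indicator_of_mem hv _
  have hY's : ContDiff ℝ ∞ Y' := contDiff_iff_contDiffAt.2 fun u => by
    by_cases hu : u ∈ (Ψ n x₀).target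
    · exact ((contDiffOn_vecInChart hY x₀).contDiffAt (hot.mem_nhds hu)).congr_of_eventuallyEq
        (heq u hu)
    · refine (contDiffAt_const (c := (0 : Eu n))).congr_of_eventuallyEq ?_
      filter_upwards [hK.isClosed.isOpen_compl.mem_nhds fun hu' => hu (hKt hu')] with v hv
        using hY'K v hv
  obtain ⟨h1, h2⟩ := first_variation_chart hR hRR' hR' hK hKR hz hY's hY'K
  have hpt : ∀ u ∈ (Ψ n x₀).target, chartDensity x₀ u *
      ∑ i, covInner (z i ((Ψ n x₀).symm u)) (priceOp Y
        ((Ψ n x₀).symm u) (z i ((Ψ n x₀).symm u))) =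
      -(1 / 2) * (chartDensity x₀ u *
        ∑ i, chartStress x₀ (lieGram x₀ Y' u) u (inChart (z i) x₀ u)) := fun u hu => by
    simp only [covInner_priceOp hY hu, chartStress_congr (heq u hu), ← mul_sum]
    ring
  have hoff : ∀ x ∉ (Ψ n x₀).source,
      ∑ i, covInner (z i x) (priceOp Y x (z i x)) = 0 := fun x hx => by
    refine Finset.sum_eq_zero fun i _ => ?_
    have hxK : x ∉ (Ψ n x₀).symm '' K := by
      rintro ⟨v, hv, rfl⟩
      exact hx (mem_source_symm (hKt hv))
    have hxt := mem_extChartAt_target (I := 𝓡 n) x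
    have h3 := covInner_priceOp hY hxt (z i)
    -- The point lies off the closed image of `K`, so Y vanishes near it and its derivatives vanish
    -- as well.
    have h4 : vecInChart Y x =ᶠ[𝓝 (Ψ n x x)] fun _ => 0 := by
      have h5 := (isClosed_symm_image hK hKt).isOpen_compl.mem_nhds hxK
      have h6 := (continuousAt_extChartAt_symm (I := 𝓡 n) x)
      rw [ContinuousAt, extChartAt_to_inv] at h6
      filter_upwards [h6 h5] with v hv
      rw [vecInChart, hYs _ hv, map_zero]
    rw [chartStress_congr h4, lieGram_zero hxt, chartStress_zero, mul_zero] at h3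
    rwa [extChartAt_to_inv] at h3
  have hm := (isOpen_extChartAt_source (I := 𝓡 n) x₀).measurableSet
  have hint : IntegrableOn (fun x => ∑ i, covInner (z i x) (priceOp Y x (z i x)))
      (Ψ n x₀).source (riemVol n M) := by
    rw [integrable_chart_iff]
    exact IntegrableOn.congr_fun (h1.const_mul (-(1 / 2))) (fun u hu => (hpt u hu).symm)
      (measurableSet_target x₀)
  refine ⟨?_, ?_⟩
  · rw [← integrableOn_univ]
    exact hint.of_forall_sdiff_eq_zero MeasurableSet.univ fun x hx => hoff x hx.2
  · rw [← setIntegral_univ, setIntegral_eq_of_subset_of_forall_sdiff_eq_zero MeasurableSet.univ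
      (subset_univ (Ψ n x₀).source) fun x hx => hoff x hx.2, setIntegral_chart,
      setIntegral_congr_fun (measurableSet_target x₀) hpt, integral_const_mul, h2, mul_zero]

/-- The integrand is linear in Y, so a partition of unity reduces to fields supported in small
coordinate balls. Of the radii R < 2R < 3R the first contains the support, the second is the ball on
which primitives are taken, and the third leaves room for the cutoff used with the Poincaré lemma.
-/
theorem priceIdentity_of_isNonlinearHarmonic {r D p : ℕ} {P : Fin D → Fin r → Fin r → ℝ}
    {h z : Fin r → Form n M p} (hz : IsNonlinearHarmonic P h z) : PriceIdentity z := by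
  intro Y hY
  have hrad : ∀ x : M, ∃ R : ℝ, 0 < R ∧ closedBall (Ψ n x x) (3 * R) ⊆
      (Ψ n x).target := fun x => by
    obtain ⟨R, hR, hR'⟩ := Metric.nhds_basis_closedBall.mem_iff.1
      (extChartAt_target_mem_nhds (I := 𝓡 n) x)
    exact ⟨R / 3, by positivity, by rwa [mul_div_cancel₀ _ three_ne_zero]⟩
  choose R hR hRt using hrad
  set U : M → Set M := fun x => (Ψ n x).source ∩
    Ψ n x ⁻¹' ball (Ψ n x x) (R x) with hU
  have hUo : ∀ x, IsOpen (U x) := fun x =>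
    (continuousOn_extChartAt x).isOpen_inter_preimage (isOpen_extChartAt_source x)
      isOpen_ball
  have hUmem : ∀ x, x ∈ U x := fun x =>
    ⟨mem_extChartAt_source x, mem_ball_self (hR x)⟩
  obtain ⟨t, ht⟩ := isCompact_univ.elim_finite_subcover U hUo
    fun x _ => mem_iUnion.2 ⟨x, hUmem x⟩
  obtain ⟨f, hf⟩ := SmoothPartitionOfUnity.exists_isSubordinate (ι := t) (𝓡 n) isClosed_univ
    (fun x => U x) (fun x => hUo x) (by simpa [iUnion_subtype] using ht)
  have hfY : ∀ x : t, ContMDiff (𝓡 n) (𝓡 n).tangent ∞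
      (fun y => (⟨y, f x y • Y y⟩ : TangentBundle (𝓡 n) M)) := fun x =>
    ContMDiff.smul_section (f x).contMDiff hY
  have hloc := fun x : t => price_of_support hz (x₀ := (x : M)) (c := Ψ n (x : M) x)
    (R := 2 * R x) (R₁ := R x) (R' := 3 * R x) (by linarith [hR x]) (by linarith [hR x])
    (by linarith [hR x]) (hRt x) (hfY x) fun y hy => by
      have : y ∉ tsupport (f x) := fun h => by
        have h1 := hf x h
        exact hy ⟨Ψ n (x : M) y, ball_subset_closedBall h1.2,
          (Ψ n (x : M)).left_inv h1.1⟩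
      rw [image_eq_zero_of_notMem_tsupport this, zero_smul]
  have hpt : ∀ y, ∑ i, covInner (z i y) (priceOp Y y (z i y)) =
      ∑ x : t, ∑ i, covInner (z i y) (priceOp (fun y => f x y • Y y) y (z i y)) := fun y => by
    rw [sum_comm]
    refine sum_congr rfl fun i _ => ?_
    have hyt := mem_extChartAt_target (I := 𝓡 n) y
    have h1 := covInner_priceOp hY hyt (z i)
    have h2 := fun x : t => covInner_priceOp (hfY x) hyt (z i)
    rw [extChartAt_to_inv] at h1
    have h2' : ∀ x : t, covInner (z i y) (priceOp (fun y => f x y • Y y) y (z i y)) =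
        -(1 / 2) * chartStress y (lieGram y (vecInChart (fun y => f x y • Y y) y)
          (Ψ n y y)) (Ψ n y y)
          (inChart (z i) y (Ψ n y y)) := fun x => by
      have := h2 x
      rwa [extChartAt_to_inv] at this
    rw [h1]
    simp only [h2']
    rw [← mul_sum, ← chartStress_sum]
    congr 2
    -- The partition sums to 1, so the components of Y are the sum of those of the localised fields.
    have h3 : vecInChart Y y = fun u => ∑ x : t, vecInChart (fun y => f x y • Y y) y u := by
      funext u
      have h4 := f.sum_eq_one (mem_univ ((Ψ n y).symm u))
      rw [finsum_eq_sum_of_fintype] at h4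
      simp only [vecInChart, map_smul]
      rw [← Finset.sum_smul, h4, one_smul]
    rw [h3]
    ext a b
    rw [Matrix.sum_apply]
    exact lieMetric_sum _ hyt (fun x _ => (((contDiffOn_vecInChart (hfY x) y).contDiffAt
      ((isOpen_extChartAt_target y).mem_nhds hyt)).differentiableAt (by simp))) _ _
  simp only [hpt]
  refine ⟨integrable_finsetSum _ fun x _ => (hloc x).1, ?_⟩
  rw [integral_finsetSum _ fun x _ => (hloc x).1]
  exact Finset.sum_eq_zero fun x _ => (hloc x).2

end Price

end RiemannianManifold

/-! ### Estimates for the approximate radial field -/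

section MetricJet

variable {E : Type*} [NormedAddCommGroup E] [NormedSpace ℝ E]

/-- Uniform bounds on `K` for a metric `G`, whose first derivatives are `DG`. -/
structure MetricBound (G : E → E → E → ℝ) (DG : E → E → E → E → ℝ) (K : Set E) (c Λ : ℝ) :
    Prop where
  c_pos : 0 < c
  one_le : 1 ≤ Λ
  add : ∀ u ∈ K, ∀ v v' w, G u (v + v') w = G u v w + G u v' w
  smul : ∀ u ∈ K, ∀ (r : ℝ) v w, G u (r • v) w = r * G u v w
  symm : ∀ u ∈ K, ∀ v w, G u v w = G u w v
  dadd : ∀ u ∈ K, ∀ x x' v w, DG u (x + x') v w = DG u x v w + DG u x' v w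
  dsmul : ∀ u ∈ K, ∀ (r : ℝ) x v w, DG u (r • x) v w = r * DG u x v w
  dadd₂ : ∀ u ∈ K, ∀ x v v' w, DG u x (v + v') w = DG u x v w + DG u x v' w
  dsmul₂ : ∀ u ∈ K, ∀ (r : ℝ) x v w, DG u x (r • v) w = r * DG u x v w
  dsymm : ∀ u ∈ K, ∀ x v w, DG u x v w = DG u x w v
  lower : ∀ u ∈ K, ∀ w, c * ‖w‖ ^ 2 ≤ G u w w
  bound : ∀ u ∈ K, ∀ v w, |G u v w| ≤ Λ * ‖v‖ * ‖w‖
  dbound : ∀ u ∈ K, ∀ x v w, |DG u x v w| ≤ Λ * ‖x‖ * ‖v‖ * ‖w‖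
  lip : ∀ u ∈ K, ∀ u' ∈ K, ∀ v w, |G u v w - G u' v w| ≤ Λ * ‖u - u'‖ * ‖v‖ * ‖w‖
  dlip : ∀ u ∈ K, ∀ u' ∈ K, ∀ x v w,
    |DG u x v w - DG u' x v w| ≤ Λ * ‖u - u'‖ * ‖x‖ * ‖v‖ * ‖w‖
  taylor : ∀ u ∈ K, ∀ u' ∈ K, ∀ v w,
    |G u' v w - G u v w - DG u (u' - u) v w| ≤ Λ * ‖u' - u‖ ^ 2 * ‖v‖ * ‖w‖

/-- The Christoffel symbols at `a`, with their defining properties and a bound. -/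
structure IsChristoffel (G : E → E → E → ℝ) (DG : E → E → E → E → ℝ) (a : E) (B : ℝ)
    (Γ : E →L[ℝ] E →L[ℝ] E) : Prop where
  one_le : 1 ≤ B
  symm : ∀ v w, Γ v w = Γ w v
  bound : ∀ v w, ‖Γ v w‖ ≤ B * ‖v‖ * ‖w‖
  compat : ∀ v w w', DG a v w w' = G a (Γ v w) w' + G a w (Γ v w')

variable {G : E → E → E → ℝ} {DG : E → E → E → E → ℝ} {K : Set E} {c Λ B : ℝ} {a : E}
  {Γ : E →L[ℝ] E →L[ℝ] E}

theorem MetricBound.sub (h : MetricBound G DG K c Λ) {u : E} (hu : u ∈ K) (v v' w : E) :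
    G u (v - v') w = G u v w - G u v' w := by
  have := h.add u hu (v - v') v' w
  rw [sub_add_cancel] at this
  linarith

theorem MetricBound.sub_right (h : MetricBound G DG K c Λ) {u : E} (hu : u ∈ K) (v w w' : E) :
    G u v (w - w') = G u v w - G u v w' := by
  rw [h.symm u hu, h.sub hu, h.symm u hu w, h.symm u hu w']

theorem MetricBound.smul_right (h : MetricBound G DG K c Λ) {u : E} (hu : u ∈ K) (r : ℝ)
    (v w : E) : G u v (r • w) = r * G u v w := by
  rw [h.symm u hu, h.smul u hu, h.symm u hu w]

theorem MetricBound.dsub (h : MetricBound G DG K c Λ) {u : E} (hu : u ∈ K) (x x' v w : E) :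
    DG u (x - x') v w = DG u x v w - DG u x' v w := by
  have := h.dadd u hu (x - x') x' v w
  rw [sub_add_cancel] at this
  linarith

theorem MetricBound.dsub₂ (h : MetricBound G DG K c Λ) {u : E} (hu : u ∈ K) (x v v' w : E) :
    DG u x (v - v') w = DG u x v w - DG u x v' w := by
  have := h.dadd₂ u hu x (v - v') v' w
  rw [sub_add_cancel] at this
  linarith

theorem MetricBound.dsub₃ (h : MetricBound G DG K c Λ) {u : E} (hu : u ∈ K) (x v w w' : E) :
    DG u x v (w - w') = DG u x v w - DG u x v w' := by
  rw [h.dsymm u hu, h.dsub₂ hu, h.dsymm u hu x w, h.dsymm u hu x w']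

theorem MetricBound.dsmul₃ (h : MetricBound G DG K c Λ) {u : E} (hu : u ∈ K) (r : ℝ)
    (x v w : E) : DG u x v (r • w) = r * DG u x v w := by
  rw [h.dsymm u hu, h.dsmul₂ u hu, h.dsymm u hu x w]

/-- Koszul's formula defines a covector, which the nondegenerate form G_a turns into a vector.
Testing with the vector itself bounds it by 2Λ/c; the summand 1 makes the bound at least 1. -/
theorem MetricBound.exists_christoffel [FiniteDimensional ℝ E] (h : MetricBound G DG K c Λ)
    (ha : a ∈ K) : ∃ Γ : E →L[ℝ] E →L[ℝ] E, IsChristoffel G DG a (1 + 2 * Λ / c) Γ := by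
  have hc := h.c_pos
  have hΛ : 0 < Λ := zero_lt_one.trans_le h.one_le
  have hadd₃ : ∀ x v w w', DG a x v (w + w') = DG a x v w + DG a x v w' := fun x v w w' => by
    rw [h.dsymm a ha, h.dadd₂ a ha, h.dsymm a ha x w, h.dsymm a ha x w']
  let T : E →ₗ[ℝ] Module.Dual ℝ E := LinearMap.mk₂ ℝ (G a) (h.add a ha) (h.smul a ha)
    (fun v w w' => by rw [h.symm a ha, h.add a ha, h.symm a ha w, h.symm a ha w'])
    (fun r v w => h.smul_right ha r v w)
  have hinj : Function.Injective T := by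
    rw [← LinearMap.ker_eq_bot, LinearMap.ker_eq_bot']
    intro w hw
    have h1 := h.lower a ha w
    have h1' : G a w w = 0 := by
      have : T w w = 0 := by rw [hw]; rfl
      exact this
    rw [h1'] at h1
    have h2 : ‖w‖ ^ 2 ≤ 0 := by
      by_contra h3
      nlinarith [not_le.1 h3]
    exact norm_eq_zero.1 (pow_eq_zero_iff two_ne_zero |>.1 (le_antisymm h2 (sq_nonneg _)))
  let A : E ≃ₗ[ℝ] Module.Dual ℝ E :=
    LinearEquiv.ofInjectiveOfFinrankEq T hinj (Subspace.dual_finrank_eq (K := ℝ) (V := E)).symm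
  have hA : ∀ f w, G a (A.symm f) w = f w := fun f w => by
    have : A (A.symm f) w = f w := by rw [A.apply_symm_apply]
    exact this
  let k : E → E → Module.Dual ℝ E := fun v w =>
    { toFun := fun w' => 1 / 2 * (DG a v w w' + DG a w v w' - DG a w' v w)
      map_add' := fun x y => by rw [hadd₃, hadd₃, h.dadd a ha]; ring
      map_smul' := fun r x => by
        rw [h.dsmul₃ ha, h.dsmul₃ ha, h.dsmul a ha, smul_eq_mul, RingHom.id_apply]; ring }
  have hk : ∀ v w w', k v w w' = 1 / 2 * (DG a v w w' + DG a w v w' - DG a w' v w) :=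
    fun _ _ _ => rfl
  let Γ₀ : E →ₗ[ℝ] E →ₗ[ℝ] E := LinearMap.mk₂ ℝ (fun v w => A.symm (k v w))
    (fun v v' w => by
      rw [← map_add]; congr 1; ext w'
      rw [LinearMap.add_apply, hk, hk, hk, h.dadd a ha, h.dadd₂ a ha, h.dadd₂ a ha]; ring)
    (fun r v w => by
      rw [← map_smul]; congr 1; ext w'
      rw [LinearMap.smul_apply, hk, hk, h.dsmul a ha, h.dsmul₂ a ha, h.dsmul₂ a ha, smul_eq_mul]
      ring)
    (fun v w w₂ => by
      rw [← map_add]; congr 1; ext w'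
      rw [LinearMap.add_apply, hk, hk, hk, h.dadd a ha, h.dadd₂ a ha, hadd₃]; ring)
    (fun r v w => by
      rw [← map_smul]; congr 1; ext w'
      rw [LinearMap.smul_apply, hk, hk, h.dsmul a ha, h.dsmul₂ a ha, h.dsmul₃ ha, smul_eq_mul]
      ring)
  have hΓ₀ : ∀ v w w', G a (Γ₀ v w) w' = 1 / 2 * (DG a v w w' + DG a w v w' - DG a w' v w) :=
    fun v w w' => by
      change G a (A.symm (k v w)) w' = _
      rw [hA, hk]
  have hbd : ∀ v w, ‖Γ₀ v w‖ ≤ (1 + 2 * Λ / c) * ‖v‖ * ‖w‖ := fun v w => by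
    set y := Γ₀ v w with hy
    have h1 := h.lower a ha y
    rw [hΓ₀ v w y] at h1
    have h2 := (abs_le.1 (h.dbound a ha v w y)).2
    have h3 := (abs_le.1 (h.dbound a ha w v y)).2
    have h4 := (abs_le.1 (h.dbound a ha y v w)).1
    have h5 : c * ‖y‖ * ‖y‖ ≤ 2 * Λ * ‖v‖ * ‖w‖ * ‖y‖ := by
      have : 0 ≤ Λ * ‖v‖ * ‖w‖ * ‖y‖ := by positivity
      linarith
    rcases (norm_nonneg y).eq_or_lt with h0 | h0
    · rw [← h0]; positivity
    · have h6 : c * ‖y‖ ≤ 2 * Λ * ‖v‖ * ‖w‖ := le_of_mul_le_mul_right h5 h0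
      have h7 : ‖y‖ ≤ 2 * Λ * ‖v‖ * ‖w‖ / c := (le_div_iff₀' hc).2 h6
      have h8 : 0 ≤ ‖v‖ * ‖w‖ := by positivity
      calc ‖y‖ ≤ 2 * Λ * ‖v‖ * ‖w‖ / c := h7
        _ ≤ ‖v‖ * ‖w‖ + 2 * Λ * ‖v‖ * ‖w‖ / c := by linarith
        _ = _ := by ring
  refine ⟨LinearMap.mkContinuous₂ Γ₀ (1 + 2 * Λ / c) hbd, ?_, fun v w => ?_, hbd,
    fun v w w' => ?_⟩
  · have : 0 ≤ 2 * Λ / c := by positivity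
    linarith
  · change A.symm (k v w) = A.symm (k w v)
    congr 1
    ext w'
    rw [hk, hk, h.dsymm a ha w' v w]
    ring
  · change DG a v w w' = G a (Γ₀ v w) w' + G a w (Γ₀ v w')
    rw [h.symm a ha w, hΓ₀, hΓ₀, h.dsymm a ha w v w', h.dsymm a ha w' v w, h.dsymm a ha v w' w]
    ring

/-- The approximate radial field at `a`. -/
def radialField (a : E) (Γ : E →L[ℝ] E →L[ℝ] E) (u : E) : E :=
  (u - a) - (1 / 2 : ℝ) • Γ (u - a) (u - a)

theorem contDiff_radialField (a : E) (Γ : E →L[ℝ] E →L[ℝ] E) :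
    ContDiff ℝ ∞ (radialField a Γ) :=
  (contDiff_id.sub contDiff_const).sub (((Γ.contDiff.comp
    (contDiff_id.sub contDiff_const)).clm_apply (contDiff_id.sub contDiff_const)).const_smul _)

/-- Normal coordinates at a are x = (u - a) + ½Γ(u - a, u - a) up to third order. Written in u,
their radial field is (u - a) - ½Γ(u - a, u - a) to second order; by symmetry of Γ the quadratic
term contributes Γ(u - a, w) to the differential. -/
theorem IsChristoffel.fderiv_radialField (hΓ : IsChristoffel G DG a B Γ) (u w : E) :
    fderiv ℝ (radialField a Γ) u w = w - Γ (u - a) w := by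
  have h1 : HasFDerivAt (fun u : E => u - a) (ContinuousLinearMap.id ℝ E) u :=
    (hasFDerivAt_id u).sub_const a
  have h2 := (h1.sub (((Γ.hasFDerivAt.comp u h1).clm_apply h1).const_smul (1 / 2 : ℝ)))
  have h3 : fderiv ℝ (radialField a Γ) u = _ := h2.fderiv
  rw [h3]
  simp only [sub_apply, smul_apply, add_apply, ContinuousLinearMap.comp_apply,
    ContinuousLinearMap.flip_apply, ContinuousLinearMap.id_apply, Function.comp_apply]
  rw [hΓ.symm w, ← two_smul ℝ (Γ (u - a) w), smul_smul]
  norm_num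

theorem IsChristoffel.norm_radialField_sub_le (hΓ : IsChristoffel G DG a B Γ) (u : E) :
    ‖radialField a Γ u - (u - a)‖ ≤ B / 2 * ‖u - a‖ ^ 2 := by
  rw [radialField, sub_sub_cancel_left, norm_neg, norm_smul]
  have := hΓ.bound (u - a) (u - a)
  rw [Real.norm_of_nonneg (by norm_num)]
  nlinarith

theorem IsChristoffel.norm_radialField_le (hΓ : IsChristoffel G DG a B Γ) {u : E}
    (hu : ‖u - a‖ ≤ 1) : ‖radialField a Γ u‖ ≤ (1 + B) * ‖u - a‖ := by
  have h1 := hΓ.norm_radialField_sub_le u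
  have h2 := norm_le_insert' (radialField a Γ u) (u - a)
  have h3 := hΓ.one_le
  nlinarith [norm_nonneg (u - a), mul_nonneg (by linarith : (0 : ℝ) ≤ B) (norm_nonneg (u - a))]

/-- The Lie derivative of the metric along the radial field is twice the metric, to second order. -/
theorem MetricBound.lie_radialField (h : MetricBound G DG K c Λ) (hΓ : IsChristoffel G DG a B Γ)
    (ha : a ∈ K) {u : E} (hu : u ∈ K) (hδ : ‖u - a‖ ≤ 1) (w w' : E) :
    |DG u (radialField a Γ u) w w' + G u (fderiv ℝ (radialField a Γ) u w) w' +
      G u w (fderiv ℝ (radialField a Γ) u w') - 2 * G u w w'| ≤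
    Λ * (1 + 4 * B) * ‖u - a‖ ^ 2 * ‖w‖ * ‖w'‖ := by
  have hΛ : 0 < Λ := zero_lt_one.trans_le h.one_le
  have hB : 0 < B := zero_lt_one.trans_le hΓ.one_le
  set v := u - a with hv
  set X := radialField a Γ u with hX
  have hXn : ‖X‖ ≤ (1 + B) * ‖v‖ := hΓ.norm_radialField_le hδ
  have hXv : ‖X - v‖ ≤ B / 2 * ‖v‖ ^ 2 := hΓ.norm_radialField_sub_le u
  have h1 := h.dlip u hu a ha X w w'
  have h2 := h.dbound a ha (X - v) w w'
  have h3 := h.lip u hu a ha (Γ v w) w'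
  have h4 := h.lip u hu a ha w (Γ v w')
  have h5 := hΓ.compat v w w'
  rw [hΓ.fderiv_radialField, hΓ.fderiv_radialField]
  -- Metric compatibility of Γ cancels the terms of first order in v = u - a. What is left compares
  -- u with a, or X with v, each time multiplied by a quantity of the right size, and is of second
  -- order.
  have h6 : DG u X w w' + G u (w - Γ v w) w' + G u w (w' - Γ v w') - 2 * G u w w' =
      (DG u X w w' - DG a X w w') + DG a (X - v) w w' -
        (G u (Γ v w) w' - G a (Γ v w) w') - (G u w (Γ v w') - G a w (Γ v w')) := by
    rw [h.sub hu, h.sub_right hu, h.dsub ha, h5]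
    ring
  rw [h6]
  have e1 : Λ * ‖v‖ * ‖X‖ * ‖w‖ * ‖w'‖ ≤ Λ * ‖v‖ * ((1 + B) * ‖v‖) * ‖w‖ * ‖w'‖ := by gcongr
  have e2 : Λ * ‖X - v‖ * ‖w‖ * ‖w'‖ ≤ Λ * (B / 2 * ‖v‖ ^ 2) * ‖w‖ * ‖w'‖ := by gcongr
  have e3 : Λ * ‖v‖ * ‖Γ v w‖ * ‖w'‖ ≤ Λ * ‖v‖ * (B * ‖v‖ * ‖w‖) * ‖w'‖ := by
    gcongr; exact hΓ.bound v w
  have e4 : Λ * ‖v‖ * ‖w‖ * ‖Γ v w'‖ ≤ Λ * ‖v‖ * ‖w‖ * (B * ‖v‖ * ‖w'‖) := by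
    gcongr; exact hΓ.bound v w'
  have e5 : 0 ≤ Λ * B * ‖v‖ ^ 2 * ‖w‖ * ‖w'‖ := by positivity
  rw [abs_le] at h1 h2 h3 h4 ⊢
  constructor <;> linarith

/-- The derivative of the squared norm of the radial field. -/
theorem MetricBound.fderiv_normSq_radialField (h : MetricBound G DG K c Λ)
    (hΓ : IsChristoffel G DG a B Γ) (ha : a ∈ K) {u : E} (hu : u ∈ K) (hδ : ‖u - a‖ ≤ 1) (w : E) :
    |DG u w (radialField a Γ u) (radialField a Γ u) +
      2 * G u (fderiv ℝ (radialField a Γ) u w) (radialField a Γ u) -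
        2 * G u w (radialField a Γ u)| ≤ 7 * Λ * (1 + B) ^ 2 * ‖u - a‖ ^ 3 * ‖w‖ := by
  have hΛ : 0 < Λ := zero_lt_one.trans_le h.one_le
  have hB : 0 < B := zero_lt_one.trans_le hΓ.one_le
  set v := u - a with hv
  set X := radialField a Γ u with hX
  have hXn : ‖X‖ ≤ (1 + B) * ‖v‖ := hΓ.norm_radialField_le hδ
  have hXv : ‖X - v‖ ≤ B / 2 * ‖v‖ ^ 2 := hΓ.norm_radialField_sub_le u
  have h1 := h.dlip u hu a ha w X X
  have h2 := h.dbound a ha w (X - v) X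
  have h2' := h.dbound a ha w v (X - v)
  have h3 := h.lip u hu a ha (Γ v w) X
  have h4 := h.bound a ha (Γ v w) (X - v)
  have h5 : DG a w v v = 2 * G a (Γ v w) v := by
    rw [hΓ.compat, h.symm a ha v, hΓ.symm w v]
    ring
  rw [hΓ.fderiv_radialField]
  -- The same cancellation leaves five terms of third order in v. They occur with weights 1, 1, 1,
  -- 2, 2, whence the constant 7.
  have h6 : DG u w X X + 2 * G u (w - Γ v w) X - 2 * G u w X =
      (DG u w X X - DG a w X X) + DG a w (X - v) X +
        DG a w v (X - v) - 2 * (G u (Γ v w) X - G a (Γ v w) X) -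
        2 * G a (Γ v w) (X - v) := by
    rw [h.sub hu, h.sub_right ha, h.dsub₂ ha, h.dsub₃ ha w v, h5]
    ring
  rw [h6]
  have hΓb := hΓ.bound v w
  set q := (1 + B) with hq
  have hq1 : B / 2 ≤ q := by rw [hq]; linarith
  have hq2 : B ≤ q := by rw [hq]; linarith
  have hq3 : 1 ≤ q := by rw [hq]; linarith
  have hXv' : ‖X - v‖ ≤ q * ‖v‖ ^ 2 := hXv.trans (by gcongr)
  have hΓb' : ‖Γ v w‖ ≤ q * ‖v‖ * ‖w‖ := hΓb.trans (by gcongr)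
  have e1 : Λ * ‖v‖ * ‖w‖ * ‖X‖ * ‖X‖ ≤ Λ * ‖v‖ * ‖w‖ * (q * ‖v‖) * (q * ‖v‖) := by gcongr
  have e2 : Λ * ‖w‖ * ‖X - v‖ * ‖X‖ ≤ Λ * ‖w‖ * (q * ‖v‖ ^ 2) * (q * ‖v‖) := by gcongr
  have e2' : Λ * ‖w‖ * ‖v‖ * ‖X - v‖ ≤ Λ * ‖w‖ * (q * ‖v‖) * (q * ‖v‖ ^ 2) := by
    gcongr
    exact le_mul_of_one_le_left (norm_nonneg _) hq3
  have e3 : Λ * ‖v‖ * ‖Γ v w‖ * ‖X‖ ≤ Λ * ‖v‖ * (q * ‖v‖ * ‖w‖) * (q * ‖v‖) := by gcongr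
  have e4 : Λ * ‖Γ v w‖ * ‖X - v‖ ≤ Λ * (q * ‖v‖ * ‖w‖) * (q * ‖v‖ ^ 2) := by gcongr
  rw [abs_le] at h1 h2 h2' h3 h4 ⊢
  constructor <;> linarith

/-- Moving against the radial field contracts lengths. -/
theorem MetricBound.contraction (h : MetricBound G DG K c Λ) (hΓ : IsChristoffel G DG a B Γ)
    (ha : a ∈ K) {u : E} (hu : u ∈ K) (hδ : ‖u - a‖ ≤ 1) {s : ℝ} (hs0 : 0 ≤ s) (hs1 : s ≤ 1)
    (hus : u - s • radialField a Γ u ∈ K) (w : E) :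
    G (u - s • radialField a Γ u) (w - s • fderiv ℝ (radialField a Γ) u w)
      (w - s • fderiv ℝ (radialField a Γ) u w) ≤
    (1 - 2 * s + s * (Λ * (1 + 4 * B) / c * ‖u - a‖ ^ 2) + s ^ 2 * (9 * Λ * (2 + B) ^ 4 / c)) *
      G u w w := by
  have hΛ : 0 < Λ := zero_lt_one.trans_le h.one_le
  have hB : 0 < B := zero_lt_one.trans_le hΓ.one_le
  have hc := h.c_pos
  have hlie := (abs_le.1 (h.lie_radialField hΓ ha hu hδ w w)).1
  set v := u - a with hv
  set X := radialField a Γ u with hX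
  set w₁ := fderiv ℝ (radialField a Γ) u w with hw₁
  have hXn : ‖X‖ ≤ 2 + B := (hΓ.norm_radialField_le hδ).trans (by nlinarith [norm_nonneg v])
  have hw₁n : ‖w₁‖ ≤ (2 + B) * ‖w‖ := by
    rw [hw₁, hΓ.fderiv_radialField]
    refine (norm_sub_le _ _).trans ?_
    have h1 := hΓ.bound v w
    have h2 : B * ‖v‖ * ‖w‖ ≤ B * 1 * ‖w‖ := by gcongr
    nlinarith [norm_nonneg w]
  set q := 2 + B with hq
  have hq1 : 1 ≤ q := by rw [hq]; linarith
  set η := w - s • w₁ with hη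
  have hηn : ‖η‖ ≤ (2 * q) * ‖w‖ := by
    refine (norm_sub_le _ _).trans ?_
    rw [norm_smul, Real.norm_of_nonneg hs0]
    have : s * ‖w₁‖ ≤ 1 * (q * ‖w‖) := by gcongr
    nlinarith [norm_nonneg w]
  have ht := (abs_le.1 (h.taylor u hu _ hus η η)).2
  have hneg : u - s • X - u = (-s) • X := by rw [sub_sub_cancel_left, neg_smul]
  rw [hneg, norm_smul, norm_neg, Real.norm_of_nonneg hs0, h.dsmul u hu] at ht
  have h1 : G u η η = G u w w - 2 * s * G u w₁ w + s ^ 2 * G u w₁ w₁ := by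
    rw [hη, h.sub hu, h.sub_right hu, h.sub_right hu, h.smul u hu, h.smul u hu, h.smul_right hu,
      h.smul_right hu, h.symm u hu w w₁]
    ring
  have h2 : DG u X η η = DG u X w w - s * DG u X w₁ w -
      s * DG u X η w₁ := by
    rw [hη, h.dsub₂ hu X _ _ (w - s • w₁), h.dsub₃ hu X w, h.dsub₃ hu X (s • w₁),
      h.dsub₂ hu X w (s • w₁) w₁, h.dsmul₃ hu, h.dsmul₃ hu, h.dsmul₂ u hu, h.dsmul₂ u hu,
      h.dsymm u hu X w w₁]
    ring
  have h3 := (abs_le.1 (h.bound u hu w₁ w₁)).2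
  have h4 := (abs_le.1 (h.dbound u hu X w₁ w)).2
  have h5 := (abs_le.1 (h.dbound u hu X η w₁)).2
  have e1 : Λ * (s * ‖X‖) ^ 2 * ‖η‖ * ‖η‖ ≤
      Λ * (s * q) ^ 2 * (2 * q * ‖w‖) * (2 * q * ‖w‖) := by gcongr
  have e3 : Λ * ‖w₁‖ * ‖w₁‖ ≤ Λ * (q * ‖w‖) * (q * ‖w‖) := by gcongr
  have e4 : Λ * ‖X‖ * ‖w₁‖ * ‖w‖ ≤ Λ * q * (q * ‖w‖) * ‖w‖ := by gcongr
  have e5 : Λ * ‖X‖ * ‖η‖ * ‖w₁‖ ≤ Λ * q * (2 * q * ‖w‖) * (q * ‖w‖) := by gcongr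
  -- To first order in s the pulled back metric is G minus s times its Lie derivative along X, which
  -- is 2G up to a multiple of ‖u - a‖²; all remaining terms carry s².
  have hmain : G (u - s • X) η η ≤ G u w w - s * (2 * G u w w) +
      s * (Λ * (1 + 4 * B) * ‖v‖ ^ 2 * ‖w‖ * ‖w‖) + s ^ 2 * (9 * Λ * q ^ 4 * ‖w‖ ^ 2) := by
    have hqq : q ^ 2 ≤ q ^ 4 := pow_le_pow_right₀ hq1 (by norm_num)
    have hqq' : q ^ 3 ≤ q ^ 4 := pow_le_pow_right₀ hq1 (by norm_num)
    have f1 : G (u - s • X) η η ≤ G u w w - s * (DG u X w w + 2 * G u w₁ w) +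
        s ^ 2 * (Λ * (q * ‖w‖) * (q * ‖w‖) + Λ * q * (q * ‖w‖) * ‖w‖ +
          Λ * q * (2 * q * ‖w‖) * (q * ‖w‖) + Λ * q ^ 2 * (2 * q * ‖w‖) * (2 * q * ‖w‖)) := by
      have g1 := mul_le_mul_of_nonneg_left (h3.trans e3) (sq_nonneg s)
      have g2 := mul_le_mul_of_nonneg_left (h4.trans e4) (sq_nonneg s)
      have g3 := mul_le_mul_of_nonneg_left (h5.trans e5) (sq_nonneg s)
      have g4 : G (u - s • X) η η ≤ G u η η - s * DG u X η η +
          Λ * (s * q) ^ 2 * (2 * q * ‖w‖) * (2 * q * ‖w‖) := by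
        linarith
      rw [h1, h2] at g4
      linarith
    -- Since q ≥ 1, each term is a multiple of q⁴; the weights 1, 1, 2, 4 add up to less than 9.
    have f2 : Λ * (q * ‖w‖) * (q * ‖w‖) + Λ * q * (q * ‖w‖) * ‖w‖ +
          Λ * q * (2 * q * ‖w‖) * (q * ‖w‖) + Λ * q ^ 2 * (2 * q * ‖w‖) * (2 * q * ‖w‖) ≤
        9 * Λ * q ^ 4 * ‖w‖ ^ 2 := by
      have g1 : 0 ≤ Λ * ‖w‖ ^ 2 := by positivity
      have g2 : 0 ≤ Λ * ‖w‖ ^ 2 * q ^ 4 := by positivity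
      linarith [mul_le_mul_of_nonneg_left hqq g1, mul_le_mul_of_nonneg_left hqq' g1]
    have f3 := mul_le_mul_of_nonneg_left f2 (sq_nonneg s)
    have f4 := mul_le_mul_of_nonneg_left hlie hs0
    rw [h.symm u hu w w₁] at f4
    linarith
  have hlow := h.lower u hu w
  have hw2 : ‖w‖ ^ 2 ≤ G u w w / c := (le_div_iff₀' hc).2 hlow
  have k1 : Λ * (1 + 4 * B) * ‖v‖ ^ 2 * ‖w‖ * ‖w‖ ≤ Λ * (1 + 4 * B) * ‖v‖ ^ 2 * (G u w w / c) := by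
    rw [mul_assoc _ ‖w‖ ‖w‖, ← sq]
    gcongr
  have k2 : 9 * Λ * q ^ 4 * ‖w‖ ^ 2 ≤ 9 * Λ * q ^ 4 * (G u w w / c) := by gcongr
  calc _ ≤ _ := hmain
    _ ≤ G u w w - s * (2 * G u w w) + s * (Λ * (1 + 4 * B) * ‖v‖ ^ 2 * (G u w w / c)) +
        s ^ 2 * (9 * Λ * q ^ 4 * (G u w w / c)) := by gcongr
    _ = _ := by ring

end MetricJet

section MetricManifold

variable {n : ℕ} {M : Type*} [MetricSpace M] [ChartedSpace (Eu n) M] [IsManifold (𝓡 n) ∞ M]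
  [RiemannianBundle (fun x : M => TangentSpace (𝓡 n) x)]
  [IsContMDiffRiemannianBundle (𝓡 n) ∞ (Eu n) (fun x : M => TangentSpace (𝓡 n) x)]

/-! ### Lengths of curves and the distance in a chart -/

section ChartPaths

/-- The length of a vector in the metric at `u`. -/
def chartNorm (x₀ : M) (u w : Eu n) : ℝ := √(chartMetric x₀ u w w)

theorem chartNorm_eq (x₀ : M) (u w : Eu n) : chartNorm x₀ u w = ‖chartFrame x₀ u w‖ := by
  rw [chartNorm, chartMetric, norm_eq_sqrt_real_inner]

theorem chartNorm_nonneg (x₀ : M) (u w : Eu n) : 0 ≤ chartNorm x₀ u w := Real.sqrt_nonneg _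

theorem continuousOn_chartMetric (x₀ : M) {X : Type*} [TopologicalSpace X] {c w : X → Eu n}
    {s : Set X} (hc : ContinuousOn c s) (hw : ContinuousOn w s)
    (hcs : ∀ t ∈ s, c t ∈ (Ψ n x₀).target) :
    ContinuousOn (fun t => chartMetric x₀ (c t) (w t) (w t)) s := by
  have h1 : ContinuousOn (fun t => metricCLM x₀ (c t)) s :=
    (contDiffOn_metricCLM x₀).continuousOn.comp hc hcs
  exact (h1.clm_apply hw).clm_apply hw

theorem mfderiv_symm_comp {x₀ : M} {c : ℝ → Eu n} {t : ℝ} (hc : DifferentiableAt ℝ c t)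
    (ht : c t ∈ (Ψ n x₀).target) :
    mfderiv 𝓘(ℝ, ℝ) (𝓡 n) (fun s => (Ψ n x₀).symm (c s)) t (1 : ℝ) =
      chartFrame x₀ (c t) (deriv c t) := by
  have h := mfderiv_comp (I := 𝓘(ℝ, ℝ)) (I' := 𝓘(ℝ, Eu n)) (I'' := 𝓡 n) t
    (g := (Ψ n x₀).symm) (f := c) (mdifferentiableAt_symm ht)
    hc.mdifferentiableAt
  have h2 : mfderiv 𝓘(ℝ, ℝ) (𝓡 n) (fun s => (Ψ n x₀).symm (c s)) t = _ := h
  rw [h2, mfderiv_eq_fderiv]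
  rfl

theorem lintegral_chartNorm {x₀ : M} {c : ℝ → Eu n} {U : Set ℝ} (hU : IsOpen U)
    (hUI : Icc 0 1 ⊆ U) (hc : ContDiffOn ℝ 1 c U)
    (ht : ∀ t ∈ Icc (0 : ℝ) 1, c t ∈ (Ψ n x₀).target) :
    Manifold.pathELength (𝓡 n) (fun s => (Ψ n x₀).symm (c s)) 0 1 =
      ENNReal.ofReal (∫ t in (0 : ℝ)..1, chartNorm x₀ (c t) (deriv c t)) ∧
    ContinuousOn (fun t => chartNorm x₀ (c t) (deriv c t)) (Icc 0 1) := by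
  have hcont : ContinuousOn (fun t => chartNorm x₀ (c t) (deriv c t)) (Icc 0 1) :=
    Real.continuous_sqrt.comp_continuousOn (continuousOn_chartMetric x₀ (hc.continuousOn.mono hUI)
      ((hc.continuousOn_deriv_of_isOpen hU le_rfl).mono hUI) ht)
  refine ⟨?_, hcont⟩
  rw [Manifold.pathELength_eq_lintegral_mfderiv_Icc,
    intervalIntegral.integral_of_le zero_le_one, ← integral_Icc_eq_integral_Ioc,
    ofReal_integral_eq_lintegral_ofReal (hcont.integrableOn_Icc)
      (ae_of_all _ fun t => chartNorm_nonneg _ _ _)]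
  refine setLIntegral_congr_fun measurableSet_Icc fun t hI => ?_
  have := mfderiv_symm_comp (x₀ := x₀) ((hc.contDiffAt (hU.mem_nhds (hUI hI))).differentiableAt
    one_ne_zero) (ht t hI)
  refine Eq.trans (b := ‖chartFrame x₀ (c t) (deriv c t)‖ₑ) ?_ ?_
  · exact congrArg (fun v : TangentSpace (𝓡 n) ((Ψ n x₀).symm (c t)) => ‖v‖ₑ) this
  · rw [chartNorm_eq, ofReal_norm]

variable [IsRiemannianManifold (𝓡 n) M]

/-- The distance is at most the length of a curve in a chart. -/
theorem dist_le_integral_chartNorm {x₀ : M} {c : ℝ → Eu n} {U : Set ℝ} (hU : IsOpen U)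
    (hUI : Icc 0 1 ⊆ U) (hc : ContDiffOn ℝ 1 c U)
    (ht : ∀ t ∈ Icc (0 : ℝ) 1, c t ∈ (Ψ n x₀).target) :
    dist ((Ψ n x₀).symm (c 0)) ((Ψ n x₀).symm (c 1)) ≤
      ∫ t in (0 : ℝ)..1, chartNorm x₀ (c t) (deriv c t) := by
  have h1 : ContMDiffOn 𝓘(ℝ, ℝ) (𝓡 n) 1 (fun s => (Ψ n x₀).symm (c s)) (Icc 0 1) :=
    ((contMDiffOn_extChartAt_symm (n := ∞) x₀).of_le (by simp)).comp
      ((hc.mono hUI).contMDiffOn) ht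
  have h2 := Manifold.riemannianEDist_le_pathELength h1 rfl rfl zero_le_one
  rw [(lintegral_chartNorm hU hUI hc ht).1, ← IsRiemannianManifold.out (I := 𝓡 n),
    edist_dist] at h2
  exact (ENNReal.ofReal_le_ofReal_iff (intervalIntegral.integral_nonneg zero_le_one
    fun t _ => chartNorm_nonneg _ _ _)).1 h2

/-- The distance is the infimum of lengths, so some C¹ curve has length below L. Its points remain
at distance less than L from the start, hence in the chart domain. The open set around [0,1]
provides honest derivatives at the endpoints. -/
theorem exists_chart_curve {x₀ : M} {a u : Eu n} (ha : a ∈ (Ψ n x₀).target)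
    (hu : u ∈ (Ψ n x₀).target) {L : ℝ}
    (hL : dist ((Ψ n x₀).symm a) ((Ψ n x₀).symm u) < L)
    (hball : ball ((Ψ n x₀).symm a) L ⊆ (Ψ n x₀).source) :
    ∃ (c : ℝ → Eu n) (U : Set ℝ), IsOpen U ∧ Icc 0 1 ⊆ U ∧ ContDiffOn ℝ 1 c U ∧ c 0 = a ∧ c 1 = u ∧
      (∀ t ∈ Icc (0 : ℝ) 1, c t ∈ (Ψ n x₀).target ∧
        dist ((Ψ n x₀).symm a) ((Ψ n x₀).symm (c t)) < L) ∧
      ∫ t in (0 : ℝ)..1, chartNorm x₀ (c t) (deriv c t) < L := by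
  have hL0 : 0 < L := dist_nonneg.trans_lt hL
  have h1 : Manifold.riemannianEDist (𝓡 n) ((Ψ n x₀).symm a)
      ((Ψ n x₀).symm u) < ENNReal.ofReal L := by
    rw [← IsRiemannianManifold.out (I := 𝓡 n), edist_dist]
    exact (ENNReal.ofReal_lt_ofReal_iff hL0).2 hL
  obtain ⟨γ, hγ0, hγ1, hγ, hlen, -⟩ :=
    Manifold.exists_lt_locally_constant_of_riemannianEDist_lt h1 (zero_lt_one (α := ℝ))
  have hd : ∀ t ∈ Icc (0 : ℝ) 1, dist ((Ψ n x₀).symm a) (γ t) < L := fun t ht => by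
    have h2 := Manifold.riemannianEDist_le_pathELength (a := 0) (b := t) hγ.contMDiffOn hγ0 rfl ht.1
    have h3 := (h2.trans (Manifold.pathELength_mono le_rfl ht.2)).trans_lt hlen
    rw [← IsRiemannianManifold.out (I := 𝓡 n), edist_dist] at h3
    exact (ENNReal.ofReal_lt_ofReal_iff hL0).1 h3
  have hsrc : ∀ t ∈ Icc (0 : ℝ) 1, γ t ∈ (Ψ n x₀).source := fun t ht =>
    hball (by rw [mem_ball, dist_comm]; exact hd t ht)
  have hU : IsOpen (γ ⁻¹' (Ψ n x₀).source) :=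
    (isOpen_extChartAt_source x₀).preimage hγ.continuous
  have hleft : ∀ t ∈ γ ⁻¹' (Ψ n x₀).source,
      (Ψ n x₀).symm (Ψ n x₀ (γ t)) = γ t := fun t ht =>
    (Ψ n x₀).left_inv ht
  have hc : ContDiffOn ℝ 1 (fun t => Ψ n x₀ (γ t))
      (γ ⁻¹' (Ψ n x₀).source) := by
    rw [← contMDiffOn_iff_contDiffOn]
    refine ((contMDiffOn_extChartAt (n := ∞)).of_le (by simp)).comp hγ.contMDiffOn fun t ht => ?_
    rw [← extChartAt_source (𝓡 n)]
    exact ht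
  have hct : ∀ t ∈ Icc (0 : ℝ) 1, Ψ n x₀ (γ t) ∈ (Ψ n x₀).target :=
    fun t ht => (Ψ n x₀).map_source (hsrc t ht)
  refine ⟨fun t => Ψ n x₀ (γ t), _, hU, hsrc, hc, ?_, ?_, fun t ht =>
    ⟨hct t ht, ?_⟩, ?_⟩
  · change Ψ n x₀ (γ 0) = a
    rw [hγ0, (Ψ n x₀).right_inv ha]
  · change Ψ n x₀ (γ 1) = u
    rw [hγ1, (Ψ n x₀).right_inv hu]
  · rw [hleft t (hsrc t ht)]
    exact hd t ht
  · have h4 := (lintegral_chartNorm hU hsrc hc hct).1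
    rw [Manifold.pathELength_congr (γ' := γ) fun t ht => hleft t (hsrc t ht)] at h4
    rw [h4] at hlen
    exact (ENNReal.ofReal_lt_ofReal_iff hL0).1 hlen

/-- A differentiable map whose differential is bounded by `κ` in the metric is `κ`-Lipschitz for
the distance. -/
theorem norm_sub_le_dist {F : Type*} [NormedAddCommGroup F] [NormedSpace ℝ F] {x₀ : M}
    {a u : Eu n} (ha : a ∈ (Ψ n x₀).target) (hu : u ∈ (Ψ n x₀).target)
    {L : ℝ} (hL : dist ((Ψ n x₀).symm a) ((Ψ n x₀).symm u) < L)
    (hball : ball ((Ψ n x₀).symm a) L ⊆ (Ψ n x₀).source)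
    {f : Eu n → F} {κ : ℝ} (hκ : 0 ≤ κ)
    (hf : ∀ y ∈ (Ψ n x₀).target,
      dist ((Ψ n x₀).symm a) ((Ψ n x₀).symm y) < L →
      DifferentiableAt ℝ f y ∧ ∀ w, ‖fderiv ℝ f y w‖ ≤ κ * chartNorm x₀ y w) :
    ‖f u - f a‖ ≤ κ * L := by
  obtain ⟨c, U, hU, hUI, hc, h0, h1, hct, hlen⟩ := exists_chart_curve ha hu hL hball
  have hcont := (lintegral_chartNorm hU hUI hc fun t ht => (hct t ht).1).2
  have hcd : ∀ t ∈ Icc (0 : ℝ) 1, HasDerivAt (fun s => f (c s) - f a)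
      (fderiv ℝ f (c t) (deriv c t)) t := fun t ht =>
    (((hf _ (hct t ht).1 (hct t ht).2).1.hasFDerivAt).comp_hasDerivAt t
      ((hc.contDiffAt (hU.mem_nhds (hUI ht))).differentiableAt one_ne_zero).hasDerivAt).sub_const _
  -- The speed is continued by constants outside [0,1], so that its primitive is differentiable at
  -- every t.
  let g : ℝ → ℝ := fun t => chartNorm x₀ (c (projIcc 0 1 zero_le_one t))
    (deriv c (projIcc 0 1 zero_le_one t))
  have hg : Continuous g := (continuousOn_iff_continuous_domRestrict.1 hcont).comp continuous_projIcc
  have hgt : ∀ t ∈ Icc (0 : ℝ) 1, g t = chartNorm x₀ (c t) (deriv c t) := fun t ht => by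
    simp only [g, projIcc_of_mem zero_le_one ht]
  have hB : ∀ t, HasDerivAt (fun t => κ * ∫ s in (0 : ℝ)..t, g s) (κ * g t) t := fun t =>
    (intervalIntegral.integral_hasDerivAt_right (hg.intervalIntegrable _ _)
      (hg.stronglyMeasurableAtFilter _ _) hg.continuousAt).const_mul κ
  have hmain := image_norm_le_of_norm_deriv_right_le_deriv_boundary
    (f := fun s => f (c s) - f a) (a := 0) (b := 1) (f' := fun t => fderiv ℝ f (c t) (deriv c t))
    (fun t ht => (hcd t ht).continuousAt.continuousWithinAt)
    (fun t ht => (hcd t ⟨ht.1, ht.2.le⟩).hasDerivWithinAt)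
    (B := fun t => κ * ∫ s in (0 : ℝ)..t, g s) (B' := fun t => κ * g t)
    (by simp [h0]) hB
    (fun t ht => by
      have ht' : t ∈ Icc (0 : ℝ) 1 := ⟨ht.1, ht.2.le⟩
      rw [hgt t ht']
      exact (hf _ (hct t ht').1 (hct t ht').2).2 _)
    (right_mem_Icc.2 zero_le_one)
  rw [h1] at hmain
  refine hmain.trans (mul_le_mul_of_nonneg_left ?_ hκ)
  rw [intervalIntegral.integral_congr (g := fun t => chartNorm x₀ (c t) (deriv c t))
    fun t ht => hgt t (by rwa [uIcc_of_le zero_le_one] at ht)]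
  exact hlen.le

/-- A map whose differential has norm at most `κ` in the metric is `κ`-Lipschitz for the
distance. -/
theorem dist_map_le_dist {x₀ : M} {a u : Eu n} (ha : a ∈ (Ψ n x₀).target)
    (hu : u ∈ (Ψ n x₀).target) {L : ℝ}
    (hL : dist ((Ψ n x₀).symm a) ((Ψ n x₀).symm u) < L)
    (hball : ball ((Ψ n x₀).symm a) L ⊆ (Ψ n x₀).source)
    {f : Eu n → Eu n} (hfd : ContDiff ℝ 1 f) {κ : ℝ} (hκ : 0 ≤ κ)
    (hf : ∀ y ∈ (Ψ n x₀).target,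
      dist ((Ψ n x₀).symm a) ((Ψ n x₀).symm y) < L →
      f y ∈ (Ψ n x₀).target ∧
        ∀ w, chartNorm x₀ (f y) (fderiv ℝ f y w) ≤ κ * chartNorm x₀ y w) :
    dist ((Ψ n x₀).symm (f a)) ((Ψ n x₀).symm (f u)) ≤ κ * L := by
  obtain ⟨c, U, hU, hUI, hc, h0, h1, hct, hlen⟩ := exists_chart_curve ha hu hL hball
  have hcont := (lintegral_chartNorm hU hUI hc fun t ht => (hct t ht).1).2
  have hfc : ContDiffOn ℝ 1 (fun t => f (c t)) U := hfd.comp_contDiffOn hc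
  have hft : ∀ t ∈ Icc (0 : ℝ) 1, f (c t) ∈ (Ψ n x₀).target := fun t ht =>
    (hf _ (hct t ht).1 (hct t ht).2).1
  have hcont' := (lintegral_chartNorm hU hUI hfc hft).2
  have h2 := dist_le_integral_chartNorm hU hUI hfc hft
  simp only [h0, h1] at h2
  have h3 : ∀ t ∈ Icc (0 : ℝ) 1, chartNorm x₀ (f (c t)) (deriv (fun t => f (c t)) t) ≤
      κ * chartNorm x₀ (c t) (deriv c t) := fun t ht => by
    have h4 : deriv (fun t => f (c t)) t = fderiv ℝ f (c t) (deriv c t) :=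
      (((hfd.differentiable one_ne_zero _).hasFDerivAt).comp_hasDerivAt t
        ((hc.contDiffAt (hU.mem_nhds (hUI ht))).differentiableAt one_ne_zero).hasDerivAt).deriv
    rw [h4]
    exact (hf _ (hct t ht).1 (hct t ht).2).2 _
  rw [← uIcc_of_le zero_le_one] at hcont hcont'
  have h5 := intervalIntegral.integral_mono_on (μ := volume) zero_le_one hcont'.intervalIntegrable
    (hcont.intervalIntegrable.const_mul κ) h3
  rw [intervalIntegral.integral_const_mul] at h5
  exact h2.trans (h5.trans (mul_le_mul_of_nonneg_left hlen.le hκ))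

/-- The distance between two points of a chart is at most the length of the segment. -/
theorem dist_symm_le_segment {x₀ : M} {u u' : Eu n} {κ : ℝ}
    (h : ∀ y ∈ segment ℝ u u', y ∈ (Ψ n x₀).target ∧
      chartNorm x₀ y (u' - u) ≤ κ) :
    dist ((Ψ n x₀).symm u) ((Ψ n x₀).symm u') ≤ κ := by
  have hc : ContDiff ℝ 1 (fun t : ℝ => u + t • (u' - u)) :=
    contDiff_const.add (contDiff_id.smul contDiff_const)
  have hd : ∀ t, deriv (fun t : ℝ => u + t • (u' - u)) t = u' - u := fun t => by
    have := (((hasDerivAt_id t).smul_const (u' - u)).const_add u).deriv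
    rwa [one_smul] at this
  have hseg : ∀ t ∈ Icc (0 : ℝ) 1, u + t • (u' - u) ∈ segment ℝ u u' := fun t ht => by
    rw [segment_eq_image']
    exact ⟨t, ht, rfl⟩
  have h1 := dist_le_integral_chartNorm (x₀ := x₀) isOpen_univ (subset_univ _) hc.contDiffOn
    fun t ht => (h _ (hseg t ht)).1
  have hcont := (lintegral_chartNorm (x₀ := x₀) isOpen_univ (subset_univ _) hc.contDiffOn
    fun t ht => (h _ (hseg t ht)).1).2
  rw [← uIcc_of_le zero_le_one] at hcont
  have h2 := intervalIntegral.integral_mono_on (μ := volume) zero_le_one hcont.intervalIntegrable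
    (intervalIntegrable_const (c := κ)) fun t ht => by
      rw [hd]
      exact (h _ (hseg t ht)).2
  simp only [zero_smul, add_zero, one_smul, add_sub_cancel] at h1
  refine h1.trans (h2.trans_eq ?_)
  simp

end ChartPaths

/-! ### Uniform bounds for smooth maps on compact convex sets -/

section JetBounds

theorem exists_lip_bound {E F : Type*} [NormedAddCommGroup E] [NormedSpace ℝ E]
    [NormedAddCommGroup F] [NormedSpace ℝ F] {f : E → F} {U K : Set E} (hU : IsOpen U)
    (hf : ContDiffOn ℝ ∞ f U) (hK : IsCompact K) (hKc : Convex ℝ K) (hKU : K ⊆ U) :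
    ∃ C : ℝ, (∀ u ∈ K, ‖f u‖ ≤ C) ∧ ∀ u ∈ K, ∀ u' ∈ K, ‖f u - f u'‖ ≤ C * ‖u - u'‖ := by
  have hf1 : ContDiffOn ℝ ∞ (fderiv ℝ f) U := hf.fderiv_of_isOpen hU (by simp)
  obtain ⟨C0, h0⟩ := hK.exists_bound_of_continuousOn (hf.continuousOn.mono hKU)
  obtain ⟨C1, h1⟩ := hK.exists_bound_of_continuousOn (hf1.continuousOn.mono hKU)
  exact ⟨max C0 C1, fun u hu => (h0 u hu).trans (le_max_left _ _), fun u hu u' hu' =>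
    hKc.norm_image_sub_le_of_norm_fderiv_le
      (fun x hx => (hf.contDiffAt (hU.mem_nhds (hKU hx))).differentiableAt (by simp))
      (fun x hx => (h1 x hx).trans (le_max_right _ _)) hu' hu⟩

/-- Values and first two derivatives are bounded by compactness, and convexity turns these into
Lipschitz bounds. The Taylor bound is the mean value inequality for the map minus its linear part,
on the segment. -/
theorem exists_jet_bound {E F : Type*} [NormedAddCommGroup E] [NormedSpace ℝ E]
    [NormedAddCommGroup F] [NormedSpace ℝ F] {f : E → F} {U K : Set E} (hU : IsOpen U)
    (hf : ContDiffOn ℝ ∞ f U) (hK : IsCompact K) (hKc : Convex ℝ K) (hKU : K ⊆ U) :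
    ∃ Λ : ℝ, 1 ≤ Λ ∧ (∀ u ∈ K, ‖f u‖ ≤ Λ ∧ ‖fderiv ℝ f u‖ ≤ Λ) ∧ ∀ u ∈ K, ∀ u' ∈ K,
      ‖f u - f u'‖ ≤ Λ * ‖u - u'‖ ∧ ‖fderiv ℝ f u - fderiv ℝ f u'‖ ≤ Λ * ‖u - u'‖ ∧
      ‖f u' - f u - fderiv ℝ f u (u' - u)‖ ≤ Λ * ‖u' - u‖ ^ 2 := by
  obtain ⟨C0, h0, h0'⟩ := exists_lip_bound hU hf hK hKc hKU
  obtain ⟨C1, h1, h1'⟩ := exists_lip_bound hU (hf.fderiv_of_isOpen hU (m := ∞) (by simp)) hK hKc hKU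
  set Λ := max 1 (max C0 C1)
  have l0 : C0 ≤ Λ := (le_max_left _ _).trans (le_max_right _ _)
  have l1 : C1 ≤ Λ := (le_max_right _ _).trans (le_max_right _ _)
  have hlip : ∀ u ∈ K, ∀ u' ∈ K, ‖fderiv ℝ f u - fderiv ℝ f u'‖ ≤ Λ * ‖u - u'‖ :=
    fun u hu u' hu' => (h1' u hu u' hu').trans (by gcongr)
  refine ⟨Λ, le_max_left _ _, fun u hu => ⟨(h0 u hu).trans l0, (h1 u hu).trans l1⟩,
    fun u hu u' hu' => ⟨(h0' u hu u' hu').trans (by gcongr), hlip u hu u' hu', ?_⟩⟩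
  have hs : segment ℝ u u' ⊆ K := hKc.segment_subset hu hu'
  have : ‖f u' - f u - fderiv ℝ f u (u' - u)‖ ≤ Λ * ‖u' - u‖ * ‖u' - u‖ := by
    refine (convex_segment u u').norm_image_sub_le_of_norm_fderiv_le'
      (fun x hx => (hf.contDiffAt (hU.mem_nhds (hKU (hs hx)))).differentiableAt (by simp))
      (fun x hx => ?_) (left_mem_segment ℝ u u') (right_mem_segment ℝ u u')
    refine (hlip x (hs hx) u hu).trans (mul_le_mul_of_nonneg_left ?_
      (zero_le_one.trans (le_max_left _ _)))
    rw [← dist_eq_norm, ← dist_eq_norm, dist_comm x, dist_comm u']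
    have := dist_add_dist_of_mem_segment hx
    linarith [dist_nonneg (x := x) (y := u')]
  rwa [mul_assoc, ← sq] at this

end JetBounds

/-! ### Uniform bounds for the metric in a chart -/

section ChartBounds

variable {n : ℕ} {M : Type*} [TopologicalSpace M] [ChartedSpace (Eu n) M] [IsManifold (𝓡 n) ∞ M]
  [RiemannianBundle (fun x : M => TangentSpace (𝓡 n) x)]
  [IsContMDiffRiemannianBundle (𝓡 n) ∞ (Eu n) (fun x : M => TangentSpace (𝓡 n) x)]

/-- The derivative of the metric in a chart. -/
def chartMetricDeriv (x₀ : M) (u x v w : Eu n) : ℝ := fderiv ℝ (metricCLM x₀) u x v w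

theorem abs_bilin_le {n : ℕ} (A : Eu n →L[ℝ] Eu n →L[ℝ] ℝ) {C : ℝ} (h : ‖A‖ ≤ C) (v w : Eu n) :
    |A v w| ≤ C * ‖v‖ * ‖w‖ := by
  refine (A.le_opNorm₂ v w).trans ?_
  gcongr

theorem exists_chartMetric_lower {x₀ : M} {K : Set (Eu n)} (hK : IsCompact K)
    (hKt : K ⊆ (Ψ n x₀).target) :
    ∃ c : ℝ, 0 < c ∧ ∀ u ∈ K, ∀ w, c * ‖w‖ ^ 2 ≤ chartMetric x₀ u w w := by
  have hcont : ContinuousOn (fun q : Eu n × Eu n => chartMetric x₀ q.1 q.2 q.2)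
      (K ×ˢ Metric.sphere (0 : Eu n) 1) := by
    have h1 : ContinuousOn (fun q : Eu n × Eu n => metricCLM x₀ q.1)
        (K ×ˢ Metric.sphere (0 : Eu n) 1) :=
      (contDiffOn_metricCLM x₀).continuousOn.comp continuousOn_fst fun q hq => hKt hq.1
    exact (h1.clm_apply continuousOn_snd).clm_apply continuousOn_snd
  have hpos : ∀ q ∈ K ×ˢ Metric.sphere (0 : Eu n) 1, 0 < chartMetric x₀ q.1 q.2 q.2 :=
    fun q hq => chartMetric_pos (hKt hq.1) (norm_ne_zero_iff.1 (by
      rw [mem_sphere_zero_iff_norm.1 hq.2]; exact one_ne_zero))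
  obtain ⟨c, hc, hcb⟩ : ∃ c : ℝ, 0 < c ∧ ∀ q ∈ K ×ˢ Metric.sphere (0 : Eu n) 1,
      c ≤ chartMetric x₀ q.1 q.2 q.2 := by
    rcases (K ×ˢ Metric.sphere (0 : Eu n) 1).eq_empty_or_nonempty with h | h
    · exact ⟨1, one_pos, fun q hq => by rw [h] at hq; exact hq.elim⟩
    · obtain ⟨q₀, hq₀, hmin⟩ := (hK.prod (isCompact_sphere _ _)).exists_isMinOn h hcont
      exact ⟨_, hpos q₀ hq₀, fun q hq => hmin hq⟩
  refine ⟨c, hc, fun u hu w => ?_⟩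
  by_cases hw : w = 0
  · rw [hw, ← metricCLM_apply]
    simp
  · have h1 := hcb (u, ‖w‖⁻¹ • w) ⟨hu, by
      rw [mem_sphere_zero_iff_norm, norm_smul, norm_inv, norm_norm,
        inv_mul_cancel₀ (norm_ne_zero_iff.2 hw)]⟩
    have h2 : chartMetric x₀ u w w =
        ‖w‖ ^ 2 * chartMetric x₀ u (‖w‖⁻¹ • w) (‖w‖⁻¹ • w) := by
      have : w = ‖w‖ • (‖w‖⁻¹ • w) := by
        rw [smul_smul, mul_inv_cancel₀ (norm_ne_zero_iff.2 hw), one_smul]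
      conv_lhs => rw [this]
      rw [chartMetric, map_smul, inner_smul_left, inner_smul_right, chartMetric]
      simp only [RCLike.conj_to_real]
      ring
    rw [h2, mul_comm]
    exact mul_le_mul_of_nonneg_left h1 (sq_nonneg _)

theorem exists_metricBound {x₀ : M} {K : Set (Eu n)} (hK : IsCompact K) (hKc : Convex ℝ K)
    (hKt : K ⊆ (Ψ n x₀).target) :
    ∃ c Λ : ℝ, MetricBound (chartMetric (n := n) x₀) (chartMetricDeriv x₀) K c Λ := by
  obtain ⟨c, hc, hlow⟩ := exists_chartMetric_lower hK hKt
  obtain ⟨Λ, h1, hb, hl⟩ := exists_jet_bound (isOpen_extChartAt_target x₀)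
    (contDiffOn_metricCLM (n := n) x₀) hK hKc hKt
  have hd : ∀ u ∈ K, ∀ x v w, chartMetricDeriv x₀ u x v w =
      fderiv ℝ (fun y => chartMetric x₀ y v w) u x := fun u hu x v w =>
    (fderiv_chartMetric (hKt hu) x v w).symm
  refine ⟨c, Λ, hc, h1, fun u hu v v' w => ?_, fun u hu r v w => ?_,
    fun u hu v w => chartMetric_comm x₀ u v w, fun u hu x x' v w => ?_, fun u hu r x v w => ?_,
    fun u hu x v v' w => congrArg (fun f : Eu n →L[ℝ] ℝ => f w)
      (ContinuousLinearMap.map_add (fderiv ℝ (metricCLM x₀) u x) v v'),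
    fun u hu r x v w => congrArg (fun f : Eu n →L[ℝ] ℝ => f w)
      (ContinuousLinearMap.map_smul (fderiv ℝ (metricCLM x₀) u x) r v),
    fun u hu x v w => ?_, hlow, fun u hu v w => abs_bilin_le (metricCLM x₀ u) (hb u hu).1 v w,
    fun u hu x v w => abs_bilin_le _ (ContinuousLinearMap.le_of_opNorm_le _ (hb u hu).2 x) v w,
    fun u hu u' hu' v w => abs_bilin_le (metricCLM x₀ u - metricCLM x₀ u') (hl u hu u' hu').1 v w,
    fun u hu u' hu' x v w => abs_bilin_le
      ((fderiv ℝ (metricCLM x₀) u - fderiv ℝ (metricCLM x₀) u') x)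
      (ContinuousLinearMap.le_of_opNorm_le _ (hl u hu u' hu').2.1 x) v w,
    fun u hu u' hu' v w => abs_bilin_le (metricCLM x₀ u' - metricCLM x₀ u -
      fderiv ℝ (metricCLM x₀) u (u' - u)) (hl u hu u' hu').2.2 v w⟩
  · rw [chartMetric, map_add, inner_add_left]; rfl
  · rw [chartMetric, map_smul, inner_smul_left]; rfl
  · rw [hd u hu, hd u hu, hd u hu, map_add]
  · rw [hd u hu, hd u hu, map_smul, smul_eq_mul]
  · rw [hd u hu, hd u hu]
    simp only [chartMetric_comm x₀ _ v w]

end ChartBounds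

/-! ### Comparison of the radial field with the distance -/

section RadialBounds

/-- The distance to the point with coordinates `a`, in a chart. -/
def chartDist (x₀ : M) (a u : Eu n) : ℝ :=
  dist ((Ψ n x₀).symm a) ((Ψ n x₀).symm u)

/-- The distance to `a` is comparable on `K` to the function whose gradient is the field `X`, up
to errors of higher order. -/
structure IsRadial (x₀ : M) (K : Set (Eu n)) (a : Eu n) (X : Eu n → Eu n) (ρ C s₀ : ℝ) :
    Prop where
  contDiff : ContDiff ℝ ∞ X
  chartNorm_le : ∀ u ∈ (Ψ n x₀).target, chartDist x₀ a u < ρ →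
    chartNorm x₀ u (X u) ≤ (1 + C * chartDist x₀ a u ^ 2) * chartDist x₀ a u
  dist_le : ∀ u ∈ (Ψ n x₀).target, chartDist x₀ a u < ρ → ∀ s, 0 ≤ s → s ≤ s₀ →
    chartDist x₀ a (u - s • X u) ≤
      (1 - s + C * s * chartDist x₀ a u ^ 2 + C * s ^ 2) * chartDist x₀ a u
  lie_le : ∀ u ∈ (Ψ n x₀).target, chartDist x₀ a u < ρ → ∀ v w,
    |lieMetric x₀ X u v w - 2 * chartMetric x₀ u v w| ≤
      C * chartDist x₀ a u ^ 2 * ‖v‖ * ‖w‖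
  lip : ∀ u ∈ K, ∀ u' ∈ K, ‖X u - X u'‖ ≤ C * ‖u - u'‖

/-- Minimising curves need not be available, so estimates are obtained for every length L exceeding
the distance; letting L decrease removes the excess. -/
theorem le_of_forall_gt_continuous {f : ℝ → ℝ} (hf : Continuous f) {x r ρ : ℝ} (hr : r < ρ)
    (h : ∀ L, r < L → L < ρ → x ≤ f L) : x ≤ f r :=
  ge_of_tendsto ((hf.tendsto r).mono_left nhdsWithin_le_nhds)
    (Filter.eventually_of_mem (Ioo_mem_nhdsGT hr) fun L hL => h L hL.1 hL.2)

theorem MetricBound.norm_le {x₀ : M} {K : Set (Eu n)} {c Λ : ℝ}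
    (h : MetricBound (chartMetric (n := n) x₀) (chartMetricDeriv x₀) K c Λ) {u : Eu n}
    (hu : u ∈ K) (w : Eu n) : ‖w‖ ≤ (√c)⁻¹ * chartNorm x₀ u w := by
  have hc : 0 < √c := Real.sqrt_pos.2 h.c_pos
  rw [inv_mul_eq_div, le_div_iff₀ hc, chartNorm]
  refine Real.le_sqrt_of_sq_le ?_
  rw [mul_pow, Real.sq_sqrt h.c_pos.le, mul_comm]
  exact h.lower u hu w

theorem MetricBound.chartNorm_le {x₀ : M} {K : Set (Eu n)} {c Λ : ℝ}
    (h : MetricBound (chartMetric (n := n) x₀) (chartMetricDeriv x₀) K c Λ) {u : Eu n}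
    (hu : u ∈ K) (w : Eu n) : chartNorm x₀ u w ≤ Λ * ‖w‖ := by
  have h1 := (abs_le.1 (h.bound u hu w w)).2
  have hΛ := h.one_le
  refine Real.sqrt_le_iff.2 ⟨by positivity, h1.trans ?_⟩
  have : 0 ≤ ‖w‖ ^ 2 := sq_nonneg _
  linarith [mul_nonneg (mul_nonneg (by linarith : (0 : ℝ) ≤ Λ) (sub_nonneg.2 hΛ)) this]

/-- The square norms at two points differ by Λ‖u - u₀‖‖w‖². Bounding one factor ‖w‖ by the norm at
u₀ and completing the square gives an additive error. It permits freezing the norm at one point when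
mollifying. -/
theorem MetricBound.chartNorm_le_add {x₀ : M} {K : Set (Eu n)} {c Λ : ℝ}
    (h : MetricBound (chartMetric (n := n) x₀) (chartMetricDeriv x₀) K c Λ) {u u₀ : Eu n}
    (hu : u ∈ K) (hu₀ : u₀ ∈ K) (w : Eu n) :
    chartNorm x₀ u w ≤ chartNorm x₀ u₀ w + Λ * (√c)⁻¹ * ‖u - u₀‖ * ‖w‖ := by
  have h1 := (abs_le.1 (h.lip u hu u₀ hu₀ w w)).2
  have h2 := h.norm_le hu₀ w
  have hΛ := h.one_le
  have h3 := chartNorm_nonneg x₀ u₀ w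
  have h4 : chartNorm x₀ u₀ w ^ 2 = chartMetric x₀ u₀ w w := by
    rw [chartNorm, Real.sq_sqrt (show 0 ≤ chartMetric x₀ u₀ w w from real_inner_self_nonneg)]
  refine Real.sqrt_le_iff.2 ⟨by positivity, ?_⟩
  have h5 : Λ * ‖u - u₀‖ * ‖w‖ * ‖w‖ ≤
      Λ * ‖u - u₀‖ * ‖w‖ * ((√c)⁻¹ * chartNorm x₀ u₀ w) := by gcongr
  have h6 : 0 ≤ Λ * ‖u - u₀‖ * ‖w‖ * ((√c)⁻¹ * chartNorm x₀ u₀ w) := by positivity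
  linarith [sq_nonneg (Λ * (√c)⁻¹ * ‖u - u₀‖ * ‖w‖)]

theorem fderiv_normSq_field {x₀ : M} {X : Eu n → Eu n} {u : Eu n}
    (hu : u ∈ (Ψ n x₀).target) (hX : DifferentiableAt ℝ X u) :
    DifferentiableAt ℝ (fun y => chartMetric x₀ y (X y) (X y)) u ∧
      ∀ w, fderiv ℝ (fun y => chartMetric x₀ y (X y) (X y)) u w =
        chartMetricDeriv x₀ u w (X u) (X u) + 2 * chartMetric x₀ u (fderiv ℝ X u w) (X u) := by
  have h : HasFDerivAt (metricCLM (n := n) x₀) (fderiv ℝ (metricCLM x₀) u) u :=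
    (((contDiffOn_metricCLM x₀).contDiffAt ((isOpen_extChartAt_target x₀).mem_nhds hu)
      ).differentiableAt (by simp)).hasFDerivAt
  have h2 := (h.clm_apply hX.hasFDerivAt).clm_apply hX.hasFDerivAt
  refine ⟨h2.differentiableAt, fun w => ?_⟩
  have h3 : fderiv ℝ (fun y => chartMetric x₀ y (X y) (X y)) u w =
      chartMetric x₀ u (X u) (fderiv ℝ X u w) + (chartMetric x₀ u (fderiv ℝ X u w) (X u) +
        chartMetricDeriv x₀ u w (X u) (X u)) := congrArg (fun T : Eu n →L[ℝ] ℝ => T w) h2.fderiv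
  rw [h3, chartMetric_comm x₀ u (X u)]
  ring

variable [IsRiemannianManifold (𝓡 n) M]

theorem MetricBound.abs_chartDist_sub_le {x₀ : M} {K : Set (Eu n)} {c Λ : ℝ}
    (h : MetricBound (chartMetric (n := n) x₀) (chartMetricDeriv x₀) K c Λ)
    (hKt : K ⊆ (Ψ n x₀).target) (a : Eu n) {u u' u₀ : Eu n} (hu₀ : u₀ ∈ K) {Δ : ℝ}
    (hseg : segment ℝ u u' ⊆ K ∩ closedBall u₀ Δ) :
    |chartDist x₀ a u' - chartDist x₀ a u| ≤
      chartNorm x₀ u₀ (u' - u) + Λ * (√c)⁻¹ * Δ * ‖u' - u‖ := by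
  have h1 : dist ((Ψ n x₀).symm u) ((Ψ n x₀).symm u') ≤
      chartNorm x₀ u₀ (u' - u) + Λ * (√c)⁻¹ * Δ * ‖u' - u‖ := by
    refine dist_symm_le_segment fun y hy => ⟨hKt (hseg hy).1, ?_⟩
    refine (h.chartNorm_le_add (hseg hy).1 hu₀ _).trans ?_
    have h2 : ‖y - u₀‖ ≤ Δ := by
      rw [← dist_eq_norm]; exact (hseg hy).2
    have := h.one_le
    gcongr
  refine (?_ : _ ≤ _).trans h1
  rw [chartDist, chartDist, dist_comm _ ((Ψ n x₀).symm u'),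
    dist_comm _ ((Ψ n x₀).symm u),
    dist_comm ((Ψ n x₀).symm u) ((Ψ n x₀).symm u')]
  exact abs_dist_sub_le _ _ _

theorem MetricBound.abs_chartDist_sub_le' {x₀ : M} {K : Set (Eu n)} {c Λ : ℝ}
    (h : MetricBound (chartMetric (n := n) x₀) (chartMetricDeriv x₀) K c Λ)
    (hKt : K ⊆ (Ψ n x₀).target) (hKc : Convex ℝ K) (a : Eu n) {u u' : Eu n}
    (hu : u ∈ K) (hu' : u' ∈ K) :
    |chartDist x₀ a u' - chartDist x₀ a u| ≤ Λ * ‖u' - u‖ := by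
  have h1 : dist ((Ψ n x₀).symm u) ((Ψ n x₀).symm u') ≤ Λ * ‖u' - u‖ :=
    dist_symm_le_segment fun y hy => ⟨hKt (hKc.segment_subset hu hu' hy),
      h.chartNorm_le (hKc.segment_subset hu hu' hy) _⟩
  refine (?_ : _ ≤ _).trans h1
  rw [chartDist, chartDist, dist_comm _ ((Ψ n x₀).symm u'),
    dist_comm _ ((Ψ n x₀).symm u),
    dist_comm ((Ψ n x₀).symm u) ((Ψ n x₀).symm u')]
  exact abs_dist_sub_le _ _ _

theorem MetricBound.norm_sub_le_chartDist {x₀ : M} {K : Set (Eu n)} {c Λ ρ : ℝ}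
    (h : MetricBound (chartMetric (n := n) x₀) (chartMetricDeriv x₀) K c Λ) {a : Eu n}
    (ha : a ∈ (Ψ n x₀).target)
    (hball : ball ((Ψ n x₀).symm a) ρ ⊆ (Ψ n x₀).source)
    (hρ : ∀ u ∈ (Ψ n x₀).target, chartDist x₀ a u < ρ → u ∈ K)
    {u : Eu n} (hu : u ∈ (Ψ n x₀).target) (hur : chartDist x₀ a u < ρ) :
    ‖u - a‖ ≤ (√c)⁻¹ * chartDist x₀ a u := by
  refine le_of_forall_gt_continuous (f := fun L => (√c)⁻¹ * L) (by fun_prop) hur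
    fun L hL hLρ => ?_
  refine norm_sub_le_dist (f := fun y => y) ha hu hL ((ball_subset_ball hLρ.le).trans hball)
    (by positivity) fun y hy hyL => ⟨differentiableAt_id, fun w => ?_⟩
  have : fderiv ℝ (fun y : Eu n => y) y w = w := by rw [fderiv_fun_id]; rfl
  rw [this]
  exact h.norm_le (hρ y hy (hyL.trans hLρ)) w

/-- The function √(|X|² + δ²) is integrated along a nearly minimising curve from a, where X
vanishes. Its differential has norm at most 1 + O(L²) because that of |X|² is 2⟨X,·⟩ up to third
order. The parameter δ avoids dividing by zero and tends to 0. -/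
theorem MetricBound.chartNorm_radialField_le {x₀ : M} {K : Set (Eu n)} {c Λ B ρ : ℝ}
    (h : MetricBound (chartMetric (n := n) x₀) (chartMetricDeriv x₀) K c Λ) {a : Eu n}
    {Γ : Eu n →L[ℝ] Eu n →L[ℝ] Eu n}
    (hΓ : IsChristoffel (chartMetric x₀) (chartMetricDeriv x₀) a B Γ) (haK : a ∈ K)
    (ha : a ∈ (Ψ n x₀).target)
    (hball : ball ((Ψ n x₀).symm a) ρ ⊆ (Ψ n x₀).source)
    (hρ : ∀ u ∈ (Ψ n x₀).target, chartDist x₀ a u < ρ → u ∈ K)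
    (hρB : (√c)⁻¹ * ρ ≤ B⁻¹)
    {u : Eu n} (hu : u ∈ (Ψ n x₀).target) (hur : chartDist x₀ a u < ρ) :
    chartNorm x₀ u (radialField a Γ u) ≤
      (1 + 7 * Λ * (1 + B) ^ 2 * (√c)⁻¹ ^ 4 * chartDist x₀ a u ^ 2) *
        chartDist x₀ a u := by
  set κ := (√c)⁻¹ with hκ
  have hc : 0 < √c := Real.sqrt_pos.2 h.c_pos
  have hκ0 : 0 < κ := inv_pos.2 hc
  set C₃ := 7 * Λ * (1 + B) ^ 2 with hC₃
  have hΛ : 0 < Λ := zero_lt_one.trans_le h.one_le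
  have hB1 := hΓ.one_le
  have hC₃0 : 0 ≤ C₃ := by positivity
  set X := radialField a Γ with hX
  refine le_of_forall_gt_continuous (f := fun L => (1 + C₃ * κ ^ 4 * L ^ 2) * L) (by fun_prop) hur
    fun L hL hLρ => le_of_forall_pos_le_add fun δ hδ => ?_
  have hball' := (ball_subset_ball hLρ.le).trans hball
  have key := norm_sub_le_dist (f := fun y => √(chartMetric x₀ y (X y) (X y) + δ ^ 2))
    (κ := 1 + C₃ * κ ^ 4 * L ^ 2) ha hu hL hball' (by positivity) fun y hy hyL => ?_
  · have hXa : X a = 0 := by simp [hX, radialField]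
    have h1 : chartMetric x₀ a (X a) (X a) = 0 := by rw [hXa, ← metricCLM_apply]; simp
    rw [h1, zero_add, Real.sqrt_sq hδ.le, Real.norm_eq_abs] at key
    have h2 := (abs_le.1 key).2
    have h3 : chartNorm x₀ u (X u) ≤ √(chartMetric x₀ u (X u) (X u) + δ ^ 2) :=
      Real.sqrt_le_sqrt (le_add_of_nonneg_right (sq_nonneg δ))
    linarith
  · have hyρ : chartDist x₀ a y < ρ := hyL.trans hLρ
    have hyK := hρ y hy hyρ
    obtain ⟨hN, hNd⟩ := fderiv_normSq_field hy
      ((contDiff_radialField a Γ).differentiable (by simp) y)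
    have hv : ‖y - a‖ ≤ κ * L := (h.norm_sub_le_chartDist ha hball hρ hy hyρ).trans
      (mul_le_mul_of_nonneg_left (le_of_lt hyL) hκ0.le)
    have hvB : B * ‖y - a‖ ≤ 1 := by
      have h1 : κ * L ≤ B⁻¹ := (mul_le_mul_of_nonneg_left hLρ.le hκ0.le).trans hρB
      calc B * ‖y - a‖ ≤ B * B⁻¹ := by gcongr; exact hv.trans h1
        _ = 1 := mul_inv_cancel₀ (by positivity)
    have hv1 : ‖y - a‖ ≤ 1 := (le_mul_of_one_le_left (norm_nonneg _) hB1).trans hvB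
    have hN0 : 0 ≤ chartMetric x₀ y (X y) (X y) := real_inner_self_nonneg
    have hpos : 0 < chartMetric x₀ y (X y) (X y) + δ ^ 2 := by positivity
    have hsq := hN.hasFDerivAt.add_const (δ ^ 2) |>.sqrt hpos.ne'
    refine ⟨hsq.differentiableAt, fun w => ?_⟩
    rw [hsq.fderiv, smul_apply, hNd, smul_eq_mul, Real.norm_eq_abs, abs_mul]
    set S := √(chartMetric x₀ y (X y) (X y) + δ ^ 2) with hS
    have hS0 : 0 < S := Real.sqrt_pos.2 hpos
    have hNS : chartNorm x₀ y (X y) ≤ S := Real.sqrt_le_sqrt (le_add_of_nonneg_right (sq_nonneg δ))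
    have h1 := h.fderiv_normSq_radialField hΓ haK hyK hv1 w
    have h2 : |chartMetric x₀ y w (X y)| ≤ chartNorm x₀ y w * chartNorm x₀ y (X y) := by
      rw [chartMetric, chartNorm_eq, chartNorm_eq]
      exact abs_real_inner_le_norm _ _
    -- As B‖y - a‖ ≤ 1, half of ‖y - a‖ absorbs the quadratic part of X. One factor of the cubic
    -- error is thus traded for S, which cancels the denominator 2S.
    have h3 : ‖y - a‖ ≤ 2 * κ * S := by
      have e1 := hΓ.norm_radialField_sub_le y
      have e2 : ‖y - a‖ ≤ ‖X y‖ + ‖X y - (y - a)‖ := by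
        have := norm_sub_norm_le (y - a) (X y)
        rw [norm_sub_rev (y - a)] at this
        linarith
      have e3 : ‖X y‖ ≤ κ * S := (h.norm_le hyK _).trans (mul_le_mul_of_nonneg_left hNS hκ0.le)
      linarith [mul_le_mul_of_nonneg_right hvB (norm_nonneg (y - a))]
    have h4 := h.norm_le hyK w
    have hnw := chartNorm_nonneg x₀ y w
    have h5 : |chartMetricDeriv x₀ y w (X y) (X y) +
        2 * chartMetric x₀ y (fderiv ℝ X y w) (X y)| ≤
        2 * S * ((1 + C₃ * κ ^ 4 * L ^ 2) * chartNorm x₀ y w) := by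
      have e1 : |chartMetricDeriv x₀ y w (X y) (X y) +
          2 * chartMetric x₀ y (fderiv ℝ X y w) (X y)| ≤
          2 * |chartMetric x₀ y w (X y)| + C₃ * ‖y - a‖ ^ 3 * ‖w‖ := by
        rw [abs_le] at h1 ⊢
        constructor <;> linarith [neg_abs_le (chartMetric x₀ y w (X y)),
          le_abs_self (chartMetric x₀ y w (X y))]
      have e2 : chartNorm x₀ y w * chartNorm x₀ y (X y) ≤ chartNorm x₀ y w * S := by gcongr
      have e3 : C₃ * ‖y - a‖ ^ 3 * ‖w‖ ≤
          C₃ * ((κ * L) ^ 2 * (2 * κ * S)) * (κ * chartNorm x₀ y w) := by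
        rw [pow_succ ‖y - a‖ 2]
        gcongr
      calc _ ≤ _ := e1
        _ ≤ 2 * (chartNorm x₀ y w * S) +
            C₃ * ((κ * L) ^ 2 * (2 * κ * S)) * (κ * chartNorm x₀ y w) := by linarith
        _ = _ := by ring
    calc _ ≤ |1 / (2 * S)| * (2 * S * ((1 + C₃ * κ ^ 4 * L ^ 2) * chartNorm x₀ y w)) := by gcongr
      _ = _ := by
        rw [abs_of_nonneg (by positivity)]
        field_simp

/-- The map y ↦ y - sX(y) fixes a and contracts lengths by `MetricBound.contraction`, so it shortens
nearly minimising curves issuing from a. The division by 2 comes from √(1 + k) ≤ 1 + k/2. -/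
theorem MetricBound.chartDist_sub_smul_le {x₀ : M} {c₀ : Eu n} {R c Λ B ρ s₀ : ℝ}
    (h : MetricBound (chartMetric (n := n) x₀) (chartMetricDeriv x₀)
      (closedBall c₀ (4 * R)) c Λ)
    (hKt : closedBall c₀ (4 * R) ⊆ (Ψ n x₀).target) {a : Eu n}
    {Γ : Eu n →L[ℝ] Eu n →L[ℝ] Eu n}
    (hΓ : IsChristoffel (chartMetric x₀) (chartMetricDeriv x₀) a B Γ) (hR : 0 < R)
    (haK : a ∈ closedBall c₀ (4 * R))
    (hball : ball ((Ψ n x₀).symm a) ρ ⊆ (Ψ n x₀).source)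
    (hρ : ∀ u ∈ (Ψ n x₀).target, chartDist x₀ a u < ρ →
      u ∈ closedBall c₀ (2 * R))
    (hρ1 : (√c)⁻¹ * ρ ≤ 1) (hs₀1 : s₀ ≤ 1) (hs₀ : s₀ * (1 + B) ≤ 2 * R)
    {u : Eu n} (hu : u ∈ (Ψ n x₀).target) (hur : chartDist x₀ a u < ρ) {s : ℝ}
    (hs : 0 ≤ s) (hss : s ≤ s₀) :
    chartDist x₀ a (u - s • radialField a Γ u) ≤
      (1 + (-2 * s + s * (Λ * (1 + 4 * B) / c * ((√c)⁻¹ * chartDist x₀ a u) ^ 2) +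
        s ^ 2 * (9 * Λ * (2 + B) ^ 4 / c)) / 2) * chartDist x₀ a u := by
  set κ := (√c)⁻¹ with hκ
  have hκ0 : 0 ≤ κ := by positivity
  have hΛ : 0 < Λ := zero_lt_one.trans_le h.one_le
  have hc := h.c_pos
  have hB1 := hΓ.one_le
  have hsub : closedBall c₀ (2 * R) ⊆ closedBall c₀ (4 * R) :=
    closedBall_subset_closedBall (by linarith)
  set X := radialField a Γ with hX
  have hXa : X a = 0 := by simp [hX, radialField]
  refine le_of_forall_gt_continuous (f := fun L => (1 + (-2 * s + s * (Λ * (1 + 4 * B) / c *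
    (κ * L) ^ 2) + s ^ 2 * (9 * Λ * (2 + B) ^ 4 / c)) / 2) * L) (by fun_prop) hur
    fun L hL hLρ => ?_
  have ha := hKt haK
  have hXd : ContDiff ℝ ∞ X := contDiff_radialField a Γ
  have hd : ContDiff ℝ 1 fun y => y - s • X y :=
    contDiff_id.sub ((hXd.of_le (by simp)).const_smul s)
  have hf : ∀ y w, fderiv ℝ (fun y => y - s • X y) y w = w - s • fderiv ℝ X y w := fun y w => by
    have h1 : HasFDerivAt X (fderiv ℝ X y) y := (hXd.differentiable (by simp) y).hasFDerivAt
    have h2 := ((hasFDerivAt_id y).sub (h1.const_smul s)).fderiv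
    exact congrArg (fun T : Eu n →L[ℝ] Eu n => T w) h2
  have hk0 : 0 ≤ s * (Λ * (1 + 4 * B) / c * (κ * L) ^ 2) + s ^ 2 * (9 * Λ * (2 + B) ^ 4 / c) := by
    positivity
  have key := dist_map_le_dist (f := fun y => y - s • X y) (κ := 1 + (-2 * s + s * (Λ *
    (1 + 4 * B) / c * (κ * L) ^ 2) + s ^ 2 * (9 * Λ * (2 + B) ^ 4 / c)) / 2) ha hu hL
    ((ball_subset_ball hLρ.le).trans hball) hd (by linarith) fun y hy hyL => ?_
  · simp only [hXa, smul_zero, sub_zero] at key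
    exact key
  · have hyρ : chartDist x₀ a y < ρ := hyL.trans hLρ
    have hyK := hsub (hρ y hy hyρ)
    have hv : ‖y - a‖ ≤ κ * L :=
      (h.norm_sub_le_chartDist ha hball (fun u hu hur => hsub (hρ u hu hur)) hy hyρ).trans
        (mul_le_mul_of_nonneg_left (le_of_lt hyL) hκ0)
    have hv1 : ‖y - a‖ ≤ 1 := hv.trans ((mul_le_mul_of_nonneg_left hLρ.le hκ0).trans hρ1)
    have hyX : y - s • X y ∈ closedBall c₀ (4 * R) := by
      have e1 : ‖X y‖ ≤ 1 + B := (hΓ.norm_radialField_le hv1).trans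
        (mul_le_of_le_one_right (by linarith) hv1)
      have e2 := hρ y hy hyρ
      rw [mem_closedBall, dist_eq_norm] at e2 ⊢
      have e3 : ‖s • X y‖ ≤ 2 * R := by
        rw [norm_smul, Real.norm_of_nonneg hs]
        exact (mul_le_mul hss e1 (norm_nonneg _) (hs.trans hss)).trans hs₀
      have e4 : y - s • X y - c₀ = (y - c₀) - s • X y := by abel
      rw [e4]
      linarith [norm_sub_le (y - c₀) (s • X y)]
    refine ⟨hKt hyX, fun w => ?_⟩
    rw [hf]
    have h1 := h.contraction hΓ haK hyK hv1 hs (hss.trans hs₀1) hyX w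
    have h2 : chartNorm x₀ y w ^ 2 = chartMetric x₀ y w w := by
      rw [chartNorm, Real.sq_sqrt (show 0 ≤ chartMetric x₀ y w w from real_inner_self_nonneg)]
    rw [← h2] at h1
    have h3 : Λ * (1 + 4 * B) / c * ‖y - a‖ ^ 2 ≤ Λ * (1 + 4 * B) / c * (κ * L) ^ 2 := by gcongr
    refine Real.sqrt_le_iff.2 ⟨mul_nonneg (by linarith) (chartNorm_nonneg _ _ _), h1.trans ?_⟩
    rw [mul_pow]
    refine mul_le_mul_of_nonneg_right ?_ (sq_nonneg _)
    have h4 := mul_le_mul_of_nonneg_left h3 hs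
    linarith [sq_nonneg (-2 * s + s * (Λ * (1 + 4 * B) / c * (κ * L) ^ 2) +
      s ^ 2 * (9 * Λ * (2 + B) ^ 4 / c))]

/-- Uniform approximate radial fields at the points of a small ball in a chart. -/
theorem exists_isRadial {x₀ : M} {c₀ : Eu n} {R : ℝ} (hR : 0 < R)
    (hKt : closedBall c₀ (4 * R) ⊆ (Ψ n x₀).target) :
    ∃ c Λ ρ C s₀ : ℝ, MetricBound (chartMetric (n := n) x₀) (chartMetricDeriv x₀)
        (closedBall c₀ (4 * R)) c Λ ∧
      0 < ρ ∧ ρ ≤ 1 ∧ 0 < C ∧ 0 < s₀ ∧ ∀ a ∈ closedBall c₀ R,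
      ball ((Ψ n x₀).symm a) ρ ⊆
        (Ψ n x₀).symm '' ball c₀ (2 * R) ∧
      ∃ X, IsRadial x₀ (closedBall c₀ (4 * R)) a X ρ C s₀ := by
  obtain ⟨c, Λ, h⟩ := exists_metricBound (n := n) (isCompact_closedBall c₀ (4 * R))
    (convex_closedBall _ _) hKt
  have hsub : closedBall c₀ (2 * R) ⊆ closedBall c₀ (4 * R) :=
    closedBall_subset_closedBall (by linarith)
  have hsub1 : closedBall c₀ R ⊆ closedBall c₀ (4 * R) :=
    closedBall_subset_closedBall (by linarith)
  have hsub2 : ball c₀ (2 * R) ⊆ (Ψ n x₀).target :=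
    (ball_subset_closedBall.trans hsub).trans hKt
  have hcomp : IsCompact ((Ψ n x₀).symm '' closedBall c₀ R) :=
    (isCompact_closedBall _ _).image_of_continuousOn
      ((continuousOn_extChartAt_symm x₀).mono (hsub1.trans hKt))
  have hopen : IsOpen ((Ψ n x₀).symm '' ball c₀ (2 * R)) := by
    rw [(Ψ n x₀).symm_image_eq_source_inter_preimage hsub2]
    exact (continuousOn_extChartAt x₀).isOpen_inter_preimage (isOpen_extChartAt_source x₀)
      isOpen_ball
  -- Compactness gives one radius such that points this close to the image of the `R`-ball have
  -- coordinates in the `2R`-ball.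
  obtain ⟨ρ₀, hρ₀, hthick⟩ := hcomp.exists_thickening_subset_open hopen
    (image_mono (closedBall_subset_ball (by linarith)))
  set κ := (√c)⁻¹ with hκ
  have hκ0 : 0 < κ := inv_pos.2 (Real.sqrt_pos.2 h.c_pos)
  have hΛ : 0 < Λ := zero_lt_one.trans_le h.one_le
  have hc := h.c_pos
  set B := 1 + 2 * Λ / c with hB
  have hB1 : 1 ≤ B := by
    have : 0 ≤ 2 * Λ / c := by positivity
    linarith
  -- The last entry makes ‖u - a‖ ≤ κρ ≤ 1/B ≤ 1 within distance ρ, as required by the estimates for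
  -- the radial field.
  set ρ := min (min ρ₀ 1) (κ⁻¹ * B⁻¹) with hρ
  have hρ0 : 0 < ρ := lt_min (lt_min hρ₀ one_pos) (by positivity)
  have hρB : κ * ρ ≤ B⁻¹ := by
    calc κ * ρ ≤ κ * (κ⁻¹ * B⁻¹) := by gcongr; exact min_le_right _ _
      _ = B⁻¹ := by rw [← mul_assoc, mul_inv_cancel₀ hκ0.ne', one_mul]
  have hρ1 : κ * ρ ≤ 1 := hρB.trans (inv_le_one_of_one_le₀ hB1)
  have hρle : ρ ≤ 1 := (min_le_left _ _).trans (min_le_right _ _)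
  -- Since |X| ≤ 1 + B, a step of this size moves points by at most 2R and cannot leave the
  -- `4R`-ball.
  set s₀ := min 1 (2 * R / (1 + B)) with hs₀
  have hs₀0 : 0 < s₀ := lt_min one_pos (by positivity)
  have hs₀B : s₀ * (1 + B) ≤ 2 * R := by
    calc s₀ * (1 + B) ≤ 2 * R / (1 + B) * (1 + B) := by gcongr; exact min_le_right _ _
      _ = 2 * R := by field_simp
  set C₁ := 7 * Λ * (1 + B) ^ 2 * κ ^ 4 with hC₁
  set C₂ := Λ * (1 + 4 * B) / c * κ ^ 2 with hC₂
  set C₃ := 9 * Λ * (2 + B) ^ 4 / c with hC₃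
  set C₄ := Λ * (1 + 4 * B) * κ ^ 2 with hC₄
  set C₅ := 1 + B * (5 * R) with hC₅
  have p1 : 0 ≤ C₁ := by positivity
  have p2 : 0 ≤ C₂ := by positivity
  have p3 : 0 ≤ C₃ := by positivity
  have p4 : 0 ≤ C₄ := by positivity
  have p5 : 0 < C₅ := by positivity
  refine ⟨c, Λ, ρ, C₁ + C₂ + C₃ + C₄ + C₅, s₀, h, hρ0, hρle, by positivity, hs₀0, fun a ha => ?_⟩
  have haK := hsub1 ha
  have hat := hKt haK
  have hb : ball ((Ψ n x₀).symm a) ρ ⊆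
      (Ψ n x₀).symm '' ball c₀ (2 * R) :=
    ((ball_subset_ball ((min_le_left _ _).trans (min_le_left _ _))).trans
      (Metric.ball_subset_thickening (mem_image_of_mem _ ha) _)).trans hthick
  have hball : ball ((Ψ n x₀).symm a) ρ ⊆ (Ψ n x₀).source :=
    hb.trans (by rintro _ ⟨u, hu, rfl⟩; exact mem_source_symm (hsub2 hu))
  have hreg : ∀ u ∈ (Ψ n x₀).target, chartDist x₀ a u < ρ →
      u ∈ closedBall c₀ (2 * R) := fun u hu hur => by
    obtain ⟨u', hu', he⟩ := hb (show (Ψ n x₀).symm u ∈ _ by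
      rw [mem_ball, dist_comm]; exact hur)
    rw [← (Ψ n x₀).symm.injOn (hsub2 hu') hu he]
    exact ball_subset_closedBall hu'
  have hreg' : ∀ u ∈ (Ψ n x₀).target, chartDist x₀ a u < ρ →
      u ∈ closedBall c₀ (4 * R) := fun u hu hur => hsub (hreg u hu hur)
  obtain ⟨Γ, hΓ⟩ := h.exists_christoffel haK
  refine ⟨hb, radialField a Γ, contDiff_radialField a Γ, fun u hu hur => ?_,
    fun u hu hur s hs hss => ?_, fun u hu hur v w => ?_, fun u hu u' hu' => ?_⟩
  · refine (h.chartNorm_radialField_le hΓ haK hat hball hreg' hρB hu hur).trans ?_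
    have : 0 ≤ chartDist x₀ a u := dist_nonneg
    gcongr
    linarith
  · refine (h.chartDist_sub_smul_le hKt hΓ hR haK hball hreg hρ1 (min_le_left _ _) hs₀B hu hur hs
      hss).trans ?_
    have h0 : 0 ≤ chartDist x₀ a u := dist_nonneg
    refine mul_le_mul_of_nonneg_right ?_ h0
    have e1 : 0 ≤ s * chartDist x₀ a u ^ 2 := by positivity
    have e2 : 0 ≤ s ^ 2 := sq_nonneg s
    have e3 : C₂ * (s * chartDist x₀ a u ^ 2) / 2 ≤
        (C₁ + C₂ + C₃ + C₄ + C₅) * (s * chartDist x₀ a u ^ 2) := by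
      rw [mul_div_right_comm]
      exact mul_le_mul_of_nonneg_right (by linarith) e1
    have e4 : C₃ * s ^ 2 / 2 ≤ (C₁ + C₂ + C₃ + C₄ + C₅) * s ^ 2 := by
      rw [mul_div_right_comm]
      exact mul_le_mul_of_nonneg_right (by linarith) e2
    calc _ = 1 - s + C₂ * (s * chartDist x₀ a u ^ 2) / 2 + C₃ * s ^ 2 / 2 := by
          rw [hC₂]; ring
      _ ≤ _ := by linarith
  · have hv := h.norm_sub_le_chartDist hat hball hreg' hu hur
    have h0 : 0 ≤ chartDist x₀ a u := dist_nonneg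
    have hv1 : ‖u - a‖ ≤ 1 := hv.trans ((mul_le_mul_of_nonneg_left hur.le hκ0.le).trans hρ1)
    refine (h.lie_radialField hΓ haK (hreg' u hu hur) hv1 v w).trans ?_
    calc Λ * (1 + 4 * B) * ‖u - a‖ ^ 2 * ‖v‖ * ‖w‖
        ≤ Λ * (1 + 4 * B) * (κ * chartDist x₀ a u) ^ 2 * ‖v‖ * ‖w‖ := by gcongr
      _ = C₄ * chartDist x₀ a u ^ 2 * ‖v‖ * ‖w‖ := by rw [hC₄]; ring
      _ ≤ _ := by gcongr; linarith
  · refine ((convex_closedBall c₀ (4 * R)).norm_image_sub_le_of_norm_fderiv_le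
      (f := radialField a Γ) (C := C₅) (fun y _ => (contDiff_radialField a Γ).differentiable
        (by simp) y) (fun y hy => ?_) hu' hu).trans ?_
    · refine ContinuousLinearMap.opNorm_le_bound _ p5.le fun w => ?_
      rw [hΓ.fderiv_radialField]
      have e1 : ‖y - a‖ ≤ 5 * R := by
        rw [mem_closedBall] at hy ha
        rw [← dist_eq_norm]
        linarith [dist_triangle_right y a c₀]
      have e2 : B * ‖y - a‖ * ‖w‖ ≤ B * (5 * R) * ‖w‖ := by gcongr
      have := norm_sub_le w (Γ (y - a) w)
      have := hΓ.bound (y - a) w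
      rw [hC₅]
      linarith
    · gcongr
      linarith

end RadialBounds

/-! ### Smooth approximation of the distance -/

section Mollification

open scoped Convolution

/-- Dividing by s and letting s tend to 0 from the right: one-sided difference inequalities suffice
to bound a directional derivative. -/
theorem fderiv_le_of_forall_pos {E : Type*} [NormedAddCommGroup E] [NormedSpace ℝ E] {F : E → ℝ}
    {u : E} (hF : DifferentiableAt ℝ F u) (w : E) {m k h₀ : ℝ} (hh₀ : 0 < h₀)
    (h : ∀ s, 0 < s → s < h₀ → F (u + s • w) - F u ≤ s * m + k * s ^ 2) : fderiv ℝ F u w ≤ m := by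
  have h1 : HasDerivAt (fun s : ℝ => F (u + s • w)) (fderiv ℝ F u w) 0 := by
    have h2 : HasDerivAt (fun s : ℝ => u + s • w) w 0 := by
      simpa using ((hasDerivAt_id (0 : ℝ)).smul_const w).const_add u
    have h3 : HasFDerivAt F (fderiv ℝ F u) (u + (0 : ℝ) • w) := by
      simpa using hF.hasFDerivAt
    exact h3.comp_hasDerivAt 0 h2
  have h4 := (hasDerivAt_iff_tendsto_slope_zero.1 h1).mono_left
    (nhdsWithin_mono 0 (show Ioi (0 : ℝ) ⊆ {0}ᶜ from fun s hs => ne_of_gt hs))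
  have h5 : Tendsto (fun s : ℝ => m + k * s) (𝓝[>] 0) (𝓝 m) := by
    have : Continuous fun s : ℝ => m + k * s := by fun_prop
    simpa using (this.tendsto 0).mono_left (nhdsWithin_le_nhds (s := Ioi 0))
  refine le_of_tendsto_of_tendsto h4 h5 (Filter.eventually_of_mem (Ioo_mem_nhdsGT hh₀)
    fun s hs => ?_)
  have h6 := h s hs.1 hs.2
  simp only [zero_add, zero_smul, add_zero, smul_eq_mul]
  rw [inv_mul_le_iff₀ hs.1]
  linarith

/-- Convolution with a nonnegative kernel of mass 1 supported in the ε-ball. Averages inherit every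
bound valid for all small translates, which transfers difference estimates from a function that need
not be differentiable. -/
theorem exists_mollification {f : Eu n → ℝ} {K : Set (Eu n)} (hK : IsCompact K)
    (hf : ContinuousOn f K) {ε : ℝ} (hε : 0 < ε) :
    ∃ F : Eu n → ℝ, ContDiff ℝ ∞ F ∧
      (∀ u u' m, (∀ t, ‖t‖ ≤ ε → u - t ∈ K ∧ u' - t ∈ K ∧ f (u' - t) - f (u - t) ≤ m) →
        F u' - F u ≤ m) ∧
      (∀ u m, (∀ t, ‖t‖ ≤ ε → u - t ∈ K ∧ f (u - t) ≤ m) → F u ≤ m) ∧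
      (∀ u m, (∀ t, ‖t‖ ≤ ε → u - t ∈ K ∧ m ≤ f (u - t)) → m ≤ F u) := by
  let ξ : ContDiffBump (0 : Eu n) := ⟨ε / 2, ε, by positivity, by linarith⟩
  set w := ξ.normed volume with hw
  set g := K.indicator f with hg
  have hgi : Integrable g := (integrable_indicator_iff hK.measurableSet).2
    (hf.integrableOn_compact hK)
  have hint : ∀ u, Integrable fun t => w t * g (u - t) := fun u =>
    (ξ.hasCompactSupport_normed (μ := volume)).convolutionExists_left (ContinuousLinearMap.lsmul ℝ ℝ)
      ξ.continuous_normed hgi.locallyIntegrable u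
  have hwi : Integrable w := ξ.integrable_normed
  have hw1 : ∫ t, w t = 1 := ξ.integral_normed
  have hw0 : ∀ t, 0 ≤ w t := ξ.nonneg_normed
  have hwt : ∀ t, ε < ‖t‖ → w t = 0 := fun t ht => by
    by_contra h
    have : t ∈ Function.support w := h
    rw [hw, ξ.support_normed_eq, mem_ball_zero_iff] at this
    exact absurd this (not_lt.2 ht.le)
  have hgK : ∀ y ∈ K, g y = f y := fun y hy => indicator_of_mem hy f
  refine ⟨fun u => ∫ t, w t * g (u - t), ?_, fun u u' m h => ?_, fun u m h => ?_, fun u m h => ?_⟩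
  · exact (ξ.hasCompactSupport_normed (μ := volume)).contDiff_convolution_left
      (ContinuousLinearMap.lsmul ℝ ℝ) ξ.contDiff_normed hgi.locallyIntegrable
  · calc (∫ t, w t * g (u' - t)) - ∫ t, w t * g (u - t)
        = ∫ t, (w t * g (u' - t) - w t * g (u - t)) := (integral_sub (hint u') (hint u)).symm
      _ ≤ ∫ t, w t * m := integral_mono ((hint u').sub (hint u)) (hwi.mul_const m) fun t => by
          by_cases ht : ‖t‖ ≤ ε
          · obtain ⟨h1, h2, h3⟩ := h t ht
            simp only [hgK _ h1, hgK _ h2]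
            nlinarith [mul_le_mul_of_nonneg_left h3 (hw0 t)]
          · simp [hwt t (not_le.1 ht)]
      _ = m := by rw [integral_mul_const, hw1, one_mul]
  · calc (∫ t, w t * g (u - t)) ≤ ∫ t, w t * m :=
          integral_mono (hint u) (hwi.mul_const m) fun t => by
          by_cases ht : ‖t‖ ≤ ε
          · obtain ⟨h1, h3⟩ := h t ht
            simp only [hgK _ h1]
            exact mul_le_mul_of_nonneg_left h3 (hw0 t)
          · simp [hwt t (not_le.1 ht)]
      _ = m := by rw [integral_mul_const, hw1, one_mul]
  · calc m = ∫ t, w t * m := by rw [integral_mul_const, hw1, one_mul]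
      _ ≤ ∫ t, w t * g (u - t) := integral_mono (hwi.mul_const m) (hint u) fun t => by
          by_cases ht : ‖t‖ ≤ ε
          · obtain ⟨h1, h3⟩ := h t ht
            simp only [hgK _ h1]
            exact mul_le_mul_of_nonneg_left h3 (hw0 t)
          · simp [hwt t (not_le.1 ht)]

variable [IsRiemannianManifold (𝓡 n) M]

/-- Smooth approximations of the distance, with control of the derivatives. -/
theorem IsRadial.exists_smooth_dist {x₀ : M} {c₀ a : Eu n} {R c Λ ρ C s₀ : ℝ} {X : Eu n → Eu n}
    (hX : IsRadial x₀ (closedBall c₀ (4 * R)) a X ρ C s₀)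
    (h : MetricBound (chartMetric (n := n) x₀) (chartMetricDeriv x₀)
      (closedBall c₀ (4 * R)) c Λ) (hR : 0 < R)
    (hKt : closedBall c₀ (4 * R) ⊆ (Ψ n x₀).target)
    (hρ : 0 < ρ) (hρ1 : ρ ≤ 1) (hC : 0 < C) (hs₀ : 0 < s₀) :
    ∃ A ε₀ : ℝ, 0 < A ∧ 0 < ε₀ ∧ ∀ ε, 0 < ε → ε < ε₀ → ∃ F : Eu n → ℝ, ContDiff ℝ ∞ F ∧
      (∀ u ∈ closedBall c₀ (3 * R), |F u - chartDist x₀ a u| ≤ A * ε) ∧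
      (∀ u ∈ closedBall c₀ (2 * R), ∀ w,
        |fderiv ℝ F u w| ≤ chartNorm x₀ u w + A * ε * ‖w‖) ∧
      (∀ u ∈ closedBall c₀ (2 * R), chartDist x₀ a u < ρ / 2 →
        chartDist x₀ a u - C * chartDist x₀ a u ^ 3 - A * ε ≤ fderiv ℝ F u (X u)) := by
  have hΛ : 0 < Λ := zero_lt_one.trans_le h.one_le
  set κ := (√c)⁻¹ with hκ
  have hκ0 : 0 < κ := inv_pos.2 (Real.sqrt_pos.2 h.c_pos)
  set K := closedBall c₀ (4 * R) with hK
  have hKc : Convex ℝ K := convex_closedBall _ _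
  set r := chartDist x₀ a with hr
  have hr0 : ∀ u, 0 ≤ r u := fun u => dist_nonneg
  have hlip : ∀ u ∈ K, ∀ u' ∈ K, |r u' - r u| ≤ Λ * ‖u' - u‖ := fun u hu u' hu' =>
    h.abs_chartDist_sub_le' hKt hKc a hu hu'
  have hrc : ContinuousOn r K := by
    refine (LipschitzOnWith.of_dist_le_mul (K := ⟨Λ, hΛ.le⟩) fun u hu u' hu' => ?_).continuousOn
    rw [Real.dist_eq, dist_eq_norm]
    exact hlip u' hu' u hu
  obtain ⟨D, hD⟩ := (isCompact_closedBall c₀ (4 * R)).exists_bound_of_continuousOn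
    hX.contDiff.continuous.continuousOn
  have hmem : ∀ {u t : Eu n} {q q' : ℝ}, ‖u - c₀‖ ≤ q * R → ‖t‖ ≤ q' * R → q + q' ≤ 4 →
      u - t ∈ K := fun {u t q q'} hu ht hq => by
    rw [hK, mem_closedBall, dist_eq_norm]
    have e : u - t - c₀ = (u - c₀) - t := by abel
    rw [e]
    refine (norm_sub_le _ _).trans ((add_le_add hu ht).trans ?_)
    linarith [mul_le_mul_of_nonneg_right hq hR.le]
  -- Λκ pays for freezing the norm and Λ for replacing the distance at a translate by that at u. In
  -- 4CΛ, the share 3CΛ comes from the cubic term and CΛ from the variation of X. The threshold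
  -- keeps translates inside the large ball and within distance ρ of a.
  refine ⟨Λ * κ + Λ + 4 * C * Λ, min (R / 2) (ρ / (2 * Λ)), by positivity, by positivity,
    fun ε hε hε₀ => ?_⟩
  have hεR : ε ≤ 1 / 2 * R := by linarith [hε₀.trans_le (min_le_left _ _)]
  have hεΛ : Λ * ε < ρ / 2 := by
    have := hε₀.trans_le (min_le_right _ _)
    rw [lt_div_iff₀ (by positivity)] at this
    linarith
  obtain ⟨F, hFs, hF1, hF2, hF3⟩ := exists_mollification (isCompact_closedBall c₀ (4 * R)) hrc hε
  have hFd : ∀ u, DifferentiableAt ℝ F u := fun u => hFs.differentiable (by simp) u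
  have hA0 : Λ * ε ≤ (Λ * κ + Λ + 4 * C * Λ) * ε := by
    gcongr
    have : 0 ≤ Λ * κ := by positivity
    have : 0 ≤ 4 * C * Λ := by positivity
    linarith
  have hnear : ∀ u t : Eu n, ‖u - c₀‖ ≤ 3 * R → ‖t‖ ≤ ε → u - t ∈ K ∧ |r (u - t) - r u| ≤ Λ * ε := by
    intro u t hu ht
    have h1 : u - t ∈ K := hmem hu (ht.trans hεR) (by norm_num)
    have h2 : u ∈ K := by
      have := hmem (t := 0) (q' := 0) hu (by simp) (by norm_num)
      rwa [sub_zero] at this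
    refine ⟨h1, (hlip u h2 _ h1).trans ?_⟩
    rw [sub_sub_cancel_left, norm_neg]
    gcongr
  refine ⟨F, hFs, fun u hu => ?_, fun u hu w => ?_, fun u hu hur => ?_⟩
  · rw [mem_closedBall, dist_eq_norm] at hu
    have h1 := hF2 u (r u + Λ * ε) fun t ht => ⟨(hnear u t hu ht).1, by
      linarith [(abs_le.1 (hnear u t hu ht).2).2]⟩
    have h2 := hF3 u (r u - Λ * ε) fun t ht => ⟨(hnear u t hu ht).1, by
      linarith [(abs_le.1 (hnear u t hu ht).2).1]⟩
    rw [abs_le]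
    constructor <;> linarith
  · rw [mem_closedBall, dist_eq_norm] at hu
    have huK : u ∈ K := by
      have := hmem (t := 0) (q' := 0) hu (by simp) (by norm_num)
      rwa [sub_zero] at this
    -- Along a translated segment the distance changes by at most the length of the segment,
    -- measured with the norm frozen at u. The segment stays within ε + s‖w‖ of u, which produces
    -- the error Λκε and a term in s².
    have key : ∀ w, fderiv ℝ F u w ≤ chartNorm x₀ u w + Λ * κ * ε * ‖w‖ := fun w => by
      refine fderiv_le_of_forall_pos (hFd u) w (h₀ := R / (2 * (‖w‖ + 1))) (k := Λ * κ * ‖w‖ ^ 2)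
        (by positivity) fun s hs hs0 => ?_
      have hsw : ‖s • w‖ ≤ 1 / 2 * R := by
        rw [norm_smul, Real.norm_of_nonneg hs.le]
        rw [lt_div_iff₀ (by positivity)] at hs0
        nlinarith [norm_nonneg w]
      refine hF1 u (u + s • w) _ fun t ht => ?_
      have e1 : u - t ∈ K := hmem hu (ht.trans hεR) (by norm_num)
      have e2 : u + s • w - t ∈ K := by
        have e3 : u + s • w - t = u - (t - s • w) := by abel
        rw [e3]
        exact hmem (q' := 1) hu ((norm_sub_le _ _).trans (by linarith)) (by norm_num)
      refine ⟨e1, e2, ?_⟩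
      have e4 := (abs_le.1 (h.abs_chartDist_sub_le hKt a (u := u - t) (u' := u + s • w - t)
        (u₀ := u) (Δ := ε + ‖s • w‖) huK (subset_inter (hKc.segment_subset e1 e2)
          ((convex_closedBall u _).segment_subset ?_ ?_)))).2
      · have e5 : u + s • w - t - (u - t) = s • w := by abel
        have e6 : chartNorm x₀ u (s • w) = s * chartNorm x₀ u w := by
          rw [chartNorm_eq, chartNorm_eq, map_smul, norm_smul, Real.norm_of_nonneg hs.le]
        rw [e5, e6, norm_smul, Real.norm_of_nonneg hs.le] at e4
        refine e4.trans (le_of_eq ?_)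
        ring
      · rw [mem_closedBall, dist_eq_norm, sub_sub_cancel_left, norm_neg]
        linarith [norm_nonneg (s • w)]
      · rw [mem_closedBall, dist_eq_norm]
        have e3 : u + s • w - t - u = s • w - t := by abel
        rw [e3]
        linarith [norm_sub_le (s • w) t]
    have hAw : Λ * κ * ε * ‖w‖ ≤ (Λ * κ + Λ + 4 * C * Λ) * ε * ‖w‖ := by
      gcongr
      have : 0 ≤ 4 * C * Λ := by positivity
      linarith
    have k1 := key w
    have k2 := key (-w)
    have k3 : chartNorm x₀ u (-w) = chartNorm x₀ u w := by
      rw [chartNorm_eq, chartNorm_eq, map_neg, norm_neg]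
    rw [map_neg, norm_neg, k3] at k2
    rw [abs_le]
    constructor <;> linarith
  · rw [mem_closedBall, dist_eq_norm] at hu
    have hD0 : 0 ≤ D := by
      have : c₀ ∈ closedBall c₀ (4 * R) := Metric.mem_closedBall_self (by positivity)
      exact (norm_nonneg _).trans (hD c₀ this)
    have huK : u ∈ K := by
      have := hmem (t := 0) (q' := 0) hu (by simp) (by norm_num)
      rwa [sub_zero] at this
    -- At the translate u - t the contraction estimate moves along X(u - t), whereas the mollified
    -- function is compared along X(u). The Lipschitz bound for X limits the discrepancy to sCε.
    have key : fderiv ℝ F u (-X u) ≤ -r u + C * r u ^ 3 + (Λ + 4 * C * Λ) * ε := by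
      refine fderiv_le_of_forall_pos (hFd u) (-X u) (h₀ := min s₀ (R / (2 * (D + 1)))) (k := C)
        (by positivity) fun s hs hs0 => ?_
      have hss : s ≤ s₀ := (hs0.trans_le (min_le_left _ _)).le
      have hsD : s * D ≤ 1 / 2 * R := by
        have := hs0.trans_le (min_le_right _ _)
        rw [lt_div_iff₀ (by positivity)] at this
        linarith
      have hsX : ∀ y ∈ K, ‖s • X y‖ ≤ 1 / 2 * R := fun y hy => by
        rw [norm_smul, Real.norm_of_nonneg hs.le]
        exact (mul_le_mul_of_nonneg_left (hD y hy) hs.le).trans hsD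
      refine hF1 u (u + s • -X u) _ fun t ht => ?_
      obtain ⟨e1, e1'⟩ := hnear u t (hu.trans (by linarith)) ht
      have e2 : u + s • -X u - t ∈ K := by
        have e3 : u + s • -X u - t = u - (t + s • X u) := by rw [smul_neg]; abel
        rw [e3]
        exact hmem (q' := 1) hu ((norm_add_le _ _).trans (by linarith [hsX u huK])) (by norm_num)
      have e4 : u - t - s • X (u - t) ∈ K := by
        have e3 : u - t - s • X (u - t) = u - (t + s • X (u - t)) := by abel
        rw [e3]
        exact hmem (q' := 1) hu ((norm_add_le _ _).trans (by linarith [hsX _ e1])) (by norm_num)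
      refine ⟨e1, e2, ?_⟩
      set ry := r (u - t) with hry
      have hryu := abs_le.1 e1'
      have hryρ : ry < ρ := by linarith [hryu.2]
      have e5 := hX.dist_le (u - t) (hKt e1) hryρ s hs.le hss
      have e6 := (abs_le.1 (hlip _ e4 _ e2)).2
      have e7 : u + s • -X u - t - (u - t - s • X (u - t)) = s • (X (u - t) - X u) := by
        rw [smul_neg, smul_sub]; abel
      have e8 : ‖X (u - t) - X u‖ ≤ C * ε := by
        refine (hX.lip _ e1 _ huK).trans ?_
        rw [sub_sub_cancel_left, norm_neg]
        gcongr
      rw [e7, norm_smul, Real.norm_of_nonneg hs.le] at e6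
      have e9 : Λ * (s * ‖X (u - t) - X u‖) ≤ Λ * (s * (C * ε)) := by gcongr
      have hry0 : 0 ≤ ry := hr0 _
      have hu0 : 0 ≤ r u := hr0 _
      have hry1 : ry ≤ 1 := hryρ.le.trans hρ1
      have hu1 : r u ≤ 1 := by linarith
      have e10 : ry ^ 3 ≤ r u ^ 3 + 3 * (Λ * ε) := by
        have f1 : ry ^ 3 - r u ^ 3 = (ry - r u) * (ry ^ 2 + ry * r u + r u ^ 2) := by ring
        have f2 : ry ^ 2 + ry * r u + r u ^ 2 ≤ 3 := by
          linarith [pow_le_one₀ (n := 2) hry0 hry1, pow_le_one₀ (n := 2) hu0 hu1,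
            mul_le_one₀ hry1 hu0 hu1]
        have f3 : 0 ≤ ry ^ 2 + ry * r u + r u ^ 2 := by positivity
        have f4 : (ry - r u) * (ry ^ 2 + ry * r u + r u ^ 2) ≤
            Λ * ε * (ry ^ 2 + ry * r u + r u ^ 2) := mul_le_mul_of_nonneg_right hryu.2 f3
        have f5 : Λ * ε * (ry ^ 2 + ry * r u + r u ^ 2) ≤ Λ * ε * 3 := by gcongr
        linarith
      have e11 : C * s * ry ^ 3 ≤ C * s * (r u ^ 3 + 3 * (Λ * ε)) := by gcongr
      have e12 : C * s ^ 2 * ry ≤ C * s ^ 2 * 1 := by gcongr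
      have e13 : s * (r u - Λ * ε) ≤ s * ry := by
        gcongr
        linarith [hryu.1]
      change r (u - t - s • X (u - t)) ≤ (1 - s + C * s * ry ^ 2 + C * s ^ 2) * ry at e5
      have e14 : (1 - s + C * s * ry ^ 2 + C * s ^ 2) * ry =
        ry - s * ry + C * s * ry ^ 3 + C * s ^ 2 * ry := by ring
      rw [e14] at e5
      linarith
    rw [map_neg] at key
    have : 0 ≤ Λ * κ * ε := by positivity
    linarith

end Mollification

/-! ### Lower bounds for the stress along radial fields -/

section StressBounds

variable {V : Type*} [NormedAddCommGroup V] [InnerProductSpace ℝ V] [FiniteDimensional ℝ V]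
  {κ : Type*} [Fintype κ] [DecidableEq κ] {k : ℕ}

/-- With y = √r ν - x/√r one has νxᵀ + xνᵀ = r ννᵀ + r⁻¹ xxᵀ - yyᵀ. The first two matrices have
nonnegative stress, and y is small when x is close to rν, as happens for x = X and ν = dr. -/
theorem neg_stress_symm_le (b : OrthonormalBasis κ ℝ V) (ν x : κ → ℝ) {r : ℝ} (hr : 0 < r)
    (hk : k ≤ Fintype.card κ) (α : V [⋀^Fin k]→L[ℝ] ℝ) :
    -stress b (Matrix.vecMulVec ν x + Matrix.vecMulVec x ν) α ≤
      (Fintype.card κ : ℝ) ^ 2 * (r * ∑ i, ν i ^ 2 + r⁻¹ * ∑ i, x i ^ 2 - 2 * ∑ i, ν i * x i) *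
        covInner α α := by
  set y : κ → ℝ := fun i => √r * ν i - (√r)⁻¹ * x i with hy
  have hs : √r * √r = r := Real.mul_self_sqrt hr.le
  have hs0 : √r ≠ 0 := (Real.sqrt_pos.2 hr).ne'
  have hs1 : √r * (√r)⁻¹ = 1 := mul_inv_cancel₀ hs0
  have hs2 : (√r)⁻¹ * (√r)⁻¹ = r⁻¹ := by rw [← mul_inv, hs]
  have h1 : Matrix.vecMulVec ν x + Matrix.vecMulVec x ν = r • Matrix.vecMulVec ν ν +
      (r⁻¹ • Matrix.vecMulVec x x + (-1 : ℝ) • Matrix.vecMulVec y y) := by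
    ext i j
    simp only [Matrix.add_apply, Matrix.smul_apply, Matrix.vecMulVec_apply, smul_eq_mul, hy]
    linear_combination (-ν i * ν j) * hs + (-x i * x j) * hs2 + (-ν i * x j - x i * ν j) * hs1 +
      2 * (ν i * ν j) * hs + 2 * (x i * x j) * hs2
  have h2 : ∑ i, y i ^ 2 = r * ∑ i, ν i ^ 2 + r⁻¹ * ∑ i, x i ^ 2 - 2 * ∑ i, ν i * x i := by
    rw [mul_sum, mul_sum, mul_sum, ← sum_add_distrib,
      ← Finset.sum_sub_distrib]
    refine sum_congr rfl fun i _ => ?_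
    simp only [hy]
    linear_combination ν i ^ 2 * hs + x i ^ 2 * hs2 - 2 * (ν i * x i) * hs1
  have hQ := covInner_self_nonneg α
  have hle : ∀ i, y i ^ 2 ≤ ∑ i, y i ^ 2 := fun i =>
    Finset.single_le_sum (f := fun i => y i ^ 2) (fun i _ => sq_nonneg _) (Finset.mem_univ i)
  have h3 : ∀ i j, |Matrix.vecMulVec y y i j| ≤ ∑ i, y i ^ 2 := fun i j => by
    rw [Matrix.vecMulVec_apply, abs_le]
    constructor <;> linarith [hle i, hle j, sq_nonneg (y i + y j), sq_nonneg (y i - y j)]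
  have h4 := (abs_le.1 (abs_stress_le b _ h3 α)).2
  have h5 := stress_vecMulVec_self_nonneg b ν α
  have h6 := stress_vecMulVec_self_nonneg b x α
  rw [h1, stress_add, stress_add, stress_smul, stress_smul, stress_smul, ← h2]
  have h7 : (k : ℝ) ≤ Fintype.card κ := by exact_mod_cast hk
  have h8 : 0 ≤ ∑ i, y i ^ 2 := Finset.sum_nonneg fun i _ => sq_nonneg _
  have h9 : (k : ℝ) * ((∑ i, y i ^ 2) * Fintype.card κ * covInner α α) ≤
      Fintype.card κ * ((∑ i, y i ^ 2) * Fintype.card κ * covInner α α) := by gcongr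
  have h10 : 0 ≤ r * stress b (Matrix.vecMulVec ν ν) α := by positivity
  have h11 : 0 ≤ r⁻¹ * stress b (Matrix.vecMulVec x x) α := by positivity
  linarith

/-- The matrix `T` models the Lie derivative along gX with dg = -θν, θ ≥ 0. Its main part 2s·1 gives
s(n - 2k), the trace of the rank one part gives -θ⟨ν,x⟩, and the stress of the rank one part has a
favourable sign up to the error of `neg_stress_symm_le`. -/
theorem stress_lower (b : OrthonormalBasis κ ℝ V) {T Er : Matrix κ κ ℝ} {ν x : κ → ℝ}
    {s θ E r : ℝ} (hs : 0 ≤ s) (hθ : 0 ≤ θ) (hr : 0 < r) (hE : ∀ i j, |Er i j| ≤ E) (hE0 : 0 ≤ E)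
    (hT : T = s • ((2 : ℝ) • 1 + Er) + (-θ) • (Matrix.vecMulVec ν x + Matrix.vecMulVec x ν))
    (hk : k ≤ Fintype.card κ) (α : V [⋀^Fin k]→L[ℝ] ℝ) :
    (s * (Fintype.card κ - 2 * k - 2 * (Fintype.card κ : ℝ) ^ 2 * E) -
      θ * (∑ i, ν i * x i + (Fintype.card κ : ℝ) ^ 2 *
        (r * ∑ i, ν i ^ 2 + r⁻¹ * ∑ i, x i ^ 2 - 2 * ∑ i, ν i * x i))) * covInner α α ≤
    1 / 2 * T.trace * covInner α α - stress b T α := by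
  set N : ℝ := (Fintype.card κ : ℝ) with hN
  have hQ := covInner_self_nonneg α
  have h7 : (k : ℝ) ≤ N := by rw [hN]; exact_mod_cast hk
  have hN2 : N ≤ N ^ 2 := by
    rw [hN]; exact_mod_cast Nat.le_self_pow two_ne_zero _
  have h1 := neg_stress_symm_le b ν x hr hk α
  have h2 := (abs_le.1 (abs_stress_le b Er hE α)).2
  have h3 : (Matrix.vecMulVec ν x + Matrix.vecMulVec x ν).trace = 2 * ∑ i, ν i * x i := by
    rw [Matrix.trace_add, Matrix.trace_vecMulVec, Matrix.trace_vecMulVec, dotProduct_comm x ν,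
      ← two_mul]
    rfl
  have h4 : -(N * E) ≤ Er.trace := by
    have : ∑ _i : κ, -E ≤ ∑ i, Er i i := sum_le_sum fun i _ => (abs_le.1 (hE i i)).1
    rw [Finset.sum_const, Finset.card_univ, nsmul_eq_mul] at this
    change _ ≤ ∑ i, Er i i
    linarith
  have h5 : T.trace = s * (2 * N + Er.trace) - θ * (2 * ∑ i, ν i * x i) := by
    rw [hT, Matrix.trace_add, Matrix.trace_smul, Matrix.trace_smul, Matrix.trace_add,
      Matrix.trace_smul, Matrix.trace_one, h3, smul_eq_mul, smul_eq_mul, smul_eq_mul]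
    ring
  have h6 : stress b T α = s * (2 * (k * covInner α α) + stress b Er α) -
      θ * stress b (Matrix.vecMulVec ν x + Matrix.vecMulVec x ν) α := by
    rw [hT, stress_add, stress_smul, stress_smul, stress_add, stress_smul, stress_one]
    ring
  rw [h5, h6]
  have e1 : (k : ℝ) * (E * N * covInner α α) ≤ N * (E * N * covInner α α) := by gcongr
  have e2 : N * E * covInner α α ≤ N ^ 2 * E * covInner α α := by gcongr
  have e3 : 0 ≤ N ^ 2 * E * covInner α α := by positivity
  have e4 := mul_le_mul_of_nonneg_right h4 hQ
  have e5 : -(2 * N ^ 2 * E * covInner α α) ≤ 1 / 2 * (Er.trace * covInner α α) - stress b Er α := by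
    linarith
  have e6 := mul_le_mul_of_nonneg_left e5 hs
  have e7 := mul_le_mul_of_nonneg_left h1 hθ
  linarith

end StressBounds

/-! ### The stress along a cut off radial field in a chart -/

section ChartStressBounds

theorem lieMetric_smul {x₀ : M} {u : Eu n} (hu : u ∈ (Ψ n x₀).target)
    {g : Eu n → ℝ} {X : Eu n → Eu n} (hg : DifferentiableAt ℝ g u) (hX : DifferentiableAt ℝ X u)
    (v w : Eu n) :
    lieMetric x₀ (fun y => g y • X y) u v w = g u * lieMetric x₀ X u v w +
      (fderiv ℝ g u v * chartMetric x₀ u (X u) w + fderiv ℝ g u w * chartMetric x₀ u v (X u)) := by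
  have h1 : ∀ v, fderiv ℝ (fun y => g y • X y) u v = g u • fderiv ℝ X u v + fderiv ℝ g u v • X u :=
    fun v => congrArg (fun T : Eu n →L[ℝ] Eu n => T v) (fderiv_fun_smul hg hX)
  have hadd : ∀ a b c, chartMetric x₀ u (a + b) c = chartMetric x₀ u a c + chartMetric x₀ u b c :=
    fun a b c => by rw [chartMetric, map_add, inner_add_left]; rfl
  have hsmul : ∀ (s : ℝ) a c, chartMetric x₀ u (s • a) c = s * chartMetric x₀ u a c :=
    fun s a c => by rw [chartMetric, map_smul, inner_smul_left]; rfl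
  rw [lieMetric, lieMetric, h1, h1, ← fderiv_chartMetric hu, ← fderiv_chartMetric hu, map_smul,
    hadd, chartMetric_comm x₀ u v, hadd, hsmul, hsmul, hsmul, hsmul, smul_eq_mul,
    chartMetric_comm x₀ u _ v, chartMetric_comm x₀ u _ v]
  ring

/-- Lower bound for the stress along a radial field multiplied by a decreasing function of an
approximate distance `r`. -/
theorem chartStress_radial_lower {k : ℕ} {x₀ : M} {u : Eu n}
    (hu : u ∈ (Ψ n x₀).target) (α : Form n M k) (hk : k ≤ n) {g : Eu n → ℝ}
    {X : Eu n → Eu n} (hg : DifferentiableAt ℝ g u) (hX : DifferentiableAt ℝ X u)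
    {N : Eu n →L[ℝ] ℝ} {r θ E κ a q q' : ℝ} (hg0 : 0 ≤ g u) (hθ : 0 ≤ θ)
    (hgN : ∀ w, fderiv ℝ g u w = -θ * N w) (hE : 0 ≤ E) (hκ : 0 ≤ κ) (ha : 0 ≤ a)
    (hlie : ∀ v w, |lieMetric x₀ X u v w - 2 * chartMetric x₀ u v w| ≤ E * ‖v‖ * ‖w‖)
    (hnorm : ∀ w, ‖w‖ ≤ κ * chartNorm x₀ u w) (hN : ∀ w, |N w| ≤ (1 + a) * chartNorm x₀ u w)
    (hXr : chartNorm x₀ u (X u) ≤ (1 + q) * r) (hNX : r - q' ≤ N (X u)) (hq : 0 ≤ q)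
    (hr : 0 ≤ r) (hrθ : r = 0 → θ = 0) :
    (g u * (n - 2 * k - 2 * (n : ℝ) ^ 2 * (E * κ ^ 2)) -
      θ * ((1 + a) * ((1 + q) * r) + (n : ℝ) ^ 2 *
        (r * (1 + a) ^ 2 + r * (1 + q) ^ 2 - 2 * (r - q')))) *
        covInner (α ((Ψ n x₀).symm u)) (α ((Ψ n x₀).symm u)) ≤
      chartStress x₀ (lieGram x₀ (fun y => g y • X y) u) u (inChart α x₀ u) := by
  set x := (Ψ n x₀).symm u with hx
  set b := stdOrthonormalBasis ℝ (TangentSpace (𝓡 n) x) with hb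
  set β : Fin (Module.finrank ℝ (TangentSpace (𝓡 n) x)) → Eu n :=
    fun i => chartCoframe x₀ x (b i) with hβ
  have hfin : Module.finrank ℝ (TangentSpace (𝓡 n) x) = n :=
    (finrank_euclideanSpace_fin (𝕜 := ℝ) (n := n))
  have hcard : Fintype.card (Fin (Module.finrank ℝ (TangentSpace (𝓡 n) x))) = n := by
    rw [Fintype.card_fin, hfin]
  have hfr : ∀ i, chartFrame x₀ u (β i) = b i := fun i => chartFrame_chartCoframe hu (b i)
  have hn1 : ∀ i, chartNorm x₀ u (β i) = 1 := fun i => by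
    rw [chartNorm_eq, hfr]
    exact b.orthonormal.1 i
  have hnb : ∀ i, ‖β i‖ ≤ κ := fun i => by simpa [hn1] using hnorm (β i)
  set xc : Fin (Module.finrank ℝ (TangentSpace (𝓡 n) x)) → ℝ :=
    fun i => chartMetric x₀ u (X u) (β i) with hxc
  set ν : Fin (Module.finrank ℝ (TangentSpace (𝓡 n) x)) → ℝ := fun i => N (β i) with hν
  set Er : Matrix _ _ ℝ := Matrix.of fun i j =>
    lieMetric x₀ X u (β i) (β j) - 2 * chartMetric x₀ u (β i) (β j) with hEr
  have hxi : ∀ i, xc i = inner ℝ (b i) (chartFrame x₀ u (X u)) := fun i => by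
    simp only [hxc]
    rw [chartMetric, hfr, real_inner_comm]
  have hEb : ∀ i j, |Er i j| ≤ E * κ ^ 2 := fun i j => by
    refine (hlie (β i) (β j)).trans ?_
    rw [sq, ← mul_assoc]
    have := hnb i
    have := hnb j
    gcongr
  have hone : ∀ i j, chartMetric x₀ u (β i) (β j) = (1 : Matrix _ _ ℝ) i j := fun i j => by
    rw [chartMetric, hfr, hfr, orthonormal_iff_ite.1 b.orthonormal, Matrix.one_apply]
  have hT : (Matrix.of fun i j => lieBilin x₀ (fun y => g y • X y) u (β i) (β j)) =
      g u • ((2 : ℝ) • 1 + Er) + (-θ) • (Matrix.vecMulVec ν xc + Matrix.vecMulVec xc ν) := by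
    ext i j
    simp only [Matrix.add_apply, Matrix.smul_apply, Matrix.vecMulVec_apply, smul_eq_mul,
      Matrix.of_apply, hEr, ← hone]
    change lieMetric x₀ (fun y => g y • X y) u (β i) (β j) = _
    rw [lieMetric_smul hu hg hX, hgN, hgN, chartMetric_comm x₀ u (β i) (X u)]
    ring
  have hX2 : ∑ i, xc i ^ 2 = chartNorm x₀ u (X u) ^ 2 := by
    rw [chartNorm_eq, ← b.sum_sq_norm_inner_right]
    refine sum_congr rfl fun i _ => ?_
    rw [hxi, Real.norm_eq_abs, sq_abs]
  have hνx : ∑ i, ν i * xc i = N (X u) := by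
    have h1 : X u = ∑ i, xc i • β i := by
      have h2 : chartFrame x₀ u (X u) = ∑ i, xc i • b i := by
        simp only [hxi]
        exact (b.sum_repr' _).symm
      have h3 := congrArg (chartCoframe x₀ x) h2
      rw [chartCoframe_chartFrame hu, map_sum] at h3
      simpa only [map_smul] using h3
    conv_rhs => rw [h1, map_sum]
    exact sum_congr rfl fun i _ => by rw [map_smul, smul_eq_mul, mul_comm]
  -- The dual norm of N: on the vector with coefficients ν it takes the value S, and that vector has
  -- length √S, so S ≤ (1 + a)√S.
  have hν2 : ∑ i, ν i ^ 2 ≤ (1 + a) ^ 2 := by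
    set S := ∑ i, ν i ^ 2 with hS
    have hS0 : 0 ≤ S := Finset.sum_nonneg fun i _ => sq_nonneg _
    have h1 : N (∑ i, ν i • β i) = S := by
      rw [map_sum]
      exact sum_congr rfl fun i _ => by rw [map_smul, smul_eq_mul, sq]
    have h2 : chartNorm x₀ u (∑ i, ν i • β i) ^ 2 = S := by
      rw [chartNorm_eq, ← b.sum_sq_norm_inner_right]
      refine sum_congr rfl fun i _ => ?_
      rw [map_sum]
      simp only [map_smul, hfr]
      rw [b.orthonormal.inner_right_fintype, Real.norm_eq_abs, sq_abs]
    have h3 := (le_abs_self _).trans (hN (∑ i, ν i • β i))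
    rw [h1] at h3
    have h4 : S ^ 2 ≤ (1 + a) ^ 2 * S := by
      calc S ^ 2 ≤ ((1 + a) * chartNorm x₀ u (∑ i, ν i • β i)) ^ 2 := by gcongr
        _ = _ := by rw [mul_pow, h2]
    by_contra h5
    linarith [mul_lt_mul_of_pos_right (not_le.1 h5) ((sq_nonneg (1 + a)).trans_lt (not_le.1 h5))]
  have hmain : lieGram x₀ (fun y => g y • X y) u =
      Matrix.of fun i j => lieBilin x₀ (fun y => g y • X y) u (stdFrame n i) (stdFrame n j) := rfl
  rw [hmain, chartStress_eq_stress hu b]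
  have hQ := covInner_self_nonneg (α x)
  -- The estimate divides by r, which may vanish. In that case θ = 0 and any positive number may
  -- take its place.
  have key : ∀ r', 0 < r' → (θ = 0 ∨ r' = r) → (g u * (n - 2 * k - 2 * (n : ℝ) ^ 2 * (E * κ ^ 2)) -
      θ * ((1 + a) * ((1 + q) * r) + (n : ℝ) ^ 2 *
        (r * (1 + a) ^ 2 + r * (1 + q) ^ 2 - 2 * (r - q')))) ≤
      (g u * (n - 2 * k - 2 * (n : ℝ) ^ 2 * (E * κ ^ 2)) -
      θ * (∑ i, ν i * xc i + (n : ℝ) ^ 2 *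
        (r' * ∑ i, ν i ^ 2 + r'⁻¹ * ∑ i, xc i ^ 2 - 2 * ∑ i, ν i * xc i))) := by
    intro r' hr' hor
    refine sub_le_sub_left ?_ _
    rcases hor with h0 | rfl
    · rw [h0]; simp
    · refine mul_le_mul_of_nonneg_left ?_ hθ
      rw [hνx, hX2]
      have e1 : N (X u) ≤ (1 + a) * ((1 + q) * r') := ((le_abs_self _).trans (hN _)).trans
        (mul_le_mul_of_nonneg_left hXr (by linarith))
      have e2 : r' * ∑ i, ν i ^ 2 ≤ r' * (1 + a) ^ 2 := by gcongr
      have e3 : r'⁻¹ * chartNorm x₀ u (X u) ^ 2 ≤ r' * (1 + q) ^ 2 := by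
        have h0 := chartNorm_nonneg x₀ u (X u)
        calc r'⁻¹ * chartNorm x₀ u (X u) ^ 2 ≤ r'⁻¹ * ((1 + q) * r') ^ 2 := by gcongr
          _ = r' * (1 + q) ^ 2 := by field_simp
      have e4 : r' * ∑ i, ν i ^ 2 + r'⁻¹ * chartNorm x₀ u (X u) ^ 2 - 2 * N (X u) ≤
          r' * (1 + a) ^ 2 + r' * (1 + q) ^ 2 - 2 * (r' - q') := by linarith
      have e5 := mul_le_mul_of_nonneg_left e4 (sq_nonneg (n : ℝ))
      linarith
  have hstress : ∀ r' : ℝ, 0 < r' → _ := fun r' hr' => stress_lower b hg0 hθ hr' hEb (by positivity) hT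
    (by rw [hcard]; exact hk) (α x)
  simp only [hcard] at hstress
  rcases hr.eq_or_lt with h0 | h0
  · exact (mul_le_mul_of_nonneg_right (key 1 one_pos (Or.inl (hrθ h0.symm))) hQ).trans
      (hstress 1 one_pos)
  · exact (mul_le_mul_of_nonneg_right (key r h0 (Or.inr rfl)) hQ).trans (hstress r h0)

end ChartStressBounds

/-! ### The radial test integrand -/

section RadialTest

/-- A smooth decreasing cutoff, constant near `0` and vanishing beyond `τ`. -/
structure IsRadialCutoff (ξ : ℝ → ℝ) (δ τ : ℝ) : Prop where
  contDiff : ContDiff ℝ ∞ ξ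
  nonneg : ∀ t, 0 ≤ ξ t
  deriv_nonpos : ∀ t, deriv ξ t ≤ 0
  deriv_eq_zero : ∀ t, t < δ → deriv ξ t = 0
  eq_zero : ∀ t, τ ≤ t → ξ t = 0

theorem IsRadialCutoff.deriv_eq_zero' {ξ : ℝ → ℝ} {δ τ : ℝ} (h : IsRadialCutoff ξ δ τ) {t : ℝ}
    (ht : τ < t) : deriv ξ t = 0 := by
  have : ξ =ᶠ[𝓝 t] fun _ => 0 := by
    filter_upwards [Ioi_mem_nhds ht] with s hs using h.eq_zero s (le_of_lt hs)
  rw [this.deriv_eq]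
  simp

theorem IsRadialCutoff.exists_lip {ξ : ℝ → ℝ} {δ τ : ℝ} (h : IsRadialCutoff ξ δ τ) :
    ∃ L : ℝ, 0 ≤ L ∧ (∀ t, |deriv ξ t| ≤ L) ∧ (∀ s t, |ξ s - ξ t| ≤ L * |s - t|) ∧
      ∀ s t, |deriv ξ s - deriv ξ t| ≤ L * |s - t| := by
  have hc : ContDiff ℝ ∞ (deriv ξ) := ((contDiff_infty_iff_deriv).1 h.contDiff).2
  have hs : HasCompactSupport (deriv ξ) :=
    HasCompactSupport.of_support_subset_isCompact (isCompact_Icc (a := δ) (b := τ)) fun t ht => by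
      by_contra h'
      rcases not_and_or.1 h' with h1 | h1
      · exact ht (h.deriv_eq_zero t (not_le.1 h1))
      · exact ht (h.deriv_eq_zero' (not_le.1 h1))
  obtain ⟨L, hL⟩ := hs.exists_bound_of_continuous hc.continuous
  obtain ⟨L', hL'⟩ := hc.lipschitzWith_of_hasCompactSupport hs (by simp)
  have hL0 : 0 ≤ L := (norm_nonneg _).trans (hL 0)
  refine ⟨L + L', by positivity, fun t => (hL t).trans (le_add_of_nonneg_right L'.2), fun s t => ?_,
    fun s t => ?_⟩
  · have := convex_univ.norm_image_sub_le_of_norm_deriv_le (f := ξ) (C := L)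
      (fun x _ => h.contDiff.differentiable (by simp) x) (fun x _ => hL x) (mem_univ t) (mem_univ s)
    refine this.trans ?_
    rw [Real.norm_eq_abs]
    gcongr
    exact le_add_of_nonneg_right L'.2
  · have := hL'.dist_le_mul s t
    rw [Real.dist_eq, Real.dist_eq] at this
    refine this.trans ?_
    gcongr
    exact le_add_of_nonneg_left hL0

/-- The integrand of the radial test inequality. -/
def radialTest (m C : ℝ) (ξ : ℝ → ℝ) (t : ℝ) : ℝ :=
  ξ t * (m - C * t ^ 2) + deriv ξ t * (t + C * t ^ 3)

theorem IsRadialCutoff.radialTest_eq_zero {ξ : ℝ → ℝ} {δ τ : ℝ} (h : IsRadialCutoff ξ δ τ)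
    (m C : ℝ) {t : ℝ} (ht : τ < t) : radialTest m C ξ t = 0 := by
  rw [radialTest, h.eq_zero t ht.le, h.deriv_eq_zero' ht]
  ring

theorem IsRadialCutoff.continuous_radialTest {ξ : ℝ → ℝ} {δ τ : ℝ} (h : IsRadialCutoff ξ δ τ)
    (m C : ℝ) : Continuous (radialTest m C ξ) := by
  have hc : Continuous (deriv ξ) := ((contDiff_infty_iff_deriv).1 h.contDiff).2.continuous
  have := h.contDiff.continuous
  unfold radialTest
  fun_prop

/-- Near a, `chartStress_radial_lower` is applied with g = ξ∘F, N = dF and θ = -ξ'(F), and F is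
replaced by the distance at a cost proportional to e and to the Lipschitz constant of ξ and ξ'. Far
from a both sides are controlled because the field and the integrand vanish. -/
theorem IsRadial.radialTest_le {x₀ : M} {c₀ a : Eu n} {R c Λ ρ C s₀ : ℝ} {X : Eu n → Eu n}
    (hX : IsRadial x₀ (closedBall c₀ (4 * R)) a X ρ C s₀)
    (h : MetricBound (chartMetric (n := n) x₀) (chartMetricDeriv x₀)
      (closedBall c₀ (4 * R)) c Λ) (hR : 0 < R)
    (hreg : ∀ u ∈ (Ψ n x₀).target, chartDist x₀ a u < ρ →
      u ∈ ball c₀ (2 * R))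
    (hρ : 0 < ρ) (hρ1 : ρ ≤ 1) (hC : 0 < C) {F χ : Eu n → ℝ} (hF : ContDiff ℝ ∞ F) {e : ℝ}
    (he : 0 ≤ e) (hF1 : ∀ u ∈ closedBall c₀ (3 * R), |F u - chartDist x₀ a u| ≤ e)
    (hF2 : ∀ u ∈ closedBall c₀ (2 * R), ∀ w,
        |fderiv ℝ F u w| ≤ chartNorm x₀ u w + e * ‖w‖)
    (hF3 : ∀ u ∈ closedBall c₀ (2 * R), chartDist x₀ a u < ρ / 2 →
        chartDist x₀ a u - C * chartDist x₀ a u ^ 3 - e ≤ fderiv ℝ F u (X u))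
    (hχ1 : ∀ u ∈ ball c₀ (2 * R), χ =ᶠ[𝓝 u] 1)
    (hχ0 : ∀ u ∉ ball c₀ (3 * R), χ =ᶠ[𝓝 u] 0)
    {ξ : ℝ → ℝ} {δ τ L : ℝ} (hξ : IsRadialCutoff ξ δ τ) (hL0 : 0 ≤ L)
    (hL : (∀ t, |deriv ξ t| ≤ L) ∧ (∀ s t, |ξ s - ξ t| ≤ L * |s - t|) ∧
      ∀ s t, |deriv ξ s - deriv ξ t| ≤ L * |s - t|)
    (heδ : e < δ) (heτ : τ + e < ρ / 2) (heκ : (√c)⁻¹ * e ≤ 1) {C₁ : ℝ}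
    (hC₁ : C₁ = 2 * (n : ℝ) ^ 2 * (C * (√c)⁻¹ ^ 2) + C + (n : ℝ) ^ 2 * (4 * C + C ^ 2))
    {r p : ℕ} (hp : 2 * p ≤ n) (z : Fin r → Form n M p) {u : Eu n}
    (hu : u ∈ (Ψ n x₀).target) :
    (radialTest (n - 2 * p) C₁ ξ (chartDist x₀ a u) - (L * (n + C₁) + L * (1 + C₁) +
      L * ((√c)⁻¹ * (1 + C) + (n : ℝ) ^ 2 * (3 * (√c)⁻¹ + 2))) * e) *
        normSq z ((Ψ n x₀).symm u) ≤
      ∑ i, chartStress x₀ (lieGram x₀ (fun y => (χ y * ξ (F y)) • X y) u) u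
        (inChart (z i) x₀ u) := by
  set κ := (√c)⁻¹ with hκ
  have hκ0 : 0 < κ := inv_pos.2 (Real.sqrt_pos.2 h.c_pos)
  have hr0 : 0 ≤ chartDist x₀ a u := dist_nonneg
  have hC₁0 : 0 ≤ C₁ := by rw [hC₁]; positivity
  have hnz : 0 ≤ normSq z ((Ψ n x₀).symm u) :=
    Finset.sum_nonneg fun i _ => covInner_self_nonneg _
  by_cases hur : chartDist x₀ a u < ρ / 2
  · have hub := hreg u hu (by linarith)
    have hub' := ball_subset_closedBall hub
    have hcongr : (fun y => (χ y * ξ (F y)) • X y) =ᶠ[𝓝 u] fun y => ξ (F y) • X y := by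
      filter_upwards [hχ1 u hub] with y hy
      rw [hy, Pi.one_apply, one_mul]
    rw [chartStress_congr hcongr]
    set r' := chartDist x₀ a u with hr'
    have hr1 : r' ≤ 1 := by linarith
    have hFr : |F u - r'| ≤ e := hF1 u (closedBall_subset_closedBall (by linarith) hub')
    have hξF : HasFDerivAt (fun y => ξ (F y)) (deriv ξ (F u) • fderiv ℝ F u) u :=
      ((hξ.contDiff.differentiable (by simp) (F u)).hasDerivAt).comp_hasFDerivAt u
        (hF.differentiable (by simp) u).hasFDerivAt
    have huK : u ∈ closedBall c₀ (4 * R) :=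
      closedBall_subset_closedBall (by linarith) hub'
    have hlow : ∀ i, _ := fun i => chartStress_radial_lower (k := p) hu (z i) (by omega)
      (g := fun y => ξ (F y)) (X := X) (N := fderiv ℝ F u) (r := r') (θ := -deriv ξ (F u))
      (E := C * r' ^ 2) (κ := κ) (a := κ * e) (q := C * r' ^ 2) (q' := C * r' ^ 3 + e)
      hξF.differentiableAt (hX.contDiff.differentiable (by simp) u) (hξ.nonneg _)
      (neg_nonneg.2 (hξ.deriv_nonpos _))
      (fun w => by rw [hξF.fderiv, neg_neg]; rfl) (by positivity) hκ0.le (by positivity)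
      (hX.lie_le u hu (by linarith)) (h.norm_le huK)
      (fun w => (hF2 u hub' w).trans (by
        have := mul_le_mul_of_nonneg_left (h.norm_le huK w) he
        linarith))
      (hX.chartNorm_le u hu (by linarith)) (by linarith [hF3 u hub' hur]) (by positivity) hr0
      -- At distance 0 the approximation F is at most e < δ, where ξ is still constant.
      (fun h0 => by
        rw [hξ.deriv_eq_zero, neg_zero]
        linarith [(abs_le.1 hFr).2])
    rw [normSq, mul_sum]
    refine sum_le_sum fun i _ => le_trans (mul_le_mul_of_nonneg_right ?_
      (covInner_self_nonneg _)) (hlow i)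
    set θ := -deriv ξ (F u) with hθ
    have hθ0 : 0 ≤ θ := neg_nonneg.2 (hξ.deriv_nonpos _)
    have hθL : θ ≤ L := by
      rw [hθ]; exact (neg_le_abs _).trans (hL.1 _)
    have hr3 : r' ^ 3 ≤ 1 := pow_le_one₀ hr0 hr1
    have hr2 : r' ^ 2 ≤ 1 := pow_le_one₀ hr0 hr1
    have e1 : (1 + κ * e) * ((1 + C * r' ^ 2) * r') ≤ r' + C * r' ^ 3 + κ * (1 + C) * e := by
      have f1 : κ * e * r' ≤ κ * e * 1 := by gcongr
      have f2 : κ * e * C * r' ^ 3 ≤ κ * e * C * 1 := by gcongr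
      linarith
    have e2 : r' * (1 + κ * e) ^ 2 + r' * (1 + C * r' ^ 2) ^ 2 - 2 * (r' - (C * r' ^ 3 + e)) ≤
        (4 * C + C ^ 2) * r' ^ 3 + (3 * κ + 2) * e := by
      have f1 : r' * (2 * (κ * e)) ≤ 1 * (2 * (κ * e)) := by gcongr
      have f2 : r' * (κ * e) * (κ * e) ≤ 1 * (κ * e) * 1 := by gcongr
      have f3 : C ^ 2 * r' ^ 3 * r' ^ 2 ≤ C ^ 2 * r' ^ 3 * 1 := by gcongr
      linarith
    have e3 := mul_le_mul_of_nonneg_left e2 (sq_nonneg (n : ℝ))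
    -- The cubic errors come from the length of X, with coefficient C, and from the rank one part,
    -- with coefficient n²(4C + C²). The remaining summand of C₁ is reserved for the error of the
    -- Lie derivative.
    have e4 : (1 + κ * e) * ((1 + C * r' ^ 2) * r') + (n : ℝ) ^ 2 *
        (r' * (1 + κ * e) ^ 2 + r' * (1 + C * r' ^ 2) ^ 2 - 2 * (r' - (C * r' ^ 3 + e))) ≤
        r' + C₁ * r' ^ 3 + (κ * (1 + C) + (n : ℝ) ^ 2 * (3 * κ + 2)) * e := by
      have f1 : 0 ≤ 2 * (n : ℝ) ^ 2 * (C * κ ^ 2) * r' ^ 3 := by positivity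
      rw [hC₁]
      linarith
    have e5 := mul_le_mul_of_nonneg_left e4 hθ0
    have e6 : θ * ((κ * (1 + C) + (n : ℝ) ^ 2 * (3 * κ + 2)) * e) ≤
        L * ((κ * (1 + C) + (n : ℝ) ^ 2 * (3 * κ + 2)) * e) := by gcongr
    have e7 : ξ (F u) * (n - 2 * p - C₁ * r' ^ 2) ≤
        ξ (F u) * (n - 2 * p - 2 * (n : ℝ) ^ 2 * (C * r' ^ 2 * κ ^ 2)) := by
      refine mul_le_mul_of_nonneg_left ?_ (hξ.nonneg _)
      have f1 : 0 ≤ (C + (n : ℝ) ^ 2 * (4 * C + C ^ 2)) * r' ^ 2 := by positivity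
      rw [hC₁]
      linarith
    have hm : |(n - 2 * p - C₁ * r' ^ 2 : ℝ)| ≤ n + C₁ := by
      have g1 : (2 * p : ℝ) ≤ n := by exact_mod_cast hp
      have g2 : (0 : ℝ) ≤ p := Nat.cast_nonneg _
      have g3 : C₁ * r' ^ 2 ≤ C₁ * 1 := by gcongr
      have g4 : 0 ≤ C₁ * r' ^ 2 := by positivity
      rw [abs_le]
      constructor <;> linarith
    have e8 : ξ r' * (n - 2 * p - C₁ * r' ^ 2) - L * (n + C₁) * e ≤
        ξ (F u) * (n - 2 * p - C₁ * r' ^ 2) := by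
      have g1 : |(ξ (F u) - ξ r') * (n - 2 * p - C₁ * r' ^ 2)| ≤ L * e * (n + C₁) := by
        rw [abs_mul]
        exact mul_le_mul ((hL.2.1 _ _).trans (mul_le_mul_of_nonneg_left hFr hL0)) hm
          (abs_nonneg _) (by positivity)
      linarith [(abs_le.1 g1).1]
    have e9 : deriv ξ r' * (r' + C₁ * r' ^ 3) - L * (1 + C₁) * e ≤
        -θ * (r' + C₁ * r' ^ 3) := by
      have g2 : |r' + C₁ * r' ^ 3| ≤ 1 + C₁ := by
        rw [abs_of_nonneg (by positivity)]
        have g3 : C₁ * r' ^ 3 ≤ C₁ * 1 := by gcongr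
        linarith
      have g1 : |(deriv ξ (F u) - deriv ξ r') * (r' + C₁ * r' ^ 3)| ≤ L * e * (1 + C₁) := by
        rw [abs_mul]
        exact mul_le_mul ((hL.2.2 _ _).trans (mul_le_mul_of_nonneg_left hFr hL0)) g2
          (abs_nonneg _) (by positivity)
      rw [hθ]
      linarith [(abs_le.1 g1).1]
    rw [radialTest]
    linarith
  -- Beyond ρ/2 the field vanishes near u: inside the `3R`-ball because F exceeds τ, outside it
  -- because of χ.
  · have hz0 : (fun y => (χ y * ξ (F y)) • X y) =ᶠ[𝓝 u] fun _ => 0 := by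
      by_cases hub : u ∈ ball c₀ (3 * R)
      · have h1 := (abs_le.1 (hF1 u (ball_subset_closedBall hub))).1
        have h2 : τ < F u := by linarith [not_lt.1 hur]
        filter_upwards [hF.continuous.continuousAt.eventually (lt_mem_nhds h2)] with y hy
        rw [hξ.eq_zero _ (le_of_lt hy), mul_zero, zero_smul]
      · filter_upwards [hχ0 u hub] with y hy
        rw [hy, Pi.zero_apply, zero_mul, zero_smul]
    rw [chartStress_congr hz0, lieGram_zero hu]
    simp only [chartStress_zero, Finset.sum_const_zero]
    rw [hξ.radialTest_eq_zero _ _ (by linarith [not_lt.1 hur] : τ < chartDist x₀ a u), zero_sub]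
    refine mul_nonpos_of_nonpos_of_nonneg (neg_nonpos.2 ?_) hnz
    positivity

end RadialTest

/-! ### The radial inequality, uniformly on the manifold -/

section RadialInequality

variable [CompactSpace M] [MeasurableSpace M] [BorelSpace M]

theorem normSq_nonneg {r p : ℕ} (z : Fin r → Form n M p) (x : M) : 0 ≤ normSq z x :=
  Finset.sum_nonneg fun _ _ => covInner_self_nonneg _

theorem IsNonlinearHarmonic.integrable_normSq {r D p : ℕ} {P : Fin D → Fin r → Fin r → ℝ}
    {h z : Fin r → Form n M p} (hz : IsNonlinearHarmonic P h z) :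
    Integrable (normSq z) (riemVol n M) :=
  integrable_finsetSum _ fun i _ => (isL2Form_of_mem_admissible hz.harmonic hz.mem i).2

theorem IsNonlinearHarmonic.integrable_mul_normSq {r D p : ℕ} {P : Fin D → Fin r → Fin r → ℝ}
    {h z : Fin r → Form n M p} (hz : IsNonlinearHarmonic P h z) {f : M → ℝ} (hf : Continuous f) :
    Integrable (fun x => f x * normSq z x) (riemVol n M) := by
  obtain ⟨C, hC⟩ := isCompact_univ.exists_bound_of_continuousOn hf.continuousOn
  exact hz.integrable_normSq.bdd_mul hf.aestronglyMeasurable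
    (ae_of_all _ fun x => hC x (mem_univ x))

variable [IsRiemannianManifold (𝓡 n) M]

/-- The first variation vanishes for the field χ ξ(F) X with F the mollified distance. The pointwise
lower bound `IsRadial.radialTest_le` bounds it from below by the test integral minus an error of
order ε times the energy, and ε tends to 0. The constants depend on neither the centre nor z. -/
theorem exists_radial_inequality_chart {x₀ : M} {c₀ : Eu n} {R : ℝ} (hR : 0 < R)
    (hKt : closedBall c₀ (4 * R) ⊆ (Ψ n x₀).target) :
    ∃ ρ₁ C₁ : ℝ, 0 < ρ₁ ∧ 0 ≤ C₁ ∧ ∀ a ∈ closedBall c₀ R, ∀ {r D p : ℕ}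
      {P : Fin D → Fin r → Fin r → ℝ} {h z : Fin r → Form n M p}, IsNonlinearHarmonic P h z →
      2 * p ≤ n → ∀ {ξ : ℝ → ℝ} {δ τ : ℝ}, IsRadialCutoff ξ δ τ → 0 < δ → τ < ρ₁ →
      ∫ x, radialTest (n - 2 * p) C₁ ξ (dist ((Ψ n x₀).symm a) x) * normSq z x
        ∂(riemVol n M) ≤ 0 := by
  obtain ⟨c, Λ, ρ, C, s₀, hb, hρ, hρ1, hC, hs₀, hall⟩ := exists_isRadial (n := n) hR hKt
  set C₁ := 2 * (n : ℝ) ^ 2 * (C * (√c)⁻¹ ^ 2) + C + (n : ℝ) ^ 2 * (4 * C + C ^ 2) with hC₁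
  have hC₁0 : 0 ≤ C₁ := by positivity
  refine ⟨ρ / 2, C₁, by positivity, hC₁0, fun a ha => ?_⟩
  intro r D p P h z hz hp ξ δ τ hξ hδ hτ
  obtain ⟨hballa, X, hX⟩ := hall a ha
  have hsub2 : ball c₀ (2 * R) ⊆ (Ψ n x₀).target :=
    (ball_subset_closedBall.trans
      (closedBall_subset_closedBall (by linarith))).trans hKt
  have hreg : ∀ u ∈ (Ψ n x₀).target, chartDist x₀ a u < ρ →
      u ∈ ball c₀ (2 * R) := fun u hu hur => by
    obtain ⟨u', hu', he⟩ := hballa (show (Ψ n x₀).symm u ∈ _ by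
      rw [mem_ball, dist_comm]; exact hur)
    rwa [← (Ψ n x₀).symm.injOn (hsub2 hu') hu he]
  obtain ⟨A, ε₀, hA, hε₀, hF⟩ := hX.exists_smooth_dist hb hR hKt hρ hρ1 hC hs₀
  obtain ⟨L, hL0, hL⟩ := hξ.exists_lip
  set κ := (√c)⁻¹ with hκ
  have hκ0 : 0 < κ := inv_pos.2 (Real.sqrt_pos.2 hb.c_pos)
  set A' := L * (n + C₁) + L * (1 + C₁) + L * (κ * (1 + C) + (n : ℝ) ^ 2 * (3 * κ + 2)) with hA'
  have hfi := hz.integrable_mul_normSq (f := fun x =>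
    radialTest (n - 2 * p) C₁ ξ (dist ((Ψ n x₀).symm a) x))
    ((hξ.continuous_radialTest _ _).comp (continuous_const.dist continuous_id))
  have hsrc : ball ((Ψ n x₀).symm a) ρ ⊆ (Ψ n x₀).source :=
    hballa.trans (by rintro _ ⟨u, hu, rfl⟩; exact mem_source_symm (hsub2 hu))
  rw [← setIntegral_eq_integral_of_forall_compl_eq_zero (s := (Ψ n x₀).source)
    (fun x hx => by
      have h1 : ρ ≤ dist ((Ψ n x₀).symm a) x := by
        by_contra h2
        exact hx (hsrc (by rw [mem_ball, dist_comm]; exact not_le.1 h2))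
      rw [hξ.radialTest_eq_zero _ _ (by linarith), zero_mul]),
    setIntegral_chart]
  have hfc := (integrable_chart_iff x₀).1 hfi.integrableOn
  have hWc := (integrable_chart_iff x₀).1 hz.integrable_normSq.integrableOn
  set J := ∫ u in (Ψ n x₀).target,
    chartDensity x₀ u * normSq z ((Ψ n x₀).symm u) with hJ
  let χ : ContDiffBump c₀ := ⟨2 * R, 5 / 2 * R, by positivity, by linarith⟩
  -- The thresholds ensure, for e = Aε, that e < δ, τ + e < ρ/2 and κe ≤ 1.
  have hε₁ : 0 < min (min ε₀ (δ / A)) (min ((ρ / 2 - τ) / A) (1 / (κ * A))) := by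
    have : 0 < ρ / 2 - τ := by linarith
    positivity
  have key := le_of_forall_gt_continuous (f := fun ε => A' * (A * ε) * J) (by fun_prop) hε₁
    (x := ∫ u in (Ψ n x₀).target, chartDensity x₀ u *
      (radialTest (n - 2 * p) C₁ ξ (dist ((Ψ n x₀).symm a)
        ((Ψ n x₀).symm u)) * normSq z ((Ψ n x₀).symm u)))
    fun ε hε hεε => ?_
  · simpa using key
  · obtain ⟨hε1, hε2⟩ := lt_min_iff.1 hεε
    obtain ⟨hεε₀, hεδ⟩ := lt_min_iff.1 hε1
    obtain ⟨hετ, hεκ⟩ := lt_min_iff.1 hε2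
    rw [lt_div_iff₀ hA] at hεδ hετ
    rw [lt_div_iff₀ (by positivity)] at hεκ
    obtain ⟨F, hFs, hF1, hF2, hF3⟩ := hF ε hε hεε₀
    have hYs : ContDiff ℝ ∞ fun y => (χ y * ξ (F y)) • X y :=
      (χ.contDiff.mul (hξ.contDiff.comp hFs)).smul hX.contDiff
    obtain ⟨hi, h0⟩ := first_variation_chart (x₀ := x₀) (c := c₀) (R := 3 * R) (R' := 4 * R)
      (by positivity) (by linarith) hKt (isCompact_closedBall c₀ (5 / 2 * R))
      (closedBall_subset_ball (by linarith)) hz hYs fun u hu => by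
        have : χ u = 0 := by
          by_contra h1
          have h2 : u ∈ Function.support χ := h1
          rw [χ.support_eq] at h2
          exact hu (ball_subset_closedBall h2)
        rw [this, zero_mul, zero_smul]
    have hpt : ∀ u ∈ (Ψ n x₀).target, _ := fun u hu =>
      hX.radialTest_le hb hR hreg hρ hρ1 hC hFs (e := A * ε) (χ := χ) (by positivity) hF1 hF2 hF3
        (fun u hu => χ.eventuallyEq_one_of_mem_ball hu) (fun u hu =>
          notMem_tsupport_iff_eventuallyEq.1 (by
            rw [χ.tsupport_eq]
            intro h1
            exact hu (closedBall_subset_ball (by linarith : 5 / 2 * R < 3 * R) h1)))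
        hξ hL0 hL (by linarith) (by linarith) (by linarith) hC₁ hp z hu
    have hmono := setIntegral_mono_on (μ := volume) (f := fun u => chartDensity x₀ u *
        (radialTest (n - 2 * p) C₁ ξ (dist ((Ψ n x₀).symm a)
          ((Ψ n x₀).symm u)) * normSq z ((Ψ n x₀).symm u)) -
        A' * (A * ε) * (chartDensity x₀ u * normSq z ((Ψ n x₀).symm u)))
      (hfc.sub (hWc.const_mul (A' * (A * ε)))) hi
      (isOpen_extChartAt_target x₀).measurableSet fun u hu => by
        have h1 := mul_le_mul_of_nonneg_left (hpt u hu) (chartDensity_pos hu).le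
        rw [chartDist, ← hA'] at h1
        linarith
    rw [h0, integral_sub hfc (hWc.const_mul (A' * (A * ε))), integral_const_mul] at hmono
    linarith

/-- Enlarging the constant weakens the inequality, so finitely many charts can share the largest
one. -/
theorem radialTest_anti (m : ℝ) {C C' : ℝ} (hC : C ≤ C') {ξ : ℝ → ℝ} {δ τ : ℝ}
    (hξ : IsRadialCutoff ξ δ τ) {t : ℝ} (ht : 0 ≤ t) :
    radialTest m C' ξ t ≤ radialTest m C ξ t := by
  have h1 : ξ t * (C * t ^ 2) ≤ ξ t * (C' * t ^ 2) := by
    have := hξ.nonneg t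
    gcongr
  have h2 : -deriv ξ t * (C * t ^ 3) ≤ -deriv ξ t * (C' * t ^ 3) := by
    have := neg_nonneg.2 (hξ.deriv_nonpos t)
    gcongr
  rw [radialTest, radialTest]
  linarith

variable (n M) in
-- Local constants become global by compactness: unions take the smaller radius and the larger
-- constant.
theorem exists_radial_inequality :
    ∃ ρ₁ C₁ : ℝ, 0 < ρ₁ ∧ 0 ≤ C₁ ∧ ∀ (q : M) {r D p : ℕ}
      {P : Fin D → Fin r → Fin r → ℝ} {h z : Fin r → Form n M p}, IsNonlinearHarmonic P h z →
      2 * p ≤ n → ∀ {ξ : ℝ → ℝ} {δ τ : ℝ}, IsRadialCutoff ξ δ τ → 0 < δ → τ < ρ₁ →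
      ∫ x, radialTest (n - 2 * p) C₁ ξ (dist q x) * normSq z x ∂(riemVol n M) ≤ 0 := by
  suffices H : ∃ ρ₁ C₁ : ℝ, 0 < ρ₁ ∧ 0 ≤ C₁ ∧ ∀ q ∈ (univ : Set M), ∀ {r D p : ℕ}
      {P : Fin D → Fin r → Fin r → ℝ} {h z : Fin r → Form n M p}, IsNonlinearHarmonic P h z →
      2 * p ≤ n → ∀ {ξ : ℝ → ℝ} {δ τ : ℝ}, IsRadialCutoff ξ δ τ → 0 < δ → τ < ρ₁ →
      ∫ x, radialTest (n - 2 * p) C₁ ξ (dist q x) * normSq z x ∂(riemVol n M) ≤ 0 by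
    obtain ⟨ρ₁, C₁, h1, h2, h3⟩ := H
    exact ⟨ρ₁, C₁, h1, h2, fun q => h3 q (mem_univ q)⟩
  refine isCompact_univ.induction_on (p := fun s : Set M => ∃ ρ₁ C₁ : ℝ, 0 < ρ₁ ∧ 0 ≤ C₁ ∧
      ∀ q ∈ s, ∀ {r D p : ℕ}
      {P : Fin D → Fin r → Fin r → ℝ} {h z : Fin r → Form n M p}, IsNonlinearHarmonic P h z →
      2 * p ≤ n → ∀ {ξ : ℝ → ℝ} {δ τ : ℝ}, IsRadialCutoff ξ δ τ → 0 < δ → τ < ρ₁ →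
      ∫ x, radialTest (n - 2 * p) C₁ ξ (dist q x) * normSq z x ∂(riemVol n M) ≤ 0)
    ⟨1, 0, one_pos, le_rfl, fun q hq => hq.elim⟩ ?_ ?_ ?_
  · rintro s t hst ⟨ρ₁, C₁, h1, h2, h3⟩
    exact ⟨ρ₁, C₁, h1, h2, fun q hq => h3 q (hst hq)⟩
  · rintro s t ⟨ρ₁, C₁, h1, h2, h3⟩ ⟨ρ₂, C₂, k1, k2, k3⟩
    refine ⟨min ρ₁ ρ₂, max C₁ C₂, lt_min h1 k1, h2.trans (le_max_left _ _), fun q hq => ?_⟩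
    intro r D p P h z hz hp ξ δ τ hξ hδ hτ
    have hint : ∀ C, Integrable (fun x => radialTest (n - 2 * p) C ξ (dist q x) * normSq z x)
        (riemVol n M) := fun C => hz.integrable_mul_normSq
      ((hξ.continuous_radialTest _ C).comp (continuous_const.dist continuous_id))
    have hmono : ∀ C, C ≤ max C₁ C₂ →
        ∫ x, radialTest (n - 2 * p) (max C₁ C₂) ξ (dist q x) * normSq z x ∂(riemVol n M) ≤
        ∫ x, radialTest (n - 2 * p) C ξ (dist q x) * normSq z x ∂(riemVol n M) := fun C hC =>
      integral_mono (hint _) (hint _) fun x => mul_le_mul_of_nonneg_right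
        (radialTest_anti _ hC hξ dist_nonneg) (normSq_nonneg z x)
    rcases hq with hq | hq
    · exact (hmono C₁ (le_max_left _ _)).trans
        (h3 q hq hz hp hξ hδ (hτ.trans_le (min_le_left _ _)))
    · exact (hmono C₂ (le_max_right _ _)).trans
        (k3 q hq hz hp hξ hδ (hτ.trans_le (min_le_right _ _)))
  · intro x _
    obtain ⟨ε, hε, hsub⟩ := Metric.nhds_basis_closedBall.mem_iff.1
      ((isOpen_extChartAt_target (I := 𝓡 n) x).mem_nhds (mem_extChartAt_target x))
    obtain ⟨ρ₁, C₁, h1, h2, h3⟩ := exists_radial_inequality_chart (n := n) (x₀ := x)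
      (c₀ := Ψ n x x) (R := ε / 4) (by positivity) (by
        rwa [mul_div_cancel₀ _ (by norm_num : (4 : ℝ) ≠ 0)])
    refine ⟨(Ψ n x).source ∩
      Ψ n x ⁻¹' ball (Ψ n x x) (ε / 4), ?_, ρ₁, C₁, h1, h2,
      fun q hq => ?_⟩
    · exact mem_nhdsWithin_of_mem_nhds (((continuousOn_extChartAt x).isOpen_inter_preimage
        (isOpen_extChartAt_source x) isOpen_ball).mem_nhds
          ⟨mem_extChartAt_source x, mem_ball_self (by positivity)⟩)
    · have := @h3 (Ψ n x q) (ball_subset_closedBall hq.2)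
      rwa [(Ψ n x).left_inv hq.1] at this

end RadialInequality

/-! ### The extremal cutoff function -/

section RadialCutoff

/-- The weight `e^{λ t²} t^{-m}` of the monotonicity formula. -/
def radialWeight (m lam t : ℝ) : ℝ := Real.exp (lam * t ^ 2) * t ^ (-m)

theorem radialWeight_pos {m lam t : ℝ} (ht : 0 < t) : 0 < radialWeight m lam t :=
  mul_pos (Real.exp_pos _) (Real.rpow_pos_of_pos ht _)

theorem hasDerivAt_radialWeight (m lam : ℝ) {t : ℝ} (ht : 0 < t) :
    HasDerivAt (radialWeight m lam) (radialWeight m lam t * ((2 * lam * t ^ 2 - m) / t)) t := by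
  have h1 : HasDerivAt (fun t : ℝ => Real.exp (lam * t ^ 2))
      (Real.exp (lam * t ^ 2) * (lam * (2 * t))) t := by
    simpa using ((hasDerivAt_pow 2 t).const_mul lam).exp
  have h2 := h1.mul (Real.hasDerivAt_rpow_const (x := t) (p := -m) (Or.inl ht.ne'))
  refine h2.congr_deriv ?_
  rw [radialWeight, Real.rpow_sub_one ht.ne']
  field_simp
  ring

/-- `-ξ'` for the extremal cutoff function `ξ` of the radial test inequality. -/
def radialDensity (m C lam t : ℝ) : ℝ := radialWeight m lam t / (t * (1 + C * t ^ 2))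

theorem radialDensity_nonneg {m C lam t : ℝ} (hC : 0 ≤ C) (ht : 0 < t) :
    0 ≤ radialDensity m C lam t :=
  div_nonneg (radialWeight_pos ht).le (by positivity)

theorem contDiffAt_radialDensity {m C lam t : ℝ} (hC : 0 ≤ C) (ht : 0 < t) :
    ContDiffAt ℝ ∞ (radialDensity m C lam) t := by
  have h1 : ContDiffAt ℝ ∞ (fun t : ℝ => t ^ (-m)) t :=
    Real.contDiffAt_rpow_const_of_ne ht.ne'
  have h2 : ContDiffAt ℝ ∞ (fun t : ℝ => Real.exp (lam * t ^ 2)) t := by fun_prop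
  have h3 : ContDiffAt ℝ ∞ (fun t : ℝ => t * (1 + C * t ^ 2)) t := by fun_prop
  exact (h2.mul h1).div h3 (by positivity)

/-- With w the weight and ξ' = -ηw/(t(1 + Ct²)), the derivative is a sum of three terms: -2Ctξ, then
η'(c - w), and -ηwt(2λ - C(m + 1) + 2λCt²)/(1 + Ct²). The last one is where λ has to be large. The
term cη gives η' a coefficient whose sign is known. -/
theorem antitoneOn_radial {m C lam c a b : ℝ} {ξ η η' : ℝ → ℝ} (hC : 0 ≤ C)
    (hl : C * (m + 1) ≤ 2 * lam) (hlam : 0 ≤ lam) (ha : 0 < a)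
    (hξ : ∀ t ∈ Icc a b, HasDerivAt ξ (-(η t * radialDensity m C lam t)) t)
    (hη : ∀ t ∈ Icc a b, HasDerivAt η (η' t) t) (hξ0 : ∀ t, 0 ≤ ξ t) (hη0 : ∀ t, 0 ≤ η t)
    (hc : ∀ t ∈ Icc a b, η' t * (c - radialWeight m lam t) ≤ 0) :
    AntitoneOn (fun t => ξ t * (m - C * t ^ 2) - η t * radialWeight m lam t + c * η t)
      (Icc a b) := by
  have hd : ∀ t ∈ Icc a b, HasDerivAt
      (fun t => ξ t * (m - C * t ^ 2) - η t * radialWeight m lam t + c * η t)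
      (-(η t * radialDensity m C lam t) * (m - C * t ^ 2) + ξ t * (-(C * (2 * t))) -
        (η' t * radialWeight m lam t +
          η t * (radialWeight m lam t * ((2 * lam * t ^ 2 - m) / t))) + c * η' t) t := by
    intro t ht
    have h1 : HasDerivAt (fun t : ℝ => m - C * t ^ 2) (-(C * (2 * t))) t := by
      simpa using ((hasDerivAt_pow 2 t).const_mul C).const_sub m
    exact (((hξ t ht).mul h1).sub ((hη t ht).mul
      (hasDerivAt_radialWeight m lam (ha.trans_le ht.1)))).add ((hη t ht).const_mul c)
  refine antitoneOn_of_deriv_nonpos (convex_Icc a b)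
    (fun t ht => (hd t ht).continuousAt.continuousWithinAt)
    (fun t ht => (hd t (interior_subset ht)).differentiableAt.differentiableWithinAt)
    fun t ht' => ?_
  have ht := interior_subset ht'
  have ht0 : 0 < t := ha.trans_le ht.1
  rw [(hd t ht).deriv]
  have h1 : 0 ≤ ξ t * (C * (2 * t)) := mul_nonneg (hξ0 t) (by positivity)
  have h2 : 0 ≤ radialDensity m C lam t * (m - C * t ^ 2) +
      radialWeight m lam t * ((2 * lam * t ^ 2 - m) / t) := by
    have : radialDensity m C lam t * (m - C * t ^ 2) +
        radialWeight m lam t * ((2 * lam * t ^ 2 - m) / t) = radialWeight m lam t *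
          (t * (2 * lam - C * (m + 1) + 2 * lam * C * t ^ 2) / (1 + C * t ^ 2)) := by
      have h3 : 1 + C * t ^ 2 ≠ 0 := by positivity
      rw [radialDensity]
      field_simp
      ring
    rw [this]
    have h4 := sub_nonneg.2 hl
    have h5 := radialWeight_pos (m := m) (lam := lam) ht0
    positivity
  have h3 := mul_nonneg (hη0 t) h2
  have h4 := hc t ht
  linarith

/-- A smooth step from `0` at `a` to `1` at `a + ε`. -/
def smoothStep (a ε t : ℝ) : ℝ := Real.smoothTransition ((t - a) / ε)

theorem contDiff_smoothStep (a ε : ℝ) : ContDiff ℝ ∞ (smoothStep a ε) :=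
  Real.smoothTransition.contDiff.comp ((contDiff_id.sub contDiff_const).div_const ε)

theorem smoothStep_eq_zero {a ε t : ℝ} (hε : 0 < ε) (ht : t ≤ a) : smoothStep a ε t = 0 :=
  Real.smoothTransition.zero_of_nonpos (div_nonpos_of_nonpos_of_nonneg (by linarith) hε.le)

theorem smoothStep_eq_one {a ε t : ℝ} (hε : 0 < ε) (ht : a + ε ≤ t) : smoothStep a ε t = 1 :=
  Real.smoothTransition.one_of_one_le ((one_le_div hε).2 (by linarith))

theorem monotone_smoothStep {a ε : ℝ} (hε : 0 < ε) : Monotone (smoothStep a ε) := fun s t hst =>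
  Real.smoothTransition.monotone (by gcongr)

theorem deriv_smoothStep_nonneg {a ε : ℝ} (hε : 0 < ε) (t : ℝ) : 0 ≤ deriv (smoothStep a ε) t :=
  (monotone_smoothStep hε).deriv_nonneg

/-- The ideal cutoff solves -ξ'(t + Ct³) = w on [σ,τ] with ξ(τ) = 0. Then ξ(m - Ct²) - w is
decreasing there and equals -w(τ) at τ, so the test function is at least -w(τ) on [σ,τ], and ξ(σ)(m
- Cσ²) ≥ w(σ) - w(τ), a bound that persists on [0,σ], where ξ is constant. Smooth steps η₁ at σ and
η₂ at τ replace the jumps of ξ', at the cost of κ each. -/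
theorem exists_isRadialCutoff {m C lam σ τ κ : ℝ} (hC : 0 ≤ C)
    (hl : C * (m + 1) ≤ 2 * lam) (hlam : 0 ≤ lam) (hσ : 0 < σ) (hστ : σ < τ) (hκ : 0 < κ)
    (hκσ : κ ≤ radialWeight m lam σ) :
    ∃ ξ, IsRadialCutoff ξ σ τ ∧
      (∀ t, 0 ≤ t → t < σ →
        radialWeight m lam σ - radialWeight m lam τ - 2 * κ ≤ radialTest m C ξ t) ∧
      ∀ t, σ ≤ t → t < τ → -(radialWeight m lam τ + κ) ≤ radialTest m C ξ t := by
  have hτ := hσ.trans hστ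
  obtain ⟨ε₁, hε₁, h1⟩ := Metric.continuousAt_iff.1
    (hasDerivAt_radialWeight m lam hσ).continuousAt κ hκ
  obtain ⟨ε₂, hε₂, h2⟩ := Metric.continuousAt_iff.1
    (hasDerivAt_radialWeight m lam hτ).continuousAt κ hκ
  obtain ⟨ε, hε, hεε⟩ := exists_between
    (lt_min (lt_min hε₁ hε₂) (half_pos (sub_pos.2 hστ)))
  obtain ⟨h3, hε3⟩ := lt_min_iff.1 hεε
  obtain ⟨hε1, hε2⟩ := lt_min_iff.1 h3
  have hA1 : ∀ t ∈ Icc σ (σ + ε), radialWeight m lam σ - κ ≤ radialWeight m lam t := fun t ht => by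
    have := h1 (x := t) (by rw [Real.dist_eq, abs_lt]; constructor <;> linarith [ht.1, ht.2])
    rw [Real.dist_eq] at this
    linarith [(abs_lt.1 this).1]
  have hA2 : ∀ t ∈ Icc (τ - ε) τ, radialWeight m lam t ≤ radialWeight m lam τ + κ := fun t ht => by
    have := h2 (x := t) (by rw [Real.dist_eq, abs_lt]; constructor <;> linarith [ht.1, ht.2])
    rw [Real.dist_eq] at this
    linarith [(abs_lt.1 this).2]
  set η₁ := smoothStep σ ε with hη₁
  set η₂ : ℝ → ℝ := fun t => 1 - smoothStep (τ - ε) ε t with hη₂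
  have hs1 : ContDiff ℝ ∞ η₁ := contDiff_smoothStep σ ε
  have hs2 : ContDiff ℝ ∞ η₂ := contDiff_const.sub (contDiff_smoothStep _ _)
  have hη₁0 : ∀ t, 0 ≤ η₁ t := fun t => Real.smoothTransition.nonneg _
  have hη₁1 : ∀ t, η₁ t ≤ 1 := fun t => Real.smoothTransition.le_one _
  have hη₂0 : ∀ t, 0 ≤ η₂ t := fun t => sub_nonneg.2 (Real.smoothTransition.le_one _)
  have hη₂1 : ∀ t, η₂ t ≤ 1 := fun t => sub_le_self _ (Real.smoothTransition.nonneg _)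
  have hη₂e : ∀ t, t ≤ τ - ε → η₂ t = 1 := fun t ht => by
    simp only [hη₂]; rw [smoothStep_eq_zero hε ht, sub_zero]
  have hη₂z : ∀ t, τ ≤ t → η₂ t = 0 := fun t ht => by
    simp only [hη₂]; rw [smoothStep_eq_one hε (by linarith), sub_self]
  set G : ℝ → ℝ := fun t => η₁ t * η₂ t * radialDensity m C lam t with hG
  have hGs : ContDiff ℝ ∞ G := by
    rw [contDiff_iff_contDiffAt]
    intro t
    rcases lt_or_ge t σ with ht | ht
    · refine contDiffAt_const (c := (0 : ℝ)) |>.congr_of_eventuallyEq ?_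
      filter_upwards [Iio_mem_nhds ht] with s hs
      rw [hG]
      simp only
      rw [hη₁, smoothStep_eq_zero hε (le_of_lt hs), zero_mul, zero_mul]
    · exact (hs1.contDiffAt.mul hs2.contDiffAt).mul
        (contDiffAt_radialDensity hC (hσ.trans_le ht))
  have hG0 : ∀ t, t ≤ σ → G t = 0 := fun t ht => by
    simp only [hG]
    rw [hη₁, smoothStep_eq_zero hε ht, zero_mul, zero_mul]
  have hGτ : ∀ t, τ ≤ t → G t = 0 := fun t ht => by
    simp only [hG]
    rw [hη₂z t ht, mul_zero, zero_mul]
  have hGn : ∀ t, 0 ≤ G t := fun t => by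
    rcases le_or_gt t σ with ht | ht
    · exact (hG0 t ht).ge
    · exact mul_nonneg (mul_nonneg (hη₁0 t) (hη₂0 t)) (radialDensity_nonneg hC (hσ.trans ht))
  set ξ : ℝ → ℝ := fun t => -∫ s in τ..t, G s with hξ
  have hξd : ∀ t, HasDerivAt ξ (-G t) t := fun t =>
    (hGs.continuous.integral_hasStrictDerivAt τ t).hasDerivAt.neg
  have hξd' : deriv ξ = fun t => -G t := funext fun t => (hξd t).deriv
  have hcut : IsRadialCutoff ξ σ τ := by
    have hz : ∀ t, τ ≤ t → ξ t = 0 := fun t ht => by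
      simp only [hξ]
      rw [intervalIntegral.integral_congr (g := fun _ => (0 : ℝ)) fun s hs => ?_]
      · simp
      · rw [uIcc_of_le ht] at hs
        exact hGτ s hs.1
    refine ⟨?_, fun t => ?_, fun t => ?_, fun t ht => ?_, hz⟩
    · rw [contDiff_infty_iff_deriv, hξd']
      exact ⟨fun t => (hξd t).differentiableAt, hGs.neg⟩
    · rcases le_total τ t with ht | ht
      · exact (hz t ht).ge
      · simp only [hξ]
        rw [← intervalIntegral.integral_symm]
        exact intervalIntegral.integral_nonneg ht fun s _ => hGn s
    · rw [hξd']
      exact neg_nonpos.2 (hGn t)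
    · rw [hξd']
      simp only
      rw [hG0 t ht.le, neg_zero]
  have hT : ∀ t, 0 < t → radialTest m C ξ t =
      ξ t * (m - C * t ^ 2) - η₁ t * η₂ t * radialWeight m lam t := fun t ht => by
    rw [radialTest, hξd']
    simp only [hG]
    rw [radialDensity]
    have h3 : 1 + C * t ^ 2 ≠ 0 := by positivity
    field_simp
    ring
  -- Up to τ - ε only the increasing step η₁ varies. Its comparison value w(σ) - κ lies below w near
  -- σ.
  have hant1 := antitoneOn_radial (m := m) (C := C) (lam := lam) (c := radialWeight m lam σ - κ)
    (a := σ) (b := σ + ε) (ξ := ξ) (η := η₁) (η' := deriv η₁) hC hl hlam hσ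
    (fun t ht => by
      have := hξd t
      simp only [hG] at this
      rwa [hη₂e t (by linarith [ht.2]), mul_one] at this)
    (fun t _ => (hs1.differentiable (by simp) t).hasDerivAt) hcut.nonneg hη₁0
    (fun t ht => mul_nonpos_of_nonneg_of_nonpos (deriv_smoothStep_nonneg hε t)
      (by linarith [hA1 t ht]))
  -- Beyond σ + ε only the decreasing step η₂ varies, and only where w ≤ w(τ) + κ.
  have hant2 := antitoneOn_radial (m := m) (C := C) (lam := lam) (c := radialWeight m lam τ + κ)
    (a := σ + ε) (b := τ) (ξ := ξ) (η := η₂) (η' := fun t => -deriv (smoothStep (τ - ε) ε) t)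
    hC hl hlam (by linarith)
    (fun t ht => by
      have := hξd t
      simp only [hG] at this
      rwa [hη₁, smoothStep_eq_one hε ht.1, one_mul] at this)
    (fun t _ => (((contDiff_smoothStep (τ - ε) ε).differentiable (by simp) t).hasDerivAt).const_sub 1)
    hcut.nonneg hη₂0
    (fun t ht => by
      rcases lt_or_ge t (τ - ε) with h | h
      · have : smoothStep (τ - ε) ε =ᶠ[𝓝 t] fun _ => 0 := by
          filter_upwards [Iio_mem_nhds h] with s hs using smoothStep_eq_zero hε (le_of_lt hs)
        rw [this.deriv_eq]
        simp
      · exact mul_nonpos_of_nonpos_of_nonneg (neg_nonpos.2 (deriv_smoothStep_nonneg hε t))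
          (by linarith [hA2 t ⟨h, ht.2⟩]))
  have hpos := radialWeight_pos (m := m) (lam := lam) hτ
  have hposσ := radialWeight_pos (m := m) (lam := lam) hσ
  have hb2 : ∀ t ∈ Icc (σ + ε) τ, -(radialWeight m lam τ + κ) ≤ radialTest m C ξ t := fun t ht => by
    have := hant2 ht ⟨by linarith [ht.1, ht.2], le_rfl⟩ ht.2
    simp only at this
    rw [hcut.eq_zero τ le_rfl, hη₂z τ le_rfl] at this
    have e1 : η₁ t = 1 := smoothStep_eq_one hε ht.1
    rw [hT t (by linarith [ht.1]), e1, one_mul]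
    have e2 : (radialWeight m lam τ + κ) * η₂ t ≤ (radialWeight m lam τ + κ) * 1 := by
      gcongr
      exact hη₂1 t
    linarith
  have hmid := hb2 (σ + ε) ⟨le_rfl, by linarith⟩
  rw [hT _ (by linarith), hη₂e (σ + ε) (by linarith), mul_one] at hmid
  have e3 : η₁ (σ + ε) = 1 := smoothStep_eq_one hε le_rfl
  have hb1 : ∀ t ∈ Icc σ (σ + ε), radialWeight m lam σ - radialWeight m lam τ - 2 * κ -
      (radialWeight m lam σ - κ) * η₁ t ≤ radialTest m C ξ t := fun t ht => by
    have := hant1 ht ⟨by linarith, le_rfl⟩ ht.2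
    simp only at this
    rw [hT t (by linarith [ht.1]), hη₂e t (by linarith [ht.2]), mul_one]
    rw [e3] at this hmid
    linarith
  refine ⟨ξ, hcut, fun t ht0 ht => ?_, fun t ht htτ => ?_⟩
  · have h4 := hb1 σ ⟨le_rfl, by linarith⟩
    have e4 : η₁ σ = 0 := smoothStep_eq_zero hε le_rfl
    rw [e4, mul_zero, sub_zero, hT σ hσ, e4, zero_mul, zero_mul, sub_zero] at h4
    have e5 : ξ t = ξ σ := by
      simp only [hξ]
      rw [← intervalIntegral.integral_add_adjacent_intervals (a := τ) (b := σ) (c := t)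
        (hGs.continuous.intervalIntegrable _ _) (hGs.continuous.intervalIntegrable _ _),
        intervalIntegral.integral_congr (a := σ) (b := t) (g := fun _ => (0 : ℝ)) fun s hs => ?_]
      · simp
      · rw [uIcc_of_ge ht.le] at hs
        exact hG0 s hs.2
    rw [radialTest, hcut.deriv_eq_zero t ht, zero_mul, add_zero, e5]
    refine h4.trans (mul_le_mul_of_nonneg_left ?_ (hcut.nonneg σ))
    have : C * t ^ 2 ≤ C * σ ^ 2 := by gcongr
    linarith
  · rcases le_total t (σ + ε) with h | h
    · refine le_trans ?_ (hb1 t ⟨ht, h⟩)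
      have := mul_le_mul_of_nonneg_left (hη₁1 t) (sub_nonneg.2 hκσ)
      linarith
    · exact hb2 t ⟨h, htτ.le⟩

end RadialCutoff

/-! ### Monotonicity of the weighted energy -/

section Monotonicity

variable [CompactSpace M] [MeasurableSpace M] [BorelSpace M]

/-- The integral of `|z|²` over a ball. -/
def ballEnergy {r p : ℕ} (z : Fin r → Form n M p) (q : M) (σ : ℝ) : ℝ :=
  ∫ x in ball q σ, normSq z x ∂(riemVol n M)

theorem ballEnergy_nonneg {r p : ℕ} (z : Fin r → Form n M p) (q : M) (σ : ℝ) :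
    0 ≤ ballEnergy z q σ :=
  integral_nonneg fun x => normSq_nonneg z x

theorem IsNonlinearHarmonic.ballEnergy_mono {r D p : ℕ} {P : Fin D → Fin r → Fin r → ℝ}
    {h z : Fin r → Form n M p} (hz : IsNonlinearHarmonic P h z) (q : M) {σ τ : ℝ} (hστ : σ ≤ τ) :
    ballEnergy z q σ ≤ ballEnergy z q τ :=
  setIntegral_mono_set hz.integrable_normSq.integrableOn (ae_of_all _ fun x => normSq_nonneg z x)
    (ball_subset_ball hστ).eventuallyLE

/-- The bounds for the cutoff say that the test function is at least w(σ) - κ times the indicator of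
the σ-ball minus w(τ) + κ times that of the τ-ball. Its integral against |z|² is not positive, and κ
tends to 0. -/
theorem IsNonlinearHarmonic.monotone_of_radial_inequality {r D p : ℕ}
    {P : Fin D → Fin r → Fin r → ℝ} {h z : Fin r → Form n M p} (hz : IsNonlinearHarmonic P h z)
    {q : M} {m C lam σ τ : ℝ} (hC : 0 ≤ C) (hl : C * (m + 1) ≤ 2 * lam) (hlam : 0 ≤ lam)
    (hσ : 0 < σ) (hστ : σ < τ) (hI : ∀ {ξ : ℝ → ℝ}, IsRadialCutoff ξ σ τ →
      ∫ x, radialTest m C ξ (dist q x) * normSq z x ∂(riemVol n M) ≤ 0) :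
    radialWeight m lam σ * ballEnergy z q σ ≤ radialWeight m lam τ * ballEnergy z q τ := by
  have hA := radialWeight_pos (m := m) (lam := lam) hσ
  have key := le_of_forall_gt_continuous (x := radialWeight m lam σ * ballEnergy z q σ)
    (f := fun κ => κ * ballEnergy z q σ + (radialWeight m lam τ + κ) * ballEnergy z q τ)
    (by fun_prop) hA fun κ hκ hκσ => ?_
  · simpa using key
  · obtain ⟨ξ, hξ, h1, h2⟩ := exists_isRadialCutoff hC hl hlam hσ hστ hκ hκσ.le
    have hi := hz.integrable_normSq
    have hσi := (hi.indicator (isOpen_ball (x := q) (ε := σ)).measurableSet).const_mul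
      (radialWeight m lam σ - κ)
    have hτi := (hi.indicator (isOpen_ball (x := q) (ε := τ)).measurableSet).const_mul
      (radialWeight m lam τ + κ)
    have hcont : Continuous fun x => radialTest m C ξ (dist q x) :=
      (hξ.continuous_radialTest m C).comp (continuous_const.dist continuous_id)
    have hmono := integral_mono (hσi.sub hτi) (hz.integrable_mul_normSq hcont) fun x => ?_
    · have := hmono.trans (hI hξ)
      rw [integral_sub' hσi hτi, integral_const_mul, integral_const_mul,
        integral_indicator isOpen_ball.measurableSet,
        integral_indicator isOpen_ball.measurableSet] at this
      simp only [ballEnergy]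
      linarith
    · have hn := normSq_nonneg z x
      simp only [Pi.sub_apply]
      rcases lt_or_ge (dist q x) σ with hx | hx
      · rw [indicator_of_mem (by rwa [Metric.mem_ball']),
          indicator_of_mem (by rw [Metric.mem_ball']; exact hx.trans hστ), ← sub_mul]
        exact mul_le_mul_of_nonneg_right (by linarith [h1 _ dist_nonneg hx]) hn
      · rw [indicator_of_notMem (s := ball q σ) (by rw [Metric.mem_ball']; exact not_lt.2 hx),
          mul_zero, zero_sub]
        rcases lt_or_ge (dist q x) τ with hx' | hx'
        · rw [indicator_of_mem (by rwa [Metric.mem_ball']), ← neg_mul]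
          exact mul_le_mul_of_nonneg_right (h2 _ hx hx') hn
        · rw [indicator_of_notMem (by rw [Metric.mem_ball']; exact not_lt.2 hx'), mul_zero, neg_zero]
          have : radialTest m C ξ (dist q x) = 0 := by
            have e1 : ξ (dist q x) = 0 := hξ.eq_zero _ hx'
            have e2 : deriv ξ (dist q x) = 0 := by
              -- At distance exactly τ the cutoff attains its minimum 0, so its derivative vanishes
              -- there as well.
              refine IsLocalMin.deriv_eq_zero (Eventually.of_forall fun s => ?_)
              rw [e1]
              exact hξ.nonneg s
            rw [radialTest, e1, e2]
            ring
          rw [this, zero_mul]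

theorem monotoneOn_radialWeight {m lam s : ℝ} (hs : 0 < s) (h : m ≤ 2 * lam * s ^ 2)
    (hlam : 0 ≤ lam) : MonotoneOn (radialWeight m lam) (Ici s) := by
  have hd : ∀ t ∈ Ici s, _ := fun t ht => hasDerivAt_radialWeight m lam (hs.trans_le (mem_Ici.1 ht))
  refine monotoneOn_of_deriv_nonneg (convex_Ici s)
    (fun t ht => (hd t ht).continuousAt.continuousWithinAt)
    (fun t ht => (hd t (interior_subset ht)).differentiableAt.differentiableWithinAt)
    fun t ht' => ?_
  have ht : s ≤ t := interior_subset ht'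
  have ht0 := hs.trans_le ht
  rw [(hd t ht).deriv]
  have h1 : 2 * lam * s ^ 2 ≤ 2 * lam * t ^ 2 := by gcongr
  exact mul_nonneg (radialWeight_pos ht0).le (div_nonneg (by linarith) ht0.le)

variable (n M) [IsRiemannianManifold (𝓡 n) M] in
-- In λ, the summand C(n + 1) serves the radial inequality for radii below ρ. The summand n/(ρ/2)²
-- makes the weight nondecreasing beyond ρ/2, where monotonicity of the energy in the radius
-- suffices; a radius interval containing ρ/2 is split there. If 2p > n the exponent is positive and
-- the weight increases everywhere. Nothing here depends on z.
theorem exists_monotonicity :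
    ∃ lam : ℝ, 0 < lam ∧ ∀ {r D p : ℕ} {P : Fin D → Fin r → Fin r → ℝ}
      {h z : Fin r → Form n M p}, IsNonlinearHarmonic P h z → ∀ (q : M) (σ τ : ℝ), 0 < σ → σ ≤ τ →
        radialWeight (n - 2 * p) lam σ * ballEnergy z q σ ≤
          radialWeight (n - 2 * p) lam τ * ballEnergy z q τ := by
  obtain ⟨ρ, C, hρ, hC, hI⟩ := exists_radial_inequality n M
  have hn : (0 : ℝ) ≤ n := Nat.cast_nonneg n
  refine ⟨C * (n + 1) + n / (ρ / 2) ^ 2 + 1, by positivity, ?_⟩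
  intro r D p P h z hz q σ τ hσ hστ
  set lam := C * (n + 1) + n / (ρ / 2) ^ 2 + 1 with hlam
  have hl0 : 0 ≤ lam := by positivity
  have hp0 : (0 : ℝ) ≤ p := Nat.cast_nonneg p
  have hmn : (n : ℝ) - 2 * p ≤ n := by linarith
  have hincr : ∀ s, 0 < s → (n : ℝ) - 2 * p ≤ 2 * lam * s ^ 2 → s ≤ σ →
      radialWeight (n - 2 * p) lam σ * ballEnergy z q σ ≤
        radialWeight (n - 2 * p) lam τ * ballEnergy z q τ := fun s hs h1 hsσ =>
    mul_le_mul (monotoneOn_radialWeight hs h1 hl0 (mem_Ici.2 hsσ) (mem_Ici.2 (hsσ.trans hστ)) hστ)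
      (hz.ballEnergy_mono q hστ) (ballEnergy_nonneg z q σ) (radialWeight_pos (hσ.trans_le hστ)).le
  by_cases hp : 2 * p ≤ n
  · have hlarge : (n : ℝ) - 2 * p ≤ 2 * lam * (ρ / 2) ^ 2 := by
      have h1 : n / (ρ / 2) ^ 2 * (ρ / 2) ^ 2 = (n : ℝ) := by field_simp
      have h2 : 0 ≤ (2 * (C * (n + 1)) + n / (ρ / 2) ^ 2 + 2) * (ρ / 2) ^ 2 := by positivity
      rw [hlam]
      linarith
    have hsmall : ∀ s, σ ≤ s → s < ρ → radialWeight (n - 2 * p) lam σ * ballEnergy z q σ ≤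
        radialWeight (n - 2 * p) lam s * ballEnergy z q s := fun s hs hsρ => by
      rcases hs.eq_or_lt with rfl | hs
      · exact le_rfl
      · refine hz.monotone_of_radial_inequality hC ?_ hl0 hσ hs fun hξ => hI q hz hp hξ hσ hsρ
        have h1 : C * ((n : ℝ) - 2 * p + 1) ≤ C * (n + 1) := by gcongr
        have h2 : 0 ≤ C * (n + 1) + 2 * (n / (ρ / 2) ^ 2) + 2 := by positivity
        rw [hlam]
        linarith
    rcases le_total (ρ / 2) σ with h1 | h1
    · exact hincr _ (by positivity) hlarge h1
    rcases le_total τ (ρ / 2) with h2 | h2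
    · exact hsmall τ hστ (by linarith)
    · refine (hsmall (ρ / 2) h1 (by linarith)).trans ?_
      exact mul_le_mul (monotoneOn_radialWeight (half_pos hρ) hlarge hl0 self_mem_Ici
        (mem_Ici.2 h2) h2) (hz.ballEnergy_mono q h2) (ballEnergy_nonneg z q _)
        (radialWeight_pos (hσ.trans_le hστ)).le
  · refine hincr σ hσ ?_ le_rfl
    have h1 : (n : ℝ) ≤ 2 * p := by exact_mod_cast (not_le.1 hp).le
    have h2 : 0 ≤ 2 * lam * σ ^ 2 := by positivity
    linarith

end Monotonicity

/-! ### The Morrey bound -/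

section Morrey

variable [CompactSpace M] [MeasurableSpace M] [BorelSpace M]

/-- Monotonicity is applied between a radius and the diameter. The exponential is at least 1 at the
smaller radius, and the energy of the larger ball is at most the total energy. -/
theorem IsNonlinearHarmonic.memMorrey {r D p : ℕ} {P : Fin D → Fin r → Fin r → ℝ}
    {h z : Fin r → Form n M p} (hz : IsNonlinearHarmonic P h z) {m lam : ℝ} (hlam : 0 ≤ lam)
    (hmono : ∀ (q : M) (σ τ : ℝ), 0 < σ → σ ≤ τ → radialWeight m lam σ * ballEnergy z q σ ≤
      radialWeight m lam τ * ballEnergy z q τ) : MemMorrey 2 m z := by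
  have hsq : ∀ x, ENNReal.ofReal (√(normSq z x) ^ (2 : ℝ)) =
      ENNReal.ofReal (normSq z x) := fun x => by
    rw [Real.rpow_two, Real.sq_sqrt (normSq_nonneg z x)]
  have hi := hz.integrable_normSq
  have hn0 : ∀ μ : Measure M, 0 ≤ᵐ[μ] normSq z := fun μ => ae_of_all _ fun x => normSq_nonneg z x
  refine ⟨fun i => (isL2Form_of_mem_admissible hz.harmonic hz.mem i).1, ?_, ?_⟩
  · simp only [hsq]
    rw [← ofReal_integral_eq_lintegral_ofReal hi (hn0 _)]
    exact ENNReal.ofReal_lt_top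
  · simp only [morreyNorm, hsq]
    set d := Metric.diam (univ : Set M)
    refine ENNReal.rpow_lt_top_of_nonneg (by norm_num) (ne_of_lt ((iSup_le fun q => iSup₂_le
      fun ρ hρ => ?_).trans_lt (ENNReal.ofReal_lt_top
        (r := radialWeight m lam d * ∫ x, normSq z x ∂(riemVol n M)))))
    rw [← ofReal_integral_eq_lintegral_ofReal hi.integrableOn (hn0 _),
      ← ENNReal.ofReal_mul (Real.rpow_nonneg hρ.1.le _)]
    refine ENNReal.ofReal_le_ofReal ?_
    have h1 := hmono q ρ d hρ.1 hρ.2.le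
    have h2 : ballEnergy z q d ≤ ∫ x, normSq z x ∂(riemVol n M) :=
      setIntegral_le_integral hi (hn0 _)
    have h3 : ρ ^ (-m) ≤ radialWeight m lam ρ := by
      refine le_mul_of_one_le_left (Real.rpow_nonneg hρ.1.le _) (Real.one_le_exp (by positivity))
    exact (mul_le_mul_of_nonneg_right h3 (ballEnergy_nonneg z q ρ)).trans (h1.trans
      (mul_le_mul_of_nonneg_left h2 (radialWeight_pos (hρ.1.trans hρ.2)).le))

end Morrey

end MetricManifold

end

end NonlinearHarmonic

theorem mainTheorem2 {n : ℕ} {M : Type*} [MetricSpace M] [CompactSpace M]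
    [ChartedSpace (EuclideanSpace ℝ (Fin n)) M] [IsManifold (𝓡 n) ∞ M]
    [RiemannianBundle (fun x : M => TangentSpace (𝓡 n) x)]
    [IsContMDiffRiemannianBundle (𝓡 n) ∞ (EuclideanSpace ℝ (Fin n))
      (fun x : M => TangentSpace (𝓡 n) x)]
    [IsRiemannianManifold (𝓡 n) M] [MeasurableSpace M] [BorelSpace M] :
    ∃ lam : ℝ, 0 < lam ∧
      ∀ {r D p : ℕ} (P : Fin D → Fin r → Fin r → ℝ)
        (h z : Fin r → NonlinearHarmonic.Form n M p),
        NonlinearHarmonic.IsNonlinearHarmonic P h z →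
          NonlinearHarmonic.PriceIdentity z ∧
          (∀ (x : M) (σ τ : ℝ), 0 < σ → σ ≤ τ →
            Real.exp (lam * σ ^ 2) * σ ^ (2 * (p : ℝ) - n) *
                ∫ x' in Metric.ball x σ, NonlinearHarmonic.normSq z x'
                  ∂(NonlinearHarmonic.riemVol n M) ≤
              Real.exp (lam * τ ^ 2) * τ ^ (2 * (p : ℝ) - n) *
                ∫ x' in Metric.ball x τ, NonlinearHarmonic.normSq z x'
                  ∂(NonlinearHarmonic.riemVol n M)) ∧
          NonlinearHarmonic.MemMorrey 2 ((n : ℝ) - 2 * p) z := by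
  obtain ⟨lam, hlam, hmono⟩ := NonlinearHarmonic.exists_monotonicity n M
  refine ⟨lam, hlam, fun P h z hz =>
    ⟨NonlinearHarmonic.priceIdentity_of_isNonlinearHarmonic hz, fun x σ τ hσ hστ => ?_,
      hz.memMorrey hlam.le (hmono hz)⟩⟩
  have := hmono hz x σ τ hσ hστ
  simpa only [NonlinearHarmonic.radialWeight, NonlinearHarmonic.ballEnergy, neg_sub] using this
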